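/- **Setting.** Let $\dot{\mathfrak g}$ be a finite-dimensional simple Lie algebra over $\mathbb C$, with a Cartan subalgebra, a base of its root system and the highest root $\theta$. Let $(\cdot|\cdot)$ be a non-degenerate symmetric invariant bilinear form on $\dot{\mathfrak g}$, normalized by $(\theta^\vee|\theta^\vee)=2$ (long roots have square length $2$). Let $h^\vee = 1+\sum_i a_i^\vee$ be the dual Coxeter number, where $\theta^\vee=\sum_i a_i^\vee\alpha_i^\vee$. Let $N\ge 1$, and let $sl_N$ carry the form $(x|y)=\mathrm{tr}(xy)$. For $\mathfrak a=\dot{\mathfrak g}$ or $sl_N$ let $\hat{\mathfrak a}=\mathbb C[t,t^{-1}]\otimes\mathfrak a\oplus\mathbb C C_{\mathfrak a}$ be the affine algebra, $[x(m),y(n)]=[x,y](m+n)+m\,\delta_{m,-n}(x|y)C_{\mathfrak a}$ with $C_{\mathfrak a}$ central. Let $Vir$ be the Virasoro algebra, $[L(m),L(n)]=(m-n)L(m+n)+\frac{m^3-m}{12}\delta_{m,-n}C_{Vir}$ with $C_{Vir}$ central. Let $\bar{\mathfrak f}$ be the semidirect product of $Vir$ with $\hat{\dot{\mathfrak g}}\oplus\widehat{sl}_N$,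 where $[L(m),x(n)]=-n\,x(m+n)$ and the elements $C_{\dot{\mathfrak g}}$, $C_{sl_N}$, $C_{Vir}$ are central. *Vertex operator algebras.* A VOA of rank $c$ is a vertex algebra with a conformal vector $\omega$, $Y(\omega,z)=\sum_n L(n)z^{-n-2}$, such that the $L(n)$ satisfy the Virasoro relations with central charge $c$, $[L(-1),Y(a,z)]=\frac{d}{dz}Y(a,z)$, and $L(0)$ is diagonalizable with integral eigenvalues. Tensor products of VOAs have $Y(a\otimes b,z)=Y(a,z)\otimes Y(b,z)$, vacuum $\mathbf 1\otimes\mathbf 1$ and conformal vector $\omega\otimes\mathbf 1+\mathbf 1\otimes\omega$; isomorphisms of VOAs preserve all products, the vacuum and the conformal vector. For complex numbers $c_{\dot{\mathfrak g}}, c_{sl_N}, \bar c$, let $V_{\bar{\mathfrak f}}(c_{\dot{\mathfrak g}},c_{sl_N},\bar c)$ be the $\bar{\mathfrak f}$-module induced from the one-dimensional module $\mathbb C\mathbf 1$ on which $x(n)$ ($n\ge0$) and $L(n)$ ($n\ge-1$) act by $0$ and the central elements $C_{\dot{\mathfrak g}}, C_{sl_N}, C_{Vir}$ by $c_{\dot{\mathfrak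 g}}, c_{sl_N},\bar c$. Its VOA structure is the one with vacuum $\mathbf 1$, $Y(x(-1)\mathbf 1,z)=\sum_n x(n)z^{-n-1}$ for $x\in\dot{\mathfrak g}$ and $x\in sl_N$, $\omega=L(-2)\mathbf 1$ and $Y(\omega,z)=\sum_n L(n)z^{-n-2}$. The vacuum modules $V_{\hat{\dot{\mathfrak g}}}(c_{\dot{\mathfrak g}})$, $V_{\widehat{sl}_N}(c_{sl_N})$, $V_{Vir}(c)$ and their VOA structures are defined in the same way, where the two affine VOAs carry the Sugawara conformal vectors $\frac{1}{2(c_{\mathfrak a}+h_{\mathfrak a})}\sum_i x_i(-1)x^i(-1)\mathbf 1$. Here $(x_i)$, $(x^i)$ are dual bases of $\mathfrak a$, and $h_{\dot{\mathfrak g}}=h^\vee$, $h_{sl_N}=N$. *Modules.* For finite-dimensional irreducible modules $V$ of $\dot{\mathfrak g}$ and $W$ of $sl_N$ and $\bar h\in\mathbb C$, let $L_{\bar{\mathfrak f}}(V,W,\bar h,c_{\dot{\mathfrak g}},c_{sl_N},\bar c)$ be the irreducible quotient (the quotient by the sum of all proper submodules) of the $\bar{\mathfrak f}$-module induced from $V\otimes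 W$, on which $x(n)$ and $L(n)$ with $n>0$ act by $0$, $x(0)$ acts as $x$, $L(0)$ as $\bar h$, and the central elements as $c_{\dot{\mathfrak g}},c_{sl_N},\bar c$. Define the irreducible modules $L_{\hat{\dot{\mathfrak g}}}(V,c_{\dot{\mathfrak g}})$, $L_{\widehat{sl}_N}(W,c_{sl_N})$ and $L_{Vir}(h,c)$ in the same way. Let $\Omega_V$, $\Omega_W$ be the eigenvalues of the Casimir operators $\sum_i x_ix^i$ of $\dot{\mathfrak g}$ and $sl_N$ on $V$ and $W$. **Proposition 3.1.** Let $c_{\dot{\mathfrak g}}\neq-h^\vee$ and $c_{sl_N}\neq-N$, let $\bar c\in\mathbb C$, and put $$c' = \bar c-\frac{c_{\dot{\mathfrak g}}\dim\dot{\mathfrak g}}{c_{\dot{\mathfrak g}}+h^\vee}-\frac{c_{sl_N}(N^2-1)}{c_{sl_N}+N}.\tag{3.1}$$ (i) The VOA structures above exist on $V_{\bar{\mathfrak f}}(c_{\dot{\mathfrak g}},c_{sl_N},\bar c)$, $V_{\hat{\dot{\mathfrak g}}}(c_{\dot{\mathfrak g}})$, $V_{\widehat{sl}_N}(c_{sl_N})$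 and $V_{Vir}(c')$, with ranks $\bar c$, $\frac{c_{\dot{\mathfrak g}}\dim\dot{\mathfrak g}}{c_{\dot{\mathfrak g}}+h^\vee}$, $\frac{c_{sl_N}(N^2-1)}{c_{sl_N}+N}$ and $c'$, and there is an isomorphism of VOAs $$V_{\bar{\mathfrak f}}(c_{\dot{\mathfrak g}},c_{sl_N},\bar c)\cong V_{\hat{\dot{\mathfrak g}}}(c_{\dot{\mathfrak g}})\otimes V_{\widehat{sl}_N}(c_{sl_N})\otimes V_{Vir}(c').$$ (ii) For all $V$, $W$ and $\bar h$ as above there is an isomorphism of $\bar{\mathfrak f}$-modules $$L_{\bar{\mathfrak f}}(V,W,\bar h,c_{\dot{\mathfrak g}},c_{sl_N},\bar c)\cong L_{\hat{\dot{\mathfrak g}}}(V,c_{\dot{\mathfrak g}})\otimes L_{\widehat{sl}_N}(W,c_{sl_N})\otimes L_{Vir}(h',c'),$$ $$h'=\bar h-\frac{\Omega_V}{2(c_{\dot{\mathfrak g}}+h^\vee)}-\frac{\Omega_W}{2(c_{sl_N}+N)}.\tag{3.2}$$ On the right-hand side the affine algebras act on the first and the second factor, $C_{Vir}$ acts as $\bar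 c$, and $L(n)$ acts as $L^{\dot{\mathfrak g}}(n)\otimes1\otimes1+1\otimes L^{sl_N}(n)\otimes1+1\otimes1\otimes L(n)$, where $L^{\mathfrak a}(n)=\frac{1}{2(c_{\mathfrak a}+h_{\mathfrak a})}\sum_i\sum_{j\in\mathbb Z}:x_i(j)x^i(n-j):$ are the Sugawara operators. -/

import Mathlib

open scoped TensorProduct

namespace TorVOA

noncomputable section

/-- A non-degenerate symmetric invariant bilinear form `(· | ·)` on a complex Lie algebra. -/
structure InvForm (g : Type*) [LieRing g] [LieAlgebra ℂ g] where
  form : LinearMap.BilinForm ℂ g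
  symm : form.IsSymm
  invariant : form.lieInvariant g
  nondeg : form.Nondegenerate

/-! ### The Virasoro algebra -/

/-- The Virasoro algebra: the underlying space is `⨁ₙ ℂ L(n) ⊕ ℂ C`. -/
@[ext] structure Virasoro where
  field : ℤ →₀ ℂ
  central : ℂ

namespace Virasoro

/-- The underlying vector space. -/
def toProd : Virasoro ≃ (ℤ →₀ ℂ) × ℂ where
  toFun x := (x.field, x.central)
  invFun p := ⟨p.1, p.2⟩
  left_inv _ := rfl
  right_inv _ := rfl

instance : AddCommGroup Virasoro := toProd.addCommGroup
instance : Module ℂ Virasoro := toProd.module ℂ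

@[simp] lemma add_field (x y : Virasoro) : (x + y).field = x.field + y.field := rfl
@[simp] lemma add_central (x y : Virasoro) : (x + y).central = x.central + y.central := rfl
@[simp] lemma zero_field : (0 : Virasoro).field = 0 := rfl
@[simp] lemma zero_central : (0 : Virasoro).central = 0 := rfl
@[simp] lemma smul_field (r : ℂ) (x : Virasoro) : (r • x).field = r • x.field := rfl
@[simp] lemma smul_central (r : ℂ) (x : Virasoro) : (r • x).central = r • x.central := rfl

/-- The bracket of vector fields on the circle: `[L(m), L(n)] = (m - n) L(m + n)`. -/
def wittBracket : (ℤ →₀ ℂ) →ₗ[ℂ] (ℤ →₀ ℂ) →ₗ[ℂ] (ℤ →₀ ℂ) :=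
  Finsupp.linearCombination ℂ fun m : ℤ =>
    Finsupp.linearCombination ℂ fun n : ℤ => Finsupp.single (m + n) ((m : ℂ) - n)

/-- The Virasoro cocycle: `(L(m), L(n)) ↦ (m³ - m) / 12 · δ_{m,-n}`. -/
def cocycle : (ℤ →₀ ℂ) →ₗ[ℂ] (ℤ →₀ ℂ) →ₗ[ℂ] ℂ :=
  Finsupp.linearCombination ℂ fun m : ℤ =>
    Finsupp.linearCombination ℂ fun n : ℤ => if m = -n then ((m : ℂ) ^ 3 - m) / 12 else 0

@[simp] lemma wittBracket_single (m n : ℤ) (a b : ℂ) :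
    wittBracket (Finsupp.single m a) (Finsupp.single n b) =
      Finsupp.single (m + n) (a * b * ((m : ℂ) - n)) := by
  simp only [wittBracket, Finsupp.linearCombination_single, LinearMap.smul_apply,
    Finsupp.smul_single, smul_eq_mul, mul_assoc]

@[simp] lemma cocycle_single (m n : ℤ) (a b : ℂ) :
    cocycle (Finsupp.single m a) (Finsupp.single n b) =
      a * b * (if m = -n then ((m : ℂ) ^ 3 - m) / 12 else 0) := by
  simp [cocycle, Finsupp.linearCombination_single]
  split_ifs <;> ring

lemma wittBracket_skew (u v : ℤ →₀ ℂ) : wittBracket u v = -wittBracket v u := by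
  induction u using Finsupp.induction_linear with
  | zero => simp
  | add a b ha hb => simp only [map_add, LinearMap.add_apply, ha, hb]; abel
  | single m a =>
  induction v using Finsupp.induction_linear with
  | zero => simp
  | add a b ha hb => simp only [map_add, LinearMap.add_apply, ha, hb]; abel
  | single n b =>
    rw [wittBracket_single, wittBracket_single, ← Finsupp.single_neg, add_comm n m]
    congr 1
    ring

lemma cocycle_skew (u v : ℤ →₀ ℂ) : cocycle u v = -cocycle v u := by
  suffices h : cocycle = -cocycle.flip by
    conv_lhs => rw [h]
    simp
  ext m n : 4
  by_cases h : m = -n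
  · subst h; simp; ring
  · simp [h, show ¬ n = -m by omega]

lemma wittBracket_jacobi (u v w : ℤ →₀ ℂ) :
    wittBracket u (wittBracket v w) =
      wittBracket (wittBracket u v) w + wittBracket v (wittBracket u w) := by
  induction u using Finsupp.induction_linear with
  | zero => simp
  | add a b ha hb => simp only [map_add, LinearMap.add_apply, ha, hb]; abel
  | single m a =>
  induction v using Finsupp.induction_linear with
  | zero => simp
  | add a b ha hb => simp only [map_add, LinearMap.add_apply, ha, hb]; abel
  | single n b =>
  induction w using Finsupp.induction_linear with
  | zero => simp
  | add a b ha hb => simp only [map_add, ha, hb]; abel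
  | single k c =>
    simp only [wittBracket_single, show n + (m + k) = m + (n + k) by ring,
      show m + n + k = m + (n + k) by ring, ← Finsupp.single_add]
    congr 1
    push_cast
    ring

lemma cocycle_jacobi (u v w : ℤ →₀ ℂ) :
    cocycle u (wittBracket v w) =
      cocycle (wittBracket u v) w + cocycle v (wittBracket u w) := by
  induction u using Finsupp.induction_linear with
  | zero => simp
  | add a b ha hb => simp only [map_add, LinearMap.add_apply, ha, hb]; ring
  | single m a =>
  induction v using Finsupp.induction_linear with
  | zero => simp
  | add a b ha hb => simp only [map_add, LinearMap.add_apply, ha, hb]; ring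
  | single n b =>
  induction w using Finsupp.induction_linear with
  | zero => simp
  | add a b ha hb => simp only [map_add, ha, hb]; ring
  | single k c =>
    simp only [wittBracket_single, cocycle_single]
    by_cases h : m + n + k = 0
    · obtain rfl : k = -m - n := by omega
      rw [if_pos (by ring), if_pos (by ring), if_pos (by ring)]
      push_cast
      ring
    · rw [if_neg (by omega), if_neg (by omega), if_neg (by omega)]
      ring

instance : LieRing Virasoro where
  bracket x y := ⟨wittBracket x.field y.field, cocycle x.field y.field⟩
  add_lie x y z := by ext1 <;> simp
  lie_add x y z := by ext1 <;> simp
  lie_self x := by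
    ext1
    · exact self_eq_neg.mp (wittBracket_skew _ _)
    · exact self_eq_neg.mp (cocycle_skew _ _)
  leibniz_lie x y z := by
    ext1
    · exact wittBracket_jacobi _ _ _
    · exact cocycle_jacobi _ _ _

lemma bracket_def (x y : Virasoro) :
    ⁅x, y⁆ = ⟨wittBracket x.field y.field, cocycle x.field y.field⟩ := rfl

instance : LieAlgebra ℂ Virasoro where
  lie_smul r x y := by simp only [bracket_def]; ext1 <;> simp

/-- The basis element `L(n)`, corresponding to the vector field `-tⁿ⁺¹ d/dt`. -/
def L (n : ℤ) : Virasoro := ⟨Finsupp.single n 1, 0⟩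

/-- The central element. -/
def C : Virasoro := ⟨0, 1⟩

lemma lie_L_L (m n : ℤ) :
    ⁅L m, L n⁆ = ((m : ℂ) - n) • L (m + n) +
      (if m = -n then ((m : ℂ) ^ 3 - m) / 12 else 0) • C := by
  rw [bracket_def]
  ext1
  · split_ifs <;> simp [L, C]
  · split_ifs with h <;> simp [L, C, h]

lemma lie_C (x : Virasoro) : ⁅C, x⁆ = 0 := by
  rw [bracket_def]; ext1 <;> simp [C]

end Virasoro

/-! ### Affine Lie algebras -/

/-- The affine Lie algebra `ĝ = ℂ[t, t⁻¹] ⊗ g ⊕ ℂ C` attached to `(g, (· | ·))`. An element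
`∑ₙ tⁿ ⊗ xₙ` of the loop algebra is stored as the finitely supported function `n ↦ xₙ`. -/
@[ext] structure Affine {g : Type*} [LieRing g] [LieAlgebra ℂ g] (B : InvForm g) where
  loop : ℤ →₀ g
  central : ℂ

namespace Affine

variable {g : Type*} [LieRing g] [LieAlgebra ℂ g] (B : InvForm g)

/-- The underlying vector space. -/
def toProd : Affine B ≃ (ℤ →₀ g) × ℂ where
  toFun x := (x.loop, x.central)
  invFun p := ⟨p.1, p.2⟩
  left_inv _ := rfl
  right_inv _ := rfl

instance : AddCommGroup (Affine B) := (toProd B).addCommGroup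
instance : Module ℂ (Affine B) := (toProd B).module ℂ

variable {B} in
@[simp] lemma add_loop (x y : Affine B) : (x + y).loop = x.loop + y.loop := rfl
variable {B} in
@[simp] lemma add_central (x y : Affine B) : (x + y).central = x.central + y.central := rfl
variable {B} in
@[simp] lemma sub_loop (x y : Affine B) : (x - y).loop = x.loop - y.loop := rfl
variable {B} in
@[simp] lemma sub_central (x y : Affine B) : (x - y).central = x.central - y.central := rfl
@[simp] lemma zero_loop : (0 : Affine B).loop = 0 := rfl
@[simp] lemma zero_central : (0 : Affine B).central = 0 := rfl
variable {B} in
@[simp] lemma smul_loop (r : ℂ) (x : Affine B) : (r • x).loop = r • x.loop := rfl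
variable {B} in
@[simp] lemma smul_central (r : ℂ) (x : Affine B) : (r • x).central = r • x.central := rfl

/-- The bracket of the loop algebra: `[x(m), y(n)] = [x, y](m + n)`. -/
def loopBracket : (ℤ →₀ g) →ₗ[ℂ] (ℤ →₀ g) →ₗ[ℂ] (ℤ →₀ g) :=
  Finsupp.lsum ℂ fun m : ℤ => LinearMap.flip <| Finsupp.lsum ℂ fun n : ℤ =>
    LinearMap.mk₂ ℂ (fun y x : g => Finsupp.single (m + n) ⁅x, y⁆)
      (by simp) (by simp) (by simp) (by simp)

/-- The cocycle `(x(m), y(n)) ↦ m (x | y) δ_{m,-n}`. -/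
def cocycle : (ℤ →₀ g) →ₗ[ℂ] (ℤ →₀ g) →ₗ[ℂ] ℂ :=
  Finsupp.lsum ℂ fun m : ℤ => LinearMap.flip <| Finsupp.lsum ℂ fun n : ℤ =>
    (if m = -n then (m : ℂ) else 0) • B.form.flip

@[simp] lemma loopBracket_single (m n : ℤ) (x y : g) :
    loopBracket (Finsupp.single m x) (Finsupp.single n y) = Finsupp.single (m + n) ⁅x, y⁆ := by
  simp [loopBracket]

@[simp] lemma cocycle_single (m n : ℤ) (x y : g) :
    cocycle B (Finsupp.single m x) (Finsupp.single n y) =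
      (if m = -n then (m : ℂ) else 0) * B.form x y := by
  simp only [cocycle, Finsupp.lsum_single, LinearMap.flip_apply, LinearMap.smul_apply,
    smul_eq_mul]
  rfl

lemma loopBracket_skew (u v : ℤ →₀ g) : loopBracket u v = -loopBracket v u := by
  induction u using Finsupp.induction_linear with
  | zero => simp
  | add a b ha hb => simp only [map_add, LinearMap.add_apply, ha, hb]; abel
  | single m a =>
  induction v using Finsupp.induction_linear with
  | zero => simp
  | add a b ha hb => simp only [map_add, LinearMap.add_apply, ha, hb]; abel
  | single n b =>
    rw [loopBracket_single, loopBracket_single, ← Finsupp.single_neg, add_comm n m, lie_skew]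

lemma cocycle_skew (u v : ℤ →₀ g) : cocycle B u v = -cocycle B v u := by
  induction u using Finsupp.induction_linear with
  | zero => simp
  | add a b ha hb => simp only [map_add, LinearMap.add_apply, ha, hb]; ring
  | single m a =>
  induction v using Finsupp.induction_linear with
  | zero => simp
  | add a b ha hb => simp only [map_add, LinearMap.add_apply, ha, hb]; ring
  | single n b =>
    rw [cocycle_single, cocycle_single, B.symm.eq b a]
    by_cases h : m + n = 0
    · obtain rfl : n = -m := by omega
      simp
    · rw [if_neg (by omega), if_neg (by omega)]; simp

lemma loopBracket_jacobi (u v w : ℤ →₀ g) :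
    loopBracket u (loopBracket v w) =
      loopBracket (loopBracket u v) w + loopBracket v (loopBracket u w) := by
  induction u using Finsupp.induction_linear with
  | zero => simp
  | add a b ha hb => simp only [map_add, LinearMap.add_apply, ha, hb]; abel
  | single m a =>
  induction v using Finsupp.induction_linear with
  | zero => simp
  | add a b ha hb => simp only [map_add, LinearMap.add_apply, ha, hb]; abel
  | single n b =>
  induction w using Finsupp.induction_linear with
  | zero => simp
  | add a b ha hb => simp only [map_add, ha, hb]; abel
  | single k c =>
    simp only [loopBracket_single, show n + (m + k) = m + (n + k) by ring,
      show m + n + k = m + (n + k) by ring, ← Finsupp.single_add]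
    rw [leibniz_lie]

lemma cocycle_jacobi (u v w : ℤ →₀ g) :
    cocycle B u (loopBracket v w) =
      cocycle B (loopBracket u v) w + cocycle B v (loopBracket u w) := by
  induction u using Finsupp.induction_linear with
  | zero => simp
  | add a b ha hb => simp only [map_add, LinearMap.add_apply, ha, hb]; ring
  | single m a =>
  induction v using Finsupp.induction_linear with
  | zero => simp
  | add a b ha hb => simp only [map_add, LinearMap.add_apply, ha, hb]; ring
  | single n b =>
  induction w using Finsupp.induction_linear with
  | zero => simp
  | add a b ha hb => simp only [map_add, ha, hb]; ring
  | single k c =>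
    simp only [loopBracket_single, cocycle_single]
    by_cases h : m + n + k = 0
    · have h1 : B.form ⁅a, b⁆ c = B.form a ⁅b, c⁆ := by
        rw [← lie_skew, map_neg, LinearMap.neg_apply, B.invariant b a c, neg_neg]
      have h2 : B.form b ⁅a, c⁆ = -B.form a ⁅b, c⁆ := by
        rw [← h1, B.invariant a b c, neg_neg]
      rw [if_pos (by omega), if_pos (by omega), if_pos (by omega), h1, h2]
      push_cast
      ring
    · rw [if_neg (by omega), if_neg (by omega), if_neg (by omega)]
      ring

instance : LieRing (Affine B) where
  bracket x y := ⟨loopBracket x.loop y.loop, cocycle B x.loop y.loop⟩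
  add_lie x y z := by ext1 <;> simp
  lie_add x y z := by ext1 <;> simp
  lie_self x := by
    ext1
    · have h : (2 : ℂ) • loopBracket x.loop x.loop = 0 := by
        rw [two_smul]
        exact add_eq_zero_iff_eq_neg.mpr (loopBracket_skew _ _)
      exact (smul_eq_zero.mp h).resolve_left two_ne_zero
    · exact self_eq_neg.mp (cocycle_skew _ _ _)
  leibniz_lie x y z := by
    ext1
    · exact loopBracket_jacobi _ _ _
    · exact cocycle_jacobi _ _ _ _

variable {B} in
lemma bracket_def (x y : Affine B) :
    ⁅x, y⁆ = ⟨loopBracket x.loop y.loop, cocycle B x.loop y.loop⟩ := rfl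

instance : LieAlgebra ℂ (Affine B) where
  lie_smul r x y := by simp only [bracket_def]; ext1 <;> simp

/-- `x(n) = tⁿ ⊗ x`. -/
def el (x : g) (n : ℤ) : Affine B := ⟨Finsupp.single n x, 0⟩

/-- The central element. -/
def C : Affine B := ⟨0, 1⟩

lemma lie_el_el (x y : g) (m n : ℤ) :
    ⁅el B x m, el B y n⁆ =
      el B ⁅x, y⁆ (m + n) + ((if m = -n then (m : ℂ) else 0) * B.form x y) • C B := by
  rw [bracket_def]
  ext1
  · simp only [el, C, loopBracket_single, add_loop, smul_loop, smul_zero, add_zero]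
  · simp only [el, C, cocycle_single, add_central, smul_central, smul_eq_mul, mul_one, zero_add]

lemma lie_C (x : Affine B) : ⁅C B, x⁆ = 0 := by
  rw [bracket_def]; ext1 <;> simp [C]

/-- The action of vector fields on the loop algebra: `L(m) · x(n) = -n x(m + n)`. -/
def vectorField : (ℤ →₀ ℂ) →ₗ[ℂ] Module.End ℂ (ℤ →₀ g) :=
  Finsupp.linearCombination ℂ fun m : ℤ =>
    Finsupp.lsum ℂ fun n : ℤ => -(n : ℂ) • Finsupp.lsingle (m + n)

@[simp] lemma vectorField_single (m n : ℤ) (a : ℂ) (x : g) :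
    vectorField (Finsupp.single m a) (Finsupp.single n x) =
      Finsupp.single (m + n) (-(a * n) • x) := by
  simp [vectorField, Finsupp.linearCombination_single, smul_smul]

lemma vectorField_lie (u v : ℤ →₀ ℂ) (f : ℤ →₀ g) :
    vectorField (Virasoro.wittBracket u v) f =
      vectorField u (vectorField v f) - vectorField v (vectorField u f) := by
  induction u using Finsupp.induction_linear with
  | zero => simp
  | add a b ha hb => simp only [map_add, LinearMap.add_apply, ha, hb]; abel
  | single m a =>
  induction v using Finsupp.induction_linear with
  | zero => simp
  | add a b ha hb => simp only [map_add, LinearMap.add_apply, ha, hb]; abel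
  | single n b =>
  induction f using Finsupp.induction_linear with
  | zero => simp
  | add a b ha hb => simp only [map_add, ha, hb]; abel
  | single k x =>
    simp only [Virasoro.wittBracket_single, vectorField_single, smul_smul,
      show n + (m + k) = m + n + k by ring, show m + (n + k) = m + n + k by ring,
      ← Finsupp.single_sub, ← sub_smul]
    congr 2
    push_cast
    ring

lemma vectorField_leibniz (u : ℤ →₀ ℂ) (f h : ℤ →₀ g) :
    vectorField u (loopBracket f h) =
      loopBracket f (vectorField u h) - loopBracket h (vectorField u f) := by
  induction u using Finsupp.induction_linear with
  | zero => simp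
  | add a b ha hb => simp only [map_add, LinearMap.add_apply, ha, hb]; abel
  | single m a =>
  induction f using Finsupp.induction_linear with
  | zero => simp
  | add a b ha hb => simp only [map_add, LinearMap.add_apply, ha, hb]; abel
  | single n x =>
  induction h using Finsupp.induction_linear with
  | zero => simp
  | add a b ha hb => simp only [map_add, LinearMap.add_apply, ha, hb]; abel
  | single k y =>
    simp only [loopBracket_single, vectorField_single, lie_smul, ← lie_skew x y, smul_neg,
      show n + (m + k) = m + (n + k) by ring, show k + (m + n) = m + (n + k) by ring,
      ← Finsupp.single_sub, ← neg_smul, ← sub_smul]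
    congr 2
    push_cast
    ring

lemma vectorField_cocycle (u : ℤ →₀ ℂ) (f h : ℤ →₀ g) :
    cocycle B f (vectorField u h) - cocycle B h (vectorField u f) = 0 := by
  induction u using Finsupp.induction_linear with
  | zero => simp
  | add a b ha hb =>
    simp only [map_add, LinearMap.add_apply]
    linear_combination ha + hb
  | single m a =>
  induction f using Finsupp.induction_linear with
  | zero => simp
  | add a b ha hb =>
    simp only [map_add, LinearMap.add_apply]
    linear_combination ha + hb
  | single n x =>
  induction h using Finsupp.induction_linear with
  | zero => simp
  | add a b ha hb =>
    simp only [map_add, LinearMap.add_apply]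
    linear_combination ha + hb
  | single k y =>
    simp only [vectorField_single, cocycle_single, map_smul, smul_eq_mul, B.symm.eq y x]
    by_cases h : m + n + k = 0
    · rw [if_pos (by omega), if_pos (by omega)]
      ring
    · rw [if_neg (by omega), if_neg (by omega)]
      ring

/-- The derivation of `ĝ` given by a vector field: `L(m) · x(n) = -n x(m + n)`, `L(m) · C = 0`. -/
def derivation (u : ℤ →₀ ℂ) : LieDerivation ℂ (Affine B) (Affine B) where
  toFun x := ⟨vectorField u x.loop, 0⟩
  map_add' x y := by ext1 <;> simp
  map_smul' r x := by ext1 <;> simp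
  leibniz' x y := by
    simp only [bracket_def, LinearMap.coe_mk, AddHom.coe_mk]
    ext1
    · exact vectorField_leibniz _ _ _
    · exact (vectorField_cocycle _ _ _ _).symm

end Affine

/-! ### The semidirect product of the Virasoro algebra with two affine algebras -/

section FBar

variable {g s : Type*} [LieRing g] [LieAlgebra ℂ g] [LieRing s] [LieAlgebra ℂ s]

/-- The action of the Virasoro algebra on `ĝ ⊕ ŝ` by derivations; the central element of the
Virasoro algebra acts by zero. -/
def virasoroAction (B : InvForm g) (B' : InvForm s) :
    Virasoro →ₗ⁅ℂ⁆ LieDerivation ℂ (Affine B × Affine B') (Affine B × Affine B') where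
  toFun u :=
    { toFun x := (Affine.derivation B u.field x.1, Affine.derivation B' u.field x.2)
      map_add' x y := by simp
      map_smul' r x := by simp
      leibniz' x y := by simp }
  map_add' u v := by
    ext x : 1
    ext1 <;> simp [Affine.derivation] <;> ext1 <;> simp
  map_smul' r u := by
    ext x : 1
    ext1 <;> simp [Affine.derivation] <;> ext1 <;> simp
  map_lie' {u v} := by
    ext x : 1
    rw [LieDerivation.lie_apply]
    ext1 <;> ext1 <;>
      simp [Affine.derivation, Virasoro.bracket_def, Affine.vectorField_lie]

lemma virasoroAction_apply (B : InvForm g) (B' : InvForm s) (u : Virasoro)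
    (x : Affine B × Affine B') : virasoroAction B B' u x =
      (⟨Affine.vectorField u.field x.1.loop, 0⟩, ⟨Affine.vectorField u.field x.2.loop, 0⟩) := rfl

/-- The Lie algebra `f̄`: the semidirect product of the Virasoro algebra with `ĝ ⊕ ŝ`. -/
abbrev FBar (B : InvForm g) (B' : InvForm s) : Type _ :=
  (Affine B × Affine B') ⋊⁅virasoroAction B B'⁆ Virasoro

namespace FBar

variable (B : InvForm g) (B' : InvForm s)

/-- The inclusion `ĝ → f̄`. -/
def ofFst (a : Affine B) : FBar B B' := LieAlgebra.SemiDirectSum.inl _ (a, 0)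

/-- The inclusion `ŝ → f̄`. -/
def ofSnd (a : Affine B') : FBar B B' := LieAlgebra.SemiDirectSum.inl _ (0, a)

/-- The inclusion of the Virasoro algebra into `f̄`. -/
def ofVir (u : Virasoro) : FBar B B' := LieAlgebra.SemiDirectSum.inr _ u

lemma lie_vir_fst (u : Virasoro) (a : Affine B) :
    ⁅ofVir B B' u, ofFst B B' a⁆ = ofFst B B' ⟨Affine.vectorField u.field a.loop, 0⟩ := by
  rw [ofVir, ofFst, ofFst, LieAlgebra.SemiDirectSum.lie_eq_mk]
  refine LieAlgebra.SemiDirectSum.ext ?_ ?_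
  · change ⁅(0 : Affine B × Affine B'), (a, 0)⁆ + virasoroAction B B' u (a, 0) -
      virasoroAction B B' 0 0 = (_, 0)
    rw [zero_lie, map_zero, sub_zero, zero_add, virasoroAction_apply]
    rw [show (Affine.loop (0 : Affine B')) = 0 from rfl, map_zero]
    rfl
  · exact lie_zero _

lemma lie_L_el (m n : ℤ) (x : g) :
    ⁅ofVir B B' (.L m), ofFst B B' (.el B x n)⁆ = ofFst B B' (-(n : ℂ) • .el B x (m + n)) := by
  rw [lie_vir_fst]
  congr 1
  ext1
  · simp [Virasoro.L, Affine.el, -neg_smul]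
  · simp [Affine.el, -neg_smul]

end FBar

end FBar

/-! ### Induced modules and their irreducible quotients -/

section Induced

variable {L : Type*} [LieRing L] [LieAlgebra ℂ L] {E : Type*} [AddCommGroup E] [Module ℂ E]

/-- The `U(L)`-submodule of `U(L) ⊗ E` generated by all `p ⊗ e - 1 ⊗ A e` with `R p A`. -/
def inducedRel (R : L → Module.End ℂ E → Prop) :
    Submodule (UniversalEnvelopingAlgebra ℂ L) (UniversalEnvelopingAlgebra ℂ L ⊗[ℂ] E) :=
  Submodule.span _ {t | ∃ (p : L) (A : Module.End ℂ E) (e : E), R p A ∧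
    t = UniversalEnvelopingAlgebra.ι ℂ p ⊗ₜ[ℂ] e - 1 ⊗ₜ[ℂ] A e}

/-- The induced module `U(L) ⊗_{U(P)} E`, where `P ⊆ L` is a subalgebra and `E` a `P`-module; the
relation `R` lists the action `A` on `E` of each `p` in a spanning set of `P`. -/
abbrev Induced (R : L → Module.End ℂ E → Prop) : Type _ :=
  (UniversalEnvelopingAlgebra ℂ L ⊗[ℂ] E) ⧸ inducedRel R

/-- The image of `1 ⊗ e` in the induced module. -/
def Induced.top (R : L → Module.End ℂ E → Prop) (e : E) : Induced R :=
  Submodule.Quotient.mk (1 ⊗ₜ[ℂ] e)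

/-- The irreducible quotient: the quotient of the induced module by its largest proper submodule,
which is the sum of all its proper submodules. -/
abbrev IrrQuotient (R : L → Module.End ℂ E → Prop) : Type _ :=
  Induced R ⧸ sSup {X : Submodule (UniversalEnvelopingAlgebra ℂ L) (Induced R) | X ≠ ⊤}

/-- The action of `L` on a `U(L)`-module. -/
def act {M : Type*} [AddCommGroup M] [Module ℂ M] [Module (UniversalEnvelopingAlgebra ℂ L) M]
    [IsScalarTower ℂ (UniversalEnvelopingAlgebra ℂ L) M] (x : L) : Module.End ℂ M :=
  Algebra.lsmul ℂ ℂ M (UniversalEnvelopingAlgebra.ι ℂ x)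

end Induced

/-! ### The vacuum modules -/

section Modules

variable {g s : Type*} [LieRing g] [LieAlgebra ℂ g] [LieRing s] [LieAlgebra ℂ s]

/-- The one-dimensional module inducing the vacuum module of the Virasoro algebra. -/
inductive VirVacRel (c : ℂ) : Virasoro → Module.End ℂ ℂ → Prop
  | nonneg (n : ℤ) (hn : -1 ≤ n) : VirVacRel c (.L n) 0
  | central : VirVacRel c .C (c • 1)

/-- The one-dimensional module inducing the vacuum module of `ĝ`. -/
inductive AffineVacRel (B : InvForm g) (c : ℂ) : Affine B → Module.End ℂ ℂ → Prop
  | nonneg (x : g) (n : ℤ) (hn : 0 ≤ n) : AffineVacRel B c (.el B x n) 0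
  | central : AffineVacRel B c (.C B) (c • 1)

/-- The one-dimensional module inducing the vacuum module of `f̄`. -/
inductive FBarVacRel (B : InvForm g) (B' : InvForm s) (c₁ c₂ c : ℂ) :
    FBar B B' → Module.End ℂ ℂ → Prop
  | fst (a : Affine B) (A : Module.End ℂ ℂ) (h : AffineVacRel B c₁ a A) :
      FBarVacRel B B' c₁ c₂ c (.ofFst B B' a) A
  | snd (a : Affine B') (A : Module.End ℂ ℂ) (h : AffineVacRel B' c₂ a A) :
      FBarVacRel B B' c₁ c₂ c (.ofSnd B B' a) A
  | vir (u : Virasoro) (A : Module.End ℂ ℂ) (h : VirVacRel c u A) :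
      FBarVacRel B B' c₁ c₂ c (.ofVir B B' u) A

/-- The underlying space of the Virasoro VOA of rank `c`. -/
abbrev VVir (c : ℂ) : Type := Induced (VirVacRel c)

/-- The underlying space of the affine VOA of level `c`. -/
abbrev VAffine (B : InvForm g) (c : ℂ) : Type _ := Induced (AffineVacRel B c)

/-- The underlying space of the VOA of `f̄` with central charges `c₁`, `c₂`, `c`. -/
abbrev VFBar (B : InvForm g) (B' : InvForm s) (c₁ c₂ c : ℂ) : Type _ :=
  Induced (FBarVacRel B B' c₁ c₂ c)

/-! ### Generalized Verma modules -/

/-- The one-dimensional module inducing the Verma module of the Virasoro algebra. -/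
inductive VirTopRel (h c : ℂ) : Virasoro → Module.End ℂ ℂ → Prop
  | pos (n : ℤ) (hn : 0 < n) : VirTopRel h c (.L n) 0
  | zero : VirTopRel h c (.L 0) (h • 1)
  | central : VirTopRel h c .C (c • 1)

/-- The action on `V` inducing the generalized Verma module of `ĝ` of level `c`. -/
inductive AffineTopRel (B : InvForm g) (V : Type*) [AddCommGroup V] [Module ℂ V]
    [LieRingModule g V] [LieModule ℂ g V] (c : ℂ) : Affine B → Module.End ℂ V → Prop
  | pos (x : g) (n : ℤ) (hn : 0 < n) : AffineTopRel B V c (.el B x n) 0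
  | zero (x : g) : AffineTopRel B V c (.el B x 0) (LieModule.toEnd ℂ g V x)
  | central : AffineTopRel B V c (.C B) (c • 1)

/-- The action on `V ⊗ W` inducing the generalized Verma module of `f̄`. -/
inductive FBarTopRel (B : InvForm g) (B' : InvForm s)
    (V : Type*) [AddCommGroup V] [Module ℂ V] [LieRingModule g V] [LieModule ℂ g V]
    (W : Type*) [AddCommGroup W] [Module ℂ W] [LieRingModule s W] [LieModule ℂ s W]
    (h c₁ c₂ c : ℂ) : FBar B B' → Module.End ℂ (V ⊗[ℂ] W) → Prop
  | fst_pos (x : g) (n : ℤ) (hn : 0 < n) :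
      FBarTopRel B B' V W h c₁ c₂ c (.ofFst B B' (.el B x n)) 0
  | fst_zero (x : g) :
      FBarTopRel B B' V W h c₁ c₂ c (.ofFst B B' (.el B x 0))
        ((LieModule.toEnd ℂ g V x).rTensor W)
  | fst_central : FBarTopRel B B' V W h c₁ c₂ c (.ofFst B B' (.C B)) (c₁ • 1)
  | snd_pos (y : s) (n : ℤ) (hn : 0 < n) :
      FBarTopRel B B' V W h c₁ c₂ c (.ofSnd B B' (.el B' y n)) 0
  | snd_zero (y : s) :
      FBarTopRel B B' V W h c₁ c₂ c (.ofSnd B B' (.el B' y 0))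
        ((LieModule.toEnd ℂ s W y).lTensor V)
  | snd_central : FBarTopRel B B' V W h c₁ c₂ c (.ofSnd B B' (.C B')) (c₂ • 1)
  | vir_pos (n : ℤ) (hn : 0 < n) : FBarTopRel B B' V W h c₁ c₂ c (.ofVir B B' (.L n)) 0
  | vir_zero : FBarTopRel B B' V W h c₁ c₂ c (.ofVir B B' (.L 0)) (h • 1)
  | vir_central : FBarTopRel B B' V W h c₁ c₂ c (.ofVir B B' .C) (c • 1)

/-- The irreducible highest weight module of the Virasoro algebra. -/
abbrev LVir (h c : ℂ) : Type := IrrQuotient (VirTopRel h c)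

/-- The irreducible highest weight module of `ĝ` of level `c` with top `V`. -/
abbrev LAffine (B : InvForm g) (V : Type*) [AddCommGroup V] [Module ℂ V]
    [LieRingModule g V] [LieModule ℂ g V] (c : ℂ) : Type _ := IrrQuotient (AffineTopRel B V c)

/-- The irreducible highest weight module of `f̄` with top `V ⊗ W`. -/
abbrev LFBar (B : InvForm g) (B' : InvForm s)
    (V : Type*) [AddCommGroup V] [Module ℂ V] [LieRingModule g V] [LieModule ℂ g V]
    (W : Type*) [AddCommGroup W] [Module ℂ W] [LieRingModule s W] [LieModule ℂ s W]
    (h c₁ c₂ c : ℂ) : Type _ := IrrQuotient (FBarTopRel B B' V W h c₁ c₂ c)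

/-! ### Casimir operators and the Sugawara construction -/

section Sugawara

variable [FiniteDimensional ℂ g] (B : InvForm g)

/-- A basis `xᵢ` of `g`. -/
def basis (g : Type*) [LieRing g] [LieAlgebra ℂ g] [FiniteDimensional ℂ g] :
    Module.Basis (Fin (Module.finrank ℂ g)) ℂ g := Module.finBasis ℂ g

/-- The basis `xⁱ` of `g` dual to `xᵢ` with respect to the invariant form. -/
def dualBasis : Module.Basis (Fin (Module.finrank ℂ g)) ℂ g :=
  LinearMap.BilinForm.dualBasis B.form B.nondeg (basis g)

/-- The Casimir operator `∑ᵢ xᵢ xⁱ` on a `g`-module. -/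
def casimir (V : Type*) [AddCommGroup V] [Module ℂ V] [LieRingModule g V] [LieModule ℂ g V] :
    Module.End ℂ V :=
  ∑ i, LieModule.toEnd ℂ g V (basis g i) * LieModule.toEnd ℂ g V (dualBasis B i)

/-- The Sugawara operator
`1 / (2 (c + h)) ∑ᵢ ∑ⱼ :xᵢ(j) xⁱ(n - j):` on a `ĝ`-module `M` on which each vector is killed by
all `x(n)` with `n` large (so that the sum over `j` is finite). -/
def sugawara (c h : ℂ) {M : Type*} [AddCommGroup M] [Module ℂ M]
    [Module (UniversalEnvelopingAlgebra ℂ (Affine B)) M]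
    [IsScalarTower ℂ (UniversalEnvelopingAlgebra ℂ (Affine B)) M] (n : ℤ) (v : M) : M :=
  (1 / (2 * (c + h))) • ∑ i, ∑ᶠ j : ℤ,
    if j < 0 then act (Affine.el B (basis g i) j) (act (Affine.el B (dualBasis B i) (n - j)) v)
    else act (Affine.el B (dualBasis B i) (n - j)) (act (Affine.el B (basis g i) j) v)

/-- The Sugawara vector `1 / (2 (c + h)) ∑ᵢ xᵢ(-1) xⁱ(-1) 𝟙` of the affine VOA. -/
def sugawaraVector (c h : ℂ) : VAffine B c :=
  (1 / (2 * (c + h))) • ∑ i, act (Affine.el B (basis g i) (-1))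
    (act (Affine.el B (dualBasis B i) (-1)) (Induced.top (AffineVacRel B c) 1))

end Sugawara
end Modules

/-! ### Vertex operator algebras -/

/-- The data of a vertex operator algebra: the state-field correspondence `Y(a, z)`, the vacuum and
the conformal vector. -/
@[ext] structure VOAData (V : Type*) [AddCommGroup V] [Module ℂ V] where
  Y : V →ₗ[ℂ] VertexOperator ℂ V
  vac : V
  conf : V

namespace VOAData

open VertexOperator (ncoeff)

variable {V : Type*} [AddCommGroup V] [Module ℂ V] {W : Type*} [AddCommGroup W] [Module ℂ W]

/-- The mode `a₍ₙ₎` of the field `Y(a, z) = ∑ₙ a₍ₙ₎ z^{-n-1}`. -/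
def mode (S : VOAData V) (a : V) (n : ℤ) : Module.End ℂ V := ncoeff (S.Y a) n

/-- The modes of the conformal vector: `Y(ω, z) = ∑ₙ L(n) z^{-n-2}`. -/
def L (S : VOAData V) (n : ℤ) : Module.End ℂ V := S.mode S.conf (n + 1)

/-- The axioms of a vertex operator algebra of rank `c`. -/
structure IsVOA (S : VOAData V) (c : ℂ) : Prop where
  /-- `Y(𝟙, z) = id`. -/
  vacuum (n : ℤ) : S.mode S.vac n = if n = -1 then 1 else 0
  /-- `Y(a, z) 𝟙` has no negative powers of `z`. -/
  creation_nonneg (a : V) (n : ℤ) (hn : 0 ≤ n) : S.mode a n S.vac = 0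
  /-- The value of `Y(a, z) 𝟙` at `z = 0` is `a`. -/
  creation (a : V) : S.mode a (-1) S.vac = a
  /-- `[L(-1), Y(a, z)] = d/dz Y(a, z)`. -/
  translation (a : V) (n : ℤ) : S.L (-1) * S.mode a n - S.mode a n * S.L (-1) =
    -(n : ℂ) • S.mode a (n - 1)
  /-- `(z - w)ᵏ [Y(a, z), Y(b, w)] = 0` for some `k`. -/
  locality (a b : V) : ∃ k : ℕ, ∀ m n : ℤ, ∑ i ∈ Finset.range (k + 1),
    ((-1 : ℂ) ^ i * (k.choose i : ℂ)) •
      (S.mode a (m + k - i) * S.mode b (n + i) - S.mode b (n + i) * S.mode a (m + k - i)) = 0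
  /-- The Virasoro relations with central charge `c`. -/
  virasoro (m n : ℤ) : S.L m * S.L n - S.L n * S.L m =
    ((m : ℂ) - n) • S.L (m + n) + ((if m = -n then ((m : ℂ) ^ 3 - m) / 12 else 0) * c) • 1
  /-- `V` is the direct sum of the eigenspaces of `L(0)` with integral eigenvalues. -/
  grading : DirectSum.IsInternal fun n : ℤ => Module.End.eigenspace (S.L 0) (n : ℂ)

lemma exists_forall_ncoeff_eq_zero (A : VertexOperator ℂ V) (v : V) :
    ∃ k : ℤ, ∀ n : ℤ, k ≤ n → ncoeff A n v = 0 := by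
  refine ⟨-HahnSeries.order ((HahnModule.of ℂ).symm (A v)), fun n hn => ?_⟩
  exact A.ncoeff_eq_zero_of_lt_order n v (by omega)

/-- The coefficient of `z^{-n-1}` in `A(z) v ⊗ B(z) w`. -/
def tensorCoeff (A : VertexOperator ℂ V) (B : VertexOperator ℂ W) (n : ℤ) (v : V) (w : W) :
    V ⊗[ℂ] W :=
  ∑ᶠ i : ℤ, ncoeff A i v ⊗ₜ[ℂ] ncoeff B (n - 1 - i) w

lemma tensorCoeff_finite (A : VertexOperator ℂ V) (B : VertexOperator ℂ W) (n : ℤ) (v : V)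
    (w : W) :
    Function.HasFiniteSupport fun i : ℤ => ncoeff A i v ⊗ₜ[ℂ] ncoeff B (n - 1 - i) w := by
  obtain ⟨k, hk⟩ := exists_forall_ncoeff_eq_zero A v
  obtain ⟨l, hl⟩ := exists_forall_ncoeff_eq_zero B w
  refine (Set.finite_Icc (n - 1 - l) k).subset fun i hi => ?_
  by_contra hc
  rw [Set.mem_Icc, not_and_or, not_le, not_le] at hc
  refine hi ?_
  rcases hc with hc | hc
  · simp [hl (n - 1 - i) (by omega)]
  · simp [hk i hc.le]

lemma tensorCoeff_eq_zero (A : VertexOperator ℂ V) (B : VertexOperator ℂ W) (v : V) (w : W) :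
    ∃ k : ℤ, ∀ n : ℤ, k ≤ n → tensorCoeff A B n v w = 0 := by
  obtain ⟨k, hk⟩ := exists_forall_ncoeff_eq_zero A v
  obtain ⟨l, hl⟩ := exists_forall_ncoeff_eq_zero B w
  refine ⟨k + l + 1, fun n hn => ?_⟩
  rw [tensorCoeff, ← finsum_zero (α := ℤ)]
  congr 1
  ext i
  by_cases hi : k ≤ i
  · simp [hk i hi]
  · simp [hl (n - 1 - i) (by omega)]

lemma tensorCoeff_add₁ (A A' : VertexOperator ℂ V) (B : VertexOperator ℂ W) (n : ℤ) (v : V)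
    (w : W) : tensorCoeff (A + A') B n v w = tensorCoeff A B n v w + tensorCoeff A' B n v w := by
  rw [tensorCoeff, tensorCoeff, tensorCoeff,
    ← finsum_add_distrib (tensorCoeff_finite ..) (tensorCoeff_finite ..)]
  simp [TensorProduct.add_tmul]

lemma tensorCoeff_add₂ (A : VertexOperator ℂ V) (B B' : VertexOperator ℂ W) (n : ℤ) (v : V)
    (w : W) : tensorCoeff A (B + B') n v w = tensorCoeff A B n v w + tensorCoeff A B' n v w := by
  rw [tensorCoeff, tensorCoeff, tensorCoeff,
    ← finsum_add_distrib (tensorCoeff_finite ..) (tensorCoeff_finite ..)]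
  simp [TensorProduct.tmul_add]

lemma tensorCoeff_add₃ (A : VertexOperator ℂ V) (B : VertexOperator ℂ W) (n : ℤ) (v v' : V)
    (w : W) : tensorCoeff A B n (v + v') w = tensorCoeff A B n v w + tensorCoeff A B n v' w := by
  rw [tensorCoeff, tensorCoeff, tensorCoeff,
    ← finsum_add_distrib (tensorCoeff_finite ..) (tensorCoeff_finite ..)]
  simp [TensorProduct.add_tmul]

lemma tensorCoeff_add₄ (A : VertexOperator ℂ V) (B : VertexOperator ℂ W) (n : ℤ) (v : V)
    (w w' : W) : tensorCoeff A B n v (w + w') = tensorCoeff A B n v w + tensorCoeff A B n v w' := by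
  rw [tensorCoeff, tensorCoeff, tensorCoeff,
    ← finsum_add_distrib (tensorCoeff_finite ..) (tensorCoeff_finite ..)]
  simp [TensorProduct.tmul_add]

lemma tensorCoeff_smul₁ (r : ℂ) (A : VertexOperator ℂ V) (B : VertexOperator ℂ W) (n : ℤ) (v : V)
    (w : W) : tensorCoeff (r • A) B n v w = r • tensorCoeff A B n v w := by
  rw [tensorCoeff, tensorCoeff, smul_finsum]
  simp [TensorProduct.smul_tmul']

lemma tensorCoeff_smul₂ (r : ℂ) (A : VertexOperator ℂ V) (B : VertexOperator ℂ W) (n : ℤ) (v : V)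
    (w : W) : tensorCoeff A (r • B) n v w = r • tensorCoeff A B n v w := by
  rw [tensorCoeff, tensorCoeff, smul_finsum]
  simp

lemma tensorCoeff_smul₃ (r : ℂ) (A : VertexOperator ℂ V) (B : VertexOperator ℂ W) (n : ℤ) (v : V)
    (w : W) : tensorCoeff A B n (r • v) w = r • tensorCoeff A B n v w := by
  rw [tensorCoeff, tensorCoeff, smul_finsum]
  simp [TensorProduct.smul_tmul']

lemma tensorCoeff_smul₄ (r : ℂ) (A : VertexOperator ℂ V) (B : VertexOperator ℂ W) (n : ℤ) (v : V)
    (w : W) : tensorCoeff A B n v (r • w) = r • tensorCoeff A B n v w := by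
  rw [tensorCoeff, tensorCoeff, smul_finsum]
  simp

/-- `tensorCoeff` as an endomorphism of `V ⊗ W`. -/
def tensorCoeffEnd (A : VertexOperator ℂ V) (B : VertexOperator ℂ W) (n : ℤ) :
    Module.End ℂ (V ⊗[ℂ] W) :=
  TensorProduct.lift <| LinearMap.mk₂ ℂ (tensorCoeff A B n)
    (fun _ _ _ => tensorCoeff_add₃ ..) (fun _ _ _ => tensorCoeff_smul₃ ..)
    (fun _ _ _ => tensorCoeff_add₄ ..) (fun _ _ _ => tensorCoeff_smul₄ ..)

@[simp] lemma tensorCoeffEnd_tmul (A : VertexOperator ℂ V) (B : VertexOperator ℂ W) (n : ℤ)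
    (v : V) (w : W) : tensorCoeffEnd A B n (v ⊗ₜ w) = tensorCoeff A B n v w := rfl

lemma tensorCoeffEnd_eq_zero (A : VertexOperator ℂ V) (B : VertexOperator ℂ W) (t : V ⊗[ℂ] W) :
    ∃ k : ℤ, ∀ n : ℤ, k ≤ n → tensorCoeffEnd A B n t = 0 := by
  induction t using TensorProduct.induction_on with
  | zero => exact ⟨0, by simp⟩
  | tmul v w => exact tensorCoeff_eq_zero A B v w
  | add s t hs ht =>
    obtain ⟨k, hk⟩ := hs
    obtain ⟨l, hl⟩ := ht
    refine ⟨max k l, fun n hn => ?_⟩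
    rw [map_add, hk n (le_trans (le_max_left _ _) hn), hl n (le_trans (le_max_right _ _) hn),
      add_zero]

/-- The vertex operator `A(z) ⊗ B(z)` on `V ⊗ W`. -/
def tensorOperator (A : VertexOperator ℂ V) (B : VertexOperator ℂ W) :
    VertexOperator ℂ (V ⊗[ℂ] W) :=
  VertexOperator.of_coeff (fun n => tensorCoeffEnd A B (-n - 1)) fun t => by
    obtain ⟨k, hk⟩ := tensorCoeffEnd_eq_zero A B t
    refine ⟨-k - 1, fun n hn => ?_⟩
    by_contra hc
    exact hn (hk _ (by omega))

lemma ncoeff_tensorOperator (A : VertexOperator ℂ V) (B : VertexOperator ℂ W) (n : ℤ) :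
    ncoeff (tensorOperator A B) n = tensorCoeffEnd A B n := by
  rw [tensorOperator, VertexOperator.ncoeff_of_coeff]
  congr 1
  ring

lemma operator_ext {A B : VertexOperator ℂ V} (h : ∀ n, ncoeff A n = ncoeff B n) : A = B := by
  refine HVertexOperator.coeff_inj (funext fun n => ?_)
  rw [VertexOperator.coeff_eq_ncoeff, VertexOperator.coeff_eq_ncoeff, h]

/-- The tensor product of two vertex operator algebras: `Y(a ⊗ b, z) = Y(a, z) ⊗ Y(b, z)`, with
vacuum `𝟙 ⊗ 𝟙` and conformal vector `ω ⊗ 𝟙 + 𝟙 ⊗ ω`. -/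
def tensor (S : VOAData V) (T : VOAData W) : VOAData (V ⊗[ℂ] W) where
  Y := TensorProduct.lift <| LinearMap.mk₂ ℂ (fun a b => tensorOperator (S.Y a) (T.Y b))
    (fun a a' b => operator_ext fun n => by
      ext v w
      simp [ncoeff_tensorOperator, tensorCoeff_add₁])
    (fun r a b => operator_ext fun n => by
      ext v w
      simp [ncoeff_tensorOperator, tensorCoeff_smul₁])
    (fun a b b' => operator_ext fun n => by
      ext v w
      simp [ncoeff_tensorOperator, tensorCoeff_add₂])
    (fun r a b => operator_ext fun n => by
      ext v w
      simp [ncoeff_tensorOperator, tensorCoeff_smul₂])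
  vac := S.vac ⊗ₜ T.vac
  conf := S.conf ⊗ₜ T.vac + S.vac ⊗ₜ T.conf

lemma tensor_mode (S : VOAData V) (T : VOAData W) (a v : V) (b w : W) (n : ℤ) :
    (S.tensor T).mode (a ⊗ₜ b) n (v ⊗ₜ w) =
      ∑ᶠ i : ℤ, S.mode a i v ⊗ₜ[ℂ] T.mode b (n - 1 - i) w := by
  change ncoeff (tensorOperator (S.Y a) (T.Y b)) n (v ⊗ₜ w) = _
  rw [ncoeff_tensorOperator]
  rfl

/-- A linear isomorphism `φ : V → W` is an isomorphism of vertex operator algebras. -/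
structure IsIso (S : VOAData V) (T : VOAData W) (φ : V ≃ₗ[ℂ] W) : Prop where
  map_mode (a v : V) (n : ℤ) : φ (S.mode a n v) = T.mode (φ a) n (φ v)
  map_vac : φ S.vac = T.vac
  map_conf : φ S.conf = T.conf

end VOAData

/-! ### The vertex operator algebras of the Virasoro algebra, of `ĝ` and of `f̄` -/

section Enveloping

variable {g s : Type*} [LieRing g] [LieAlgebra ℂ g] [LieRing s] [LieAlgebra ℂ s]

/-- `S` is the VOA structure of the vacuum module of the Virasoro algebra: its vacuum is the
generator, its conformal vector is `L(-2) 𝟙`, with field `∑ₙ L(n) z^{-n-2}`. -/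
structure IsVirVOA (c : ℂ) (S : VOAData (VVir c)) : Prop where
  isVOA : S.IsVOA c
  vac : S.vac = .top _ 1
  conf : S.conf = act (Virasoro.L (-2)) S.vac
  field (n : ℤ) : S.L n = act (Virasoro.L n)

/-- `S` is the VOA structure of the vacuum module of `ĝ` of level `c`: its vacuum is the generator,
the field of `x(-1) 𝟙` is `∑ₙ x(n) z^{-n-1}`, and the conformal vector is the Sugawara vector. -/
structure IsAffineVOA [FiniteDimensional ℂ g] (B : InvForm g) (c h : ℂ)
    (S : VOAData (VAffine B c)) : Prop where
  isVOA : S.IsVOA (c * Module.finrank ℂ g / (c + h))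
  vac : S.vac = .top _ 1
  conf : S.conf = sugawaraVector B c h
  field (x : g) (n : ℤ) : S.mode (act (Affine.el B x (-1)) S.vac) n = act (Affine.el B x n)

/-- `S` is the VOA structure of the vacuum module of `f̄`: its vacuum is the generator, the fields of
`x(-1) 𝟙` for `x` in `g` and in `s` are `∑ₙ x(n) z^{-n-1}`, and the conformal vector is `L(-2) 𝟙`,
with field `∑ₙ L(n) z^{-n-2}`. -/
structure IsFBarVOA (B : InvForm g) (B' : InvForm s) (c₁ c₂ c : ℂ)
    (S : VOAData (VFBar B B' c₁ c₂ c)) : Prop where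
  isVOA : S.IsVOA c
  vac : S.vac = .top _ 1
  conf : S.conf = act (FBar.ofVir B B' (.L (-2))) S.vac
  field_fst (x : g) (n : ℤ) : S.mode (act (FBar.ofFst B B' (.el B x (-1))) S.vac) n =
    act (FBar.ofFst B B' (.el B x n))
  field_snd (y : s) (n : ℤ) : S.mode (act (FBar.ofSnd B B' (.el B' y (-1))) S.vac) n =
    act (FBar.ofSnd B B' (.el B' y n))
  field_vir (n : ℤ) : S.L n = act (FBar.ofVir B B' (.L n))

end Enveloping

/-! ### The action of `f̄` on a tensor product of modules for `ĝ`, `ŝ` and the Virasoro algebra -/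

/-- A linear isomorphism from `L_ĝ(V) ⊗ L_ŝ(W) ⊗ L_Vir(h')` to `L_f̄(V, W, h)` is an isomorphism of
`f̄`-modules. On the tensor product `ĝ` acts on the first factor, `ŝ` on the second one, `L(n)` as the
sum of the two Sugawara operators and of `L(n)` on the third factor, and the central element of the
Virasoro algebra as the scalar `c`. Here `k₁`, `k₂` are the dual Coxeter numbers. -/
structure IsFBarIso {g s : Type*} [LieRing g] [LieAlgebra ℂ g] [LieRing s] [LieAlgebra ℂ s]
    [FiniteDimensional ℂ g] [FiniteDimensional ℂ s] {B : InvForm g} {B' : InvForm s}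
    {V : Type*} [AddCommGroup V] [Module ℂ V] [LieRingModule g V] [LieModule ℂ g V]
    {W : Type*} [AddCommGroup W] [Module ℂ W] [LieRingModule s W] [LieModule ℂ s W]
    {h c₁ c₂ c h' c' : ℂ} (k₁ k₂ : ℂ)
    (φ : LAffine B V c₁ ⊗[ℂ] (LAffine B' W c₂ ⊗[ℂ] LVir h' c') ≃ₗ[ℂ] LFBar B B' V W h c₁ c₂ c) :
    Prop where
  fst (a : Affine B) (u : LAffine B V c₁) (v : LAffine B' W c₂) (w : LVir h' c') :
    act (FBar.ofFst B B' a) (φ (u ⊗ₜ (v ⊗ₜ w))) = φ (act a u ⊗ₜ (v ⊗ₜ w))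
  snd (a : Affine B') (u : LAffine B V c₁) (v : LAffine B' W c₂) (w : LVir h' c') :
    act (FBar.ofSnd B B' a) (φ (u ⊗ₜ (v ⊗ₜ w))) = φ (u ⊗ₜ (act a v ⊗ₜ w))
  vir (n : ℤ) (u : LAffine B V c₁) (v : LAffine B' W c₂) (w : LVir h' c') :
    act (FBar.ofVir B B' (.L n)) (φ (u ⊗ₜ (v ⊗ₜ w))) =
      φ (sugawara B c₁ k₁ n u ⊗ₜ (v ⊗ₜ w) + u ⊗ₜ (sugawara B' c₂ k₂ n v ⊗ₜ w) +
        u ⊗ₜ (v ⊗ₜ act (Virasoro.L n) w))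
  vir_central (u : LAffine B V c₁) (v : LAffine B' W c₂) (w : LVir h' c') :
    act (FBar.ofVir B B' .C) (φ (u ⊗ₜ (v ⊗ₜ w))) = φ (c • (u ⊗ₜ (v ⊗ₜ w)))

/-! ### The trace form of `sl_N` and the dual Coxeter number -/

/-- The special linear Lie algebra `sl_N` over `ℂ`. -/
abbrev SL (N : ℕ) : Type := LieAlgebra.SpecialLinear.sl (Fin N) ℂ

/-- The form `(x | y) = tr(xy)` on `sl_N`. -/
def slForm (N : ℕ) : InvForm (SL N) where
  form := LinearMap.mk₂ ℂ (fun x y : SL N => (x.1 * y.1).trace)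
    (by simp [add_mul]) (by simp) (by simp [mul_add]) (by simp)
  symm := ⟨fun x y => by simpa using Matrix.trace_mul_comm x.1 y.1⟩
  invariant x y z := by
    simp only [LinearMap.mk₂_apply, LieAlgebra.SpecialLinear.sl_bracket, mul_sub, sub_mul,
      Matrix.trace_sub, ← mul_assoc]
    rw [mul_assoc x.1, Matrix.trace_mul_comm x.1]
    ring
  nondeg := by
    have key (x : SL N) (hx : ∀ y : SL N, (x.1 * y.1).trace = 0) : x = 0 := by
      have hoff (i j : Fin N) (hij : i ≠ j) : x.1 i j = 0 := by
        simpa [Matrix.trace_mul_single] using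
          hx (LieAlgebra.SpecialLinear.single j i hij.symm (1 : ℂ))
      have hdiag (i j : Fin N) : x.1 i i = x.1 j j := by
        have := hx (LieAlgebra.SpecialLinear.singleSubSingle i j (1 : ℂ))
        simpa [mul_sub, sub_eq_zero, Matrix.trace_mul_single] using this
      have htr : x.1.trace = 0 := x.2
      ext i j
      by_cases hij : i = j
      · subst hij
        have h2 : (N : ℂ) * x.1 i i = 0 := by
          calc (N : ℂ) * x.1 i i = ∑ _j : Fin N, x.1 i i := by simp
            _ = ∑ j : Fin N, x.1 j j := Finset.sum_congr rfl fun j _ => hdiag i j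
            _ = 0 := htr
        have hN : (N : ℂ) ≠ 0 := Nat.cast_ne_zero.mpr (Fin.pos i).ne'
        simpa using (mul_eq_zero.mp h2).resolve_left hN
      · simpa using hoff i j hij
    refine ⟨fun x hx => key x fun y => by simpa using hx y, fun x hx => key x fun y => ?_⟩
    rw [Matrix.trace_mul_comm]
    simpa using hx y

section Coxeter

open LieAlgebra.IsKilling

variable {g : Type*} [LieRing g] [LieAlgebra ℂ g] [FiniteDimensional ℂ g]
  [LieAlgebra.IsKilling ℂ g] {H : LieSubalgebra ℂ g} [H.IsCartanSubalgebra]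

/-- `θ` is the highest root: `θ - α` is a sum of simple roots for every root `α`. -/
def IsHighestRoot (b : (rootSystem H).Base) (θ : H.root) : Prop :=
  ∀ α : H.root, (rootSystem H).root θ - (rootSystem H).root α ∈
    AddSubmonoid.closure ((rootSystem H).root '' b.support)

/-- The dual Coxeter number `1 + ∑ aᵢ^∨`, where `θ^∨ = ∑ aᵢ^∨ αᵢ^∨` is the expansion of the coroot
of the highest root `θ` in simple coroots. -/
def dualCoxeter (b : (rootSystem H).Base) (θ : H.root) : ℤ := 1 + b.flip.height θ

end Coxeter

end
end TorVOA

/-! ### The Sugawara construction and the splitting of representations of f̄. -/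

namespace TorVOA

noncomputable section

/-! ### Finitely supported sums over the integers -/

section Finsum

variable {M : Type*} [AddCommGroup M]

/-! The Casimir element acts on the adjoint representation as a scalar: 2h^∨ for the simple algebra,
because of the normalization of the form at θ^∨, and 2N for sl_N with the trace form
(`isDualCoxeter_dualCoxeter`, `isDualCoxeter_slForm`). From this alone the Sugawara operators
satisfy [L(m), x(n)] = -n x(m+n) and the Virasoro relations with central charge c dim/(c+k)
(`LoopRep.lie_sug`, `LoopRep.sug_comm`). On a representation of f̄ the operator L(n) has the same
brackets with the loops, so L(n) minus both Sugawara operators commutes with both affine algebras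
and is a Virasoro representation of central charge c'. Representations of f̄ are thus the same as
triples of commuting representations of ĝ, of the affine algebra of sl_N and of Vir
(`FBarRep.toSplitRep`, `SplitRep.toFBarRep`).

For (i), the two sides therefore have the same universal property, and `exists_vacuum_equiv` obtains
mutually inverse maps from it, without bases or a PBW theorem. The vertex algebra structures come
from the reconstruction theorem `GeneratingFields.voa_isVOA`, which rests on Goddard's uniqueness
theorem (`eq_zero_of_isLocal`) and Dong's lemma (`IsLocal.normalProduct`). The isomorphism preserves
all products because a field is determined by its value on the vacuum and its locality with the
generating fields (`VOAData.map_mode_of_generatingFields`).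

For (ii), the density theorem and Schur's lemma make the tensor product of the three irreducible
modules irreducible (`IsIrreducibleFamily.tensor`). The Sugawara operators act on the tops as the
Casimir scalars over 2(c+k), so the tensor product is a quotient of the module induced from V ⊗ W,
and `exists_irrQuotient_equiv` identifies it with the irreducible quotient. Without PBW the tops are
not known to be nonzero; `subsingleton_of_factor` shows that both sides vanish if a factor does. -/

lemma hasFiniteSupport_of_bounds {f : ℤ → M} {a b : ℤ} (ha : ∀ j < a, f j = 0)
    (hb : ∀ j ≥ b, f j = 0) : Function.HasFiniteSupport f := by
  refine (Set.finite_Icc a b).subset fun j hj => ?_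
  by_contra hc
  rw [Set.mem_Icc, not_and_or, not_le, not_le] at hc
  rcases hc with hc | hc
  · exact hj (ha j hc)
  · exact hj (hb j hc.le)

lemma HasFiniteSupport.shift {f : ℤ → M} (hf : Function.HasFiniteSupport f) (m : ℤ) :
    Function.HasFiniteSupport fun j => f (j + m) :=
  Set.Finite.preimage (add_left_injective m).injOn hf

lemma HasFiniteSupport.add {ι : Type*} {f h : ι → M} (hf : Function.HasFiniteSupport f)
    (hh : Function.HasFiniteSupport h) : Function.HasFiniteSupport fun j => f j + h j :=
  (hf.union hh).subset fun j hj => by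
    by_contra hc
    simp only [Set.mem_union, Function.mem_support, not_or, not_not] at hc
    exact hj (by dsimp only; rw [hc.1, hc.2, add_zero])

lemma HasFiniteSupport.sub {ι : Type*} {f h : ι → M} (hf : Function.HasFiniteSupport f)
    (hh : Function.HasFiniteSupport h) : Function.HasFiniteSupport fun j => f j - h j :=
  (hf.union hh).subset fun j hj => by
    by_contra hc
    simp only [Set.mem_union, Function.mem_support, not_or, not_not] at hc
    exact hj (by dsimp only; rw [hc.1, hc.2, sub_zero])

lemma finsum_shift_sub {f : ℤ → M} (hf : Function.HasFiniteSupport f) (m : ℤ) :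
    ∑ᶠ j : ℤ, (f (j + m) - f j) = 0 := by
  rw [finsum_sub_distrib (HasFiniteSupport.shift hf m) hf, sub_eq_zero]
  exact finsum_comp_equiv (Equiv.addRight m) (f := f)

/-- The difference of the indicator functions of `j + m < 0` and `j < 0`. -/
def stepDiff (m j : ℤ) : ℂ := (if j + m < 0 then 1 else 0) - (if j < 0 then 1 else 0)

lemma stepDiff_finite (p : ℤ → ℂ) (m : ℤ) :
    Function.HasFiniteSupport fun j => p j * stepDiff m j := by
  refine hasFiniteSupport_of_bounds (a := min 0 (-m)) (b := max 0 (-m)) (fun j hj => ?_)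
    (fun j hj => ?_)
  · rw [stepDiff, if_pos (by omega), if_pos (by omega)]; simp
  · rw [stepDiff, if_neg (by omega), if_neg (by omega)]; simp

/-- For a shift by m ≥ 0 the weight is -1 on -m ≤ j < 0 and 0 elsewhere; i ↦ -1 - i runs through
this interval. -/
lemma finsum_stepDiff_natCast (p : ℤ → ℂ) (m : ℕ) :
    ∑ᶠ j : ℤ, p j * stepDiff m j = -∑ i ∈ Finset.range m, p (-1 - i) := by
  rw [finsum_eq_sum_of_support_subset (s := (Finset.range m).image fun i : ℕ => (-1 - i : ℤ)),
    Finset.sum_image (by intro i _ j _ h; simpa using h), ← Finset.sum_neg_distrib]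
  · refine Finset.sum_congr rfl fun i hi => ?_
    rw [Finset.mem_range] at hi
    rw [stepDiff, if_neg (by omega), if_pos (by omega)]
    simp
  · intro j hj
    simp only [Finset.coe_image, Finset.coe_range, Set.mem_image, Set.mem_Iio]
    by_contra hc
    push Not at hc
    refine hj ?_
    dsimp only
    rw [stepDiff]
    by_cases h1 : j < 0
    · by_cases h2 : j + m < 0
      · simp [h1, h2]
      · exact absurd (by omega) (hc (-1 - j).toNat (by omega))
    · rw [if_neg (by omega), if_neg h1]; simp

lemma finsum_stepDiff_neg (p : ℤ → ℂ) (m : ℕ) :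
    ∑ᶠ j : ℤ, p j * stepDiff (-m) j = ∑ i ∈ Finset.range m, p i := by
  rw [finsum_eq_sum_of_support_subset (s := (Finset.range m).image fun i : ℕ => (i : ℤ)),
    Finset.sum_image (by intro i _ j _ h; simpa using h)]
  · refine Finset.sum_congr rfl fun i hi => ?_
    rw [Finset.mem_range] at hi
    rw [stepDiff, if_pos (by omega), if_neg (by omega)]
    simp
  · intro j hj
    simp only [Finset.coe_image, Finset.coe_range, Set.mem_image, Set.mem_Iio]
    by_contra hc
    push Not at hc
    refine hj ?_
    dsimp only
    rw [stepDiff]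
    by_cases h1 : j < 0
    · rw [if_pos (by omega), if_pos h1]; simp
    · by_cases h2 : j + -m < 0
      · exact absurd (by omega) (hc j.toNat (by omega))
      · simp [h1, h2]

lemma finsum_stepDiff (m : ℤ) : ∑ᶠ j : ℤ, stepDiff m j = -m := by
  have h1 : ∀ m : ℤ, ∑ᶠ j : ℤ, stepDiff m j = ∑ᶠ j : ℤ, (fun _ => 1 : ℤ → ℂ) j * stepDiff m j := by
    simp
  obtain ⟨n, rfl | rfl⟩ := Int.eq_nat_or_neg m
  · rw [h1, finsum_stepDiff_natCast]; simp
  · rw [h1, finsum_stepDiff_neg]; simp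

/-- The source of the cubic Virasoro cocycle: the factor 1/(2(c+k)) of the Sugawara operator turns
the 6 into a 12. -/
lemma finsum_mul_stepDiff (m : ℤ) :
    ∑ᶠ j : ℤ, ((j : ℂ) * (j + m)) * stepDiff m j = ((m : ℂ) ^ 3 - m) / 6 := by
  obtain ⟨n, rfl | rfl⟩ := Int.eq_nat_or_neg m
  · rw [finsum_stepDiff_natCast (fun j => (j : ℂ) * (j + (n : ℤ)))]
    -- The parameter `a` separates the shift in the summand from the upper limit, so that induction
    -- works; afterwards `a = n`.
    have (a : ℂ) : ∀ n : ℕ, ∑ i ∈ Finset.range n, ((-1 - i : ℂ) * (-1 - i + a)) =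
        (n * (n + 1) * (2 * n + 1)) / 6 - a * n * (n + 1) / 2 := by
      intro n
      induction n with
      | zero => simp
      | succ n ih => rw [Finset.sum_range_succ, ih]; push_cast; ring
    have h := this n n
    push_cast at h ⊢
    rw [h]
    ring
  · rw [finsum_stepDiff_neg (fun j => (j : ℂ) * (j + (-n : ℤ)))]
    have (a : ℂ) : ∀ n : ℕ, ∑ i ∈ Finset.range n, ((i : ℂ) * (i - a)) =
        (n * (n - 1) * (2 * n - 1)) / 6 - a * n * (n - 1) / 2 := by
      intro n
      induction n with
      | zero => simp
      | succ n ih => rw [Finset.sum_range_succ, ih]; push_cast; ring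
    have h := this n n
    push_cast at h ⊢
    simp only [sub_eq_add_neg] at h
    rw [h]
    ring

end Finsum

/-! ### The Casimir tensor -/

section CasimirTensor

variable {g : Type*} [LieRing g] [LieAlgebra ℂ g] (B : InvForm g)
  {X : Type*} [AddCommGroup X] [Module ℂ X]

lemma InvForm.form_comm (x y : g) : B.form x y = B.form y x := B.symm.eq x y

lemma InvForm.form_lie (y x z : g) : B.form ⁅y, x⁆ z = -B.form x ⁅y, z⁆ := B.invariant y x z

variable [FiniteDimensional ℂ g]

lemma form_dualBasis_basis (i j : Fin (Module.finrank ℂ g)) :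
    B.form (dualBasis B i) (basis g j) = if j = i then 1 else 0 :=
  LinearMap.BilinForm.apply_dualBasis_left ..

lemma sum_form_dualBasis_smul (y : g) : ∑ i, B.form y (dualBasis B i) • basis g i = y := by
  conv_rhs => rw [← (basis g).sum_repr y]
  refine Finset.sum_congr rfl fun i _ => ?_
  conv_lhs => rw [← (basis g).sum_repr y]
  rw [map_sum, LinearMap.sum_apply, Finset.sum_eq_single i]
  · simp [B.form_comm _ (dualBasis B i), form_dualBasis_basis]
  · intro j _ hj
    simp [B.form_comm _ (dualBasis B i), form_dualBasis_basis, hj]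
  · simp

lemma sum_form_basis_smul (y : g) : ∑ i, B.form y (basis g i) • dualBasis B i = y := by
  conv_rhs => rw [← (dualBasis B).sum_repr y]
  refine Finset.sum_congr rfl fun i _ => ?_
  conv_lhs => rw [← (dualBasis B).sum_repr y]
  rw [map_sum, LinearMap.sum_apply, Finset.sum_eq_single i]
  · simp [form_dualBasis_basis]
  · intro j _ hj
    simp [form_dualBasis_basis, hj.symm]
  · simp

/-- Expanding xⁱ in the basis xⱼ turns both sides into sums against the Gram matrix (xⁱ|xʲ), which
is symmetric. -/
lemma sum_dualBasis_symm (β : g →ₗ[ℂ] g →ₗ[ℂ] X) :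
    ∑ i, β (dualBasis B i) (basis g i) = ∑ i, β (basis g i) (dualBasis B i) := by
  have h1 (i) : β (dualBasis B i) (basis g i) =
      ∑ j, B.form (dualBasis B i) (dualBasis B j) • β (basis g j) (basis g i) := by
    conv_lhs => rw [← sum_form_dualBasis_smul B (dualBasis B i)]
    simp
  have h2 (i) : β (basis g i) (dualBasis B i) =
      ∑ j, B.form (dualBasis B i) (dualBasis B j) • β (basis g i) (basis g j) := by
    conv_lhs => rw [← sum_form_dualBasis_smul B (dualBasis B i)]
    simp
  simp_rw [h1, h2]
  rw [Finset.sum_comm]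
  refine Finset.sum_congr rfl fun i _ => Finset.sum_congr rfl fun j _ => ?_
  rw [B.form_comm]

/-- Invariance of the Casimir tensor: by invariance of the form, the matrix of ad y in the basis xⁱ
is minus the transpose of its matrix in the basis xᵢ. -/
lemma sum_dualBasis_invariant (β : g →ₗ[ℂ] g →ₗ[ℂ] X) (y : g) :
    ∑ i, β ⁅y, dualBasis B i⁆ (basis g i) = -∑ i, β (dualBasis B i) ⁅y, basis g i⁆ := by
  have h1 (i) : β ⁅y, dualBasis B i⁆ (basis g i) =
      ∑ j, B.form ⁅y, dualBasis B i⁆ (basis g j) • β (dualBasis B j) (basis g i) := by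
    conv_lhs => rw [← sum_form_basis_smul B ⁅y, dualBasis B i⁆]
    simp
  have h2 (i) : β (dualBasis B i) ⁅y, basis g i⁆ =
      ∑ j, B.form ⁅y, basis g i⁆ (dualBasis B j) • β (dualBasis B i) (basis g j) := by
    conv_lhs => rw [← sum_form_dualBasis_smul B ⁅y, basis g i⁆]
    simp
  simp_rw [h1, h2]
  rw [Finset.sum_comm, ← Finset.sum_neg_distrib]
  refine Finset.sum_congr rfl fun i _ => ?_
  rw [← Finset.sum_neg_distrib]
  refine Finset.sum_congr rfl fun j _ => ?_
  rw [B.form_lie, B.form_comm, neg_smul]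

/-- The Casimir tensor is symmetric and the bracket antisymmetric. Hence reordering in the Sugawara
operators costs only central terms. -/
lemma sum_lie_dualBasis_basis : ∑ i, ⁅dualBasis B i, basis g i⁆ = 0 := by
  have h := sum_dualBasis_symm B (LinearMap.mk₂ ℂ (fun x z : g => ⁅x, z⁆)
    (by simp) (by simp) (by simp) (by simp))
  have h2 : ∑ i, ⁅dualBasis B i, basis g i⁆ = -∑ i, ⁅dualBasis B i, basis g i⁆ := by
    conv_rhs => rw [← Finset.sum_neg_distrib]
    simp_rw [lie_skew]
    exact h
  have h3 : (2 : ℂ) • ∑ i, ⁅dualBasis B i, basis g i⁆ = 0 := by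
    rw [two_smul]; exact add_eq_zero_iff_eq_neg.mpr h2
  exact (smul_eq_zero.mp h3).resolve_left two_ne_zero

/-- Symmetry and invariance of the Casimir tensor make the sum equal to its negative. This removes a
central term in `lie_sug`. -/
lemma sum_form_dualBasis_lie_basis (y : g) :
    ∑ i, B.form (dualBasis B i) ⁅y, basis g i⁆ = 0 := by
  have h1 := sum_dualBasis_invariant B B.form y
  have h2 := sum_dualBasis_symm B (LinearMap.mk₂ ℂ (fun x z : g => B.form x ⁅y, z⁆)
    (by simp) (by simp) (by simp) (by simp))
  simp only [LinearMap.mk₂_apply] at h2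
  simp_rw [B.form_comm ⁅y, dualBasis B _⁆, ← h2] at h1
  exact self_eq_neg.mp h1

/-- The Casimir element of `(g, B)` acts on the adjoint representation as the scalar `2 k`. -/
def IsDualCoxeter (k : ℂ) : Prop := ∀ y : g, ∑ i, ⁅basis g i, ⁅dualBasis B i, y⁆⁆ = (2 * k) • y

/-- The dual bases may be exchanged by symmetry of the tensor; the sign comes from reversing the
inner bracket. -/
lemma IsDualCoxeter.sum_lie_lie {k : ℂ} (hk : IsDualCoxeter B k) (y : g) :
    ∑ i, ⁅dualBasis B i, ⁅y, basis g i⁆⁆ = -((2 * k) • y) := by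
  have h := sum_dualBasis_symm B (LinearMap.mk₂ ℂ (fun x z : g => ⁅x, ⁅z, y⁆⁆)
    (by simp) (by simp) (by simp) (by simp))
  simp only [LinearMap.mk₂_apply] at h
  rw [hk y] at h
  rw [← h, ← Finset.sum_neg_distrib]
  refine Finset.sum_congr rfl fun i _ => ?_
  rw [← lie_skew y, lie_neg]

end CasimirTensor

/-! ### Representations of affine algebras and of the Virasoro algebra -/

/-- A representation of level `c` of the affine algebra, by operators `x(n)` that annihilate each
given vector for `n` large. -/
structure LoopRep {g : Type*} [LieRing g] [LieAlgebra ℂ g] (B : InvForm g) (c : ℂ) (M : Type*)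
    [AddCommGroup M] [Module ℂ M] where
  op : ℤ → g →ₗ[ℂ] Module.End ℂ M
  comm (m n : ℤ) (x y : g) (v : M) : op m x (op n y v) =
    op n y (op m x v) + op (m + n) ⁅x, y⁆ v + ((if m = -n then (m : ℂ) else 0) * B.form x y * c) • v
  smooth (v : M) : ∃ k : ℤ, ∀ n ≥ k, ∀ x, op n x v = 0

/-- A representation of the Virasoro algebra with central charge `c`. -/
structure VirRep (c : ℂ) (M : Type*) [AddCommGroup M] [Module ℂ M] where
  op : ℤ → Module.End ℂ M
  comm (m n : ℤ) (v : M) : op m (op n v) = op n (op m v) + ((m : ℂ) - n) • op (m + n) v +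
    ((if m = -n then ((m : ℂ) ^ 3 - m) / 12 else 0) * c) • v

namespace LoopRep

variable {g : Type*} [LieRing g] [LieAlgebra ℂ g] [FiniteDimensional ℂ g] {B : InvForm g} {c : ℂ}
  {M : Type*} [AddCommGroup M] [Module ℂ M] (R : LoopRep B c M)

/-- `∑ᵢ xⁱ(n - j) xᵢ(j)`. -/
def quad (n j : ℤ) : Module.End ℂ M := ∑ i, R.op (n - j) (dualBasis B i) * R.op j (basis g i)

/-- `∑ᵢ :xᵢ(j) xⁱ(n - j):`. -/
def normal (n j : ℤ) : Module.End ℂ M := ∑ i, if j < 0 then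
  R.op j (basis g i) * R.op (n - j) (dualBasis B i)
  else R.op (n - j) (dualBasis B i) * R.op j (basis g i)

/-- For j < 0 the two factors are interchanged: the bracket terms cancel because ∑ [xᵢ, xⁱ] = 0, and
the central term occurs only for n = 0, with ∑ (xᵢ|xⁱ) = dim g. -/
lemma normal_apply (n j : ℤ) (v : M) : R.normal n j v = R.quad n j v +
    (if n = 0 then (if j < 0 then (j : ℂ) else 0) * c * Module.finrank ℂ g else 0) • v := by
  unfold normal quad
  split_ifs with h1 h2
  · simp only [LinearMap.sum_apply, Module.End.mul_apply]
    subst h2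
    simp_rw [R.comm j (0 - j)]
    have h3 : ∑ i, R.op (j + (0 - j)) ⁅basis g i, dualBasis B i⁆ v = 0 := by
      rw [← LinearMap.sum_apply, ← map_sum]
      simp_rw [← lie_skew (basis g _)]
      rw [Finset.sum_neg_distrib, sum_lie_dualBasis_basis]
      simp
    rw [Finset.sum_add_distrib, Finset.sum_add_distrib, h3, ← Finset.sum_smul]
    simp [B.form_comm (basis g _), form_dualBasis_basis, mul_comm]
  · simp only [LinearMap.sum_apply, Module.End.mul_apply]
    simp_rw [R.comm j (n - j)]
    have h3 : ∑ i, R.op (j + (n - j)) ⁅basis g i, dualBasis B i⁆ v = 0 := by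
      rw [← LinearMap.sum_apply, ← map_sum]
      simp_rw [← lie_skew (basis g _)]
      rw [Finset.sum_neg_distrib, sum_lie_dualBasis_basis]
      simp
    rw [Finset.sum_add_distrib, Finset.sum_add_distrib, h3, ← Finset.sum_smul,
      if_neg (by omega)]
    simp
  · simp
  · simp

lemma normal_finite (n : ℤ) (v : M) : Function.HasFiniteSupport fun j => R.normal n j v := by
  obtain ⟨k, hk⟩ := R.smooth v
  refine hasFiniteSupport_of_bounds (a := min 0 (n - k)) (b := max 0 k) (fun j hj => ?_)
    (fun j hj => ?_)
  · simp [normal, show j < 0 by omega, hk (n - j) (by omega)]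
  · simp [normal, show ¬ j < 0 by omega, hk j (by omega)]

/-- The Sugawara operator `1 / (2 (c + k)) ∑ᵢ ∑ⱼ :xᵢ(j) xⁱ(n - j):`. -/
def sug (k : ℂ) (n : ℤ) : Module.End ℂ M where
  toFun v := (1 / (2 * (c + k))) • ∑ᶠ j : ℤ, R.normal n j v
  map_add' v w := by
    simp only [map_add]
    rw [finsum_add_distrib (R.normal_finite n v) (R.normal_finite n w), smul_add]
  map_smul' r v := by
    simp only [map_smul, RingHom.id_apply]
    rw [← smul_finsum, smul_comm]

lemma sug_apply (k : ℂ) (n : ℤ) (v : M) :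
    R.sug k n v = (1 / (2 * (c + k))) • ∑ᶠ j : ℤ, R.normal n j v := rfl

/-- For n large the terms with j < 0 or j ≥ K vanish on `v`. For each of the finitely many j in
between, smoothness at the vector xᵢ(j)v bounds n - j. -/
lemma sug_smooth (k : ℂ) (v : M) : ∃ N : ℤ, ∀ n ≥ N, R.sug k n v = 0 := by
  obtain ⟨K, hK⟩ := R.smooth v
  have h (j : ℤ) (i) : ∃ N : ℤ, ∀ n ≥ N, ∀ x, R.op n x (R.op j (basis g i) v) = 0 := R.smooth _
  choose N hN using h
  let S : Finset ℤ := (Finset.Ico 0 K ×ˢ Finset.univ).image fun p => p.1 + N p.1 p.2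
  obtain ⟨T, hT⟩ := S.bddAbove
  refine ⟨max K T, fun n hn => ?_⟩
  rw [sug_apply, finsum_eq_zero_of_forall_eq_zero fun j => ?_, smul_zero]
  · simp only [normal, LinearMap.sum_apply]
    refine Finset.sum_eq_zero fun i _ => ?_
    split_ifs with hj
    · simp [hK (n - j) (by omega)]
    · by_cases hjK : K ≤ j
      · simp [hK j hjK]
      · rw [Module.End.mul_apply]
        refine hN j i _ ?_ _
        have : j + N j i ≤ T := hT (Finset.mem_coe.2 (Finset.mem_image.2
          ⟨(j, i), by simp; omega, rfl⟩))
        omega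

/-- Sugawara operators commute with intertwining maps. -/
lemma map_sug {M' : Type*} [AddCommGroup M'] [Module ℂ M'] (R' : LoopRep B c M') (f : M →ₗ[ℂ] M')
    (hf : ∀ n x v, f (R.op n x v) = R'.op n x (f v)) (k : ℂ) (n : ℤ) (v : M) :
    f (R.sug k n v) = R'.sug k n (f v) := by
  rw [sug_apply, sug_apply, map_smul]
  congr 1
  have : f (∑ᶠ j : ℤ, R.normal n j v) = ∑ᶠ j : ℤ, f (R.normal n j v) :=
    f.toAddMonoidHom.map_finsum (R.normal_finite n v)
  rw [this]
  refine finsum_congr fun j => ?_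
  simp only [normal, LinearMap.sum_apply, map_sum]
  refine Finset.sum_congr rfl fun i _ => ?_
  split_ifs <;> simp [hf]

/-- Invariance of the Casimir tensor turns the bracket terms from the two factors into the values at
j + m and at j of one function of j, so they telescope when summed over j. The central terms sit at
j = -m and j = m + n, and each reproduces m c y(m+n). -/
lemma quad_commutator (m n j : ℤ) (y : g) (v : M) : R.op m y (R.quad n j v) =
    R.quad n j (R.op m y v) +
    (∑ i, R.op (n + m - (j + m)) (dualBasis B i) (R.op (j + m) ⁅y, basis g i⁆ v) -
      ∑ i, R.op (n + m - j) (dualBasis B i) (R.op j ⁅y, basis g i⁆ v)) +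
    (((if j = m + n then (m : ℂ) else 0) + if j = -m then (m : ℂ) else 0) * c) •
      R.op (m + n) y v := by
  have h1 (i) : R.op m y (R.op (n - j) (dualBasis B i) (R.op j (basis g i) v)) =
      R.op (n - j) (dualBasis B i) (R.op j (basis g i) (R.op m y v)) +
      R.op (n + m - (j + m)) (dualBasis B i) (R.op (j + m) ⁅y, basis g i⁆ v) +
      R.op (n + m - j) ⁅y, dualBasis B i⁆ (R.op j (basis g i) v) +
      ((if m = -j then (m : ℂ) else 0) * c) •
        (B.form y (basis g i) • R.op (n - j) (dualBasis B i) v) +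
      ((if m = -(n - j) then (m : ℂ) else 0) * c) •
        (B.form y (dualBasis B i) • R.op j (basis g i) v) := by
    rw [R.comm m (n - j), R.comm m j, show n + m - (j + m) = n - j by ring, add_comm j m,
      show m + (n - j) = n + m - j by ring]
    simp only [map_add, map_smul, smul_smul]
    rw [mul_right_comm, mul_right_comm _ _ c]
    abel
  have h2 := sum_dualBasis_invariant B (LinearMap.mk₂ ℂ (fun x z : g => R.op (n + m - j) x
    (R.op j z v)) (by simp) (by simp) (by simp) (by simp)) y
  simp only [LinearMap.mk₂_apply] at h2
  have h3 (l : ℤ) : ∑ i, B.form y (basis g i) • R.op l (dualBasis B i) v = R.op l y v := by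
    conv_rhs => rw [← sum_form_basis_smul B y]
    simp
  have h4 (l : ℤ) : ∑ i, B.form y (dualBasis B i) • R.op l (basis g i) v = R.op l y v := by
    conv_rhs => rw [← sum_form_dualBasis_smul B y]
    simp
  simp only [quad, LinearMap.sum_apply, map_sum, Module.End.mul_apply]
  simp_rw [h1]
  rw [Finset.sum_add_distrib, Finset.sum_add_distrib, Finset.sum_add_distrib,
    Finset.sum_add_distrib, h2, ← Finset.smul_sum, ← Finset.smul_sum, h3, h4, add_mul, add_smul]
  have h5 : ((if m = -j then (m : ℂ) else 0) * c) • R.op (n - j) y v =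
      ((if j = -m then (m : ℂ) else 0) * c) • R.op (m + n) y v := by
    by_cases h : j = -m
    · subst h; simp [add_comm]
    · rw [if_neg h, if_neg (by omega)]; simp
  have h6 : ((if m = -(n - j) then (m : ℂ) else 0) * c) • R.op j y v =
      ((if j = m + n then (m : ℂ) else 0) * c) • R.op (m + n) y v := by
    by_cases h : j = m + n
    · subst h; simp
    · rw [if_neg h, if_neg (by omega)]; simp
  rw [h5, h6]
  abel

/-- The Sugawara operators act on the loops as vector fields. -/
lemma lie_sug {k : ℂ} (hk : IsDualCoxeter B k) (hc : c + k ≠ 0) (m n : ℤ) (y : g) (v : M) :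
    R.op m y (R.sug k n v) = R.sug k n (R.op m y v) + (m : ℂ) • R.op (m + n) y v := by
  obtain ⟨K, hK⟩ := R.smooth v
  set w := R.op (m + n) y v with hw
  -- The telescoping function vanishes for j large, but for j very negative it equals -2k y(m+n)v,
  -- by commuting its factors. The step function compensates for this and makes `F` finitely
  -- supported.
  let F : ℤ → M := fun j => ∑ i, R.op (n + m - j) (dualBasis B i) (R.op j ⁅y, basis g i⁆ v) +
    (if j < 0 then (1 : ℂ) else 0) • ((2 * k) • w)
  have hF : Function.HasFiniteSupport F := by
    refine hasFiniteSupport_of_bounds (a := min 0 (n + m - K)) (b := max 0 K) (fun j hj => ?_)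
      (fun j hj => ?_)
    · have hj0 : j < 0 := by omega
      have h1 (i) : R.op (n + m - j) (dualBasis B i) (R.op j ⁅y, basis g i⁆ v) =
          R.op (m + n) ⁅dualBasis B i, ⁅y, basis g i⁆⁆ v +
          ((if n + m - j = -j then ((n + m - j : ℤ) : ℂ) else 0) * c) •
            (B.form (dualBasis B i) ⁅y, basis g i⁆ • v) := by
        rw [R.comm, hK (n + m - j) (by omega), map_zero, zero_add,
          show n + m - j + j = m + n by ring, smul_smul, mul_right_comm]
      simp only [F]
      simp_rw [h1]
      rw [Finset.sum_add_distrib, ← LinearMap.sum_apply, ← map_sum, hk.sum_lie_lie,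
        ← Finset.smul_sum, ← Finset.sum_smul, sum_form_dualBasis_lie_basis, if_pos hj0]
      simp [hw]
    · simp only [F]
      rw [if_neg (by omega)]
      simp [hK j (by omega)]
  have hlin : R.op m y (∑ᶠ j : ℤ, R.normal n j v) = ∑ᶠ j : ℤ, R.op m y (R.normal n j v) :=
    (R.op m y).toAddMonoidHom.map_finsum (R.normal_finite n v)
  have hδ (a : ℤ) : Function.HasFiniteSupport fun j : ℤ => if j = a then (m : ℂ) else 0 :=
    (Set.finite_singleton a).subset fun j hj => by
      by_contra hc
      exact hj (if_neg hc)
  have hstep : Function.HasFiniteSupport fun j : ℤ => stepDiff m j := by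
    simpa using stepDiff_finite (fun _ => 1) m
  -- The constants of `normal_apply` multiply y(m)v on both sides and cancel; what remains is the
  -- step correction made in `F`.
  have hterm (j : ℤ) : R.op m y (R.normal n j v) = R.normal n j (R.op m y v) +
      ((F (j + m) - F j) + ((((if j = m + n then (m : ℂ) else 0) +
        (if j = -m then (m : ℂ) else 0)) * c) • w - stepDiff m j • ((2 * k) • w))) := by
    rw [normal_apply, normal_apply, map_add, quad_commutator, map_smul]
    simp only [F, stepDiff, sub_smul]
    abel
  have hfin (f : ℤ → ℂ) (hf : Function.HasFiniteSupport f) (u : M) :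
      Function.HasFiniteSupport fun j => f j • u :=
    hf.subset fun j hj h => hj (by dsimp only; rw [h, zero_smul])
  have hsum (f : ℤ → ℂ) (hf : Function.HasFiniteSupport f) (u : M) :
      ∑ᶠ j, f j • u = (∑ᶠ j, f j) • u :=
    (((LinearMap.toSpanSingleton ℂ M u).toAddMonoidHom).map_finsum hf).symm
  have hd : Function.HasFiniteSupport fun j : ℤ =>
      ((if j = m + n then (m : ℂ) else 0) + (if j = -m then (m : ℂ) else 0)) * c :=
    ((hδ (m + n)).union (hδ (-m))).subset fun j hj => by
      by_contra hc
      simp only [Set.mem_union, Function.mem_support, not_or, not_not] at hc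
      exact hj (by dsimp only; rw [hc.1, hc.2]; simp)
  have hds : ∑ᶠ j : ℤ, ((if j = m + n then (m : ℂ) else 0) + (if j = -m then (m : ℂ) else 0)) * c
      = 2 * m * c := by
    rw [← finsum_mul, finsum_add_distrib (hδ _) (hδ _),
      finsum_eq_single _ (m + n) (by intro x hx; simp [hx]),
      finsum_eq_single _ (-m) (by intro x hx; simp [hx])]
    simp [two_mul]
  -- The central terms add up to 2mc and the step correction to 2mk; the factor 1/(2(c+k)) leaves m.
  rw [sug_apply, sug_apply, map_smul, hlin]
  simp_rw [hterm]
  rw [finsum_add_distrib (R.normal_finite n _), finsum_add_distrib,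
    finsum_shift_sub hF, finsum_sub_distrib (hfin _ hd _) (hfin _ hstep _), hsum _ hd, hsum _ hstep,
    hds, finsum_stepDiff, smul_add, zero_add, smul_smul, ← sub_smul, smul_smul]
  · congr 2
    field_simp
    ring
  · exact HasFiniteSupport.sub (HasFiniteSupport.shift hF m) hF
  · exact HasFiniteSupport.sub (hfin _ hd w) (hfin _ hstep ((2 * k) • w))
  · exact HasFiniteSupport.add (HasFiniteSupport.sub (HasFiniteSupport.shift hF m) hF)
      (HasFiniteSupport.sub (hfin _ hd w) (hfin _ hstep ((2 * k) • w)))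

/-- The bracket with a Sugawara operator is a derivation, known on each of the two loop factors by
`lie_sug`. -/
lemma sug_quad {k : ℂ} (hk : IsDualCoxeter B k) (hc : c + k ≠ 0) (m n j : ℤ) (v : M) :
    R.sug k m (R.quad n j v) = R.quad n j (R.sug k m v) -
      ((n - j : ℤ) : ℂ) • R.quad (m + n) j v - (j : ℂ) • R.quad (m + n) (j + m) v := by
  have hL (l : ℤ) (y : g) (v : M) :
      R.sug k m (R.op l y v) = R.op l y (R.sug k m v) - (l : ℂ) • R.op (l + m) y v := by
    rw [R.lie_sug hk hc l m y v, add_sub_cancel_right]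
  simp only [quad, LinearMap.sum_apply, Module.End.mul_apply, map_sum]
  simp_rw [hL, map_sub, map_smul, Finset.smul_sum, ← Finset.sum_sub_distrib]
  refine Finset.sum_congr rfl fun i _ => ?_
  rw [show n - j + m = m + n - j by ring, show m + n - (j + m) = n - j by ring]
  abel

/-- The Sugawara operators form a representation of the Virasoro algebra. -/
lemma sug_comm {k : ℂ} (hk : IsDualCoxeter B k) (hc : c + k ≠ 0) (m n : ℤ) (v : M) :
    R.sug k m (R.sug k n v) = R.sug k n (R.sug k m v) + ((m : ℂ) - n) • R.sug k (m + n) v +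
      ((if m = -n then ((m : ℂ) ^ 3 - m) / 12 else 0) * (c * Module.finrank ℂ g / (c + k))) • v := by
  set D : ℂ := (Module.finrank ℂ g : ℂ)
  -- Chosen so that -(n-j) q(j) - j q(j+m) equals (m-n) q(j) plus a telescoping difference; the
  -- normally ordered terms are used because they have finite support in j.
  let H : ℤ → M := fun j => ((j - m : ℤ) : ℂ) • R.normal (m + n) j v
  have hH : Function.HasFiniteSupport H := (R.normal_finite (m + n) v).subset fun j hj h => hj (by
    simp only [H]; dsimp only at h; rw [h, smul_zero])
  let δ : ℂ := if m + n = 0 then c * D else 0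
  have hq (l j : ℤ) (u : M) : R.quad l j u = R.normal l j u -
      (if l = 0 then (if j < 0 then (j : ℂ) else 0) * c * D else 0) • u := by
    rw [normal_apply, add_sub_cancel_right]
  -- For m + n = 0, passing from `quad` to `normal` at j and at j + m leaves the scalar c dim(g)
  -- j(j+m) times the step difference: the Virasoro anomaly.
  have hterm (j : ℤ) : R.sug k m (R.normal n j v) = R.normal n j (R.sug k m v) +
      (((m : ℂ) - n) • R.normal (m + n) j v - (H (j + m) - H j) +
        (δ * ((j : ℂ) * (j + m) * stepDiff m j)) • v) := by
    rw [normal_apply, normal_apply, map_add, map_smul, sug_quad R hk hc, hq (m + n), hq (m + n)]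
    simp only [H, δ, stepDiff]
    by_cases h : m + n = 0
    · obtain rfl : n = -m := by omega
      by_cases h1 : j < 0 <;> by_cases h2 : j + m < 0 <;>
      · simp only [h, h1, h2, if_true, if_false]
        push_cast
        module
    · simp only [h, if_false]
      push_cast
      module
  have hs := stepDiff_finite (fun j => (j : ℂ) * (j + m)) m
  have hsv : Function.HasFiniteSupport
      fun j : ℤ => (δ * ((j : ℂ) * (j + m) * stepDiff m j)) • v :=
    hs.subset fun j hj h => hj (by dsimp only at h ⊢; rw [h, mul_zero, zero_smul])
  have hsum : ∑ᶠ j : ℤ, (δ * ((j : ℂ) * (j + m) * stepDiff m j)) • v =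
      (δ * (((m : ℂ) ^ 3 - m) / 6)) • v := by
    rw [← finsum_mul_stepDiff, mul_finsum]
    exact (((LinearMap.toSpanSingleton ℂ M v).toAddMonoidHom).map_finsum
      (hs.subset fun j hj h => hj (by dsimp only at h ⊢; rw [h]; exact mul_zero δ))).symm
  have hlin : R.sug k m (∑ᶠ j : ℤ, R.normal n j v) = ∑ᶠ j : ℤ, R.sug k m (R.normal n j v) :=
    (R.sug k m).toAddMonoidHom.map_finsum (R.normal_finite n v)
  have hN : Function.HasFiniteSupport fun j => ((m : ℂ) - n) • R.normal (m + n) j v :=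
    (R.normal_finite (m + n) v).subset fun j hj h => hj (by
      dsimp only at h ⊢; rw [h, smul_zero])
  have hHd := HasFiniteSupport.sub (HasFiniteSupport.shift hH m) hH
  rw [sug_apply (n := n), sug_apply (n := n), sug_apply (n := m + n), map_smul, hlin]
  simp_rw [hterm]
  rw [finsum_add_distrib (R.normal_finite n _)
      (HasFiniteSupport.add (HasFiniteSupport.sub hN hHd) hsv),
    finsum_add_distrib (HasFiniteSupport.sub hN hHd) hsv, finsum_sub_distrib hN hHd,
    finsum_shift_sub hH, hsum, ← smul_finsum]
  by_cases h : m + n = 0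
  · simp only [δ, if_pos h, if_pos (show m = -n by omega)]
    match_scalars
    · ring
    · ring
    · field_simp
      ring
  · simp only [δ, if_neg h, if_neg (show ¬ m = -n by omega)]
    module

/-- The Sugawara operators as a representation of the Virasoro algebra. -/
def sugRep {k : ℂ} (hk : IsDualCoxeter B k) (hc : c + k ≠ 0) :
    VirRep (c * (Module.finrank ℂ g : ℂ) / (c + k)) M where
  op := R.sug k
  comm := R.sug_comm hk hc

end LoopRep

namespace VirRep

variable {M : Type*} [AddCommGroup M] [Module ℂ M] {c c' : ℂ}

/-- The sum of two commuting representations of the Virasoro algebra. -/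
def add (P : VirRep c M) (Q : VirRep c' M)
    (h : ∀ m n v, P.op m (Q.op n v) = Q.op n (P.op m v)) : VirRep (c + c') M where
  op n := P.op n + Q.op n
  comm m n v := by
    simp only [LinearMap.add_apply, map_add]
    rw [P.comm m n, Q.comm m n, h m n, ← h n m]
    module

/-- The difference of two representations of the Virasoro algebra, where the difference commutes
with the second one (the coset construction). -/
def sub (P : VirRep c M) (Q : VirRep c' M)
    (h : ∀ m n v, Q.op m (P.op n v - Q.op n v) = P.op n (Q.op m v) - Q.op n (Q.op m v)) :
    VirRep (c - c') M where
  op n := P.op n - Q.op n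
  comm m n v := by
    simp only [LinearMap.sub_apply, map_sub]
    -- Since Q commutes with P - Q, one has [P, Q] = [Q, Q], and therefore [P - Q, P - Q] = [P, P] -
    -- [Q, Q].
    have h1 := h m n v
    have h2 := h n m v
    rw [map_sub] at h1 h2
    have h3 := P.comm m n v
    have h4 := Q.comm m n v
    linear_combination (norm := module) h3 - h1 + h2 - h4

end VirRep

/-! ### Splitting off the Sugawara operators. -/

section Coset

variable {g s : Type*} [LieRing g] [LieAlgebra ℂ g] [LieRing s] [LieAlgebra ℂ s]

/-- A representation of `f̄` on which the loop operators annihilate each given vector in large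
degrees. -/
structure FBarRep (B : InvForm g) (B' : InvForm s) (c₁ c₂ c : ℂ) (M : Type*) [AddCommGroup M]
    [Module ℂ M] where
  fst : LoopRep B c₁ M
  snd : LoopRep B' c₂ M
  vir : VirRep c M
  fst_snd (m n x y v) : fst.op m x (snd.op n y v) = snd.op n y (fst.op m x v)
  vir_fst (m n x v) : vir.op m (fst.op n x v) = fst.op n x (vir.op m v) - (n : ℂ) •
    fst.op (n + m) x v
  vir_snd (m n x v) : vir.op m (snd.op n x v) = snd.op n x (vir.op m v) - (n : ℂ) •
    snd.op (n + m) x v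

/-- Commuting representations of `ĝ`, of `ŝ` and of the Virasoro algebra. -/
structure SplitRep (B : InvForm g) (B' : InvForm s) (c₁ c₂ c : ℂ) (M : Type*) [AddCommGroup M]
    [Module ℂ M] where
  fst : LoopRep B c₁ M
  snd : LoopRep B' c₂ M
  vir : VirRep c M
  fst_snd (m n x y v) : fst.op m x (snd.op n y v) = snd.op n y (fst.op m x v)
  vir_fst (m n x v) : vir.op m (fst.op n x v) = fst.op n x (vir.op m v)
  vir_snd (m n x v) : vir.op m (snd.op n x v) = snd.op n x (vir.op m v)

variable [FiniteDimensional ℂ g] [FiniteDimensional ℂ s] {B : InvForm g} {B' : InvForm s}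
  {c₁ c₂ c k₁ k₂ : ℂ} {M : Type*} [AddCommGroup M] [Module ℂ M]

/-- Commuting representations of `ĝ`, `ŝ` and the Virasoro algebra form a representation of `f̄`, by
adding the Sugawara operators to those of the Virasoro algebra. -/
def SplitRep.toFBarRep (R : SplitRep B B' c₁ c₂ c M) (hk₁ : IsDualCoxeter B k₁)
    (hk₂ : IsDualCoxeter B' k₂) (hc₁ : c₁ + k₁ ≠ 0) (hc₂ : c₂ + k₂ ≠ 0) :
    FBarRep B B' c₁ c₂ (c₁ * (Module.finrank ℂ g : ℂ) / (c₁ + k₁) +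
      (c₂ * (Module.finrank ℂ s : ℂ) / (c₂ + k₂) + c)) M where
  fst := R.fst
  snd := R.snd
  vir := (R.fst.sugRep hk₁ hc₁).add ((R.snd.sugRep hk₂ hc₂).add R.vir fun m n v =>
      (R.snd.map_sug R.snd (R.vir.op n) (R.vir_snd n) k₂ m v).symm) fun m n v => by
    change R.fst.sug k₁ m ((R.snd.sug k₂ n + R.vir.op n) v) =
      (R.snd.sug k₂ n + R.vir.op n) (R.fst.sug k₁ m v)
    refine (R.fst.map_sug R.fst (R.snd.sug k₂ n + R.vir.op n) (fun l x u => ?_) k₁ m v).symm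
    rw [LinearMap.add_apply, R.vir_fst, LinearMap.add_apply, map_add,
      R.snd.map_sug R.snd (R.fst.op l x) (fun a b w => R.fst_snd _ _ _ _ _) k₂ n u]
  fst_snd := R.fst_snd
  vir_fst m n x v := by
    change R.fst.sug k₁ m _ + (R.snd.sug k₂ m _ + R.vir.op m _) =
      R.fst.op n x (R.fst.sug k₁ m v + (R.snd.sug k₂ m v + R.vir.op m v)) - _
    rw [map_add, map_add, R.fst.lie_sug hk₁ hc₁, R.vir_fst,
      R.snd.map_sug R.snd (R.fst.op n x) (fun a b w => R.fst_snd _ _ _ _ _)]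
    module
  vir_snd m n x v := by
    change R.fst.sug k₁ m _ + (R.snd.sug k₂ m _ + R.vir.op m _) =
      R.snd.op n x (R.fst.sug k₁ m v + (R.snd.sug k₂ m v + R.vir.op m v)) - _
    rw [map_add, map_add, R.snd.lie_sug hk₂ hc₂, R.vir_snd,
      R.fst.map_sug R.fst (R.snd.op n x) (fun a b w => (R.fst_snd _ _ _ _ _).symm)]
    module

/-- The coset construction: subtracting the Sugawara operators from the operators of the Virasoro
algebra splits a representation of `f̄` into commuting ones. -/
def FBarRep.toSplitRep (R : FBarRep B B' c₁ c₂ c M) (hk₁ : IsDualCoxeter B k₁)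
    (hk₂ : IsDualCoxeter B' k₂) (hc₁ : c₁ + k₁ ≠ 0) (hc₂ : c₂ + k₂ ≠ 0) :
    SplitRep B B' c₁ c₂ (c - c₁ * (Module.finrank ℂ g : ℂ) / (c₁ + k₁) -
      c₂ * (Module.finrank ℂ s : ℂ) / (c₂ + k₂)) M :=
  -- L(n) and the Sugawara operator have the same bracket -m x(m+n) with x(m), so their difference
  -- commutes with x(m).
  have h11 (n m x v) : (R.vir.op n - R.fst.sug k₁ n) (R.fst.op m x v) =
      R.fst.op m x ((R.vir.op n - R.fst.sug k₁ n) v) := by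
    rw [LinearMap.sub_apply, LinearMap.sub_apply, map_sub, R.vir_fst, R.fst.lie_sug hk₁ hc₁,
      add_comm m n]
    module
  have h21 (n m x v) : R.snd.sug k₂ n (R.fst.op m x v) = R.fst.op m x (R.snd.sug k₂ n v) :=
    (R.snd.map_sug R.snd (R.fst.op m x) (fun a b w => R.fst_snd _ _ _ _ _) k₂ n v).symm
  have h12 (n m x v) : R.fst.sug k₁ n (R.snd.op m x v) = R.snd.op m x (R.fst.sug k₁ n v) :=
    (R.fst.map_sug R.fst (R.snd.op m x) (fun a b w => (R.fst_snd _ _ _ _ _).symm) k₁ n v).symm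
  have h22 (n m x v) : (R.vir.op n - R.fst.sug k₁ n - R.snd.sug k₂ n) (R.snd.op m x v) =
      R.snd.op m x ((R.vir.op n - R.fst.sug k₁ n - R.snd.sug k₂ n) v) := by
    simp only [LinearMap.sub_apply, map_sub]
    rw [R.vir_snd, h12, R.snd.lie_sug hk₂ hc₂, add_comm m n]
    module
  { fst := R.fst
    snd := R.snd
    -- An operator that commutes with the loops commutes with the Sugawara operators built from
    -- them, by `map_sug`; this is the hypothesis of `VirRep.sub`, used twice.
    vir := (R.vir.sub (R.fst.sugRep hk₁ hc₁) fun m n v =>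
        (R.fst.map_sug R.fst _ (h11 n) k₁ m v).symm).sub (R.snd.sugRep hk₂ hc₂)
      fun m n v => (R.snd.map_sug R.snd _ (h22 n) k₂ m v).symm
    fst_snd := R.fst_snd
    vir_fst m n x v := by
      change (R.vir.op m - R.fst.sug k₁ m) (R.fst.op n x v) - R.snd.sug k₂ m (R.fst.op n x v) =
        R.fst.op n x ((R.vir.op m - R.fst.sug k₁ m) v - R.snd.sug k₂ m v)
      rw [h11, h21, map_sub]
    vir_snd := h22 }

end Coset

end

end TorVOA


/-! ### Formal distributions, local fields and reconstruction. -/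

namespace TorVOA

noncomputable section

lemma finsum_nat_shift_sub {M : Type*} [AddCommGroup M] {f : ℕ → M} (hf : Function.HasFiniteSupport f) :
    ∑ᶠ i : ℕ, (f i - f (i + 1)) = f 0 := by
  have h1 : Function.HasFiniteSupport fun i => f (i + 1) :=
    Set.Finite.preimage (add_left_injective 1).injOn hf
  obtain ⟨N, hN⟩ := hf.bddAbove
  have h0 (i : ℕ) (hi : N < i) : f i = 0 := by
    by_contra h
    exact absurd (hN h) (by omega)
  rw [finsum_eq_sum_of_support_subset (s := Finset.range (N + 1)), Finset.sum_range_sub',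
    h0 (N + 1) (by omega), sub_zero]
  intro i hi
  rw [Finset.coe_range, Set.mem_Iio]
  by_contra hc
  exact hi (by dsimp only; rw [h0 i (by omega), h0 (i + 1) (by omega), sub_zero])

lemma hasFiniteSupport_nat {M : Type*} [AddCommGroup M] {f : ℕ → M} (K : ℕ) (h : ∀ i ≥ K, f i = 0) :
    Function.HasFiniteSupport f :=
  (Set.finite_Iio K).subset fun i hi => by
    rw [Set.mem_Iio]
    by_contra hc
    exact hi (h i (by omega))

/-! ### Shift operators -/

section Shift

variable {G H V : Type*} [AddCommGroup V] [Module ℂ V]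

/-- The operator `D` commutes with pointwise finite sums. -/
def CommutesWithFinsum (D : Module.End ℂ (G → V)) : Prop :=
  ∀ X : ℕ → G → V, (∀ x, Function.HasFiniteSupport fun i => X i x) →
    (∀ x, Function.HasFiniteSupport fun i => D (X i) x) ∧
      D (fun x => ∑ᶠ i, X i x) = fun x => ∑ᶠ i, D (X i) x

lemma CommutesWithFinsum.mul {D E : Module.End ℂ (G → V)} (hD : CommutesWithFinsum D)
    (hE : CommutesWithFinsum E) : CommutesWithFinsum (D * E) := fun X hX => by
  obtain ⟨h1, h2⟩ := hE X hX
  obtain ⟨h3, h4⟩ := hD _ h1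
  exact ⟨h3, by rw [Module.End.mul_apply, h2, h4]; rfl⟩

lemma CommutesWithFinsum.pow {D : Module.End ℂ (G → V)} (hD : CommutesWithFinsum D) (k : ℕ) :
    CommutesWithFinsum (D ^ k) := by
  induction k with
  | zero => exact fun X hX => ⟨hX, rfl⟩
  | succ k ih => rw [pow_succ]; exact ih.mul hD

variable [AddCommGroup G] [AddCommGroup H]

/-- The translation of functions by `a`. -/
def shift (V : Type*) [AddCommGroup V] [Module ℂ V] (a : G) : Module.End ℂ (G → V) where
  toFun f x := f (x + a)
  map_add' _ _ := rfl
  map_smul' _ _ := rfl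

/-- The difference of two translations: multiplication of a formal distribution by `z - w`. -/
def delta (V : Type*) [AddCommGroup V] [Module ℂ V] (a b : G) : Module.End ℂ (G → V) :=
  shift V a - shift V b

@[simp] lemma shift_apply (a : G) (f : G → V) (x : G) : shift V a f x = f (x + a) := rfl

@[simp] lemma delta_apply (a b : G) (f : G → V) (x : G) :
    delta V a b f x = f (x + a) - f (x + b) := rfl

lemma shift_commute (a b : G) : Commute (shift V a) (shift V b) := by
  ext f x
  simp [add_right_comm]

lemma delta_commute (a b c d : G) : Commute (delta V a b) (delta V c d) :=
  ((shift_commute a c).sub_right (shift_commute a d)).sub_left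
    ((shift_commute b c).sub_right (shift_commute b d))

lemma shift_pow_apply (a : G) (n : ℕ) (f : G → V) (x : G) :
    (shift V a ^ n) f x = f (x + n • a) := by
  induction n generalizing x with
  | zero => simp
  | succ n ih =>
    rw [pow_succ', Module.End.mul_apply, shift_apply, ih, succ_nsmul, add_assoc, add_comm a]

/-- The two translations commute, so the binomial theorem applies. This gives the alternating sum of
the locality axiom. -/
lemma delta_pow_apply (a b : G) (k : ℕ) (f : G → V) (x : G) :
    (delta V a b ^ k) f x = ∑ i ∈ Finset.range (k + 1),
      ((-1 : ℂ) ^ i * (k.choose i : ℂ)) • f (x + (k - i) • a + i • b) := by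
  rw [delta, sub_eq_add_neg, add_comm, ← neg_one_smul ℂ (shift V b),
    ((shift_commute b a).smul_left (-1 : ℂ)).add_pow, LinearMap.sum_apply, Finset.sum_apply]
  refine Finset.sum_congr rfl fun i _ => ?_
  rw [smul_pow, ← nsmul_eq_mul', smul_mul_assoc, ← Nat.cast_smul_eq_nsmul ℂ, smul_smul, mul_comm,
    LinearMap.smul_apply, Pi.smul_apply, Module.End.mul_apply, shift_pow_apply, shift_pow_apply,
    add_right_comm]

/-- Pullback of functions along `p`. -/
def pull (V : Type*) [AddCommGroup V] [Module ℂ V] (p : H → G) : (G → V) →ₗ[ℂ] (H → V) where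
  toFun f x := f (p x)
  map_add' _ _ := rfl
  map_smul' _ _ := rfl

/-- Moves difference operators through changes of index: swapping variables, translating an index,
restricting to a slice. -/
lemma delta_pow_pull (p : H → G) {a b : H} {a' b' : G} (ha : ∀ x, p (x + a) = p x + a')
    (hb : ∀ x, p (x + b) = p x + b') (k : ℕ) (f : G → V) :
    (delta V a b ^ k) (pull V p f) = pull V p ((delta V a' b' ^ k) f) := by
  induction k generalizing f with
  | zero => rfl
  | succ k ih =>
    rw [pow_succ, pow_succ, Module.End.mul_apply, Module.End.mul_apply, ← ih]
    congr 1
    funext x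
    simp [pull, ha, hb]

lemma delta_commutesWithFinsum (a b : G) : CommutesWithFinsum (delta V a b) := fun _ hX =>
  ⟨fun x => HasFiniteSupport.sub (hX (x + a)) (hX (x + b)), funext fun x =>
    (finsum_sub_distrib (hX (x + a)) (hX (x + b))).symm⟩

end Shift

/-! ### Local fields -/

section Field

variable {V : Type*} [AddCommGroup V] [Module ℂ V]

/-- The modes `A n` are those of a field: each vector is annihilated by `A n` for `n` large. -/
def IsField (A : ℤ → Module.End ℂ V) : Prop := ∀ v, ∃ k : ℤ, ∀ n ≥ k, A n v = 0

/-- The commutator of the modes of two fields, applied to a vector. -/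
def commFun (A C : ℤ → Module.End ℂ V) (v : V) (x : ℤ × ℤ) : V :=
  A x.1 (C x.2 v) - C x.2 (A x.1 v)

/-- Multiplication by `z - w` on formal distributions in two variables. -/
abbrev delta₂ (V : Type*) [AddCommGroup V] [Module ℂ V] : Module.End ℂ (ℤ × ℤ → V) :=
  delta V ((1, 0) : ℤ × ℤ) (0, 1)

/-- `(z - w)ᵏ [A(z), C(w)] = 0`. -/
def IsLocalAt (k : ℕ) (A C : ℤ → Module.End ℂ V) : Prop :=
  ∀ v, (delta₂ V ^ k) (commFun A C v) = 0

/-- The fields `A` and `C` are mutually local. -/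
def IsLocal (A C : ℤ → Module.End ℂ V) : Prop := ∃ k, IsLocalAt k A C

lemma IsLocalAt.mono {k l : ℕ} {A C : ℤ → Module.End ℂ V} (h : IsLocalAt k A C) (hkl : k ≤ l) :
    IsLocalAt l A C := fun v => by
  obtain ⟨d, rfl⟩ := Nat.exists_eq_add_of_le' hkl
  rw [pow_add, Module.End.mul_apply, h v, map_zero]

lemma delta₂_pow_apply (k : ℕ) (f : ℤ × ℤ → V) (m n : ℤ) :
    (delta₂ V ^ k) f (m, n) = ∑ i ∈ Finset.range (k + 1),
      ((-1 : ℂ) ^ i * (k.choose i : ℂ)) • f (m + k - i, n + i) := by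
  rw [delta_pow_apply]
  refine Finset.sum_congr rfl fun i hi => ?_
  rw [Finset.mem_range] at hi
  congr 2
  ext
  · simp [Nat.cast_sub (show i ≤ k by omega), add_sub_assoc]
  · simp

lemma isLocalAt_iff {k : ℕ} {A C : ℤ → Module.End ℂ V} : IsLocalAt k A C ↔
    ∀ m n : ℤ, ∀ v, ∑ i ∈ Finset.range (k + 1), ((-1 : ℂ) ^ i * (k.choose i : ℂ)) •
      (A (m + k - i) (C (n + i) v) - C (n + i) (A (m + k - i) v)) = 0 := by
  constructor
  · intro h m n v
    have := congrFun (h v) (m, n)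
    rwa [delta₂_pow_apply] at this
  · intro h v
    funext ⟨m, n⟩
    rw [delta₂_pow_apply]
    exact h m n v

lemma IsLocalAt.symm {k : ℕ} {A C : ℤ → Module.End ℂ V} (h : IsLocalAt k A C) :
    IsLocalAt k C A := fun v => by
  have h1 : commFun C A v = -pull V Prod.swap (commFun A C v) := by
    funext x
    simp [commFun, pull]
  have h2 : delta₂ V = (-1 : ℂ) • delta V ((0, 1) : ℤ × ℤ) (1, 0) := by
    simp only [delta]
    module
  rw [h1, h2, map_neg, smul_pow, LinearMap.smul_apply,
    delta_pow_pull Prod.swap (a' := (1, 0)) (b' := (0, 1)) (by simp) (by simp), h v, map_zero,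
    smul_zero, neg_zero]

lemma IsLocal.symm {A C : ℤ → Module.End ℂ V} (h : IsLocal A C) : IsLocal C A :=
  h.imp fun _ hk => hk.symm

lemma IsLocal.add {A A' C : ℤ → Module.End ℂ V} (h : IsLocal A C) (h' : IsLocal A' C) :
    IsLocal (A + A') C := by
  obtain ⟨k, hk⟩ := h
  obtain ⟨l, hl⟩ := h'
  refine ⟨max k l, fun v => ?_⟩
  have : commFun (A + A') C v = commFun A C v + commFun A' C v := by
    funext x
    simp [commFun]
    abel
  rw [this, map_add, hk.mono (le_max_left _ _), hl.mono (le_max_right _ _), add_zero]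

lemma IsLocal.smul {A C : ℤ → Module.End ℂ V} (r : ℂ) (h : IsLocal A C) : IsLocal (r • A) C := by
  obtain ⟨k, hk⟩ := h
  refine ⟨k, fun v => ?_⟩
  have : commFun (r • A) C v = r • commFun A C v := by
    funext x
    simp [commFun, smul_sub]
  rw [this, map_smul, hk, smul_zero]

lemma IsLocal.zero (C : ℤ → Module.End ℂ V) : IsLocal 0 C :=
  ⟨0, fun v => by funext x; simp [commFun]⟩

/-- The identity field. -/
def idField (V : Type*) [AddCommGroup V] [Module ℂ V] (n : ℤ) : Module.End ℂ V :=
  if n = -1 then 1 else 0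

lemma IsLocal.id (C : ℤ → Module.End ℂ V) : IsLocal (idField V) C :=
  ⟨0, fun v => by
    have : commFun (idField V) C v = 0 := by
      funext x
      by_cases h : x.1 = -1 <;> simp [commFun, idField, h]
    rw [this, map_zero]⟩

/-- The derivative of a field. -/
def dField (A : ℤ → Module.End ℂ V) (n : ℤ) : Module.End ℂ V := -(n : ℂ) • A (n - 1)

lemma IsField.dField {A : ℤ → Module.End ℂ V} (h : IsField A) : IsField (dField A) := fun v => by
  obtain ⟨k, hk⟩ := h v
  refine ⟨k + 1, fun n hn => ?_⟩
  simp [TorVOA.dField, hk (n - 1) (by omega)]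

/-- Differentiating multiplies by the mode index, an operator `M` whose commutator with z - w is a
translation. Moving `M` past the power k + 1 of z - w thus leaves at least the power k, so one extra
power suffices. -/
lemma IsLocal.dField {A C : ℤ → Module.End ℂ V} (h : IsLocal A C) : IsLocal (dField A) C := by
  obtain ⟨k, hk⟩ := h
  let M : Module.End ℂ (ℤ × ℤ → V) :=
    { toFun f x := (x.1 : ℂ) • f x
      map_add' _ _ := by funext x; simp
      map_smul' r f := by funext x; simp [smul_comm r] }
  have hM : delta₂ V * M = M * delta₂ V + shift V (1, 0) := by
    refine LinearMap.ext fun f => funext fun x => ?_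
    simp only [M, Module.End.mul_apply, LinearMap.coe_mk, AddHom.coe_mk, delta_apply,
      LinearMap.add_apply, Pi.add_apply, shift_apply, Prod.fst_add]
    push_cast
    module
  have hMk (l : ℕ) : delta₂ V ^ (l + 1) * M =
      M * delta₂ V ^ (l + 1) + ((l + 1 : ℕ) : ℂ) • (shift V (1, 0) * delta₂ V ^ l) := by
    induction l with
    | zero => simp [hM]
    | succ l ih =>
      have hc : Commute (delta₂ V) (shift V (1, 0)) :=
        (shift_commute _ _).sub_left (shift_commute _ _)
      rw [pow_succ' _ (l + 1), mul_assoc, ih, mul_add, ← mul_assoc, hM, add_mul, mul_assoc,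
        ← pow_succ', mul_smul_comm, ← mul_assoc, hc.eq, mul_assoc, ← pow_succ', add_assoc]
      congr 1
      push_cast
      module
  refine ⟨k + 1, fun v => ?_⟩
  have h1 : commFun (TorVOA.dField A) C v = -M (pull V (fun x => (x.1 - 1, x.2)) (commFun A C v)) := by
    funext x
    simp only [TorVOA.dField, commFun, pull, M, LinearMap.coe_mk, AddHom.coe_mk, Pi.neg_apply,
      LinearMap.smul_apply, map_smul]
    module
  have h2 (l : ℕ) (hl : k ≤ l) :
      (delta₂ V ^ l) (pull V (fun x : ℤ × ℤ => (x.1 - 1, x.2)) (commFun A C v)) = 0 := by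
    rw [delta_pow_pull _ (a' := (1, 0)) (b' := (0, 1)), hk.mono hl, map_zero]
    · intro x; ext <;> simp
    · intro x; ext <;> simp
  rw [h1, map_neg, ← Module.End.mul_apply, hMk, LinearMap.add_apply, Module.End.mul_apply,
    LinearMap.smul_apply, Module.End.mul_apply, h2 _ (by omega), h2 _ le_rfl]
  simp

/-! ### Normally ordered products and Dong's lemma -/

section NormalProduct

variable {A C : ℤ → Module.End ℂ V} {D : ℤ → Module.End ℂ V}

lemma IsField.exists_nat (hA : IsField A) (a : ℤ) (v : V) : ∃ K : ℕ, ∀ i ≥ K, A (a + i) v = 0 := by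
  obtain ⟨k, hk⟩ := hA v
  exact ⟨(k - a).toNat, fun i hi => hk _ (by omega)⟩

lemma normalProduct_finite (hA : IsField A) (hC : IsField C) (a b : ℤ) (v : V) :
    Function.HasFiniteSupport fun i : ℕ =>
      A (a - 1 - i) (C (b + i) v) + C (b - 1 - i) (A (a + i) v) := by
  obtain ⟨K, hK⟩ := hA.exists_nat a v
  obtain ⟨L, hL⟩ := hC.exists_nat b v
  refine hasFiniteSupport_nat (max K L) fun i hi => ?_
  rw [hK i (by omega), hL i (by omega), map_zero, map_zero, add_zero]

/-- The modes of the expansion of `A(z) C(w) / (z - w) - C(w) A(z) / (z - w)`. -/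
def normalKernel (hA : IsField A) (hC : IsField C) (a b : ℤ) : Module.End ℂ V where
  toFun v := ∑ᶠ i : ℕ, (A (a - 1 - i) (C (b + i) v) + C (b - 1 - i) (A (a + i) v))
  map_add' v w := by
    rw [← finsum_add_distrib (normalProduct_finite hA hC a b v) (normalProduct_finite hA hC a b w)]
    refine finsum_congr fun i => ?_
    simp only [map_add]
    abel
  map_smul' r v := by
    rw [RingHom.id_apply, smul_finsum]
    refine finsum_congr fun i => ?_
    simp only [map_smul, smul_add]

/-- The normally ordered product of two fields. -/
def normalProduct (hA : IsField A) (hC : IsField C) (n : ℤ) : Module.End ℂ V :=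
  normalKernel hA hC 0 n

lemma normalKernel_apply (hA : IsField A) (hC : IsField C) (a b : ℤ) (v : V) :
    normalKernel hA hC a b v =
      ∑ᶠ i : ℕ, (A (a - 1 - i) (C (b + i) v) + C (b - 1 - i) (A (a + i) v)) := rfl

/-- Multiplying the kernel by z - w recovers the commutator: the two sums telescope and only their
term i = 0 remains. -/
lemma normalKernel_sub (hA : IsField A) (hC : IsField C) (a b : ℤ) (v : V) :
    normalKernel hA hC (a + 1) b v - normalKernel hA hC a (b + 1) v = commFun A C v (a, b) := by
  have hf : Function.HasFiniteSupport fun i : ℕ => A (a - i) (C (b + i) v) -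
      C (b - i) (A (a + i) v) := by
    obtain ⟨K, hK⟩ := hA.exists_nat a v
    obtain ⟨L, hL⟩ := hC.exists_nat b v
    refine hasFiniteSupport_nat (max K L) fun i hi => ?_
    rw [hK i (by omega), hL i (by omega), map_zero, map_zero, sub_zero]
  rw [normalKernel_apply, normalKernel_apply, ← finsum_sub_distrib (normalProduct_finite hA hC _ _ v)
    (normalProduct_finite hA hC _ _ v), show commFun A C v (a, b) =
      A (a - (0 : ℕ)) (C (b + (0 : ℕ)) v) - C (b - (0 : ℕ)) (A (a + (0 : ℕ)) v) by simp [commFun],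
    ← finsum_nat_shift_sub hf]
  refine finsum_congr fun i => ?_
  push_cast
  rw [show a + 1 - 1 - (i : ℤ) = a - i by ring, show a + 1 + (i : ℤ) = a + (i + 1) by ring,
    show b + 1 - 1 - (i : ℤ) = b - i by ring, show b + 1 + (i : ℤ) = b + (i + 1) by ring,
    show a - 1 - (i : ℤ) = a - (i + 1) by ring, show b - 1 - (i : ℤ) = b - (i + 1) by ring]
  abel

/-- Only finitely many i have A(i)v ≠ 0, and for each of them the field property of `C` at A(i)v
gives a bound. -/
lemma IsField.normalProduct (hA : IsField A) (hC : IsField C) :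
    IsField (normalProduct hA hC) := fun v => by
  obtain ⟨K, hK⟩ := hA.exists_nat 0 v
  obtain ⟨L, hL⟩ := hC v
  choose N hN using fun i : ℕ => hC (A (0 + i) v)
  obtain ⟨T, hT⟩ := ((Finset.range K).image fun i => N i + 1 + i).bddAbove
  refine ⟨max L T, fun n hn => ?_⟩
  rw [TorVOA.normalProduct, normalKernel_apply]
  refine finsum_eq_zero_of_forall_eq_zero fun i => ?_
  rw [hL (n + i) (by omega), map_zero, zero_add]
  by_cases hi : K ≤ i
  · rw [hK i hi, map_zero]
  · refine hN i _ ?_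
    have : N i + 1 + i ≤ T := hT (Finset.mem_coe.2 (Finset.mem_image.2
      ⟨i, Finset.mem_range.2 (by omega), rfl⟩))
    omega

/-- Dong's lemma for normally ordered products. -/
theorem IsLocal.normalProduct (hA : IsField A) (hC : IsField C)
    (hAC : IsLocal A C) (hAD : IsLocal A D) (hCD : IsLocal C D) :
    IsLocal (normalProduct hA hC) D := by
  obtain ⟨k, hk⟩ := hAC
  obtain ⟨l, hl⟩ := hAD
  obtain ⟨m, hm⟩ := hCD
  let e₁ : ℤ × ℤ × ℤ := (1, 0, 0)
  let e₂ : ℤ × ℤ × ℤ := (0, 1, 0)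
  let e₃ : ℤ × ℤ × ℤ := (0, 0, 1)
  refine ⟨l + (k + 1) + m, fun v => ?_⟩
  -- The variables z, w, u of A, C, D are kept independent; the normally ordered product is
  -- recovered at the end as the slice where the first index is 0.
  let Q : ℤ × ℤ × ℤ → V := fun x =>
    normalKernel hA hC x.1 x.2.1 (D x.2.2 v) - D x.2.2 (normalKernel hA hC x.1 x.2.1 v)
  -- One factor z - w turns `Q` into [[A(z), C(w)], D(u)], which the other k factors kill.
  have h12 : (delta V e₁ e₂ ^ (k + 1)) Q = 0 := by
    have h1 : delta V e₁ e₂ Q = fun x => commFun A C (D x.2.2 v) (x.1, x.2.1) -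
        D x.2.2 (commFun A C v (x.1, x.2.1)) := by
      funext x
      rw [← normalKernel_sub hA hC, ← normalKernel_sub hA hC, map_sub]
      simp only [delta_apply, Q, e₁, e₂, Prod.fst_add, Prod.snd_add, add_zero]
      abel
    rw [pow_succ, Module.End.mul_apply, h1]
    funext ⟨a, b, d⟩
    rw [delta_pow_apply]
    have h2 := hk (D d v)
    have h3 := congrArg (D d) (congrFun (hk v) (a, b))
    replace h2 := congrFun h2 (a, b)
    rw [delta_pow_apply] at h2 h3
    rw [Pi.zero_apply, map_zero, map_sum] at h3
    rw [Pi.zero_apply] at h2 ⊢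
    refine Eq.trans ?_ ((congrArg₂ (· - ·) h2 h3).trans (sub_zero 0))
    rw [← Finset.sum_sub_distrib]
    refine Finset.sum_congr rfl fun i _ => ?_
    simp [e₁, e₂, smul_sub]
  -- By the Leibniz rule `Q` is a sum over i of four terms, each containing [A, D], killed by
  -- (z-u)^l, or [C, D], killed by (w-u)^m. The product of both powers therefore kills `Q`.
  let X : ℕ → ℤ × ℤ × ℤ → V := fun i x => A (x.1 - 1 - i) (commFun C D v (x.2.1 + i, x.2.2))
  let X' : ℕ → ℤ × ℤ × ℤ → V := fun i x => commFun A D (C (x.2.1 + i) v) (x.1 - 1 - i, x.2.2)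
  let Z : ℕ → ℤ × ℤ × ℤ → V := fun i x => C (x.2.1 - 1 - i) (commFun A D v (x.1 + i, x.2.2))
  let Z' : ℕ → ℤ × ℤ × ℤ → V := fun i x => commFun C D (A (x.1 + i) v) (x.2.1 - 1 - i, x.2.2)
  have hQ (x) : Q x = ∑ᶠ i : ℕ, (X i + X' i + Z i + Z' i) x := by
    simp only [Q, normalKernel_apply]
    have h1 : D x.2.2 (∑ᶠ i : ℕ, (A (x.1 - 1 - i) (C (x.2.1 + i) v) +
        C (x.2.1 - 1 - i) (A (x.1 + i) v))) = ∑ᶠ i : ℕ, D x.2.2 (A (x.1 - 1 - i) (C (x.2.1 + i) v) +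
        C (x.2.1 - 1 - i) (A (x.1 + i) v)) :=
      (D x.2.2).toAddMonoidHom.map_finsum (normalProduct_finite hA hC _ _ v)
    rw [h1, ← finsum_sub_distrib (normalProduct_finite hA hC _ _ _)
      ((normalProduct_finite hA hC _ _ v).subset fun i hi h => hi (by
        dsimp only at h ⊢; rw [h, map_zero]))]
    refine finsum_congr fun i => ?_
    simp only [X, X', Z, Z', commFun, Pi.add_apply, map_sub, map_add]
    abel
  have hXfin (x) : Function.HasFiniteSupport fun i => (X i + X' i + Z i + Z' i) x := by
    obtain ⟨K₁, h₁⟩ := hA.exists_nat x.1 v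
    obtain ⟨K₂, h₂⟩ := hC.exists_nat x.2.1 v
    obtain ⟨K₃, h₃⟩ := hA.exists_nat x.1 (D x.2.2 v)
    obtain ⟨K₄, h₄⟩ := hC.exists_nat x.2.1 (D x.2.2 v)
    refine hasFiniteSupport_nat (max (max K₁ K₂) (max K₃ K₄)) fun i hi => ?_
    simp only [X, X', Z, Z', commFun, Pi.add_apply]
    rw [h₁ i (by omega), h₂ i (by omega), h₃ i (by omega), h₄ i (by omega)]
    simp
  have hX (i) : (delta V e₂ e₃ ^ m) (X i) = 0 := by
    funext ⟨a, b, d⟩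
    have h := congrArg (A (a - 1 - i)) (congrFun (hm v) (b + i, d))
    rw [delta_pow_apply, map_sum, Pi.zero_apply, map_zero] at h
    rw [delta_pow_apply, Pi.zero_apply, ← h]
    refine Finset.sum_congr rfl fun j _ => ?_
    simp [e₂, e₃, X, add_right_comm]
  have hZ' (i) : (delta V e₂ e₃ ^ m) (Z' i) = 0 := by
    funext ⟨a, b, d⟩
    have h := congrFun (hm (A (a + i) v)) (b - 1 - i, d)
    rw [delta_pow_apply, Pi.zero_apply] at h
    rw [delta_pow_apply, Pi.zero_apply, ← h]
    refine Finset.sum_congr rfl fun j _ => ?_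
    simp [e₂, e₃, Z', sub_add_eq_add_sub]
  have hX' (i) : (delta V e₁ e₃ ^ l) (X' i) = 0 := by
    funext ⟨a, b, d⟩
    have h := congrFun (hl (C (b + i) v)) (a - 1 - i, d)
    rw [delta_pow_apply, Pi.zero_apply] at h
    rw [delta_pow_apply, Pi.zero_apply, ← h]
    refine Finset.sum_congr rfl fun j _ => ?_
    simp [e₁, e₃, X', sub_add_eq_add_sub]
  have hZ (i) : (delta V e₁ e₃ ^ l) (Z i) = 0 := by
    funext ⟨a, b, d⟩
    have h := congrArg (C (b - 1 - i)) (congrFun (hl v) (a + i, d))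
    rw [delta_pow_apply, map_sum, Pi.zero_apply, map_zero] at h
    rw [delta_pow_apply, Pi.zero_apply, ← h]
    refine Finset.sum_congr rfl fun j _ => ?_
    simp [e₁, e₃, Z, add_right_comm]
  have hcomm := ((delta_commute (V := V) e₁ e₃ e₂ e₃).pow_pow l m).eq
  have h1323 : (delta V e₁ e₃ ^ l) ((delta V e₂ e₃ ^ m) Q) = 0 := by
    rw [show Q = fun x => ∑ᶠ i : ℕ, (X i + X' i + Z i + Z' i) x from funext hQ,
      ← Module.End.mul_apply, ((((delta_commutesWithFinsum e₁ e₃).pow l).mul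
        ((delta_commutesWithFinsum e₂ e₃).pow m)) _ hXfin).2]
    funext x
    refine finsum_eq_zero_of_forall_eq_zero fun i => ?_
    rw [map_add, map_add, map_add, Module.End.mul_apply _ _ (X i), hX,
      Module.End.mul_apply _ _ (Z' i), hZ', hcomm, Module.End.mul_apply _ _ (X' i), hX',
      Module.End.mul_apply _ _ (Z i), hZ]
    simp
  -- Expand (w-u)^(l+k+1) using w - u = (z-u) - (z-w): each term contains (z-u)^l or (z-w)^(k+1).
  -- The spare factor (w-u)^m is needed in the first case.
  have h23 : (delta V e₂ e₃ ^ (l + (k + 1) + m)) Q = 0 := by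
    have hd : delta V e₂ e₃ = delta V e₁ e₃ + (-1 : ℂ) • delta V e₁ e₂ := by
      simp only [delta]
      module
    have hc := (delta_commute (V := V) e₁ e₃ e₁ e₂).smul_right (-1 : ℂ)
    rw [pow_add, Module.End.mul_apply]
    conv_lhs => arg 1; rw [hd]
    rw [hc.add_pow, LinearMap.sum_apply]
    refine Finset.sum_eq_zero fun j hj => ?_
    rw [← nsmul_eq_mul', LinearMap.smul_apply, (hc.pow_pow _ _).eq]
    by_cases hjl : l ≤ j
    · obtain ⟨d, rfl⟩ := Nat.exists_eq_add_of_le' hjl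
      rw [pow_add, ← mul_assoc, Module.End.mul_apply, h1323, map_zero, smul_zero]
    · obtain ⟨d, hd'⟩ := Nat.exists_eq_add_of_le' (show k + 1 ≤ l + (k + 1) - j by omega)
      rw [← (hc.pow_pow _ _).eq, ← Module.End.mul_apply, mul_assoc, hd', smul_pow, smul_mul_assoc,
        ((delta_commute (V := V) e₁ e₂ e₂ e₃).pow_pow _ _).eq, pow_add (delta V e₁ e₂)]
      simp only [Module.End.mul_apply, LinearMap.smul_apply, h12, map_zero, smul_zero]
  have hpull : commFun (TorVOA.normalProduct hA hC) D v = pull V (fun x => (0, x)) Q := by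
    funext x
    simp [commFun, TorVOA.normalProduct, pull, Q]
  rw [hpull, delta_pow_pull (a' := e₂) (b' := e₃), h23, map_zero]
  · intro x; simp [e₂]
  · intro x; simp [e₃]

end NormalProduct

/-! ### The reconstruction theorem -/

/-- Goddard's uniqueness theorem: a field that annihilates the vacuum and is local with respect to
a generating family of fields is zero. -/
theorem eq_zero_of_isLocal {I : Type*} {vac : V} {G : I → ℤ → Module.End ℂ V}
    (hG : ∀ s, IsField (G s))
    (hspan : ∀ X : Submodule ℂ V, vac ∈ X → (∀ s n, ∀ v ∈ X, G s n v ∈ X) → X = ⊤)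
    {D : ℤ → Module.End ℂ V} (hD : ∀ s, IsLocal D (G s)) (hvac : ∀ n, D n vac = 0) (n : ℤ) :
    D n = 0 := by
  let X : Submodule ℂ V := ⨅ n, LinearMap.ker (D n)
  have hX (v) : v ∈ X ↔ ∀ n, D n v = 0 := by simp [X, Submodule.mem_iInf]
  have htop : X = ⊤ := by
    refine hspan X ((hX _).2 hvac) fun s n v hv => ?_
    rw [hX] at hv ⊢
    obtain ⟨k, hk⟩ := hD s
    obtain ⟨K, hK⟩ := hG s v
    -- Descending induction on n, from where G(n)v = 0. As D kills v, the locality relation at (m -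
    -- k, n) reduces to the term D(m)G(n)v, the others having larger n.
    have key (d : ℕ) : ∀ m n : ℤ, K - d ≤ n → D m (G s n v) = 0 := by
      induction d with
      | zero => intro m n hn; rw [hK n (by push_cast at hn; omega), map_zero]
      | succ d ih =>
        intro m n hn
        have h := isLocalAt_iff.1 hk (m - k) n v
        rw [Finset.sum_eq_single 0] at h
        · simpa [hv] using h
        · intro i _ hi
          rw [hv, map_zero, sub_zero, ih _ _ (by push_cast at hn; omega), smul_zero]
        · simp
    intro m
    exact key (K - n).toNat m n (by omega)
  ext v
  exact (hX v).1 (htop ▸ Submodule.mem_top) n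

/-- A generating family of mutually local translation covariant fields. -/
structure GeneratingFields (V : Type*) [AddCommGroup V] [Module ℂ V] (I : Type*) where
  vac : V
  T : Module.End ℂ V
  G : I → ℤ → Module.End ℂ V
  T_vac : T vac = 0
  isField (s) : IsField (G s)
  isLocal (s t) : IsLocal (G s) (G t)
  vac_nonneg (s) (n : ℤ) (hn : 0 ≤ n) : G s n vac = 0
  translation (s) (n : ℤ) (v : V) : T (G s n v) = G s n (T v) - (n : ℂ) • G s (n - 1) v
  span (X : Submodule ℂ V) (h : vac ∈ X) (hX : ∀ s, ∀ n < 0, ∀ v ∈ X, G s n v ∈ X) : X = ⊤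

namespace GeneratingFields

variable {I : Type*} (Γ : GeneratingFields V I)

/-- The space of translation covariant fields that are regular on the vacuum and local with respect
to the generating fields. -/
def fields : Submodule ℂ (ℤ → Module.End ℂ V) where
  carrier := {A | IsField A ∧ (∀ n : ℤ, 0 ≤ n → A n Γ.vac = 0) ∧
    (∀ (n : ℤ) (v : V), Γ.T (A n v) = A n (Γ.T v) - (n : ℂ) • A (n - 1) v) ∧
    ∀ s, IsLocal A (Γ.G s)}
  add_mem' := by
    rintro A C ⟨h1, h2, h3, h4⟩ ⟨h1', h2', h3', h4'⟩
    refine ⟨fun v => ?_, fun n hn => ?_, fun n v => ?_, fun s => (h4 s).add (h4' s)⟩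
    · obtain ⟨k, hk⟩ := h1 v
      obtain ⟨l, hl⟩ := h1' v
      exact ⟨max k l, fun n hn => by simp [hk n (by omega), hl n (by omega)]⟩
    · simp [h2 n hn, h2' n hn]
    · simp only [Pi.add_apply, LinearMap.add_apply, map_add, h3, h3']
      module
  zero_mem' := ⟨fun v => ⟨0, fun _ _ => rfl⟩, fun _ _ => rfl, fun n v => by simp,
    fun s => IsLocal.zero _⟩
  smul_mem' := by
    rintro r A ⟨h1, h2, h3, h4⟩
    refine ⟨fun v => ?_, fun n hn => ?_, fun n v => ?_, fun s => (h4 s).smul r⟩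
    · obtain ⟨k, hk⟩ := h1 v
      exact ⟨k, fun n hn => by simp [hk n hn]⟩
    · simp [h2 n hn]
    · simp only [Pi.smul_apply, LinearMap.smul_apply, map_smul, h3]
      module

lemma generator_mem (s : I) : Γ.G s ∈ Γ.fields :=
  ⟨Γ.isField s, Γ.vac_nonneg s, Γ.translation s, Γ.isLocal s⟩

lemma id_mem : idField V ∈ Γ.fields := by
  refine ⟨fun v => ⟨0, fun n hn => ?_⟩, fun n hn => ?_, fun n v => ?_, fun s => IsLocal.id _⟩
  · rw [idField, if_neg (by omega), LinearMap.zero_apply]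
  · rw [idField, if_neg (by omega), LinearMap.zero_apply]
  · by_cases h : n = 0
    · subst h; simp [idField]
    · rw [show idField V (n - 1) = 0 from if_neg (by omega)]
      simp only [idField]
      split_ifs <;> simp

lemma dField_mem {A : ℤ → Module.End ℂ V} (hA : A ∈ Γ.fields) : dField A ∈ Γ.fields := by
  obtain ⟨h1, h2, h3, h4⟩ := hA
  refine ⟨h1.dField, fun n hn => ?_, fun n v => ?_, fun s => (h4 s).dField⟩
  · by_cases h : n = 0
    · subst h; simp [dField]
    · simp [dField, h2 (n - 1) (by omega)]
  · simp only [dField, LinearMap.smul_apply, map_smul, h3]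
    push_cast
    module

/-- Dong's lemma gives locality. Translation covariance follows from that of both factors after a
telescoping rearrangement. -/
lemma normalProduct_mem {A C : ℤ → Module.End ℂ V} (hA : A ∈ Γ.fields) (hC : C ∈ Γ.fields)
    (hAC : IsLocal A C) : normalProduct hA.1 hC.1 ∈ Γ.fields := by
  obtain ⟨h1, h2, h3, h4⟩ := hA
  obtain ⟨h1', h2', h3', h4'⟩ := hC
  refine ⟨h1.normalProduct h1', fun n hn => ?_, fun n v => ?_,
    fun s => IsLocal.normalProduct h1 h1' hAC (h4 s) (h4' s)⟩
  · rw [normalProduct, normalKernel_apply]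
    refine finsum_eq_zero_of_forall_eq_zero fun i => ?_
    rw [h2' _ (by omega), h2 _ (by omega), map_zero, map_zero, add_zero]
  · rw [normalProduct, normalProduct, normalKernel_apply, normalKernel_apply, normalKernel_apply]
    have hfin := normalProduct_finite h1 h1' 0 n v
    -- Its differences account for the gap between the separate mode indices, produced by T on each
    -- factor, and the common coefficient n. They sum to f 0 = 0.
    let f : ℕ → V := fun i => (i : ℂ) • (A (-1 - i) (C (n + i - 1) v) + C (n - 1 - i) (A (i - 1) v))
    have hf : Function.HasFiniteSupport f := by
      obtain ⟨K, hK⟩ := h1.exists_nat (-1) v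
      obtain ⟨L, hL⟩ := h1'.exists_nat (n - 1) v
      refine hasFiniteSupport_nat (max K L) fun i hi => ?_
      simp only [f]
      rw [show (i : ℤ) - 1 = -1 + i by ring, hK i (by omega), show n + (i : ℤ) - 1 = n - 1 + i by ring,
        hL i (by omega)]
      simp
    have hlin : Γ.T (∑ᶠ i : ℕ, (A (0 - 1 - i) (C (n + i) v) + C (n - 1 - i) (A (0 + i) v))) =
        ∑ᶠ i : ℕ, Γ.T (A (0 - 1 - i) (C (n + i) v) + C (n - 1 - i) (A (0 + i) v)) :=
      Γ.T.toAddMonoidHom.map_finsum hfin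
    have hsh := finsum_nat_shift_sub hf
    have hf1 : Function.HasFiniteSupport fun i => f i - f (i + 1) :=
      HasFiniteSupport.sub hf (Set.Finite.preimage (add_left_injective 1).injOn hf)
    have hfin' := normalProduct_finite h1 h1' 0 (n - 1) v
    rw [show f 0 = 0 by simp [f]] at hsh
    rw [hlin, smul_finsum, ← finsum_sub_distrib (normalProduct_finite h1 h1' 0 n _)
      (hfin'.subset fun i hi h => hi (by dsimp only at h ⊢; rw [h, smul_zero]))]
    refine Eq.trans ?_ (sub_zero _)
    rw [← hsh, ← finsum_sub_distrib _ hf1]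
    · refine finsum_congr fun i => ?_
      rw [map_add, h3, h3', h3', h3]
      simp only [f, map_sub, map_smul]
      rw [show (0 : ℤ) - 1 - i - 1 = -1 - (i + 1 : ℕ) by push_cast; ring,
        show n + ((i + 1 : ℕ) : ℤ) - 1 = n + i by push_cast; ring,
        show n - 1 - ((i + 1 : ℕ) : ℤ) = n - 1 - i - 1 by push_cast; ring,
        show ((i + 1 : ℕ) : ℤ) - 1 = 0 + i by push_cast; ring,
        show (0 : ℤ) - 1 - i = -1 - i by ring, show n - 1 + (i : ℤ) = n + i - 1 by ring,
        show n - 1 - 1 - (i : ℤ) = n - 1 - i - 1 by ring, show (0 : ℤ) + i - 1 = i - 1 by ring]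
      push_cast
      module
    · exact HasFiniteSupport.sub (normalProduct_finite h1 h1' 0 n (Γ.T v))
        (hfin'.subset fun i hi h => hi (by
          dsimp only at h ⊢; rw [h]; exact smul_zero (n : ℂ)))

/-- A subspace containing the vacuum that is stable under translation and under the modes `-1` of
the generating fields is the whole space. -/
lemma eq_top_of_stable (X : Submodule ℂ V) (hvac : Γ.vac ∈ X) (hT : ∀ v ∈ X, Γ.T v ∈ X)
    (hG : ∀ s, ∀ v ∈ X, Γ.G s (-1) v ∈ X) : X = ⊤ := by
  refine Γ.span X hvac fun s n hn => ?_
  obtain ⟨k, rfl⟩ : ∃ k : ℕ, n = -1 - k := ⟨(-1 - n).toNat, by omega⟩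
  clear hn
  induction k with
  | zero => simpa using hG s
  | succ k ih =>
    intro v hv
    have h := Γ.translation s (-1 - k) v
    have hk : (k + 1 : ℂ) ≠ 0 := Nat.cast_add_one_ne_zero k
    -- The commutator of T with the mode -1-k is k+1 times the next mode, and k+1 is invertible.
    have h2 : Γ.G s (-1 - (k + 1 : ℕ)) v =
        (k + 1 : ℂ)⁻¹ • (Γ.T (Γ.G s (-1 - k) v) - Γ.G s (-1 - k) (Γ.T v)) := by
      rw [h, show (-1 - (k + 1 : ℕ) : ℤ) = -1 - k - 1 by push_cast; ring, sub_sub_cancel_left,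
        ← neg_smul, smul_smul]
      push_cast
      rw [show (k + 1 : ℂ)⁻¹ * -(-1 - (k : ℂ)) = 1 by field_simp; ring, one_smul]
    rw [h2]
    exact X.smul_mem _ (X.sub_mem (hT _ (ih v hv)) (ih _ (hT v hv)))

lemma span_all (X : Submodule ℂ V) (h : Γ.vac ∈ X) (hX : ∀ s n, ∀ v ∈ X, Γ.G s n v ∈ X) : X = ⊤ :=
  Γ.span X h fun s n _ => hX s n

/-- Since T kills the vacuum, applying T to A(n)𝟙 gives -n A(n-1)𝟙; descending from n = -1, the
factor never vanishes. -/
lemma mode_vac_neg {A : ℤ → Module.End ℂ V} (hA : A ∈ Γ.fields) (h : A (-1) Γ.vac = 0) (n : ℤ) :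
    A n Γ.vac = 0 := by
  by_cases hn : 0 ≤ n
  · exact hA.2.1 n hn
  · obtain ⟨k, rfl⟩ : ∃ k : ℕ, n = -1 - k := ⟨(-1 - n).toNat, by omega⟩
    clear hn
    induction k with
    | zero => simpa using h
    | succ k ih =>
      have h3 := hA.2.2.1 (-1 - k) Γ.vac
      rw [ih, map_zero, Γ.T_vac, map_zero, zero_sub, eq_comm, neg_eq_zero, smul_eq_zero] at h3
      rw [show (-1 - (k + 1 : ℕ) : ℤ) = -1 - k - 1 by push_cast; ring]
      exact h3.resolve_left (Int.cast_ne_zero.2 (by omega))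

/-- The difference kills the vacuum, so Goddard's theorem applies to it. -/
lemma eq_of_mem {A C : ℤ → Module.End ℂ V} (hA : A ∈ Γ.fields) (hC : C ∈ Γ.fields)
    (h : A (-1) Γ.vac = C (-1) Γ.vac) : A = C := by
  have hAC := Γ.fields.sub_mem hA hC
  funext n
  rw [← sub_eq_zero]
  refine eq_zero_of_isLocal Γ.isField Γ.span_all hAC.2.2.2 (Γ.mode_vac_neg hAC ?_) n
  simp [h]

/-- The map sending a field to its state. -/
def state : Γ.fields →ₗ[ℂ] V where
  toFun A := A.1 (-1) Γ.vac
  map_add' _ _ := rfl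
  map_smul' _ _ := rfl

lemma state_dField {A : ℤ → Module.End ℂ V} (hA : A ∈ Γ.fields) :
    dField A (-1) Γ.vac = Γ.T (A (-1) Γ.vac) := by
  rw [hA.2.2.1, Γ.T_vac]
  simp [dField]

lemma state_normalProduct {A C : ℤ → Module.End ℂ V} (hA : A ∈ Γ.fields) (hC : C ∈ Γ.fields) :
    normalProduct hA.1 hC.1 (-1) Γ.vac = A (-1) (C (-1) Γ.vac) := by
  rw [normalProduct, normalKernel_apply, finsum_eq_single _ 0]
  · simp [hA.2.1 0 le_rfl]
  · intro i hi
    rw [hA.2.1 _ (by omega), hC.2.1 _ (by omega)]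
    simp

/-- Injectivity is uniqueness. The image contains the vacuum, is stable under T through derivatives
of fields and under the generating modes -1 through normally ordered products, hence is everything.
-/
lemma state_bijective : Function.Bijective Γ.state := by
  constructor
  · intro A C h
    exact Subtype.ext (Γ.eq_of_mem A.2 C.2 h)
  · rw [← LinearMap.range_eq_top]
    refine Γ.eq_top_of_stable _ ⟨⟨_, Γ.id_mem⟩, by simp [state, idField]⟩ ?_ ?_
    · rintro _ ⟨A, rfl⟩
      exact ⟨⟨_, Γ.dField_mem A.2⟩, Γ.state_dField A.2⟩
    · rintro s _ ⟨A, rfl⟩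
      exact ⟨⟨_, Γ.normalProduct_mem (Γ.generator_mem s) A.2 (A.2.2.2.2 s).symm⟩,
        Γ.state_normalProduct (Γ.generator_mem s) A.2⟩

/-- The field with a given state. -/
def ofState : V ≃ₗ[ℂ] Γ.fields := (LinearEquiv.ofBijective Γ.state Γ.state_bijective).symm

lemma ofState_vac (a : V) : (Γ.ofState a).1 (-1) Γ.vac = a :=
  (LinearEquiv.ofBijective Γ.state Γ.state_bijective).apply_symm_apply a

lemma ofState_eq {A : ℤ → Module.End ℂ V} (hA : A ∈ Γ.fields) {a : V} (h : A (-1) Γ.vac = a) :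
    (Γ.ofState a).1 = A :=
  Γ.eq_of_mem (Γ.ofState a).2 hA (by rw [ofState_vac, h])

/-- The states whose field is local with that of `b` form a subspace to which `eq_top_of_stable`
applies; stability under the generating modes is Dong's lemma. -/
lemma ofState_isLocal (a b : V) : IsLocal (Γ.ofState a).1 (Γ.ofState b).1 := by
  let X : Submodule ℂ V :=
    { carrier := {a | IsLocal (Γ.ofState a).1 (Γ.ofState b).1}
      add_mem' := fun {x y} hx hy => by
        rw [Set.mem_ofPred_eq, map_add]
        exact IsLocal.add hx hy
      zero_mem' := by
        rw [Set.mem_ofPred_eq, map_zero]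
        exact IsLocal.zero _
      smul_mem' := fun r x hx => by
        rw [Set.mem_ofPred_eq, map_smul]
        exact IsLocal.smul r hx }
  have hX : X = ⊤ := by
    refine Γ.eq_top_of_stable X ?_ (fun v hv => ?_) fun s v hv => ?_
    · change IsLocal _ _
      rw [Γ.ofState_eq Γ.id_mem (by simp [idField])]
      exact IsLocal.id _
    · change IsLocal _ _
      rw [Γ.ofState_eq (Γ.dField_mem (Γ.ofState v).2) (by rw [Γ.state_dField (Γ.ofState v).2,
        ofState_vac])]
      exact IsLocal.dField hv
    · change IsLocal _ _
      rw [Γ.ofState_eq (Γ.normalProduct_mem (Γ.generator_mem s) (Γ.ofState v).2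
        ((Γ.ofState v).2.2.2.2 s).symm)
        (by rw [Γ.state_normalProduct (Γ.generator_mem s) (Γ.ofState v).2, ofState_vac])]
      exact IsLocal.normalProduct _ _ ((Γ.ofState v).2.2.2.2 s).symm
        ((Γ.ofState b).2.2.2.2 s).symm hv
  exact (hX ▸ Submodule.mem_top : a ∈ X)

/-- The vertex operator with given modes. -/
def toVertexOperator {A : ℤ → Module.End ℂ V} (hA : IsField A) : VertexOperator ℂ V :=
  VertexOperator.of_coeff (fun n => A (-n - 1)) fun v => by
    obtain ⟨k, hk⟩ := hA v
    refine ⟨-k - 1, fun n hn => ?_⟩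
    by_contra hc
    exact hn (hk _ (by omega))

lemma ncoeff_toVertexOperator {A : ℤ → Module.End ℂ V} (hA : IsField A) (n : ℤ) :
    VertexOperator.ncoeff (toVertexOperator hA) n = A n := by
  rw [toVertexOperator, VertexOperator.ncoeff_of_coeff]
  congr 1
  ring

/-- The state-field correspondence generated by `Γ`, with conformal vector `ω`. -/
def voa (ω : V) : VOAData V where
  Y :=
    { toFun a := toVertexOperator (Γ.ofState a).2.1
      map_add' a b := VOAData.operator_ext fun n => by
        simp [ncoeff_toVertexOperator]
      map_smul' r a := VOAData.operator_ext fun n => by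
        simp [ncoeff_toVertexOperator] }
  vac := Γ.vac
  conf := ω

lemma voa_mode (ω a : V) (n : ℤ) : (Γ.voa ω).mode a n = (Γ.ofState a).1 n :=
  ncoeff_toVertexOperator (Γ.ofState a).2.1 n

lemma voa_mode_eq (ω : V) {A : ℤ → Module.End ℂ V} (hA : A ∈ Γ.fields) {a : V}
    (h : A (-1) Γ.vac = a) (n : ℤ) : (Γ.voa ω).mode a n = A n := by
  rw [voa_mode, Γ.ofState_eq hA h]

/-- The reconstruction theorem. -/
theorem voa_isVOA {ω : V} {c : ℂ} {A : ℤ → Module.End ℂ V} (hA : A ∈ Γ.fields)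
    (hω : A (-1) Γ.vac = ω) (hT : A 0 = Γ.T) (R : VirRep c V) (hR : ∀ n, A (n + 1) = R.op n)
    (hgr : ⨆ n : ℤ, Module.End.eigenspace (A 1) (n : ℂ) = ⊤) : (Γ.voa ω).IsVOA c := by
  have hL (n : ℤ) : (Γ.voa ω).L n = A (n + 1) := Γ.voa_mode_eq ω hA hω (n + 1)
  refine ⟨fun n => Γ.voa_mode_eq ω Γ.id_mem (by simp [idField, voa]) n, fun a n hn => ?_,
    fun a => ?_, fun a n => ?_, fun a b => ?_, fun m n => ?_, ?_⟩
  · rw [voa_mode]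
    exact (Γ.ofState a).2.2.1 n hn
  · rw [voa_mode]
    exact Γ.ofState_vac a
  · rw [hL, voa_mode, voa_mode, show (-1 + 1 : ℤ) = 0 from rfl, hT]
    ext v
    simp [(Γ.ofState a).2.2.2.1 n v]
  · obtain ⟨k, hk⟩ := Γ.ofState_isLocal a b
    refine ⟨k, fun m n => ?_⟩
    ext v
    simpa [voa_mode] using isLocalAt_iff.1 hk m n v
  · ext v
    simp only [hL, hR]
    simp only [LinearMap.sub_apply, Module.End.mul_apply, R.comm m n v, LinearMap.add_apply,
      LinearMap.smul_apply, Module.End.one_apply]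
    abel
  -- Eigenspaces are always independent, so only their spanning has to be supplied.
  · rw [hL, zero_add]
    refine DirectSum.isInternal_submodule_of_iSupIndep_of_iSup_eq_top ?_ hgr
    exact (Module.End.eigenspaces_iSupIndep (A 1)).comp Int.cast_injective

/-- The fields of a vertex operator algebra whose vacuum, translation operator and generating fields
are those of `Γ`. -/
lemma mode_eq_ofState {S : VOAData V} {c : ℂ} (hS : S.IsVOA c) (hvac : S.vac = Γ.vac)
    (hT : S.L (-1) = Γ.T) (hG : ∀ s, ∃ a, ∀ n, S.mode a n = Γ.G s n) (a : V) (n : ℤ) :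
    S.mode a n = (Γ.ofState a).1 n := by
  have hmem : S.mode a ∈ Γ.fields := by
    refine ⟨fun v => VOAData.exists_forall_ncoeff_eq_zero (S.Y a) v, fun n hn => ?_, fun n v => ?_,
      fun s => ?_⟩
    · rw [← hvac]
      exact hS.creation_nonneg a n hn
    · have := LinearMap.congr_fun (hS.translation a n) v
      rw [hT] at this
      simp only [LinearMap.sub_apply, Module.End.mul_apply, LinearMap.smul_apply] at this
      rw [eq_add_of_sub_eq this]
      module
    · obtain ⟨b, hb⟩ := hG s
      obtain ⟨k, hk⟩ := hS.locality a b
      refine ⟨k, isLocalAt_iff.2 fun m n v => ?_⟩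
      have := LinearMap.congr_fun (hk m n) v
      simpa [hb] using this
  rw [Γ.ofState_eq hmem]
  rw [← hvac]
  exact hS.creation a

end GeneratingFields

end Field

end

end TorVOA


namespace TorVOA

noncomputable section

/-! ### Modules over enveloping algebras -/

section Rep

variable {L : Type*} [LieRing L] [LieAlgebra ℂ L] {M : Type*} [AddCommGroup M] [Module ℂ M]

/-- The operators `ρ x` form a representation of the Lie algebra `L`. -/
def IsRep (ρ : L →ₗ[ℂ] Module.End ℂ M) : Prop :=
  ∀ x y v, ρ ⁅x, y⁆ v = ρ x (ρ y v) - ρ y (ρ x v)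

attribute [local instance] LieRing.ofAssociativeRing in
/-- The action of the enveloping algebra defined by a representation. -/
lemma IsRep.exists_algHom {ρ : L →ₗ[ℂ] Module.End ℂ M} (hρ : IsRep ρ) :
    ∃ F : UniversalEnvelopingAlgebra ℂ L →ₐ[ℂ] Module.End ℂ M,
      ∀ x, F (UniversalEnvelopingAlgebra.ι ℂ x) = ρ x := by
  let f : L →ₗ⁅ℂ⁆ Module.End ℂ M :=
    { ρ with
      map_lie' := by
        intro x y
        ext v
        rw [LieRing.of_associative_ring_bracket]
        exact hρ x y v }
  exact ⟨UniversalEnvelopingAlgebra.lift ℂ f, fun x => UniversalEnvelopingAlgebra.lift_ι_apply ℂ f x⟩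

attribute [local instance] LieRing.ofAssociativeRing in
-- The universal property gives a map into the subalgebra generated by L; composed with the
-- inclusion it is the identity, so the subalgebra is everything.
lemma adjoin_range_ι : Algebra.adjoin ℂ (Set.range (UniversalEnvelopingAlgebra.ι ℂ (L := L))) = ⊤ := by
  set S := Algebra.adjoin ℂ (Set.range (UniversalEnvelopingAlgebra.ι ℂ (L := L)))
  let f : L →ₗ⁅ℂ⁆ S :=
    { toFun x := ⟨UniversalEnvelopingAlgebra.ι ℂ x, Algebra.subset_adjoin ⟨x, rfl⟩⟩
      map_add' x y := Subtype.ext (map_add _ _ _)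
      map_smul' r x := Subtype.ext (map_smul _ _ _)
      map_lie' := by
        intro x y
        refine Subtype.ext ?_
        simp [LieRing.of_associative_ring_bracket] }
  have h : S.val.comp (UniversalEnvelopingAlgebra.lift ℂ f) = AlgHom.id ℂ _ := by
    refine UniversalEnvelopingAlgebra.hom_ext ℂ ?_
    ext x
    change S.val (UniversalEnvelopingAlgebra.lift ℂ f (UniversalEnvelopingAlgebra.ι ℂ x)) = _
    rw [UniversalEnvelopingAlgebra.lift_ι_apply]
    rfl
  refine eq_top_iff.2 fun u _ => ?_
  have h2 : S.val (UniversalEnvelopingAlgebra.lift ℂ f u) = u := DFunLike.congr_fun h u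
  rw [← h2]
  exact Subtype.prop _

section Act

variable [Module (UniversalEnvelopingAlgebra ℂ L) M]
    [IsScalarTower ℂ (UniversalEnvelopingAlgebra ℂ L) M]

lemma act_apply (x : L) (v : M) : act x v = UniversalEnvelopingAlgebra.ι ℂ x • v := rfl

lemma smul_mem_of_act_mem (X : Submodule ℂ M) (hX : ∀ x : L, ∀ v ∈ X, act x v ∈ X)
    (u : UniversalEnvelopingAlgebra ℂ L) {v : M} (hv : v ∈ X) : u • v ∈ X := by
  have hu : u ∈ Algebra.adjoin ℂ (Set.range (UniversalEnvelopingAlgebra.ι ℂ (L := L))) := by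
    rw [adjoin_range_ι]; trivial
  induction hu using Algebra.adjoin_induction generalizing v with
  | mem u hu => obtain ⟨x, rfl⟩ := hu; exact hX x v hv
  | algebraMap r => rw [algebraMap_smul]; exact X.smul_mem r hv
  | add a b _ _ ha hb => rw [add_smul]; exact X.add_mem (ha hv) (hb hv)
  | mul a b _ _ ha hb => rw [mul_smul]; exact ha (hb hv)

variable (L M) in
/-- The action of `L` on a module over its enveloping algebra. -/
def actRep : L →ₗ[ℂ] Module.End ℂ M where
  toFun := act
  map_add' x y := by ext v; simp [act_apply, add_smul]
  map_smul' r x := by ext v; simp [act_apply]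

@[simp] lemma actRep_apply (x : L) : actRep L M x = act x := rfl

attribute [local instance] LieRing.ofAssociativeRing in
lemma act_lie (x y : L) (v : M) : act ⁅x, y⁆ v = act x (act y v) - act y (act x v) := by
  rw [act_apply, LieHom.map_lie, LieRing.of_associative_ring_bracket, sub_smul, mul_smul, mul_smul]
  rfl

variable (L) in
/-- The vectors in `T` generate the module `M`. -/
def Generates (T : Set M) : Prop :=
  ∀ X : Submodule ℂ M, T ⊆ X → (∀ x : L, ∀ v ∈ X, act x v ∈ X) → X = ⊤

/-- An eigenspace of a central element is stable under L. -/
lemma Generates.central {T : Set M} (hT : Generates L T) {z : L} (hz : ∀ x : L, ⁅z, x⁆ = 0) {c : ℂ}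
    (h : ∀ t ∈ T, act z t = c • t) (v : M) : act z v = c • v := by
  have := hT (Module.End.eigenspace (act z) c)
    (fun t ht => Module.End.mem_eigenspace_iff.2 (h t ht)) fun x v hv => by
      rw [Module.End.mem_eigenspace_iff] at hv ⊢
      have h1 := act_lie z x v
      rw [hz, ← actRep_apply, map_zero, LinearMap.zero_apply, eq_comm, sub_eq_zero] at h1
      rw [h1, hv, map_smul]
  exact Module.End.mem_eigenspace_iff.1 (this ▸ Submodule.mem_top)

end Act

/-- A grading of `L` modulo its center. -/
structure CentralGrading (D : ℤ → Submodule ℂ L) (Z : Submodule ℂ L) : Prop where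
  central (z) (hz : z ∈ Z) (x : L) : ⁅z, x⁆ = 0
  lie_mem (m n : ℤ) (h : m + n ≠ 0) (x) (hx : x ∈ D m) (y) (hy : y ∈ D n) : ⁅x, y⁆ ∈ D (m + n)
  span : (⨆ n, D n) ⊔ Z = ⊤

variable [Module (UniversalEnvelopingAlgebra ℂ L) M]
    [IsScalarTower ℂ (UniversalEnvelopingAlgebra ℂ L) M]

/-- Annihilation in large degrees passes from v to y v because x y v = y x v + [x, y] v, where [x,
y] again has large degree. -/
lemma CentralGrading.smooth {D : ℤ → Submodule ℂ L} {Z : Submodule ℂ L} (hD : CentralGrading D Z)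
    {T : Set M} (hT : Generates L T) (h : ∀ t ∈ T, ∃ k : ℤ, ∀ n ≥ k, ∀ x ∈ D n, act x t = 0) (v : M) :
    ∃ k : ℤ, ∀ n ≥ k, ∀ x ∈ D n, act x v = 0 := by
  let X : Submodule ℂ M :=
    { carrier := {v | ∃ k : ℤ, ∀ n ≥ k, ∀ x ∈ D n, act x v = 0}
      add_mem' := by
        rintro v w ⟨k, hk⟩ ⟨l, hl⟩
        exact ⟨max k l, fun n hn x hx => by
          rw [map_add, hk n (by omega) x hx, hl n (by omega) x hx, add_zero]⟩
      zero_mem' := ⟨0, fun _ _ _ _ => map_zero _⟩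
      smul_mem' := by
        rintro r v ⟨k, hk⟩
        exact ⟨k, fun n hn x hx => by rw [map_smul, hk n hn x hx, smul_zero]⟩ }
  have key (v) (hv : v ∈ X) : (⊤ : Submodule ℂ L) ≤
      X.comap ((actRep L M).flip v) := by
    obtain ⟨k, hk⟩ := hv
    rw [← hD.span, sup_le_iff, iSup_le_iff]
    -- The bound 1 - m ensures n + m ≠ 0, so that the bracket has no central part.
    refine ⟨fun m y hy => ⟨max (max k (k - m)) (1 - m), fun n hn x hx => ?_⟩,
      fun z hz => ⟨k, fun n hn x hx => ?_⟩⟩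
    · have h1 := act_lie x y v
      rw [hk n (by omega) x hx, map_zero, sub_zero, hk (n + m) (by omega) _
        (hD.lie_mem n m (by omega) x hx y hy)] at h1
      exact h1.symm
    · have h1 := act_lie z x v
      rw [hD.central z hz, ← actRep_apply, map_zero, LinearMap.zero_apply, hk n hn x hx, map_zero,
        zero_sub, eq_comm, neg_eq_zero] at h1
      exact h1
  have := hT X h fun x v hv => key v hv Submodule.mem_top
  exact (this ▸ Submodule.mem_top : v ∈ X)

/-- An element of degree n shifts the eigenvalue of `L₀` by -n, so the sum of these eigenspaces is
stable under L, and it contains the generators. -/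
lemma CentralGrading.iSup_eigenspace {D : ℤ → Submodule ℂ L} {Z : Submodule ℂ L}
    (hD : CentralGrading D Z) {T : Set M} (hT : Generates L T) (L₀ : Module.End ℂ M) (h : ℂ)
    (hL₀ : ∀ n, ∀ x ∈ D n, ∀ v : M, L₀ (act x v) = act x (L₀ v) - (n : ℂ) • act x v)
    (hZ : ∀ z ∈ Z, ∀ v : M, L₀ (act z v) = act z (L₀ v))
    (ht : ∀ t ∈ T, L₀ t = h • t) :
    ⨆ n : ℤ, Module.End.eigenspace L₀ (h + n) = ⊤ := by
  refine hT _ (fun t h1 => ?_) fun x v hv => ?_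
  · refine Submodule.mem_iSup_of_mem 0 (Module.End.mem_eigenspace_iff.2 ?_)
    simpa using ht t h1
  · revert v
    change (⨆ n : ℤ, Module.End.eigenspace L₀ (h + n)) ≤
      (⨆ n : ℤ, Module.End.eigenspace L₀ (h + n)).comap (act x)
    refine iSup_le fun k v hv => ?_
    rw [Module.End.mem_eigenspace_iff] at hv
    have key : (⊤ : Submodule ℂ L) ≤
      (⨆ n : ℤ, Module.End.eigenspace L₀ (h + n)).comap ((actRep L M).flip v) := by
      rw [← hD.span, sup_le_iff, iSup_le_iff]
      refine ⟨fun m y hy => Submodule.mem_iSup_of_mem (k - m) (Module.End.mem_eigenspace_iff.2 ?_),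
        fun z hz => Submodule.mem_iSup_of_mem k (Module.End.mem_eigenspace_iff.2 ?_)⟩
      · rw [LinearMap.flip_apply, actRep_apply, hL₀ m y hy, hv, map_smul, ← sub_smul]
        congr 1
        push_cast
        ring
      · rw [LinearMap.flip_apply, actRep_apply, hZ z hz, hv, map_smul]
    exact key (Submodule.mem_top (x := x))

/-- If `P` preserves the generating subspace `T` and `L` is spanned by `P` and `N`, then `T`
generates the module under the action of `N` alone. -/
lemma Generates.eq_top_of_stable {T : Submodule ℂ M} (hT : Generates L (T : Set M))
    (P : Submodule ℂ L) (N : Set L) (hPN : P ⊔ Submodule.span ℂ N = ⊤)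
    (hP : ∀ p ∈ P, ∀ t ∈ T, act p t ∈ T)
    (X : Submodule ℂ M) (hTX : T ≤ X) (hX : ∀ x ∈ N, ∀ v ∈ X, act x v ∈ X) : X = ⊤ := by
  -- This replaces PBW: the smallest member of `S` turns out to be stable under P too, hence under
  -- L.
  let S : Set (Submodule ℂ M) := {X | T ≤ X ∧ ∀ x ∈ N, ∀ v ∈ X, act x v ∈ X}
  have hmem : sInf S ∈ S := by
    refine ⟨le_sInf fun Y hY => hY.1, fun x hx v hv => (Submodule.mem_sInf).2
      fun Y hY => hY.2 x hx v ((Submodule.mem_sInf).1 hv Y hY)⟩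
  have hN (v) (hv : v ∈ sInf S) : Submodule.span ℂ N ≤ (sInf S).comap ((actRep L M).flip v) :=
    Submodule.span_le.2 fun x hx => hmem.2 x hx v hv
  -- The vectors that P keeps inside the smallest member. `Y` is stable under N because p x v = [p,
  -- x] v + x p v and [p, x] lies in P plus the span of N. So `Y` is a member of `S`, and by
  -- minimality it is all of `sInf S`.
  let Y : Submodule ℂ M := sInf S ⊓ ⨅ p : P, (sInf S).comap (act p.1)
  have hY (v) : v ∈ Y ↔ v ∈ sInf S ∧ ∀ p ∈ P, act p v ∈ sInf S := by
    simp [Y, Submodule.mem_iInf]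
  have hall (v) (hv : v ∈ Y) (x : L) : act x v ∈ sInf S := by
    obtain ⟨p, hp, q, hq, rfl⟩ := Submodule.mem_sup.1 (hPN ▸ Submodule.mem_top : x ∈ P ⊔ _)
    rw [← actRep_apply, map_add]
    exact (sInf S).add_mem (((hY v).1 hv).2 p hp) (hN v ((hY v).1 hv).1 hq)
  have hYS : Y ∈ S := by
    refine ⟨fun t ht => (hY _).2 ⟨hmem.1 ht, fun p hp => hmem.1 (hP p hp t ht)⟩,
      fun x hx v hv => (hY _).2 ⟨hmem.2 x hx v ((hY v).1 hv).1, fun p hp => ?_⟩⟩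
    have h1 := act_lie p x v
    rw [eq_add_of_sub_eq h1.symm]
    exact (sInf S).add_mem (hall v hv _) (hmem.2 x hx _ (((hY v).1 hv).2 p hp))
  have htop : sInf S = ⊤ := hT _ hmem.1 fun x v hv => hall v (sInf_le hYS hv) x
  exact eq_top_iff.2 (htop ▸ sInf_le ⟨hTX, hX⟩)

lemma Generates.span {T : Set M} (hT : Generates L T) :
    Generates L (Submodule.span ℂ T : Set M) := fun X hX => hT X (Submodule.subset_span.trans hX)

end Rep

/-! ### The universal property of induced modules -/

section Induced

variable {L : Type*} [LieRing L] [LieAlgebra ℂ L] {E : Type*} [AddCommGroup E] [Module ℂ E]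
  {R : L → Module.End ℂ E → Prop} {M : Type*} [AddCommGroup M] [Module ℂ M]

variable (R) in
/-- The map `e ↦ 1 ⊗ e` to the induced module. -/
def topMap : E →ₗ[ℂ] Induced R where
  toFun := Induced.top R
  map_add' e f := by simp [Induced.top, TensorProduct.tmul_add]
  map_smul' r e := by
    rw [Induced.top, TensorProduct.tmul_smul]
    rfl

lemma topMap_apply (e : E) : topMap R e = Induced.top R e := rfl

lemma act_top {p : L} {A : Module.End ℂ E} (h : R p A) (e : E) :
    act p (Induced.top R e) = Induced.top R (A e) := by
  rw [act_apply, Induced.top, Induced.top, ← Submodule.Quotient.mk_smul, Submodule.Quotient.eq]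
  refine Submodule.subset_span ⟨p, A, e, h, ?_⟩
  rw [TensorProduct.smul_tmul', smul_eq_mul, mul_one]

lemma generates_top : Generates L (Set.range (topMap R)) := by
  intro X hT hX
  refine eq_top_iff.2 fun v _ => ?_
  obtain ⟨t, rfl⟩ := Submodule.Quotient.mk_surjective _ v
  induction t using TensorProduct.induction_on with
  | zero => exact X.zero_mem
  | add s t hs ht => exact X.add_mem (hs trivial) (ht trivial)
  | tmul u e =>
    have h := smul_mem_of_act_mem X hX u (hT ⟨e, rfl⟩)
    rw [topMap_apply, Induced.top, ← Submodule.Quotient.mk_smul, TensorProduct.smul_tmul',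
      smul_eq_mul, mul_one] at h
    exact h

/-- The universal property of the induced module. -/
lemma exists_lift {ρ : L →ₗ[ℂ] Module.End ℂ M} (hρ : IsRep ρ) (f : E →ₗ[ℂ] M)
    (hf : ∀ p A, R p A → ∀ e, ρ p (f e) = f (A e)) :
    ∃ F : Induced R →ₗ[ℂ] M, (∀ e, F (Induced.top R e) = f e) ∧ ∀ x v, F (act x v) = ρ x (F v) := by
  obtain ⟨φ, hφ⟩ := hρ.exists_algHom
  let F₀ : UniversalEnvelopingAlgebra ℂ L ⊗[ℂ] E →ₗ[ℂ] M :=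
    TensorProduct.lift ((LinearMap.llcomp ℂ E M M).flip f ∘ₗ φ.toLinearMap)
  have h0 (u e) : F₀ (u ⊗ₜ e) = φ u (f e) := rfl
  have hsmul (u : UniversalEnvelopingAlgebra ℂ L) (t) : F₀ (u • t) = φ u (F₀ t) := by
    induction t using TensorProduct.induction_on with
    | zero => simp
    | add s t hs ht => rw [smul_add, map_add, hs, ht, map_add, map_add]
    | tmul w e => rw [TensorProduct.smul_tmul', h0, h0, smul_eq_mul, map_mul, Module.End.mul_apply]
  have hker : (inducedRel R).restrictScalars ℂ ≤ LinearMap.ker F₀ := by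
    intro t ht
    rw [Submodule.restrictScalars_mem] at ht
    rw [LinearMap.mem_ker]
    induction ht using Submodule.span_induction with
    | zero => exact map_zero _
    | add s t _ _ hs ht => rw [map_add, hs, ht, add_zero]
    | smul u t _ ht => rw [hsmul, ht, map_zero]
    | mem t ht =>
      obtain ⟨p, A, e, h, rfl⟩ := ht
      rw [map_sub, h0, h0, hφ, hf p A h, map_one, Module.End.one_apply, sub_self]
  let F : Induced R →ₗ[ℂ] M :=
    (Submodule.liftQ _ F₀ hker).comp (Submodule.Quotient.restrictScalarsEquiv ℂ (inducedRel R)).symm.toLinearMap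
  have hF (t) : F (Submodule.Quotient.mk t) = F₀ t := rfl
  refine ⟨F, fun e => ?_, fun x v => ?_⟩
  · rw [Induced.top, hF, h0, map_one, Module.End.one_apply]
  · obtain ⟨t, rfl⟩ := Submodule.Quotient.mk_surjective _ v
    rw [act_apply, ← Submodule.Quotient.mk_smul, hF, hF, hsmul, hφ]

end Induced

end

end TorVOA


namespace TorVOA

noncomputable section

/-! ### Representations of the affine algebras, of the Virasoro algebra and of `f̄` -/

section Linearize

variable {g s : Type*} [LieRing g] [LieAlgebra ℂ g] [LieRing s] [LieAlgebra ℂ s]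
  {B : InvForm g} {B' : InvForm s} {c₁ c₂ c : ℂ} {M : Type*} [AddCommGroup M] [Module ℂ M]

variable (B) in
/-- `x(n)` as a linear function of `x`. -/
def Affine.elMap (n : ℤ) : g →ₗ[ℂ] Affine B where
  toFun x := Affine.el B x n
  map_add' x y := by ext1 <;> simp [Affine.el]
  map_smul' r x := by ext1 <;> simp [Affine.el]

@[simp] lemma Affine.elMap_apply (n : ℤ) (x : g) : Affine.elMap B n x = Affine.el B x n := rfl

lemma Affine.span_eq_top : (⨆ n : ℤ, LinearMap.range (Affine.elMap B n)) ⊔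
    Submodule.span ℂ {Affine.C B} = ⊤ := by
  refine eq_top_iff.2 fun a _ => ?_
  have ha : a = (⟨a.loop, 0⟩ : Affine B) + a.central • Affine.C B := by
    ext1 <;> simp [Affine.C]
  rw [ha]
  refine Submodule.add_mem_sup ?_ (Submodule.smul_mem _ _ (Submodule.mem_span_singleton_self _))
  induction a.loop using Finsupp.induction_linear with
  | zero => exact Submodule.zero_mem _
  | add f h hf hh =>
    have : (⟨f + h, 0⟩ : Affine B) = ⟨f, 0⟩ + ⟨h, 0⟩ := by ext1 <;> simp
    rw [this]
    exact Submodule.add_mem _ hf hh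
  | single n x => exact Submodule.mem_iSup_of_mem n ⟨x, rfl⟩

lemma Virasoro.span_eq_top : (⨆ n : ℤ, Submodule.span ℂ {Virasoro.L n}) ⊔
    Submodule.span ℂ {Virasoro.C} = ⊤ := by
  refine eq_top_iff.2 fun a _ => ?_
  have ha : a = (⟨a.field, 0⟩ : Virasoro) + a.central • Virasoro.C := by
    ext1 <;> simp [Virasoro.C]
  rw [ha]
  refine Submodule.add_mem_sup ?_ (Submodule.smul_mem _ _ (Submodule.mem_span_singleton_self _))
  induction a.field using Finsupp.induction_linear with
  | zero => exact Submodule.zero_mem _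
  | add f h hf hh =>
    have : (⟨f + h, 0⟩ : Virasoro) = ⟨f, 0⟩ + ⟨h, 0⟩ := by ext1 <;> simp
    rw [this]
    exact Submodule.add_mem _ hf hh
  | single n x =>
    refine Submodule.mem_iSup_of_mem n (Submodule.mem_span_singleton.2 ⟨x, ?_⟩)
    ext1 <;> simp [Virasoro.L]

/-- The action of `ĝ` defined by a representation. -/
def LoopRep.lin (R : LoopRep B c M) : Affine B →ₗ[ℂ] Module.End ℂ M where
  toFun a := Finsupp.lsum ℂ R.op a.loop + (a.central * c) • 1
  map_add' a b := by simp only [Affine.add_loop, Affine.add_central, map_add]; module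
  map_smul' r a := by
    simp only [Affine.smul_loop, Affine.smul_central, map_smul, RingHom.id_apply, smul_eq_mul]
    module

@[simp] lemma LoopRep.lin_el (R : LoopRep B c M) (x : g) (n : ℤ) :
    R.lin (Affine.el B x n) = R.op n x := by
  simp [LoopRep.lin, Affine.el]

@[simp] lemma LoopRep.lin_C (R : LoopRep B c M) : R.lin (Affine.C B) = c • 1 := by
  simp [LoopRep.lin, Affine.C]

lemma LoopRep.isRep (R : LoopRep B c M) : IsRep R.lin := by
  intro a b v
  simp only [LoopRep.lin, LinearMap.coe_mk, AddHom.coe_mk, Affine.bracket_def, LinearMap.add_apply,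
    LinearMap.smul_apply, Module.End.one_apply, map_add, map_smul]
  have key (f h : ℤ →₀ g) : Finsupp.lsum ℂ R.op (Affine.loopBracket f h) v +
      (Affine.cocycle B f h * c) • v = Finsupp.lsum ℂ R.op f (Finsupp.lsum ℂ R.op h v) -
        Finsupp.lsum ℂ R.op h (Finsupp.lsum ℂ R.op f v) := by
    induction f using Finsupp.induction_linear with
    | zero => simp
    | add f₁ f₂ h₁ h₂ =>
      simp only [map_add, LinearMap.add_apply]
      linear_combination (norm := module) h₁ + h₂
    | single m x =>
    induction h using Finsupp.induction_linear with
    | zero => simp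
    | add f₁ f₂ h₁ h₂ =>
      simp only [map_add, LinearMap.add_apply]
      linear_combination (norm := module) h₁ + h₂
    | single n y =>
      rw [Affine.loopBracket_single, Affine.cocycle_single, Finsupp.lsum_single,
        Finsupp.lsum_single, Finsupp.lsum_single, R.comm m n]
      module
  rw [key]
  module

/-- The action of the Virasoro algebra defined by a representation. -/
def VirRep.lin (R : VirRep c M) : Virasoro →ₗ[ℂ] Module.End ℂ M where
  toFun a := Finsupp.linearCombination ℂ R.op a.field + (a.central * c) • 1
  map_add' a b := by simp only [Virasoro.add_field, Virasoro.add_central, map_add]; module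
  map_smul' r a := by
    simp only [Virasoro.smul_field, Virasoro.smul_central, map_smul, RingHom.id_apply, smul_eq_mul]
    module

@[simp] lemma VirRep.lin_L (R : VirRep c M) (n : ℤ) : R.lin (Virasoro.L n) = R.op n := by
  simp [VirRep.lin, Virasoro.L]

@[simp] lemma VirRep.lin_C (R : VirRep c M) : R.lin Virasoro.C = c • 1 := by
  simp [VirRep.lin, Virasoro.C]

lemma VirRep.isRep (R : VirRep c M) : IsRep R.lin := by
  intro a b v
  simp only [VirRep.lin, LinearMap.coe_mk, AddHom.coe_mk, Virasoro.bracket_def,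
    LinearMap.add_apply, LinearMap.smul_apply, Module.End.one_apply, map_add, map_smul]
  have key (f h : ℤ →₀ ℂ) : Finsupp.linearCombination ℂ R.op (Virasoro.wittBracket f h) v +
      (Virasoro.cocycle f h * c) • v =
        Finsupp.linearCombination ℂ R.op f (Finsupp.linearCombination ℂ R.op h v) -
        Finsupp.linearCombination ℂ R.op h (Finsupp.linearCombination ℂ R.op f v) := by
    induction f using Finsupp.induction_linear with
    | zero => simp
    | add f₁ f₂ h₁ h₂ =>
      simp only [map_add, LinearMap.add_apply]
      linear_combination (norm := module) h₁ + h₂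
    | single m x =>
    induction h using Finsupp.induction_linear with
    | zero => simp
    | add f₁ f₂ h₁ h₂ =>
      simp only [map_add, LinearMap.add_apply]
      linear_combination (norm := module) h₁ + h₂
    | single n y =>
      rw [Virasoro.wittBracket_single, Virasoro.cocycle_single]
      simp only [Finsupp.linearCombination_single, LinearMap.smul_apply, map_smul]
      rw [R.comm m n]
      module
  rw [key]
  module

/-- The action of `f̄` defined by a representation. -/
def FBarRep.lin (R : FBarRep B B' c₁ c₂ c M) : FBar B B' →ₗ[ℂ] Module.End ℂ M where
  toFun a := R.fst.lin a.left.1 + R.snd.lin a.left.2 + R.vir.lin a.right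
  map_add' a b := by
    simp only [LieAlgebra.SemiDirectSum.add_eq_mk, Prod.fst_add, Prod.snd_add, map_add]
    abel
  map_smul' r a := by
    simp only [LieAlgebra.SemiDirectSum.smul_eq_mk, Prod.smul_fst, Prod.smul_snd, map_smul,
      RingHom.id_apply, smul_add]

@[simp] lemma FBarRep.lin_ofFst (R : FBarRep B B' c₁ c₂ c M) (a : Affine B) :
    R.lin (FBar.ofFst B B' a) = R.fst.lin a := by
  simp [FBarRep.lin, FBar.ofFst]

@[simp] lemma FBarRep.lin_ofSnd (R : FBarRep B B' c₁ c₂ c M) (a : Affine B') :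
    R.lin (FBar.ofSnd B B' a) = R.snd.lin a := by
  simp [FBarRep.lin, FBar.ofSnd]

@[simp] lemma FBarRep.lin_ofVir (R : FBarRep B B' c₁ c₂ c M) (u : Virasoro) :
    R.lin (FBar.ofVir B B' u) = R.vir.lin u := by
  simp [FBarRep.lin, FBar.ofVir]

lemma lin_vectorField (R : LoopRep B c M) (Q : VirRep c₁ M)
    (h : ∀ m n x v, Q.op m (R.op n x v) = R.op n x (Q.op m v) - (n : ℂ) • R.op (n + m) x v)
    (u : Virasoro) (a : Affine B) (v : M) :
    R.lin ⟨Affine.vectorField u.field a.loop, 0⟩ v = Q.lin u (R.lin a v) - R.lin a (Q.lin u v) := by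
  simp only [VirRep.lin, LoopRep.lin, LinearMap.coe_mk, AddHom.coe_mk,
    LinearMap.add_apply, LinearMap.smul_apply, Module.End.one_apply, map_add, map_smul]
  have key (f : ℤ →₀ ℂ) (h : ℤ →₀ g) : Finsupp.lsum ℂ R.op (Affine.vectorField f h) v =
        Finsupp.linearCombination ℂ Q.op f (Finsupp.lsum ℂ R.op h v) -
        Finsupp.lsum ℂ R.op h (Finsupp.linearCombination ℂ Q.op f v) := by
    induction f using Finsupp.induction_linear with
    | zero => simp
    | add f₁ f₂ h₁ h₂ =>
      simp only [map_add, LinearMap.add_apply]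
      linear_combination (norm := module) h₁ + h₂
    | single m x =>
    induction h using Finsupp.induction_linear with
    | zero => simp
    | add f₁ f₂ h₁ h₂ =>
      simp only [map_add, LinearMap.add_apply]
      linear_combination (norm := module) h₁ + h₂
    | single n y =>
      rw [Affine.vectorField_single]
      simp only [Finsupp.linearCombination_single, Finsupp.lsum_single, LinearMap.smul_apply,
        map_smul]
      rw [h m n, add_comm m n]
      module
  rw [key]
  module

lemma FBarRep.isRep (R : FBarRep B B' c₁ c₂ c M) : IsRep R.lin := by
  intro a b v
  have h12 (x : Affine B) (y : Affine B') (v : M) :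
      R.fst.lin x (R.snd.lin y v) = R.snd.lin y (R.fst.lin x v) := by
    simp only [LoopRep.lin, LinearMap.coe_mk, AddHom.coe_mk,
      LinearMap.add_apply, LinearMap.smul_apply, Module.End.one_apply, map_add, map_smul]
    have key (f : ℤ →₀ g) (h : ℤ →₀ s) :
        Finsupp.lsum ℂ R.fst.op f (Finsupp.lsum ℂ R.snd.op h v) =
        Finsupp.lsum ℂ R.snd.op h (Finsupp.lsum ℂ R.fst.op f v) := by
      induction f using Finsupp.induction_linear with
      | zero => simp
      | add f₁ f₂ h₁ h₂ => simp only [map_add, LinearMap.add_apply, h₁, h₂]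
      | single m x =>
      induction h using Finsupp.induction_linear with
      | zero => simp
      | add f₁ f₂ h₁ h₂ => simp only [map_add, LinearMap.add_apply, h₁, h₂]
      | single n y =>
        rw [Finsupp.lsum_single, Finsupp.lsum_single, R.fst_snd]
    rw [key]
    module
  have h1 := lin_vectorField R.fst R.vir R.vir_fst
  have h2 := lin_vectorField R.snd R.vir R.vir_snd
  rw [LieAlgebra.SemiDirectSum.lie_eq_mk]
  simp only [FBarRep.lin, LinearMap.coe_mk, AddHom.coe_mk, LinearMap.add_apply,
    virasoroAction_apply, Prod.fst_sub, Prod.fst_add, Prod.snd_sub, Prod.snd_add, map_add, map_sub,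
    LinearMap.sub_apply, h1, h2, show ⁅a.left, b.left⁆.1 = ⁅a.left.1, b.left.1⁆ from rfl,
    show ⁅a.left, b.left⁆.2 = ⁅a.left.2, b.left.2⁆ from rfl, R.fst.isRep a.left.1 b.left.1 v,
    R.snd.isRep a.left.2 b.left.2 v, R.vir.isRep a.right b.right v]
  rw [h12, ← h12 b.left.1]
  abel

end Linearize

/-! ### Gradings -/

section Grading

variable {g s : Type*} [LieRing g] [LieAlgebra ℂ g] [LieRing s] [LieAlgebra ℂ s]
  (B : InvForm g) (B' : InvForm s) {c₁ c₂ c : ℂ}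

lemma Affine.centralGrading : CentralGrading (fun n => LinearMap.range (Affine.elMap B n))
    (Submodule.span ℂ {Affine.C B}) where
  central z hz x := by
    obtain ⟨r, rfl⟩ := Submodule.mem_span_singleton.1 hz
    rw [smul_lie, Affine.lie_C, smul_zero]
  lie_mem m n h := by
    rintro _ ⟨x, rfl⟩ _ ⟨y, rfl⟩
    refine ⟨⁅x, y⁆, ?_⟩
    rw [Affine.elMap_apply, Affine.elMap_apply, Affine.elMap_apply, Affine.lie_el_el,
      if_neg (by omega), zero_mul, zero_smul, add_zero]
  span := Affine.span_eq_top

lemma Virasoro.centralGrading : CentralGrading (fun n => Submodule.span ℂ {Virasoro.L n})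
    (Submodule.span ℂ {Virasoro.C}) where
  central z hz x := by
    obtain ⟨r, rfl⟩ := Submodule.mem_span_singleton.1 hz
    rw [smul_lie, Virasoro.lie_C, smul_zero]
  lie_mem m n h x hx y hy := by
    obtain ⟨r, rfl⟩ := Submodule.mem_span_singleton.1 hx
    obtain ⟨t, rfl⟩ := Submodule.mem_span_singleton.1 hy
    rw [smul_lie, lie_smul, Virasoro.lie_L_L, if_neg (by omega), zero_smul, add_zero]
    exact Submodule.smul_mem _ _ (Submodule.smul_mem _ _ (Submodule.smul_mem _ _
      (Submodule.mem_span_singleton_self _)))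
  span := Virasoro.span_eq_top

namespace FBar

variable {B B'}

lemma lie_fst_fst (a b : Affine B) : ⁅ofFst B B' a, ofFst B B' b⁆ = ofFst B B' ⁅a, b⁆ := by
  simp only [ofFst]
  rw [← LieHom.map_lie]
  congr 1

lemma lie_snd_snd (a b : Affine B') : ⁅ofSnd B B' a, ofSnd B B' b⁆ = ofSnd B B' ⁅a, b⁆ := by
  simp only [ofSnd]
  rw [← LieHom.map_lie]
  congr 1

lemma lie_fst_snd (a : Affine B) (b : Affine B') : ⁅ofFst B B' a, ofSnd B B' b⁆ = 0 := by
  simp only [ofFst, ofSnd]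
  rw [← LieHom.map_lie, show ⁅((a, 0) : Affine B × Affine B'), ((0, b) : Affine B × Affine B')⁆ = 0
    from ?_, map_zero]
  change (⁅a, (0 : Affine B)⁆, ⁅(0 : Affine B'), b⁆) = _
  rw [lie_zero, zero_lie]
  rfl

lemma lie_vir_vir (u v : Virasoro) : ⁅ofVir B B' u, ofVir B B' v⁆ = ofVir B B' ⁅u, v⁆ := by
  simp only [ofVir]
  rw [← LieHom.map_lie]

lemma lie_vir_snd (u : Virasoro) (a : Affine B') :
    ⁅ofVir B B' u, ofSnd B B' a⁆ = ofSnd B B' ⟨Affine.vectorField u.field a.loop, 0⟩ := by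
  rw [ofVir, ofSnd, ofSnd, LieAlgebra.SemiDirectSum.lie_eq_mk]
  refine LieAlgebra.SemiDirectSum.ext ?_ ?_
  · change ⁅(0 : Affine B × Affine B'), (0, a)⁆ + virasoroAction B B' u (0, a) -
      virasoroAction B B' 0 0 = (0, _)
    rw [zero_lie, map_zero, sub_zero, zero_add, virasoroAction_apply]
    rw [show (Affine.loop (0 : Affine B)) = 0 from rfl, map_zero]
    rfl
  · exact lie_zero _

lemma lie_L_snd (m n : ℤ) (x : s) :
    ⁅ofVir B B' (.L m), ofSnd B B' (.el B' x n)⁆ = ofSnd B B' (-(n : ℂ) • .el B' x (m + n)) := by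
  rw [lie_vir_snd]
  congr 1
  ext1
  · simp [Virasoro.L, Affine.el, -neg_smul]
  · simp [Affine.el, -neg_smul]

variable (B B')

/-- The inclusion of `ĝ` as a linear map. -/
def fstMap : Affine B →ₗ[ℂ] FBar B B' where
  toFun := ofFst B B'
  map_add' a b := by simp only [ofFst, ← map_add, Prod.mk_add_mk, add_zero]
  map_smul' r a := by simp only [ofFst, ← map_smul, Prod.smul_mk, smul_zero, RingHom.id_apply]

/-- The inclusion of `ŝ` as a linear map. -/
def sndMap : Affine B' →ₗ[ℂ] FBar B B' where
  toFun := ofSnd B B'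
  map_add' a b := by simp only [ofSnd, ← map_add, Prod.mk_add_mk, add_zero]
  map_smul' r a := by simp only [ofSnd, ← map_smul, Prod.smul_mk, smul_zero, RingHom.id_apply]

/-- The inclusion of the Virasoro algebra as a linear map. -/
def virMap : Virasoro →ₗ[ℂ] FBar B B' where
  toFun := ofVir B B'
  map_add' a b := by simp only [ofVir, ← map_add]
  map_smul' r a := by simp only [ofVir, ← map_smul, RingHom.id_apply]

variable {B B'}

@[simp] lemma fstMap_apply (a : Affine B) : fstMap B B' a = ofFst B B' a := rfl
@[simp] lemma sndMap_apply (a : Affine B') : sndMap B B' a = ofSnd B B' a := rfl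
@[simp] lemma virMap_apply (a : Virasoro) : virMap B B' a = ofVir B B' a := rfl

lemma eq_sum (x : FBar B B') :
    x = ofFst B B' x.left.1 + ofSnd B B' x.left.2 + ofVir B B' x.right := by
  simp only [ofFst, ofSnd, ofVir]
  refine LieAlgebra.SemiDirectSum.ext ?_ ?_ <;> simp

lemma lie_fst_C (x : FBar B B') : ⁅ofFst B B' (.C B), x⁆ = 0 := by
  rw [eq_sum x, lie_add, lie_add, lie_fst_fst, lie_fst_snd,
    ← lie_skew _ (ofVir B B' _), lie_vir_fst, Affine.lie_C]
  simp only [Affine.C, map_zero]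
  rw [show (⟨0, 0⟩ : Affine B) = 0 from rfl, ← fstMap_apply, map_zero]
  abel

lemma lie_snd_C (x : FBar B B') : ⁅ofSnd B B' (.C B'), x⁆ = 0 := by
  rw [eq_sum x, lie_add, lie_add, lie_snd_snd, ← lie_skew _ (ofFst B B' _), lie_fst_snd,
    ← lie_skew _ (ofVir B B' _), lie_vir_snd, Affine.lie_C]
  simp only [Affine.C, map_zero]
  rw [show (⟨0, 0⟩ : Affine B') = 0 from rfl, ← sndMap_apply, map_zero]
  abel

lemma lie_vir_C (x : FBar B B') : ⁅ofVir B B' .C, x⁆ = 0 := by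
  rw [eq_sum x, lie_add, lie_add, lie_vir_fst, lie_vir_snd, lie_vir_vir, Virasoro.lie_C]
  simp only [Virasoro.C, map_zero, LinearMap.zero_apply]
  rw [show (⟨0, 0⟩ : Affine B') = 0 from rfl, ← sndMap_apply, map_zero,
    show (⟨0, 0⟩ : Affine B) = 0 from rfl, ← fstMap_apply, map_zero, ← virMap_apply, map_zero]
  abel

variable (B B') in
/-- The elements `x(n) + y(n) + r L(n)` of degree `n`. -/
def degMap (n : ℤ) : (g × s) × ℂ →ₗ[ℂ] FBar B B' :=
  ((fstMap B B' ∘ₗ Affine.elMap B n).coprod (sndMap B B' ∘ₗ Affine.elMap B' n)).coprod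
    (virMap B B' ∘ₗ LinearMap.toSpanSingleton ℂ _ (Virasoro.L n))

lemma degMap_apply (n : ℤ) (p : (g × s) × ℂ) : degMap B B' n p =
    ofFst B B' (.el B p.1.1 n) + ofSnd B B' (.el B' p.1.2 n) + p.2 • ofVir B B' (.L n) := by
  simp [degMap, ← virMap_apply]

lemma fst_mem (n : ℤ) (x : g) : ofFst B B' (.el B x n) ∈ LinearMap.range (degMap B B' n) :=
  ⟨((x, 0), 0), by
    rw [degMap_apply]
    simp only [← Affine.elMap_apply, map_zero, zero_smul, ← sndMap_apply, add_zero]⟩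

lemma snd_mem (n : ℤ) (x : s) : ofSnd B B' (.el B' x n) ∈ LinearMap.range (degMap B B' n) :=
  ⟨((0, x), 0), by
    rw [degMap_apply]
    simp only [← Affine.elMap_apply, map_zero, zero_smul, ← fstMap_apply, add_zero, zero_add]⟩

lemma vir_mem (n : ℤ) : ofVir B B' (.L n) ∈ LinearMap.range (degMap B B' n) :=
  ⟨((0, 0), 1), by
    rw [degMap_apply]
    simp only [← Affine.elMap_apply, map_zero, one_smul, ← fstMap_apply, ← sndMap_apply, zero_add]⟩

lemma lie_fst_L (m n : ℤ) (x : g) :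
    ⁅ofFst B B' (.el B x m), ofVir B B' (.L n)⁆ = (m : ℂ) • ofFst B B' (.el B x (m + n)) := by
  rw [← lie_skew, lie_L_el, ← fstMap_apply, map_smul, fstMap_apply, add_comm n m]
  module

lemma lie_snd_L (m n : ℤ) (x : s) :
    ⁅ofSnd B B' (.el B' x m), ofVir B B' (.L n)⁆ = (m : ℂ) • ofSnd B B' (.el B' x (m + n)) := by
  rw [← lie_skew, lie_L_snd, ← sndMap_apply, map_smul, sndMap_apply, add_comm n m]
  module

lemma lie_snd_fst (a : Affine B') (b : Affine B) : ⁅ofSnd B B' a, ofFst B B' b⁆ = 0 := by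
  rw [← lie_skew, lie_fst_snd, neg_zero]

/-- The condition m + n ≠ 0 makes all three cocycles vanish. -/
lemma lie_degMap (m n : ℤ) (h : m + n ≠ 0) (p q : (g × s) × ℂ) :
    ⁅degMap B B' m p, degMap B B' n q⁆ = degMap B B' (m + n)
      ((⁅p.1.1, q.1.1⁆ + (m * q.2) • p.1.1 - (n * p.2) • q.1.1,
        ⁅p.1.2, q.1.2⁆ + (m * q.2) • p.1.2 - (n * p.2) • q.1.2), p.2 * q.2 * (m - n)) := by
  rw [degMap_apply, degMap_apply, degMap_apply]
  generalize p.1.1 = x, p.1.2 = y, p.2 = r, q.1.1 = x', q.1.2 = y', q.2 = r'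
  simp only [add_lie, lie_add, smul_lie, lie_smul, lie_fst_fst, lie_fst_snd, lie_snd_snd,
    lie_snd_fst, lie_fst_L, lie_snd_L, lie_vir_vir, lie_L_el, lie_L_snd]
  rw [Affine.lie_el_el, Affine.lie_el_el, Virasoro.lie_L_L, if_neg (by omega), if_neg (by omega)]
  simp only [← fstMap_apply, ← sndMap_apply, ← virMap_apply, ← Affine.elMap_apply, map_smul,
    map_add, map_sub, zero_mul, zero_smul, add_zero]
  module

variable (B B') in
lemma span_degMap : (⨆ n, LinearMap.range (degMap B B' n)) ⊔
    Submodule.span ℂ {ofFst B B' (.C B), ofSnd B B' (.C B'), ofVir B B' .C} = ⊤ := by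
  refine eq_top_iff.2 fun x _ => ?_
  rw [eq_sum x]
  have hD (n : ℤ) := (le_iSup (fun n => LinearMap.range (degMap B B' n)) n).trans
    (le_sup_left (b := Submodule.span ℂ {ofFst B B' (.C B), ofSnd B B' (.C B'), ofVir B B' .C}))
  have hZ := Submodule.span_le.1 (le_sup_right (a := ⨆ n, LinearMap.range (degMap B B' n))
    (b := Submodule.span ℂ {ofFst B B' (.C B), ofSnd B B' (.C B'), ofVir B B' .C}))
  generalize (⨆ n, LinearMap.range (degMap B B' n)) ⊔
    Submodule.span ℂ {ofFst B B' (.C B), ofSnd B B' (.C B'), ofVir B B' .C} = N at hD hZ ⊢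
  have h1 : (⊤ : Submodule ℂ (Affine B)) ≤ N.comap (fstMap B B') := by
    rw [← Affine.span_eq_top, sup_le_iff, iSup_le_iff, Submodule.span_singleton_le_iff_mem]
    refine ⟨fun n => ?_, hZ (by simp)⟩
    rintro _ ⟨x, rfl⟩
    exact hD n (fst_mem n x)
  have h2 : (⊤ : Submodule ℂ (Affine B')) ≤ N.comap (sndMap B B') := by
    rw [← Affine.span_eq_top, sup_le_iff, iSup_le_iff, Submodule.span_singleton_le_iff_mem]
    refine ⟨fun n => ?_, hZ (by simp)⟩
    rintro _ ⟨x, rfl⟩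
    exact hD n (snd_mem n x)
  have h3 : (⊤ : Submodule ℂ Virasoro) ≤ N.comap (virMap B B') := by
    rw [← Virasoro.span_eq_top, sup_le_iff, iSup_le_iff, Submodule.span_singleton_le_iff_mem]
    refine ⟨fun n => ?_, hZ (by simp)⟩
    rw [Submodule.span_singleton_le_iff_mem]
    exact hD n (vir_mem n)
  exact N.add_mem (N.add_mem (h1 trivial) (h2 trivial)) (h3 trivial)

lemma lie_of_mem_span {z : FBar B B'}
    (hz : z ∈ Submodule.span ℂ {ofFst B B' (.C B), ofSnd B B' (.C B'), ofVir B B' .C})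
    (x : FBar B B') : ⁅z, x⁆ = 0 := by
  induction hz using Submodule.span_induction with
  | zero => exact zero_lie x
  | add y z _ _ hy hz => rw [add_lie, hy, hz, add_zero]
  | smul r y _ hy => rw [smul_lie, hy, smul_zero]
  | mem y hy =>
    rcases hy with rfl | rfl | rfl
    · exact lie_fst_C x
    · exact lie_snd_C x
    · exact lie_vir_C x

variable (B B') in
lemma centralGrading : CentralGrading (fun n => LinearMap.range (degMap B B' n))
    (Submodule.span ℂ {ofFst B B' (.C B), ofSnd B B' (.C B'), ofVir B B' .C}) where
  central z hz x := lie_of_mem_span hz x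
  lie_mem m n h := by
    rintro _ ⟨p, rfl⟩ _ ⟨q, rfl⟩
    exact ⟨_, (lie_degMap m n h p q).symm⟩
  span := span_degMap B B'

end FBar

end Grading

/-! ### Representations from modules over enveloping algebras -/

section OfModule

variable {g s : Type*} [LieRing g] [LieAlgebra ℂ g] [LieRing s] [LieAlgebra ℂ s]
  {B : InvForm g} {B' : InvForm s} {c₁ c₂ c : ℂ} {M : Type*} [AddCommGroup M] [Module ℂ M]

/-- A module over the enveloping algebra of `ĝ` as a representation. -/
def LoopRep.ofModule [Module (UniversalEnvelopingAlgebra ℂ (Affine B)) M]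
    [IsScalarTower ℂ (UniversalEnvelopingAlgebra ℂ (Affine B)) M]
    (hC : ∀ v : M, act (Affine.C B) v = c • v)
    (hM : ∀ v : M, ∃ k : ℤ, ∀ n ≥ k, ∀ a ∈ LinearMap.range (Affine.elMap B n), act a v = 0) :
    LoopRep B c M where
  op n := actRep (Affine B) M ∘ₗ Affine.elMap B n
  comm m n x y v := by
    simp only [LinearMap.comp_apply, Affine.elMap_apply, actRep_apply]
    have h := act_lie (Affine.el B x m) (Affine.el B y n) v
    rw [Affine.lie_el_el, ← actRep_apply, map_add, map_smul] at h
    simp only [actRep_apply, LinearMap.add_apply, LinearMap.smul_apply, hC] at h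
    rw [eq_add_of_sub_eq h.symm, smul_smul]
    abel
  smooth v := by
    obtain ⟨k, hk⟩ := hM v
    exact ⟨k, fun n hn x => hk n hn _ ⟨x, rfl⟩⟩

/-- A module over the enveloping algebra of the Virasoro algebra as a representation. -/
def VirRep.ofModule [Module (UniversalEnvelopingAlgebra ℂ Virasoro) M]
    [IsScalarTower ℂ (UniversalEnvelopingAlgebra ℂ Virasoro) M]
    (hC : ∀ v : M, act Virasoro.C v = c • v) : VirRep c M where
  op n := act (Virasoro.L n)
  comm m n v := by
    have h := act_lie (Virasoro.L m) (Virasoro.L n) v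
    rw [Virasoro.lie_L_L, ← actRep_apply, map_add, map_smul, map_smul] at h
    simp only [actRep_apply, LinearMap.add_apply, LinearMap.smul_apply, hC] at h
    rw [eq_add_of_sub_eq h.symm, smul_smul]
    abel

/-- A module over the enveloping algebra of `f̄` as a representation. -/
def FBarRep.ofModule [Module (UniversalEnvelopingAlgebra ℂ (FBar B B')) M]
    [IsScalarTower ℂ (UniversalEnvelopingAlgebra ℂ (FBar B B')) M]
    (h₁ : ∀ v : M, act (FBar.ofFst B B' (.C B)) v = c₁ • v)
    (h₂ : ∀ v : M, act (FBar.ofSnd B B' (.C B')) v = c₂ • v)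
    (h₃ : ∀ v : M, act (FBar.ofVir B B' .C) v = c • v)
    (hM : ∀ v : M, ∃ k : ℤ, ∀ n ≥ k, ∀ a ∈ LinearMap.range (FBar.degMap B B' n), act a v = 0) :
    FBarRep B B' c₁ c₂ c M where
  fst :=
    { op n := actRep (FBar B B') M ∘ₗ FBar.fstMap B B' ∘ₗ Affine.elMap B n
      comm m n x y v := by
        simp only [LinearMap.comp_apply, Affine.elMap_apply, FBar.fstMap_apply, actRep_apply]
        have h := act_lie (FBar.ofFst B B' (.el B x m)) (FBar.ofFst B B' (.el B y n)) v
        rw [FBar.lie_fst_fst, Affine.lie_el_el, ← actRep_apply, ← FBar.fstMap_apply, map_add,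
          map_add, map_smul, map_smul] at h
        simp only [actRep_apply, FBar.fstMap_apply, LinearMap.add_apply, LinearMap.smul_apply,
          h₁] at h
        rw [eq_add_of_sub_eq h.symm, smul_smul]
        abel
      smooth v := by
        obtain ⟨k, hk⟩ := hM v
        exact ⟨k, fun n hn x => hk n hn _ (FBar.fst_mem n x)⟩ }
  snd :=
    { op n := actRep (FBar B B') M ∘ₗ FBar.sndMap B B' ∘ₗ Affine.elMap B' n
      comm m n x y v := by
        simp only [LinearMap.comp_apply, Affine.elMap_apply, FBar.sndMap_apply, actRep_apply]
        have h := act_lie (FBar.ofSnd B B' (.el B' x m)) (FBar.ofSnd B B' (.el B' y n)) v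
        rw [FBar.lie_snd_snd, Affine.lie_el_el, ← actRep_apply, ← FBar.sndMap_apply, map_add,
          map_add, map_smul, map_smul] at h
        simp only [actRep_apply, FBar.sndMap_apply, LinearMap.add_apply, LinearMap.smul_apply,
          h₂] at h
        rw [eq_add_of_sub_eq h.symm, smul_smul]
        abel
      smooth v := by
        obtain ⟨k, hk⟩ := hM v
        exact ⟨k, fun n hn x => hk n hn _ (FBar.snd_mem n x)⟩ }
  vir :=
    { op n := act (FBar.ofVir B B' (.L n))
      comm m n v := by
        have h := act_lie (FBar.ofVir B B' (.L m)) (FBar.ofVir B B' (.L n)) v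
        rw [FBar.lie_vir_vir, Virasoro.lie_L_L, ← actRep_apply, ← FBar.virMap_apply, map_add,
          map_add, map_smul, map_smul, map_smul, map_smul] at h
        simp only [actRep_apply, FBar.virMap_apply, LinearMap.add_apply, LinearMap.smul_apply,
          h₃] at h
        rw [eq_add_of_sub_eq h.symm, smul_smul]
        abel }
  fst_snd m n x y v := by
    have h := act_lie (FBar.ofFst B B' (.el B x m)) (FBar.ofSnd B B' (.el B' y n)) v
    rw [FBar.lie_fst_snd, ← actRep_apply, map_zero, LinearMap.zero_apply, eq_comm, sub_eq_zero] at h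
    exact h
  vir_fst m n x v := by
    have h := act_lie (FBar.ofVir B B' (.L m)) (FBar.ofFst B B' (.el B x n)) v
    rw [FBar.lie_L_el, ← actRep_apply, ← FBar.fstMap_apply, map_smul, map_smul] at h
    change act (FBar.ofVir B B' (.L m)) (act (FBar.ofFst B B' (.el B x n)) v) =
      act (FBar.ofFst B B' (.el B x n)) (act (FBar.ofVir B B' (.L m)) v) -
        (n : ℂ) • act (FBar.ofFst B B' (.el B x (n + m))) v
    rw [eq_add_of_sub_eq h.symm, add_comm n m]
    simp only [actRep_apply, FBar.fstMap_apply, LinearMap.smul_apply]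
    module
  vir_snd m n x v := by
    have h := act_lie (FBar.ofVir B B' (.L m)) (FBar.ofSnd B B' (.el B' x n)) v
    rw [FBar.lie_L_snd, ← actRep_apply, ← FBar.sndMap_apply, map_smul, map_smul] at h
    change act (FBar.ofVir B B' (.L m)) (act (FBar.ofSnd B B' (.el B' x n)) v) =
      act (FBar.ofSnd B B' (.el B' x n)) (act (FBar.ofVir B B' (.L m)) v) -
        (n : ℂ) • act (FBar.ofSnd B B' (.el B' x (n + m))) v
    rw [eq_add_of_sub_eq h.symm, add_comm n m]
    simp only [actRep_apply, FBar.sndMap_apply, LinearMap.smul_apply]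
    module

/-- The two definitions differ in the order of the sums over i and j, which finite support in j
allows to exchange. -/
lemma sugawara_eq_sug [FiniteDimensional ℂ g] [Module (UniversalEnvelopingAlgebra ℂ (Affine B)) M]
    [IsScalarTower ℂ (UniversalEnvelopingAlgebra ℂ (Affine B)) M] (R : LoopRep B c M)
    (hR : ∀ n x v, R.op n x v = act (Affine.el B x n) v) (k : ℂ) (n : ℤ) (v : M) :
    sugawara B c k n v = R.sug k n v := by
  rw [sugawara, LoopRep.sug_apply, ← finsum_sum_comm]
  · congr 1
    refine finsum_congr fun j => ?_
    simp only [LoopRep.normal, LinearMap.sum_apply]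
    refine Finset.sum_congr rfl fun i _ => ?_
    split_ifs <;> simp [hR]
  · intro i _
    obtain ⟨k, hk⟩ := R.smooth v
    refine hasFiniteSupport_of_bounds (a := min 0 (n - k)) (b := max 0 k) (fun j hj => ?_)
      (fun j hj => ?_)
    · rw [if_pos (by omega), ← hR (n - j), hk (n - j) (by omega), map_zero]
    · rw [if_neg (by omega), ← hR j, hk j (by omega), map_zero]

end OfModule

end

end TorVOA


namespace TorVOA

noncomputable section

/-! ### Vacuum modules as vertex operator algebras -/

section Commutator

variable {V : Type*} [AddCommGroup V] [Module ℂ V]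

/-- Fields whose commutator is `[A(m), C(n)] = ∑_{i ≤ 3} mⁱ Eᵢ(m + n)` are mutually local. -/
lemma IsLocal.of_commutator {A C : ℤ → Module.End ℂ V} (E : Fin 4 → ℤ → V → V)
    (h : ∀ m n v, A m (C n v) - C n (A m v) = E 0 (m + n) v + (m : ℂ) • E 1 (m + n) v +
      (m : ℂ) ^ 2 • E 2 (m + n) v + (m : ℂ) ^ 3 • E 3 (m + n) v) : IsLocal A C := by
  -- The total index is the same in all terms of the sum, so this is a fourth difference of a cubic
  -- polynomial in the first index.
  refine ⟨4, isLocalAt_iff.2 fun m n v => ?_⟩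
  simp only [h, Finset.sum_range_succ, Finset.sum_range_zero]
  simp only [Nat.cast_ofNat, Nat.cast_zero, Nat.cast_one, sub_zero, add_zero,
    show m + 4 + n = n + m + 4 by ring, show m + 4 - 1 + (n + 1) = n + m + 4 by ring,
    show m + 4 - 2 + (n + 2) = n + m + 4 by ring, show m + 4 - 3 + (n + 3) = n + m + 4 by ring,
    show m + 4 - 4 + (n + 4) = n + m + 4 by ring]
  generalize E 0 (n + m + 4) v = e₀, E 1 (n + m + 4) v = e₁, E 2 (n + m + 4) v = e₂,
    E 3 (n + m + 4) v = e₃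
  norm_num [Nat.choose]
  module

variable {g s : Type*} [LieRing g] [LieAlgebra ℂ g] [LieRing s] [LieAlgebra ℂ s]
  {B : InvForm g} {B' : InvForm s} {c c₁ c₂ : ℂ}

lemma LoopRep.isField (R : LoopRep B c V) (x : g) : IsField fun n => R.op n x := fun v =>
  (R.smooth v).imp fun _ hk n hn => hk n hn x

lemma LoopRep.isLocal (R : LoopRep B c V) (x y : g) :
    IsLocal (fun n => R.op n x) (fun n => R.op n y) := by
  refine IsLocal.of_commutator ![fun n v => R.op n ⁅x, y⁆ v,
    fun n v => (if n = 0 then B.form x y * c else 0) • v, 0, 0] fun m n v => ?_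
  rw [R.comm m n]
  by_cases h : m = -n
  · subst h
    simp
    module
  · simp [h, show ¬ m + n = 0 by omega]

/-- The field index is shifted by one, so the bracket is taken at m - 1 and n - 1. The coefficients
come from (m-1)³ - (m-1) = m³ - 3m² + 2m and m - n = 2m - (m+n). -/
lemma VirRep.isLocal (R : VirRep c V) :
    IsLocal (fun n => R.op (n - 1)) (fun n => R.op (n - 1)) := by
  refine IsLocal.of_commutator ![fun n v => -(n : ℂ) • R.op (n - 2) v, fun n v => (2 : ℂ) • R.op (n - 2) v +
      (if n = 2 then (2 / 12 * c) else 0) • v,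
    fun n v => (if n = 2 then (-3 / 12 * c) else 0) • v,
    fun n v => (if n = 2 then (1 / 12 * c) else 0) • v] fun m n v => ?_
  rw [R.comm (m - 1) (n - 1), show m - 1 + (n - 1) = m + n - 2 by ring]
  by_cases h : m + n = 2
  · rw [if_pos (by omega)]
    simp [h]
    obtain rfl : n = 2 - m := by omega
    push_cast
    module
  · rw [if_neg (by omega)]
    simp [h]
    module

/-- With the total index fixed, the coefficient -n = m - (m+n) is linear in m, so
`IsLocal.of_commutator` applies. -/
lemma isLocal_of_primary {A : ℤ → Module.End ℂ V} {L : ℤ → Module.End ℂ V}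
    (h : ∀ m n v, L m (A n v) = A n (L m v) - (n : ℂ) • A (n + m) v) :
    IsLocal (fun n => L (n - 1)) A := by
  refine IsLocal.of_commutator ![fun n v => -(n : ℂ) • A (n - 1) v, fun n v => A (n - 1) v, 0, 0]
    fun m n v => ?_
  rw [h, show n + (m - 1) = m + n - 1 by ring]
  simp
  module

end Commutator

section Vacuum

variable {L : Type*} [LieRing L] [LieAlgebra ℂ L] {R : L → Module.End ℂ ℂ → Prop}

lemma generates_vac : Generates L {Induced.top R 1} := by
  intro X hT hX
  refine generates_top X ?_ hX
  rintro _ ⟨r, rfl⟩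
  rw [← mul_one r, ← smul_eq_mul, map_smul]
  exact X.smul_mem r (hT rfl)

end Vacuum

lemma act_mem_span {M : Type*} [AddCommGroup M] [Module ℂ M] {L : Type*} [LieRing L] [LieAlgebra ℂ L]
    [Module (UniversalEnvelopingAlgebra ℂ L) M] [IsScalarTower ℂ (UniversalEnvelopingAlgebra ℂ L) M]
    {p : L} {v : M} (h : act p v ∈ Submodule.span ℂ {v}) (t) (ht : t ∈ Submodule.span ℂ {v}) :
    act p t ∈ Submodule.span ℂ {v} := by
  obtain ⟨r, rfl⟩ := Submodule.mem_span_singleton.1 ht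
  rw [map_smul]
  exact Submodule.smul_mem _ _ h

/-! ### The Virasoro vertex operator algebra. -/

section Virasoro

variable {c : ℂ}

lemma VVir.top_central :
    act Virasoro.C (Induced.top (VirVacRel c) 1) = c • Induced.top (VirVacRel c) 1 := by
  rw [act_top VirVacRel.central, ← topMap_apply, ← topMap_apply, ← map_smul]
  rfl

/-- The action of the Virasoro algebra on its vacuum module. -/
def VVir.rep (c : ℂ) : VirRep c (VVir c) :=
  VirRep.ofModule fun v => generates_vac.central Virasoro.lie_C (by
    rintro _ rfl
    exact VVir.top_central) v

lemma VVir.rep_op (n : ℤ) : (VVir.rep c).op n = act (Virasoro.L n) := rfl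

lemma VVir.rep_vac {n : ℤ} (hn : -1 ≤ n) :
    (VVir.rep c).op n (Induced.top (VirVacRel c) 1) = 0 := by
  rw [VVir.rep_op, act_top (VirVacRel.nonneg n hn), ← topMap_apply, LinearMap.zero_apply, map_zero]

lemma VVir.isField : IsField fun n => (VVir.rep c).op (n - 1) := fun v => by
  obtain ⟨k, hk⟩ := Virasoro.centralGrading.smooth (generates_vac (R := VirVacRel c)) (by
    rintro _ rfl
    refine ⟨-1, fun n hn x hx => ?_⟩
    obtain ⟨r, rfl⟩ := Submodule.mem_span_singleton.1 hx
    rw [← actRep_apply, map_smul, LinearMap.smul_apply, actRep_apply, ← VVir.rep_op,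
      VVir.rep_vac hn, smul_zero]) v
  exact ⟨k + 1, fun n hn => hk _ (by omega) _ (Submodule.mem_span_singleton_self _)⟩

/-- The cocycle (m³ - m)/12 vanishes at m = -1, so no central term appears. -/
lemma VirRep.translation {M : Type*} [AddCommGroup M] [Module ℂ M] (R : VirRep c M) (n : ℤ) (v : M) :
    R.op (-1) (R.op (n - 1) v) = R.op (n - 1) (R.op (-1) v) - (n : ℂ) • R.op (n - 1 - 1) v := by
  rw [R.comm (-1) (n - 1), show -1 + (n - 1) = n - 1 - 1 by ring]
  by_cases h : n = 2
  · subst h; norm_num; module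
  · rw [if_neg (by omega)]; push_cast; module

/-- The generating field of the Virasoro vertex operator algebra. -/
def VVir.fields (c : ℂ) : GeneratingFields (VVir c) Unit where
  vac := Induced.top _ 1
  T := (VVir.rep c).op (-1)
  G _ n := (VVir.rep c).op (n - 1)
  T_vac := VVir.rep_vac le_rfl
  isField _ := VVir.isField
  isLocal _ _ := (VVir.rep c).isLocal
  vac_nonneg _ n hn := VVir.rep_vac (by omega)
  translation _ n v := (VVir.rep c).translation n v
  span X h hX := by
    -- The L(n) with n ≥ -1 and the centre preserve the vacuum line. The remaining L(n), n < -1, are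
    -- the negative modes n + 1 of the generating field.
    refine generates_vac.span.eq_top_of_stable
      ((⨆ n : {n : ℤ // -1 ≤ n}, Submodule.span ℂ {Virasoro.L n}) ⊔ Submodule.span ℂ {Virasoro.C})
      {x | ∃ n < -1, x = Virasoro.L n} ?_ ?_ X ((Submodule.span_singleton_le_iff_mem _ _).2 h) ?_
    · rw [eq_top_iff, ← Virasoro.span_eq_top]
      refine sup_le (iSup_le fun n => ?_) (le_sup_right.trans le_sup_left)
      by_cases hn : -1 ≤ n
      · exact (le_iSup (fun n : {n : ℤ // -1 ≤ n} => Submodule.span ℂ {Virasoro.L n}) ⟨n, hn⟩).trans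
          (le_sup_left.trans le_sup_left)
      · refine le_trans (Submodule.span_mono ?_) le_sup_right
        rintro _ rfl
        exact ⟨n, by omega, rfl⟩
    · intro p hp
      refine fun t ht => act_mem_span ?_ t ht
      have : (⨆ n : {n : ℤ // -1 ≤ n}, Submodule.span ℂ {Virasoro.L n}) ⊔
          Submodule.span ℂ {Virasoro.C} ≤ (Submodule.span ℂ {Induced.top (VirVacRel c) 1}).comap
            ((actRep Virasoro (VVir c)).flip (Induced.top _ 1)) := by
        rw [sup_le_iff, iSup_le_iff, Submodule.span_singleton_le_iff_mem]
        refine ⟨fun n => ?_, ?_⟩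
        · rw [Submodule.span_singleton_le_iff_mem]
          rw [Submodule.mem_comap, LinearMap.flip_apply, actRep_apply]
          rw [← VVir.rep_op, VVir.rep_vac n.2]
          exact Submodule.zero_mem _
        · rw [Submodule.mem_comap, LinearMap.flip_apply, actRep_apply]
          rw [VVir.top_central]
          exact Submodule.smul_mem _ _ (Submodule.mem_span_singleton_self _)
      exact this hp
    · rintro _ ⟨n, hn, rfl⟩ v hv
      have := hX () (n + 1) (by omega) v hv
      rwa [add_sub_cancel_right] at this

lemma VVir.iSup_eigenspace :
    ⨆ n : ℤ, Module.End.eigenspace ((VVir.rep c).op 0) (n : ℂ) = ⊤ := by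
  have := Virasoro.centralGrading.iSup_eigenspace (generates_vac (R := VirVacRel c))
    ((VVir.rep c).op 0) 0 ?_ ?_ ?_
  · simpa using this
  · intro n x hx v
    obtain ⟨r, rfl⟩ := Submodule.mem_span_singleton.1 hx
    rw [← actRep_apply, map_smul]
    simp only [LinearMap.smul_apply, actRep_apply, ← VVir.rep_op, map_smul]
    rw [(VVir.rep c).comm 0 n]
    by_cases h : n = 0
    · subst h; simp
    · rw [if_neg (by omega), zero_add]; push_cast; module
  · intro z hz v
    have h := act_lie z (Virasoro.L 0) v
    rw [Virasoro.centralGrading.central z hz, ← actRep_apply, map_zero, LinearMap.zero_apply,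
      eq_comm, sub_eq_zero] at h
    exact h.symm
  · rintro _ rfl
    rw [VVir.rep_vac (by norm_num), zero_smul]

/-- The Virasoro vertex operator algebra exists. -/
theorem exists_isVirVOA (c : ℂ) : ∃ S, IsVirVOA c S := by
  have hA := (VVir.fields c).generator_mem ()
  have hop (n : ℤ) : (VVir.fields c).G () (n + 1) = (VVir.rep c).op n :=
    congrArg (VVir.rep c).op (add_sub_cancel_right n 1)
  refine ⟨(VVir.fields c).voa (act (Virasoro.L (-2)) (Induced.top _ 1)),
    (VVir.fields c).voa_isVOA hA rfl rfl (VVir.rep c) (fun n => ?_) ?_, rfl, rfl, fun n => ?_⟩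
  · exact hop n
  · exact VVir.iSup_eigenspace
  · exact ((VVir.fields c).voa_mode_eq _ hA rfl (n + 1)).trans (hop n)

end Virasoro

/-! ### The affine vertex operator algebras. -/

section Affine

variable {g : Type*} [LieRing g] [LieAlgebra ℂ g] {B : InvForm g} {c k : ℂ}

lemma VAffine.top_central :
    act (Affine.C B) (Induced.top (AffineVacRel B c) 1) = c • Induced.top (AffineVacRel B c) 1 := by
  rw [act_top AffineVacRel.central, ← topMap_apply, ← topMap_apply, ← map_smul]
  rfl

/-- The action of `ĝ` on its vacuum module. -/
def VAffine.rep (B : InvForm g) (c : ℂ) : LoopRep B c (VAffine B c) :=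
  LoopRep.ofModule (fun v => generates_vac.central (Affine.lie_C B) (by
    rintro _ rfl
    exact VAffine.top_central) v)
    ((Affine.centralGrading B).smooth (generates_vac (R := AffineVacRel B c)) (by
      rintro _ rfl
      refine ⟨0, fun n hn x hx => ?_⟩
      obtain ⟨x, rfl⟩ := hx
      rw [Affine.elMap_apply, act_top (AffineVacRel.nonneg x n hn), ← topMap_apply,
        LinearMap.zero_apply, map_zero]))

lemma VAffine.rep_op (n : ℤ) (x : g) : (VAffine.rep B c).op n x = act (Affine.el B x n) := rfl

lemma VAffine.rep_vac {n : ℤ} (hn : 0 ≤ n) (x : g) :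
    (VAffine.rep B c).op n x (Induced.top (AffineVacRel B c) 1) = 0 := by
  rw [VAffine.rep_op, act_top (AffineVacRel.nonneg x n hn), ← topMap_apply, LinearMap.zero_apply,
    map_zero]

variable [FiniteDimensional ℂ g]

/-- In each normally ordered term the rightmost factor has degree ≥ 0: j itself if j ≥ 0, and n - j
≥ 0 if j < 0, as n ≥ -1. -/
lemma LoopRep.sug_vac {M : Type*} [AddCommGroup M] [Module ℂ M] (R : LoopRep B c M) {v : M}
    (hv : ∀ n ≥ 0, ∀ x, R.op n x v = 0) {n : ℤ} (hn : -1 ≤ n) : R.sug k n v = 0 := by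
  rw [R.sug_apply, finsum_eq_zero_of_forall_eq_zero fun j => ?_, smul_zero]
  simp only [LoopRep.normal, LinearMap.sum_apply]
  refine Finset.sum_eq_zero fun i _ => ?_
  split_ifs with h
  · rw [Module.End.mul_apply, hv _ (by omega), map_zero]
  · rw [Module.End.mul_apply, hv _ (by omega), map_zero]

/-- Only for j = -1 is the rightmost factor of negative degree. -/
lemma VAffine.sug_vac : (VAffine.rep B c).sug k (-2) (Induced.top (AffineVacRel B c) 1) =
    sugawaraVector B c k := by
  rw [LoopRep.sug_apply, sugawaraVector, finsum_eq_single _ (-1)]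
  · simp [LoopRep.normal, VAffine.rep_op]
  · intro j hj
    simp only [LoopRep.normal, LinearMap.sum_apply]
    refine Finset.sum_eq_zero fun i _ => ?_
    split_ifs with h
    · rw [Module.End.mul_apply, VAffine.rep_vac (by omega), map_zero]
    · rw [Module.End.mul_apply, VAffine.rep_vac (by omega), map_zero]

/-- The generating fields of the affine vertex operator algebra. -/
def VAffine.fields (hk : IsDualCoxeter B k) (hc : c + k ≠ 0) : GeneratingFields (VAffine B c) g where
  vac := Induced.top _ 1
  T := (VAffine.rep B c).sug k (-1)
  G x n := (VAffine.rep B c).op n x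
  T_vac := (VAffine.rep B c).sug_vac (fun _ hn => VAffine.rep_vac hn) le_rfl
  isField := (VAffine.rep B c).isField
  isLocal := (VAffine.rep B c).isLocal
  vac_nonneg x n hn := VAffine.rep_vac hn x
  translation x n v := by
    rw [(VAffine.rep B c).lie_sug hk hc n (-1)]
    rw [add_sub_assoc]
    simp [sub_eq_add_neg]
  span X h hX := by
    refine generates_vac.span.eq_top_of_stable
      ((⨆ n : {n : ℤ // 0 ≤ n}, LinearMap.range (Affine.elMap B n)) ⊔ Submodule.span ℂ {Affine.C B})
      {a | ∃ n < 0, ∃ x, a = Affine.el B x n} ?_ ?_ X ((Submodule.span_singleton_le_iff_mem _ _).2 h) ?_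
    · rw [eq_top_iff, ← Affine.span_eq_top]
      refine sup_le (iSup_le fun n => ?_) (le_sup_right.trans le_sup_left)
      by_cases hn : 0 ≤ n
      · exact (le_iSup (fun n : {n : ℤ // 0 ≤ n} => LinearMap.range (Affine.elMap B n))
          ⟨n, hn⟩).trans (le_sup_left.trans le_sup_left)
      · refine le_trans ?_ le_sup_right
        rintro _ ⟨x, rfl⟩
        exact Submodule.subset_span ⟨n, by omega, x, rfl⟩
    · intro p hp
      refine fun t ht => act_mem_span ?_ t ht
      have : (⨆ n : {n : ℤ // 0 ≤ n}, LinearMap.range (Affine.elMap B n)) ⊔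
          Submodule.span ℂ {Affine.C B} ≤ (Submodule.span ℂ {Induced.top (AffineVacRel B c) 1}).comap
            ((actRep (Affine B) (VAffine B c)).flip (Induced.top _ 1)) := by
        rw [sup_le_iff, iSup_le_iff, Submodule.span_singleton_le_iff_mem]
        refine ⟨fun n => ?_, ?_⟩
        · rintro _ ⟨x, rfl⟩
          rw [Submodule.mem_comap, LinearMap.flip_apply, actRep_apply]
          rw [Affine.elMap_apply, ← VAffine.rep_op, VAffine.rep_vac n.2]
          exact Submodule.zero_mem _
        · rw [Submodule.mem_comap, LinearMap.flip_apply, actRep_apply]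
          rw [VAffine.top_central]
          exact Submodule.smul_mem _ _ (Submodule.mem_span_singleton_self _)
      exact this hp
    · rintro _ ⟨n, hn, x, rfl⟩ v hv
      exact hX x n hn v hv

/-- The Sugawara field is not a generator, but membership in `fields` suffices for it to be the
field of its state, the Sugawara vector. -/
lemma VAffine.sug_mem (hk : IsDualCoxeter B k) (hc : c + k ≠ 0) :
    (fun n => (VAffine.rep B c).sug k (n - 1)) ∈ (VAffine.fields hk hc).fields := by
  refine ⟨fun v => ?_, fun n hn => ?_, fun n v => ?_, fun x => ?_⟩
  · obtain ⟨N, hN⟩ := (VAffine.rep B c).sug_smooth k v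
    exact ⟨N + 1, fun n hn => hN _ (by omega)⟩
  · exact (VAffine.rep B c).sug_vac (fun _ hn => VAffine.rep_vac hn) (by omega)
  · exact ((VAffine.rep B c).sugRep hk hc).translation n v
  · refine isLocal_of_primary fun m n v => ?_
    change (VAffine.rep B c).sug k m ((VAffine.rep B c).op n x v) =
      (VAffine.rep B c).op n x ((VAffine.rep B c).sug k m v) -
        (n : ℂ) • (VAffine.rep B c).op (n + m) x v
    rw [(VAffine.rep B c).lie_sug hk hc n m, add_sub_cancel_right]

lemma VAffine.iSup_eigenspace (hk : IsDualCoxeter B k) (hc : c + k ≠ 0) :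
    ⨆ n : ℤ, Module.End.eigenspace ((VAffine.rep B c).sug k 0) (n : ℂ) = ⊤ := by
  have := (Affine.centralGrading B).iSup_eigenspace (generates_vac (R := AffineVacRel B c))
    ((VAffine.rep B c).sug k 0) 0 ?_ ?_ ?_
  · simpa using this
  · rintro n _ ⟨x, rfl⟩ v
    rw [Affine.elMap_apply, ← VAffine.rep_op, (VAffine.rep B c).lie_sug hk hc n 0, add_zero,
      add_sub_cancel_right]
  · intro z hz v
    obtain ⟨r, rfl⟩ := Submodule.mem_span_singleton.1 hz
    have h (v : VAffine B c) : act (Affine.C B) v = c • v :=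
      generates_vac.central (Affine.lie_C B) (by
        rintro _ rfl
        exact VAffine.top_central) v
    rw [← actRep_apply, map_smul]
    simp only [LinearMap.smul_apply, actRep_apply, h, map_smul]
  · rintro _ rfl
    rw [(VAffine.rep B c).sug_vac (fun _ hn => VAffine.rep_vac hn) (by norm_num), zero_smul]

/-- The affine vertex operator algebra exists. -/
theorem exists_isAffineVOA (hk : IsDualCoxeter B k) (hc : c + k ≠ 0) :
    ∃ S, IsAffineVOA B c k S := by
  have hA := VAffine.sug_mem hk hc
  refine ⟨(VAffine.fields hk hc).voa (sugawaraVector B c k), ?_, rfl, rfl, fun x n => ?_⟩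
  · refine (VAffine.fields hk hc).voa_isVOA hA VAffine.sug_vac rfl
      ((VAffine.rep B c).sugRep hk hc) (fun n => ?_) (VAffine.iSup_eigenspace hk hc)
    exact congrArg ((VAffine.rep B c).sug k) (add_sub_cancel_right n 1)
  · exact (VAffine.fields hk hc).voa_mode_eq _ ((VAffine.fields hk hc).generator_mem x) rfl n

end Affine

/-! ### The vertex operator algebra of f̄. -/

section FBar

variable {g s : Type*} [LieRing g] [LieAlgebra ℂ g] [LieRing s] [LieAlgebra ℂ s]
  {B : InvForm g} {B' : InvForm s} {c₁ c₂ c : ℂ}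

lemma VFBar.top_fst {n : ℤ} (hn : 0 ≤ n) (x : g) :
    act (FBar.ofFst B B' (.el B x n)) (Induced.top (FBarVacRel B B' c₁ c₂ c) 1) = 0 := by
  rw [act_top (.fst _ _ (.nonneg x n hn)), ← topMap_apply, LinearMap.zero_apply, map_zero]

lemma VFBar.top_snd {n : ℤ} (hn : 0 ≤ n) (x : s) :
    act (FBar.ofSnd B B' (.el B' x n)) (Induced.top (FBarVacRel B B' c₁ c₂ c) 1) = 0 := by
  rw [act_top (.snd _ _ (.nonneg x n hn)), ← topMap_apply, LinearMap.zero_apply, map_zero]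

lemma VFBar.top_vir {n : ℤ} (hn : -1 ≤ n) :
    act (FBar.ofVir B B' (.L n)) (Induced.top (FBarVacRel B B' c₁ c₂ c) 1) = 0 := by
  rw [act_top (.vir _ _ (.nonneg n hn)), ← topMap_apply, LinearMap.zero_apply, map_zero]

lemma VFBar.top_central : (∀ t ∈ ({Induced.top (FBarVacRel B B' c₁ c₂ c) 1} : Set _),
      act (FBar.ofFst B B' (.C B)) t = c₁ • t) ∧
    (∀ t ∈ ({Induced.top (FBarVacRel B B' c₁ c₂ c) 1} : Set _),
      act (FBar.ofSnd B B' (.C B')) t = c₂ • t) ∧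
    (∀ t ∈ ({Induced.top (FBarVacRel B B' c₁ c₂ c) 1} : Set _),
      act (FBar.ofVir B B' .C) t = c • t) := by
  refine ⟨?_, ?_, ?_⟩
  · rintro _ rfl
    rw [act_top (.fst _ _ .central), ← topMap_apply, ← topMap_apply, ← map_smul]
    rfl
  · rintro _ rfl
    rw [act_top (.snd _ _ .central), ← topMap_apply, ← topMap_apply, ← map_smul]
    rfl
  · rintro _ rfl
    rw [act_top (.vir _ _ .central), ← topMap_apply, ← topMap_apply, ← map_smul]
    rfl

/-- The action of `f̄` on its vacuum module. -/
def VFBar.rep (B : InvForm g) (B' : InvForm s) (c₁ c₂ c : ℂ) :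
    FBarRep B B' c₁ c₂ c (VFBar B B' c₁ c₂ c) :=
  FBarRep.ofModule (generates_vac.central FBar.lie_fst_C VFBar.top_central.1)
    (generates_vac.central FBar.lie_snd_C VFBar.top_central.2.1)
    (generates_vac.central FBar.lie_vir_C VFBar.top_central.2.2)
    ((FBar.centralGrading B B').smooth generates_vac (by
      rintro _ rfl
      refine ⟨0, fun n hn x hx => ?_⟩
      obtain ⟨p, rfl⟩ := hx
      rw [FBar.degMap_apply, ← actRep_apply]
      simp only [map_add, map_smul, LinearMap.add_apply, LinearMap.smul_apply, actRep_apply]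
      rw [VFBar.top_fst hn, VFBar.top_snd hn, VFBar.top_vir (by omega), smul_zero, add_zero,
        add_zero]))

lemma VFBar.rep_fst (n : ℤ) (x : g) :
    (VFBar.rep B B' c₁ c₂ c).fst.op n x = act (FBar.ofFst B B' (.el B x n)) := rfl
lemma VFBar.rep_snd (n : ℤ) (x : s) :
    (VFBar.rep B B' c₁ c₂ c).snd.op n x = act (FBar.ofSnd B B' (.el B' x n)) := rfl
lemma VFBar.rep_vir (n : ℤ) :
    (VFBar.rep B B' c₁ c₂ c).vir.op n = act (FBar.ofVir B B' (.L n)) := rfl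

lemma VFBar.vir_isField : IsField fun n => (VFBar.rep B B' c₁ c₂ c).vir.op (n - 1) := fun v => by
  obtain ⟨k, hk⟩ := (FBar.centralGrading B B').smooth
    (generates_vac (R := FBarVacRel B B' c₁ c₂ c)) (by
      rintro _ rfl
      refine ⟨0, fun n hn x hx => ?_⟩
      obtain ⟨p, rfl⟩ := hx
      rw [FBar.degMap_apply, ← actRep_apply]
      simp only [map_add, map_smul, LinearMap.add_apply, LinearMap.smul_apply, actRep_apply]
      rw [VFBar.top_fst hn, VFBar.top_snd hn, VFBar.top_vir (by omega), smul_zero, add_zero,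
        add_zero]) v
  exact ⟨k + 1, fun n hn => hk _ (by omega) _ (FBar.vir_mem _)⟩

/-- The family of generating fields of `V_f̄`. -/
def FBarRep.field {M : Type*} [AddCommGroup M] [Module ℂ M] (R : FBarRep B B' c₁ c₂ c M) :
    (g ⊕ s) ⊕ Unit → ℤ → Module.End ℂ M
  | .inl (.inl x), n => R.fst.op n x
  | .inl (.inr y), n => R.snd.op n y
  | .inr (), n => R.vir.op (n - 1)

lemma FBarRep.isLocal_field {M : Type*} [AddCommGroup M] [Module ℂ M]
    (R : FBarRep B B' c₁ c₂ c M) (i j) : IsLocal (R.field i) (R.field j) := by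
  have h12 (x y) : IsLocal (fun n => R.fst.op n x) (fun n => R.snd.op n y) :=
    IsLocal.of_commutator 0 fun m n v => by simp [R.fst_snd]
  have h31 (x) : IsLocal (fun n => R.vir.op (n - 1)) (fun n => R.fst.op n x) :=
    isLocal_of_primary fun m n v => R.vir_fst m n x v
  have h32 (x) : IsLocal (fun n => R.vir.op (n - 1)) (fun n => R.snd.op n x) :=
    isLocal_of_primary fun m n v => R.vir_snd m n x v
  rcases i with (x | x) | ⟨⟩ <;> rcases j with (y | y) | ⟨⟩
  · exact R.fst.isLocal x y
  · exact h12 x y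
  · exact (h31 x).symm
  · exact (h12 y x).symm
  · exact R.snd.isLocal x y
  · exact (h32 x).symm
  · exact h31 y
  · exact h32 y
  · exact R.vir.isLocal

lemma FBarRep.translation {M : Type*} [AddCommGroup M] [Module ℂ M] (R : FBarRep B B' c₁ c₂ c M)
    (i) (n : ℤ) (v : M) : R.vir.op (-1) (R.field i n v) =
      R.field i n (R.vir.op (-1) v) - (n : ℂ) • R.field i (n - 1) v := by
  rcases i with (x | x) | ⟨⟩
  · exact R.vir_fst (-1) n x v
  · exact R.vir_snd (-1) n x v
  · exact R.vir.translation n v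

/-- L(0) is the degree operator on all three kinds of modes at once, since the Virasoro cocycle
vanishes at m = 0. -/
lemma FBarRep.vir_zero {M : Type*} [AddCommGroup M] [Module ℂ M] (R : FBarRep B B' c₁ c₂ c M)
    (n : ℤ) (x : g) (y : s) (r : ℂ) (v : M) :
    R.vir.op 0 (R.fst.op n x v + R.snd.op n y v + r • R.vir.op n v) =
      R.fst.op n x (R.vir.op 0 v) + R.snd.op n y (R.vir.op 0 v) + r • R.vir.op n (R.vir.op 0 v) -
        (n : ℂ) • (R.fst.op n x v + R.snd.op n y v + r • R.vir.op n v) := by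
  rw [map_add, map_add, map_smul, R.vir_fst, R.vir_snd, R.vir.comm 0 n, add_zero, zero_add]
  by_cases h : n = 0
  · subst h; simp
  · rw [if_neg (by omega)]; push_cast; module

/-- The generating fields of the vertex operator algebra of `f̄`. -/
def VFBar.fields (B : InvForm g) (B' : InvForm s) (c₁ c₂ c : ℂ) :
    GeneratingFields (VFBar B B' c₁ c₂ c) ((g ⊕ s) ⊕ Unit) where
  vac := Induced.top _ 1
  T := (VFBar.rep B B' c₁ c₂ c).vir.op (-1)
  G := (VFBar.rep B B' c₁ c₂ c).field
  T_vac := VFBar.top_vir le_rfl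
  isField i := by
    rcases i with (x | x) | ⟨⟩
    · exact LoopRep.isField _ x
    · exact LoopRep.isField _ x
    · exact VFBar.vir_isField
  isLocal := FBarRep.isLocal_field _
  vac_nonneg i n hn := by
    rcases i with (x | x) | ⟨⟩
    · exact VFBar.top_fst hn x
    · exact VFBar.top_snd hn x
    · exact VFBar.top_vir (by omega)
  translation := FBarRep.translation _
  span X h hX := by
    have hX1 (n : ℤ) (hn : n < 0) (x : g) (v) (hv : v ∈ X) :
      act (FBar.ofFst B B' (.el B x n)) v ∈ X := hX (.inl (.inl x)) n hn v hv
    have hX2 (n : ℤ) (hn : n < 0) (x : s) (v) (hv : v ∈ X) :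
      act (FBar.ofSnd B B' (.el B' x n)) v ∈ X := hX (.inl (.inr x)) n hn v hv
    have hX3 (n : ℤ) (hn : n < -1) (v) (hv : v ∈ X) :
        act (FBar.ofVir B B' (.L n)) v ∈ X := by
      have := hX (.inr ()) (n + 1) (by omega) v hv
      simp only [FBarRep.field, add_sub_cancel_right] at this
      exact this
    clear hX
    -- `P` sends the vacuum into its line and `N` preserves `X`. By its degree every spanning
    -- element of f̄ lies in one of them.
    let P : Submodule ℂ (FBar B B') := (Submodule.span ℂ {Induced.top (FBarVacRel B B' c₁ c₂ c) 1}).comap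
        ((actRep (FBar B B') (VFBar B B' c₁ c₂ c)).flip (Induced.top _ 1))
    have hP (a : FBar B B') : a ∈ P ↔ act a (Induced.top (FBarVacRel B B' c₁ c₂ c) 1) ∈
      Submodule.span ℂ {Induced.top (FBarVacRel B B' c₁ c₂ c) 1} := Iff.rfl
    let N : Set (FBar B B') := {a | ∀ v ∈ X, act a v ∈ X}
    refine generates_vac.span.eq_top_of_stable P N ?_ (fun p hp => act_mem_span ((hP p).1 hp)) X
      ((Submodule.span_singleton_le_iff_mem _ _).2 h) fun a ha => ha
    have h1 (a) (ha : a ∈ P) : a ∈ P ⊔ Submodule.span ℂ N := (le_sup_left : P ≤ _) ha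
    have h2 (a) (ha : a ∈ N) : a ∈ P ⊔ Submodule.span ℂ N :=
      (le_sup_right : Submodule.span ℂ N ≤ P ⊔ _) (Submodule.subset_span ha)
    have hz {v : VFBar B B' c₁ c₂ c} (hv : v = 0) :
        v ∈ Submodule.span ℂ {Induced.top (FBarVacRel B B' c₁ c₂ c) 1} :=
      hv ▸ Submodule.zero_mem _
    have hs {v : VFBar B B' c₁ c₂ c} {r : ℂ} (hv : v = r • Induced.top _ 1) :
        v ∈ Submodule.span ℂ {Induced.top (FBarVacRel B B' c₁ c₂ c) 1} :=
      hv ▸ Submodule.smul_mem _ _ (Submodule.mem_span_singleton_self _)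
    have hc := VFBar.top_central (B := B) (B' := B') (c₁ := c₁) (c₂ := c₂) (c := c)
    rw [eq_top_iff, ← FBar.span_degMap B B', sup_le_iff, iSup_le_iff, Submodule.span_le]
    refine ⟨fun n => ?_, ?_⟩
    · rintro _ ⟨p, rfl⟩
      rw [FBar.degMap_apply]
      refine Submodule.add_mem _ (Submodule.add_mem _ ?_ ?_) (Submodule.smul_mem _ _ ?_)
      · by_cases hn : 0 ≤ n
        · exact h1 _ ((hP _).2 (hz (VFBar.top_fst hn _)))
        · exact h2 _ (hX1 n (by omega) _)
      · by_cases hn : 0 ≤ n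
        · exact h1 _ ((hP _).2 (hz (VFBar.top_snd hn _)))
        · exact h2 _ (hX2 n (by omega) _)
      · by_cases hn : -1 ≤ n
        · exact h1 _ ((hP _).2 (hz (VFBar.top_vir hn)))
        · exact h2 _ (hX3 n (by omega))
    · rintro _ (rfl | rfl | rfl)
      · exact h1 _ ((hP _).2 (hs (hc.1 _ rfl)))
      · exact h1 _ ((hP _).2 (hs (hc.2.1 _ rfl)))
      · exact h1 _ ((hP _).2 (hs (hc.2.2 _ rfl)))

lemma VFBar.iSup_eigenspace :
    ⨆ n : ℤ, Module.End.eigenspace ((VFBar.rep B B' c₁ c₂ c).vir.op 0) (n : ℂ) = ⊤ := by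
  have := (FBar.centralGrading B B').iSup_eigenspace
    (generates_vac (R := FBarVacRel B B' c₁ c₂ c)) ((VFBar.rep B B' c₁ c₂ c).vir.op 0) 0 ?_ ?_ ?_
  · simpa using this
  · rintro n _ ⟨p, rfl⟩ v
    have h := (VFBar.rep B B' c₁ c₂ c).vir_zero n p.1.1 p.1.2 p.2 v
    rw [FBar.degMap_apply, ← actRep_apply]
    simp only [map_add, map_smul, LinearMap.add_apply, LinearMap.smul_apply, actRep_apply,
      ← VFBar.rep_fst, ← VFBar.rep_snd, ← VFBar.rep_vir] at h ⊢
    exact h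
  · intro z hz v
    have h := act_lie z (FBar.ofVir B B' (.L 0)) v
    rw [FBar.lie_of_mem_span hz, ← actRep_apply, map_zero, LinearMap.zero_apply,
      eq_comm, sub_eq_zero] at h
    rw [VFBar.rep_vir, h]
  · rintro _ rfl
    rw [VFBar.rep_vir, VFBar.top_vir (by norm_num), zero_smul]

/-- The vertex operator algebra of `f̄` exists. -/
theorem exists_isFBarVOA (B : InvForm g) (B' : InvForm s) (c₁ c₂ c : ℂ) :
    ∃ S, IsFBarVOA B B' c₁ c₂ c S := by
  have hA := (VFBar.fields B B' c₁ c₂ c).generator_mem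
  have h3 : ((VFBar.fields B B' c₁ c₂ c).G (.inr ())) (-1) (VFBar.fields B B' c₁ c₂ c).vac =
    act (FBar.ofVir B B' (.L (-2))) (Induced.top _ 1) := rfl
  have hop (n : ℤ) : (VFBar.fields B B' c₁ c₂ c).G (.inr ()) (n + 1) =
      (VFBar.rep B B' c₁ c₂ c).vir.op n :=
    congrArg (VFBar.rep B B' c₁ c₂ c).vir.op (add_sub_cancel_right n 1)
  refine ⟨(VFBar.fields B B' c₁ c₂ c).voa (act (FBar.ofVir B B' (.L (-2))) (Induced.top _ 1)),
    ?_, rfl, rfl, fun x n => ?_, fun x n => ?_, fun n => ?_⟩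
  · exact (VFBar.fields B B' c₁ c₂ c).voa_isVOA (hA _) h3 rfl (VFBar.rep B B' c₁ c₂ c).vir hop
      VFBar.iSup_eigenspace
  · exact (VFBar.fields B B' c₁ c₂ c).voa_mode_eq _ (hA (.inl (.inl x))) rfl n
  · exact (VFBar.fields B B' c₁ c₂ c).voa_mode_eq _ (hA (.inl (.inr x))) rfl n
  · exact ((VFBar.fields B B' c₁ c₂ c).voa_mode_eq _ (hA _) h3 (n + 1)).trans (hop n)

end FBar

end

end TorVOA


namespace TorVOA

noncomputable section

/-! ### Tensor products of vertex operator algebras -/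

namespace VOAData

variable {V W : Type*} [AddCommGroup V] [Module ℂ V] [AddCommGroup W] [Module ℂ W]

lemma mode_add (S : VOAData V) (a b : V) (n : ℤ) : S.mode (a + b) n = S.mode a n + S.mode b n := by
  simp [mode]

lemma mode_zero (S : VOAData V) (n : ℤ) : S.mode 0 n = 0 := by
  simp [mode]

lemma mode_isField (S : VOAData V) (a : V) : IsField (S.mode a) :=
  exists_forall_ncoeff_eq_zero (S.Y a)

/-- The axioms for the vacuum and for the translation operator `T`. -/
structure IsTranslationCovariant (S : VOAData V) (T : Module.End ℂ V) : Prop where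
  creation_nonneg (a : V) (n : ℤ) (hn : 0 ≤ n) : S.mode a n S.vac = 0
  creation (a : V) : S.mode a (-1) S.vac = a
  translation (a : V) (n : ℤ) (v : V) :
    T (S.mode a n v) = S.mode a n (T v) - (n : ℂ) • S.mode a (n - 1) v

/-- The field `G` is local with respect to all fields of `S`. -/
def LocalWith (S : VOAData V) (G : ℤ → Module.End ℂ V) : Prop := ∀ a, IsLocal (S.mode a) G

lemma tensor_mode_finite (S : VOAData V) (T : VOAData W) (a v : V) (b w : W) (n : ℤ) :
    Function.HasFiniteSupport fun i : ℤ => S.mode a i v ⊗ₜ[ℂ] T.mode b (n - 1 - i) w :=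
  tensorCoeff_finite (S.Y a) (T.Y b) n v w

lemma tensor_mode' (S : VOAData V) (T : VOAData W) (a v : V) (b w : W) (n : ℤ) :
    (S.tensor T).mode (a ⊗ₜ b) n (v ⊗ₜ w) =
      ∑ᶠ i : ℤ, S.mode a (n - 1 - i) v ⊗ₜ[ℂ] T.mode b i w := by
  rw [tensor_mode, ← finsum_comp_equiv (Equiv.subLeft (n - 1))]
  refine finsum_congr fun i => ?_
  simp

lemma tensor_mode_finite' (S : VOAData V) (T : VOAData W) (a v : V) (b w : W) (n : ℤ) :
    Function.HasFiniteSupport fun i : ℤ => S.mode a (n - 1 - i) v ⊗ₜ[ℂ] T.mode b i w := by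
  have := Set.Finite.preimage (Equiv.subLeft (n - 1)).injective.injOn
    (tensor_mode_finite S T a v b w n)
  refine this.subset fun i hi => ?_
  simpa using hi

/-- These axioms and locality with the images of the generating fields are all that
`map_mode_of_generatingFields` requires of the tensor product. -/
lemma IsTranslationCovariant.tensor {S : VOAData V} {S' : VOAData W} {T : Module.End ℂ V}
    {T' : Module.End ℂ W} (h : S.IsTranslationCovariant T) (h' : S'.IsTranslationCovariant T') :
    (S.tensor S').IsTranslationCovariant (T.rTensor W + T'.lTensor V) where
  creation_nonneg t n hn := by
    induction t using TensorProduct.induction_on with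
    | zero => rw [mode_zero, LinearMap.zero_apply]
    | add t u ht hu => rw [mode_add, LinearMap.add_apply, ht, hu, add_zero]
    | tmul a b =>
      change (S.tensor S').mode _ n (S.vac ⊗ₜ S'.vac) = 0
      rw [tensor_mode]
      refine finsum_eq_zero_of_forall_eq_zero fun i => ?_
      by_cases hi : 0 ≤ i
      · rw [h.creation_nonneg a i hi, TensorProduct.zero_tmul]
      · rw [h'.creation_nonneg b _ (by omega), TensorProduct.tmul_zero]
  creation t := by
    induction t using TensorProduct.induction_on with
    | zero => rw [mode_zero, LinearMap.zero_apply]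
    | add t u ht hu => rw [mode_add, LinearMap.add_apply, ht, hu]
    | tmul a b =>
      change (S.tensor S').mode _ (-1) (S.vac ⊗ₜ S'.vac) = _
      rw [tensor_mode, finsum_eq_single _ (-1)]
      · rw [h.creation, show (-1 - 1 - -1 : ℤ) = -1 by norm_num, h'.creation]
      · intro i hi
        by_cases hi : 0 ≤ i
        · rw [h.creation_nonneg a i hi, TensorProduct.zero_tmul]
        · rw [h'.creation_nonneg b _ (by omega), TensorProduct.tmul_zero]
  translation t n x := by
    induction t using TensorProduct.induction_on with
    | zero => simp [mode_zero]
    | add t u ht hu =>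
      simp only [mode_add, LinearMap.add_apply, map_add] at ht hu ⊢
      linear_combination (norm := module) ht + hu
    | tmul a b =>
    induction x using TensorProduct.induction_on with
    | zero => simp
    | add x y hx hy =>
      simp only [map_add] at hx hy ⊢
      linear_combination (norm := module) hx + hy
    | tmul v w =>
      simp only [LinearMap.add_apply, LinearMap.rTensor_tmul, LinearMap.lTensor_tmul, map_add]
      rw [tensor_mode, tensor_mode, tensor_mode, tensor_mode]
      have e1 := (T.rTensor W).toAddMonoidHom.map_finsum (tensor_mode_finite S S' a v b w n)
      have e2 := (T'.lTensor V).toAddMonoidHom.map_finsum (tensor_mode_finite S S' a v b w n)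
      simp only [LinearMap.toAddMonoidHom_coe, LinearMap.rTensor_tmul, LinearMap.lTensor_tmul]
        at e1 e2
      rw [e1, e2]
      let f : ℤ → V ⊗[ℂ] W := fun i => S.mode a i v ⊗ₜ S'.mode b (n - 1 - 1 - i) w
      have hf : Function.HasFiniteSupport f := tensor_mode_finite S S' a v b w (n - 1)
      -- The derivations on the two factors produce -i f(i-1) = -F(i-1) and -(n-1-i) f(i) = -n f(i)
      -- + F(i); the F terms telescope away.
      let F : ℤ → V ⊗[ℂ] W := fun i => ((i + 1 : ℤ) : ℂ) • f i
      have hF : Function.HasFiniteSupport F := hf.subset fun i hi h => hi (by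
        simp only [F]; rw [h, smul_zero])
      have hnf : Function.HasFiniteSupport fun i => (n : ℂ) • f i := hf.subset fun i hi h => hi (by
        dsimp only at h ⊢; rw [h, smul_zero])
      have hsh := finsum_shift_sub hF (-1)
      have hsf := HasFiniteSupport.sub (HasFiniteSupport.shift hF (-1)) hF
      have h1 (i : ℤ) : T (S.mode a i v) ⊗ₜ[ℂ] S'.mode b (n - 1 - i) w +
          S.mode a i v ⊗ₜ T' (S'.mode b (n - 1 - i) w) =
          (S.mode a i (T v) ⊗ₜ S'.mode b (n - 1 - i) w +
          S.mode a i v ⊗ₜ S'.mode b (n - 1 - i) (T' w)) - (n : ℂ) • f i -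
          (F (i + -1) - F i) := by
        rw [h.translation, h'.translation]
        simp only [F, f, TensorProduct.sub_tmul, TensorProduct.tmul_sub, ← TensorProduct.smul_tmul',
          TensorProduct.tmul_smul]
        rw [show n - 1 - 1 - (i + -1) = n - 1 - i by ring, show n - 1 - i - 1 = n - 1 - 1 - i by ring,
          ← sub_eq_add_neg i 1]
        push_cast
        module
      have g1 : Function.HasFiniteSupport fun i =>
          T (S.mode a i v) ⊗ₜ[ℂ] S'.mode b (n - 1 - i) w :=
        (tensor_mode_finite S S' a v b w n).subset fun i hi h => hi (by
          have := congrArg (T.rTensor W) h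
          simpa using this)
      have g2 : Function.HasFiniteSupport fun i =>
          S.mode a i v ⊗ₜ[ℂ] T' (S'.mode b (n - 1 - i) w) :=
        (tensor_mode_finite S S' a v b w n).subset fun i hi h => hi (by
          have := congrArg (T'.lTensor V) h
          simpa using this)
      have g3 := tensor_mode_finite S S' a (T v) b w n
      have g4 := tensor_mode_finite S S' a v b (T' w) n
      rw [← finsum_add_distrib g1 g2, finsum_congr h1,
        finsum_sub_distrib (HasFiniteSupport.sub (HasFiniteSupport.add g3 g4) hnf) hsf, hsh, sub_zero,
        finsum_sub_distrib (HasFiniteSupport.add g3 g4) hnf, finsum_add_distrib g3 g4, smul_finsum]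

/-- In the sum defining the modes of a ⊗ b, fix the index j of the right factor b(j)w. The left
factors then form the locality relation of a and G with first index m - 1 - j. -/
lemma LocalWith.rTensor {S : VOAData V} {G : ℤ → Module.End ℂ V} (h : S.LocalWith G)
    (S' : VOAData W) : (S.tensor S').LocalWith fun n => (G n).rTensor W := fun t => by
  induction t using TensorProduct.induction_on with
  | zero =>
    rw [show (S.tensor S').mode 0 = 0 from funext fun n => mode_zero _ n]
    exact IsLocal.zero _
  | add t u ht hu =>
    rw [show (S.tensor S').mode (t + u) = (S.tensor S').mode t + (S.tensor S').mode u from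
      funext fun n => mode_add _ _ _ n]
    exact ht.add hu
  | tmul a b =>
    obtain ⟨k, hk⟩ := h a
    rw [isLocalAt_iff] at hk
    refine ⟨k, isLocalAt_iff.2 fun m n x => ?_⟩
    induction x using TensorProduct.induction_on with
    | zero => simp
    | add x y hx hy =>
      simp only [map_add, add_sub_add_comm, smul_add, Finset.sum_add_distrib]
      rw [hx, hy, add_zero]
    | tmul v w =>
      have h1 (i : ℕ) := (tensor_mode_finite' S S' a (G (n + i) v) b w (m + k - i))
      have h2 (i : ℕ) : Function.HasFiniteSupport fun j : ℤ =>
          G (n + i) (S.mode a (m + k - i - 1 - j) v) ⊗ₜ[ℂ] S'.mode b j w :=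
        (tensor_mode_finite' S S' a v b w (m + k - i)).subset fun j hj h => hj (by
          have := congrArg ((G (n + i)).rTensor W) h
          simpa using this)
      have key (i : ℕ) : ((-1 : ℂ) ^ i * (k.choose i : ℂ)) •
          ((S.tensor S').mode (a ⊗ₜ b) (m + k - i) ((G (n + i)).rTensor W (v ⊗ₜ w)) -
            (G (n + i)).rTensor W ((S.tensor S').mode (a ⊗ₜ b) (m + k - i) (v ⊗ₜ w))) =
          ∑ᶠ j : ℤ, ((-1 : ℂ) ^ i * (k.choose i : ℂ)) •
            ((S.mode a (m - 1 - j + k - i) (G (n + i) v) -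
              G (n + i) (S.mode a (m - 1 - j + k - i) v)) ⊗ₜ[ℂ] S'.mode b j w) := by
        have e1 := ((G (n + i)).rTensor W).toAddMonoidHom.map_finsum
          (tensor_mode_finite' S S' a v b w (m + k - i))
        simp only [LinearMap.toAddMonoidHom_coe, LinearMap.rTensor_tmul] at e1
        rw [LinearMap.rTensor_tmul, tensor_mode', tensor_mode', e1, ← finsum_sub_distrib (h1 i) (h2 i),
          smul_finsum]
        refine finsum_congr fun j => ?_
        rw [TensorProduct.sub_tmul, show m - 1 - j + k - i = m + k - i - 1 - j by ring]
      simp_rw [key]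
      rw [← finsum_sum_comm]
      · refine finsum_eq_zero_of_forall_eq_zero fun j => ?_
        simp_rw [TensorProduct.smul_tmul', ← TensorProduct.sum_tmul]
        rw [hk, TensorProduct.zero_tmul]
      · intro i _
        refine (HasFiniteSupport.sub (h1 i) (h2 i)).subset fun j hj h => hj ?_
        dsimp only at h ⊢
        rw [TensorProduct.sub_tmul, show m - 1 - j + k - i = m + k - i - 1 - j by ring, h, smul_zero]

lemma LocalWith.lTensor {S' : VOAData W} {G : ℤ → Module.End ℂ W} (h : S'.LocalWith G)
    (S : VOAData V) : (S.tensor S').LocalWith fun n => (G n).lTensor V := fun t => by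
  induction t using TensorProduct.induction_on with
  | zero =>
    rw [show (S.tensor S').mode 0 = 0 from funext fun n => mode_zero _ n]
    exact IsLocal.zero _
  | add t u ht hu =>
    rw [show (S.tensor S').mode (t + u) = (S.tensor S').mode t + (S.tensor S').mode u from
      funext fun n => mode_add _ _ _ n]
    exact ht.add hu
  | tmul a b =>
    obtain ⟨k, hk⟩ := h b
    rw [isLocalAt_iff] at hk
    refine ⟨k, isLocalAt_iff.2 fun m n x => ?_⟩
    induction x using TensorProduct.induction_on with
    | zero => simp
    | add x y hx hy =>
      simp only [map_add, add_sub_add_comm, smul_add, Finset.sum_add_distrib]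
      rw [hx, hy, add_zero]
    | tmul v w =>
      have h1 (i : ℕ) := (tensor_mode_finite S S' a v b (G (n + i) w) (m + k - i))
      have h2 (i : ℕ) : Function.HasFiniteSupport fun j : ℤ =>
          S.mode a j v ⊗ₜ[ℂ] G (n + i) (S'.mode b (m + k - i - 1 - j) w) :=
        (tensor_mode_finite S S' a v b w (m + k - i)).subset fun j hj h => hj (by
          have := congrArg ((G (n + i)).lTensor V) h
          simpa using this)
      have key (i : ℕ) : ((-1 : ℂ) ^ i * (k.choose i : ℂ)) •
          ((S.tensor S').mode (a ⊗ₜ b) (m + k - i) ((G (n + i)).lTensor V (v ⊗ₜ w)) -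
            (G (n + i)).lTensor V ((S.tensor S').mode (a ⊗ₜ b) (m + k - i) (v ⊗ₜ w))) =
          ∑ᶠ j : ℤ, ((-1 : ℂ) ^ i * (k.choose i : ℂ)) •
            (S.mode a j v ⊗ₜ[ℂ] (S'.mode b (m - 1 - j + k - i) (G (n + i) w) -
              G (n + i) (S'.mode b (m - 1 - j + k - i) w))) := by
        have e1 := ((G (n + i)).lTensor V).toAddMonoidHom.map_finsum
          (tensor_mode_finite S S' a v b w (m + k - i))
        simp only [LinearMap.toAddMonoidHom_coe, LinearMap.lTensor_tmul] at e1
        rw [LinearMap.lTensor_tmul, tensor_mode, tensor_mode, e1, ← finsum_sub_distrib (h1 i) (h2 i),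
          smul_finsum]
        refine finsum_congr fun j => ?_
        rw [TensorProduct.tmul_sub, show m - 1 - j + k - i = m + k - i - 1 - j by ring]
      simp_rw [key]
      rw [← finsum_sum_comm]
      · refine finsum_eq_zero_of_forall_eq_zero fun j => ?_
        simp_rw [← TensorProduct.tmul_smul, ← TensorProduct.tmul_sum]
        rw [hk, TensorProduct.tmul_zero]
      · intro i _
        refine (HasFiniteSupport.sub (h1 i) (h2 i)).subset fun j hj h => hj ?_
        dsimp only at h ⊢
        rw [TensorProduct.tmul_sub, show m - 1 - j + k - i = m + k - i - 1 - j by ring, h, smul_zero]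

lemma IsVOA.localWith {S : VOAData V} {c : ℂ} (h : S.IsVOA c) (b : V) : S.LocalWith (S.mode b) :=
  fun a => (h.locality a b).imp fun k hk => isLocalAt_iff.2 fun m n v => by
    have := LinearMap.congr_fun (hk m n) v
    simpa using this

lemma IsVOA.isTranslationCovariant {S : VOAData V} {c : ℂ} (h : S.IsVOA c) :
    S.IsTranslationCovariant (S.L (-1)) where
  creation_nonneg := h.creation_nonneg
  creation := h.creation
  translation a n v := by
    have := LinearMap.congr_fun (h.translation a n) v
    simp only [LinearMap.sub_apply, Module.End.mul_apply, LinearMap.smul_apply] at this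
    rw [eq_add_of_sub_eq this]
    module

/-- A linear isomorphism that intertwines the vacuum vectors, the translation operators and the
generating fields preserves all products. -/
lemma map_mode_of_generatingFields {I : Type*} (Γ : GeneratingFields V I) {S : VOAData V}
    {S' : VOAData W} {T' : Module.End ℂ W} (hS : ∀ a n, S.mode a n = (Γ.ofState a).1 n)
    (hS' : S'.IsTranslationCovariant T') (φ : V ≃ₗ[ℂ] W) (hvac : φ Γ.vac = S'.vac)
    (hT : ∀ v, φ (Γ.T v) = T' (φ v))
    (hG : ∀ s, ∃ G', S'.LocalWith G' ∧ ∀ n v, φ (Γ.G s n v) = G' n (φ v)) (a v : V) (n : ℤ) :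
    φ (S.mode a n v) = S'.mode (φ a) n (φ v) := by
  -- The field of φ(a) transported back to V belongs to `Γ.fields` and has state a, so it is the
  -- field of a by uniqueness.
  let A : ℤ → Module.End ℂ V := fun n => φ.symm.toLinearMap ∘ₗ S'.mode (φ a) n ∘ₗ φ.toLinearMap
  have hA' (n v) : A n v = φ.symm (S'.mode (φ a) n (φ v)) := rfl
  have hA : A ∈ Γ.fields := by
    refine ⟨fun v => ?_, fun n hn => ?_, fun n v => ?_, fun s => ?_⟩
    · obtain ⟨k, hk⟩ := S'.mode_isField (φ a) (φ v)
      exact ⟨k, fun n hn => by rw [hA', hk n hn, map_zero]⟩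
    · rw [hA', hvac, hS'.creation_nonneg _ n hn, map_zero]
    · rw [hA', hA', hA', ← map_smul, ← map_sub, LinearEquiv.eq_symm_apply, hT,
        LinearEquiv.apply_symm_apply, hT, hS'.translation]
    · obtain ⟨G', h1, h2⟩ := hG s
      obtain ⟨k, hk⟩ := h1 (φ a)
      rw [isLocalAt_iff] at hk
      refine ⟨k, isLocalAt_iff.2 fun m n v => φ.injective ?_⟩
      rw [map_zero, ← hk m n (φ v), map_sum]
      refine Finset.sum_congr rfl fun i _ => ?_
      rw [map_smul, map_sub, hA', hA', h2, h2, LinearEquiv.apply_symm_apply,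
        LinearEquiv.apply_symm_apply]
  rw [hS, Γ.ofState_eq hA, hA', LinearEquiv.apply_symm_apply]
  rw [hA', hvac, hS'.creation, LinearEquiv.symm_apply_apply]

end VOAData

/-! ### The conformal fields of vacuum modules -/

section Conformal

variable {g s : Type*} [LieRing g] [LieAlgebra ℂ g] [LieRing s] [LieAlgebra ℂ s]
  {B : InvForm g} {B' : InvForm s} {c₁ c₂ c k : ℂ}

/-- `IsAffineVOA` does not prescribe the field of the conformal vector. But both operators kill the
vacuum and have the same commutators with the x(n), so they agree on everything generated from it.
-/
lemma IsAffineVOA.translation_eq [FiniteDimensional ℂ g] {S : VOAData (VAffine B c)}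
    (h : IsAffineVOA B c k S) (hk : IsDualCoxeter B k) (hc : c + k ≠ 0) :
    S.L (-1) = (VAffine.rep B c).sug k (-1) := by
  refine LinearMap.ext fun v => ?_
  let X : Submodule ℂ (VAffine B c) := LinearMap.ker (S.L (-1) - (VAffine.rep B c).sug k (-1))
  have hX (v) : v ∈ X ↔ S.L (-1) v = (VAffine.rep B c).sug k (-1) v := by
    rw [LinearMap.mem_ker, LinearMap.sub_apply, sub_eq_zero]
  have : X = ⊤ := by
    refine (VAffine.fields hk hc).span_all X ((hX _).2 ?_) fun x n v hv => ?_
    · have := h.isVOA.creation_nonneg S.conf 0 le_rfl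
      rw [h.vac] at this
      exact this.trans (VAffine.fields hk hc).T_vac.symm
    · rw [hX] at hv ⊢
      have h1 := h.isVOA.isTranslationCovariant.translation (act (Affine.el B x (-1)) S.vac) n v
      rw [h.field, h.field, hv] at h1
      exact h1.trans ((VAffine.fields hk hc).translation x n v).symm
  exact (hX v).1 (this ▸ Submodule.mem_top)

lemma IsFBarVOA.mode_eq {S : VOAData (VFBar B B' c₁ c₂ c)} (h : IsFBarVOA B B' c₁ c₂ c S)
    (a : VFBar B B' c₁ c₂ c) (n : ℤ) :
    S.mode a n = ((VFBar.fields B B' c₁ c₂ c).ofState a).1 n := by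
  refine (VFBar.fields B B' c₁ c₂ c).mode_eq_ofState h.isVOA h.vac (h.field_vir (-1)) (fun i => ?_) a n
  rcases i with (x | x) | ⟨⟩
  · exact ⟨_, h.field_fst x⟩
  · exact ⟨_, h.field_snd x⟩
  · refine ⟨S.conf, fun n => ?_⟩
    have := h.field_vir (n - 1)
    rw [VOAData.L, sub_add_cancel] at this
    exact this

end Conformal

end

end TorVOA


namespace TorVOA

noncomputable section

/-! ### Tensor products of representations -/

section TensorRep

variable {g s : Type*} [LieRing g] [LieAlgebra ℂ g] [LieRing s] [LieAlgebra ℂ s]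
  {B : InvForm g} {B' : InvForm s} {c₁ c₂ c k : ℂ}
  {M M' N : Type*} [AddCommGroup M] [Module ℂ M] [AddCommGroup M'] [Module ℂ M']
  [AddCommGroup N] [Module ℂ N]

/-- The action of `ĝ` on the first factor of a tensor product. -/
def LoopRep.rTensor (R : LoopRep B c M) (N : Type*) [AddCommGroup N] [Module ℂ N] :
    LoopRep B c (M ⊗[ℂ] N) where
  op n := LinearMap.rTensorHom N ∘ₗ R.op n
  comm m n x y t := by
    simp only [LinearMap.comp_apply, LinearMap.coe_rTensorHom]
    induction t using TensorProduct.induction_on with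
    | zero => simp
    | add t u ht hu =>
      simp only [map_add]
      linear_combination (norm := module) ht + hu
    | tmul v w =>
      simp only [LinearMap.rTensor_tmul]
      rw [R.comm m n, TensorProduct.add_tmul, TensorProduct.add_tmul, TensorProduct.smul_tmul']
  smooth t := by
    simp only [LinearMap.comp_apply, LinearMap.coe_rTensorHom]
    induction t using TensorProduct.induction_on with
    | zero => exact ⟨0, fun n _ x => map_zero _⟩
    | add t u ht hu =>
      obtain ⟨k, hk⟩ := ht
      obtain ⟨l, hl⟩ := hu
      exact ⟨max k l, fun n hn x => by rw [map_add, hk n (by omega), hl n (by omega), add_zero]⟩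
    | tmul v w =>
      obtain ⟨k, hk⟩ := R.smooth v
      exact ⟨k, fun n hn x => by rw [LinearMap.rTensor_tmul, hk n hn, TensorProduct.zero_tmul]⟩

/-- The action of `ĝ` on the second factor of a tensor product. -/
def LoopRep.lTensor (R : LoopRep B c M) (N : Type*) [AddCommGroup N] [Module ℂ N] :
    LoopRep B c (N ⊗[ℂ] M) where
  op n := LinearMap.lTensorHom N ∘ₗ R.op n
  comm m n x y t := by
    simp only [LinearMap.comp_apply, LinearMap.coe_lTensorHom]
    induction t using TensorProduct.induction_on with
    | zero => simp
    | add t u ht hu =>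
      simp only [map_add]
      linear_combination (norm := module) ht + hu
    | tmul v w =>
      simp only [LinearMap.lTensor_tmul]
      rw [R.comm m n, TensorProduct.tmul_add, TensorProduct.tmul_add, TensorProduct.tmul_smul]
  smooth t := by
    simp only [LinearMap.comp_apply, LinearMap.coe_lTensorHom]
    induction t using TensorProduct.induction_on with
    | zero => exact ⟨0, fun n _ x => map_zero _⟩
    | add t u ht hu =>
      obtain ⟨k, hk⟩ := ht
      obtain ⟨l, hl⟩ := hu
      exact ⟨max k l, fun n hn x => by rw [map_add, hk n (by omega), hl n (by omega), add_zero]⟩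
    | tmul w v =>
      obtain ⟨k, hk⟩ := R.smooth v
      exact ⟨k, fun n hn x => by rw [LinearMap.lTensor_tmul, hk n hn, TensorProduct.tmul_zero]⟩

/-- The action of the Virasoro algebra on the second factor of a tensor product. -/
def VirRep.lTensor (R : VirRep c M) (N : Type*) [AddCommGroup N] [Module ℂ N] :
    VirRep c (N ⊗[ℂ] M) where
  op n := (R.op n).lTensor N
  comm m n t := by
    induction t using TensorProduct.induction_on with
    | zero => simp
    | add t u ht hu =>
      simp only [map_add]
      linear_combination (norm := module) ht + hu
    | tmul v w =>
      simp only [LinearMap.lTensor_tmul]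
      rw [R.comm m n, TensorProduct.tmul_add, TensorProduct.tmul_add, TensorProduct.tmul_smul,
        TensorProduct.tmul_smul]

lemma LoopRep.rTensor_op (R : LoopRep B c M) (n : ℤ) (x : g) :
    (R.rTensor N).op n x = (R.op n x).rTensor N := rfl

lemma LoopRep.lTensor_op (R : LoopRep B c M) (n : ℤ) (x : g) :
    (R.lTensor N).op n x = (R.op n x).lTensor N := rfl

lemma VirRep.lTensor_op (R : VirRep c M) (n : ℤ) : (R.lTensor N).op n = (R.op n).lTensor N := rfl

lemma LoopRep.rTensor_sug [FiniteDimensional ℂ g] (R : LoopRep B c M) (n : ℤ) :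
    (R.rTensor N).sug k n = (R.sug k n).rTensor N :=
  TensorProduct.ext' fun v w => (R.map_sug (R.rTensor N) ((TensorProduct.mk ℂ M N).flip w)
    (fun _ _ _ => rfl) k n v).symm

lemma LoopRep.lTensor_sug [FiniteDimensional ℂ g] (R : LoopRep B c M) (n : ℤ) :
    (R.lTensor N).sug k n = (R.sug k n).lTensor N :=
  TensorProduct.ext' fun w v => (R.map_sug (R.lTensor N) (TensorProduct.mk ℂ N M w)
    (fun _ _ _ => rfl) k n v).symm

/-- Representations of `ĝ`, `ŝ` and the Virasoro algebra on the factors of a tensor product. -/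
def SplitRep.tensor {M₁ M₂ M₃ : Type*} [AddCommGroup M₁] [Module ℂ M₁] [AddCommGroup M₂]
    [Module ℂ M₂] [AddCommGroup M₃] [Module ℂ M₃] (R₁ : LoopRep B c₁ M₁) (R₂ : LoopRep B' c₂ M₂)
    (R₃ : VirRep c M₃) : SplitRep B B' c₁ c₂ c (M₁ ⊗[ℂ] (M₂ ⊗[ℂ] M₃)) where
  fst := R₁.rTensor _
  snd := (R₂.rTensor _).lTensor _
  vir := (R₃.lTensor _).lTensor _
  fst_snd m n x y t := by
    rw [LoopRep.rTensor_op, LoopRep.lTensor_op, ← LinearMap.comp_apply, LinearMap.rTensor_comp_lTensor,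
      ← LinearMap.comp_apply, LinearMap.lTensor_comp_rTensor]
  vir_fst m n x t := by
    rw [LoopRep.rTensor_op, VirRep.lTensor_op, ← LinearMap.comp_apply,
      LinearMap.lTensor_comp_rTensor, ← LinearMap.comp_apply, LinearMap.rTensor_comp_lTensor]
  vir_snd m n x t := by
    rw [LoopRep.lTensor_op, VirRep.lTensor_op, ← LinearMap.comp_apply, ← LinearMap.lTensor_comp,
      ← LinearMap.comp_apply, ← LinearMap.lTensor_comp, LoopRep.rTensor_op, VirRep.lTensor_op,
      LinearMap.lTensor_comp_rTensor, LinearMap.rTensor_comp_lTensor]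

end TensorRep

/-! ### Intertwining maps -/

section Intertwine

variable {g s : Type*} [LieRing g] [LieAlgebra ℂ g] [LieRing s] [LieAlgebra ℂ s]
  {B : InvForm g} {B' : InvForm s} {c₁ c₂ c k : ℂ}
  {M M' N : Type*} [AddCommGroup M] [Module ℂ M] [AddCommGroup M'] [Module ℂ M']
  [AddCommGroup N] [Module ℂ N]

lemma LoopRep.map_lin (R : LoopRep B c M) (R' : LoopRep B c M') (f : M →ₗ[ℂ] M')
    (hf : ∀ n x v, f (R.op n x v) = R'.op n x (f v)) (a : Affine B) (v : M) :
    f (R.lin a v) = R'.lin a (f v) := by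
  have : (⊤ : Submodule ℂ (Affine B)) ≤
      LinearMap.eqLocus (f ∘ₗ R.lin.flip v) (R'.lin.flip (f v)) := by
    rw [← Affine.span_eq_top, sup_le_iff, iSup_le_iff, Submodule.span_singleton_le_iff_mem]
    refine ⟨fun n => ?_, ?_⟩
    · rintro _ ⟨x, rfl⟩
      simpa [LinearMap.mem_eqLocus] using hf n x v
    · simp [LinearMap.mem_eqLocus]
  exact this (Submodule.mem_top (x := a))

lemma VirRep.map_lin (R : VirRep c M) (R' : VirRep c M') (f : M →ₗ[ℂ] M')
    (hf : ∀ n v, f (R.op n v) = R'.op n (f v)) (a : Virasoro) (v : M) :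
    f (R.lin a v) = R'.lin a (f v) := by
  have : (⊤ : Submodule ℂ Virasoro) ≤
      LinearMap.eqLocus (f ∘ₗ R.lin.flip v) (R'.lin.flip (f v)) := by
    rw [← Virasoro.span_eq_top, sup_le_iff, iSup_le_iff, Submodule.span_singleton_le_iff_mem]
    refine ⟨fun n => ?_, ?_⟩
    · rw [Submodule.span_singleton_le_iff_mem]
      simpa [LinearMap.mem_eqLocus] using hf n v
    · simp [LinearMap.mem_eqLocus]
  exact this (Submodule.mem_top (x := a))

lemma FBarRep.map_lin (R : FBarRep B B' c₁ c₂ c M) (R' : FBarRep B B' c₁ c₂ c M') (f : M →ₗ[ℂ] M')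
    (h₁ : ∀ n x v, f (R.fst.op n x v) = R'.fst.op n x (f v))
    (h₂ : ∀ n x v, f (R.snd.op n x v) = R'.snd.op n x (f v))
    (h₃ : ∀ n v, f (R.vir.op n v) = R'.vir.op n (f v)) (a : FBar B B') (v : M) :
    f (R.lin a v) = R'.lin a (f v) := by
  simp only [FBarRep.lin, LinearMap.coe_mk, AddHom.coe_mk, LinearMap.add_apply, map_add,
    R.fst.map_lin R'.fst f h₁, R.snd.map_lin R'.snd f h₂, R.vir.map_lin R'.vir f h₃]

lemma LoopRep.lin_eq_act [Module (UniversalEnvelopingAlgebra ℂ (Affine B)) M]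
    [IsScalarTower ℂ (UniversalEnvelopingAlgebra ℂ (Affine B)) M] (R : LoopRep B c M)
    (hR : ∀ n x, R.op n x = act (Affine.el B x n)) (hC : ∀ v : M, act (Affine.C B) v = c • v)
    (a : Affine B) : R.lin a = act a := by
  have : (⊤ : Submodule ℂ (Affine B)) ≤ LinearMap.eqLocus R.lin (actRep _ M) := by
    rw [← Affine.span_eq_top, sup_le_iff, iSup_le_iff, Submodule.span_singleton_le_iff_mem]
    refine ⟨fun n => ?_, ?_⟩
    · rintro _ ⟨x, rfl⟩
      simpa [LinearMap.mem_eqLocus] using hR n x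
    · rw [LinearMap.mem_eqLocus, LoopRep.lin_C]
      exact LinearMap.ext fun v => (hC v).symm
  exact this (Submodule.mem_top (x := a))

lemma VirRep.lin_eq_act [Module (UniversalEnvelopingAlgebra ℂ Virasoro) M]
    [IsScalarTower ℂ (UniversalEnvelopingAlgebra ℂ Virasoro) M] (R : VirRep c M)
    (hR : ∀ n, R.op n = act (Virasoro.L n)) (hC : ∀ v : M, act Virasoro.C v = c • v)
    (a : Virasoro) : R.lin a = act a := by
  have : (⊤ : Submodule ℂ Virasoro) ≤ LinearMap.eqLocus R.lin (actRep _ M) := by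
    rw [← Virasoro.span_eq_top, sup_le_iff, iSup_le_iff, Submodule.span_singleton_le_iff_mem]
    refine ⟨fun n => ?_, ?_⟩
    · rw [Submodule.span_singleton_le_iff_mem]
      simpa [LinearMap.mem_eqLocus] using hR n
    · rw [LinearMap.mem_eqLocus, VirRep.lin_C]
      exact LinearMap.ext fun v => (hC v).symm
  exact this (Submodule.mem_top (x := a))

lemma FBarRep.lin_eq_act [Module (UniversalEnvelopingAlgebra ℂ (FBar B B')) M]
    [IsScalarTower ℂ (UniversalEnvelopingAlgebra ℂ (FBar B B')) M] (R : FBarRep B B' c₁ c₂ c M)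
    (h₁ : ∀ n x, R.fst.op n x = act (FBar.ofFst B B' (.el B x n)))
    (h₂ : ∀ n x, R.snd.op n x = act (FBar.ofSnd B B' (.el B' x n)))
    (h₃ : ∀ n, R.vir.op n = act (FBar.ofVir B B' (.L n)))
    (hC₁ : ∀ v : M, act (FBar.ofFst B B' (.C B)) v = c₁ • v)
    (hC₂ : ∀ v : M, act (FBar.ofSnd B B' (.C B')) v = c₂ • v)
    (hC₃ : ∀ v : M, act (FBar.ofVir B B' .C) v = c • v) (a : FBar B B') : R.lin a = act a := by
  have : (⊤ : Submodule ℂ (FBar B B')) ≤ LinearMap.eqLocus R.lin (actRep _ M) := by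
    rw [← FBar.span_degMap B B', sup_le_iff, iSup_le_iff, Submodule.span_le]
    refine ⟨fun n => ?_, ?_⟩
    · rintro _ ⟨p, rfl⟩
      rw [LinearMap.mem_eqLocus, FBar.degMap_apply]
      simp only [map_add, map_smul, FBarRep.lin_ofFst, FBarRep.lin_ofSnd, FBarRep.lin_ofVir,
        LoopRep.lin_el, VirRep.lin_L, h₁, h₂, h₃, actRep_apply]
    · rintro _ (rfl | rfl | rfl)
      · rw [SetLike.mem_coe, LinearMap.mem_eqLocus, FBarRep.lin_ofFst, LoopRep.lin_C]
        exact LinearMap.ext fun v => (hC₁ v).symm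
      · rw [SetLike.mem_coe, LinearMap.mem_eqLocus, FBarRep.lin_ofSnd, LoopRep.lin_C]
        exact LinearMap.ext fun v => (hC₂ v).symm
      · rw [SetLike.mem_coe, LinearMap.mem_eqLocus, FBarRep.lin_ofVir, VirRep.lin_C]
        exact LinearMap.ext fun v => (hC₃ v).symm
  exact this (Submodule.mem_top (x := a))

end Intertwine

/-! ### Universal properties of vacuum modules -/

section Universal

variable {g s : Type*} [LieRing g] [LieAlgebra ℂ g] [LieRing s] [LieAlgebra ℂ s]
  {B : InvForm g} {B' : InvForm s} {c₁ c₂ c k : ℂ}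
  {M N : Type*} [AddCommGroup M] [Module ℂ M] [AddCommGroup N] [Module ℂ N]

lemma VAffine.lin_eq_act (a : Affine B) : (VAffine.rep B c).lin a = act a :=
  LoopRep.lin_eq_act _ (fun _ _ => rfl) (generates_vac.central (Affine.lie_C B) (by
    rintro _ rfl
    exact VAffine.top_central)) a

lemma VVir.lin_eq_act (a : Virasoro) : (VVir.rep c).lin a = act a :=
  VirRep.lin_eq_act _ (fun _ => rfl) (generates_vac.central Virasoro.lie_C (by
    rintro _ rfl
    exact VVir.top_central)) a

lemma VFBar.lin_eq_act (a : FBar B B') : (VFBar.rep B B' c₁ c₂ c).lin a = act a :=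
  FBarRep.lin_eq_act _ (fun _ _ => rfl) (fun _ _ => rfl) (fun _ => rfl)
    (generates_vac.central FBar.lie_fst_C VFBar.top_central.1)
    (generates_vac.central FBar.lie_snd_C VFBar.top_central.2.1)
    (generates_vac.central FBar.lie_vir_C VFBar.top_central.2.2) a

lemma VAffine.hom_ext (R : LoopRep B c M) {f f' : VAffine B c →ₗ[ℂ] M}
    (hf : ∀ n x v, f ((VAffine.rep B c).op n x v) = R.op n x (f v))
    (hf' : ∀ n x v, f' ((VAffine.rep B c).op n x v) = R.op n x (f' v))
    (h : f (Induced.top _ 1) = f' (Induced.top _ 1)) : f = f' := by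
  refine LinearMap.eqLocus_eq_top.1 (generates_vac _ ?_ fun a v hv => ?_)
  · rintro _ rfl; exact h
  · rw [LinearMap.mem_eqLocus] at hv ⊢
    rw [← VAffine.lin_eq_act, LoopRep.map_lin _ R f hf, LoopRep.map_lin _ R f' hf', hv]

lemma VVir.hom_ext (R : VirRep c M) {f f' : VVir c →ₗ[ℂ] M}
    (hf : ∀ n v, f ((VVir.rep c).op n v) = R.op n (f v))
    (hf' : ∀ n v, f' ((VVir.rep c).op n v) = R.op n (f' v))
    (h : f (Induced.top _ 1) = f' (Induced.top _ 1)) : f = f' := by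
  refine LinearMap.eqLocus_eq_top.1 (generates_vac _ ?_ fun a v hv => ?_)
  · rintro _ rfl; exact h
  · rw [LinearMap.mem_eqLocus] at hv ⊢
    rw [← VVir.lin_eq_act, VirRep.map_lin _ R f hf, VirRep.map_lin _ R f' hf', hv]

lemma VFBar.hom_ext (R : FBarRep B B' c₁ c₂ c M) {f f' : VFBar B B' c₁ c₂ c →ₗ[ℂ] M}
    (h₁ : ∀ n x v, f ((VFBar.rep B B' c₁ c₂ c).fst.op n x v) = R.fst.op n x (f v))
    (h₂ : ∀ n x v, f ((VFBar.rep B B' c₁ c₂ c).snd.op n x v) = R.snd.op n x (f v))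
    (h₃ : ∀ n v, f ((VFBar.rep B B' c₁ c₂ c).vir.op n v) = R.vir.op n (f v))
    (h₁' : ∀ n x v, f' ((VFBar.rep B B' c₁ c₂ c).fst.op n x v) = R.fst.op n x (f' v))
    (h₂' : ∀ n x v, f' ((VFBar.rep B B' c₁ c₂ c).snd.op n x v) = R.snd.op n x (f' v))
    (h₃' : ∀ n v, f' ((VFBar.rep B B' c₁ c₂ c).vir.op n v) = R.vir.op n (f' v))
    (h : f (Induced.top _ 1) = f' (Induced.top _ 1)) : f = f' := by
  refine LinearMap.eqLocus_eq_top.1 (generates_vac _ ?_ fun a v hv => ?_)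
  · rintro _ rfl; exact h
  · rw [LinearMap.mem_eqLocus] at hv ⊢
    rw [← VFBar.lin_eq_act, FBarRep.map_lin _ R f h₁ h₂ h₃, FBarRep.map_lin _ R f' h₁' h₂' h₃', hv]

lemma VVir.exists_lift (R : VirRep c M) (e : M) (he : ∀ n ≥ -1, R.op n e = 0) :
    ∃ F : VVir c →ₗ[ℂ] M, F (Induced.top _ 1) = e ∧ ∀ n v, F ((VVir.rep c).op n v) = R.op n (F v) := by
  obtain ⟨F, h1, h2⟩ := TorVOA.exists_lift (R := VirVacRel c) R.isRep
    (LinearMap.toSpanSingleton ℂ M e) (by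
      rintro p A (⟨n, hn⟩ | _) r
      · rw [VirRep.lin_L, LinearMap.toSpanSingleton_apply, map_smul, he n hn, smul_zero]
        simp
      · rw [VirRep.lin_C]
        simp [smul_smul, mul_comm])
  refine ⟨F, by rw [h1]; simp, fun n v => ?_⟩
  rw [VVir.rep_op, h2, VirRep.lin_L]

lemma VFBar.exists_lift (R : FBarRep B B' c₁ c₂ c M) (e : M)
    (h₁ : ∀ n ≥ 0, ∀ x, R.fst.op n x e = 0) (h₂ : ∀ n ≥ 0, ∀ x, R.snd.op n x e = 0)
    (h₃ : ∀ n ≥ -1, R.vir.op n e = 0) :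
    ∃ F : VFBar B B' c₁ c₂ c →ₗ[ℂ] M, F (Induced.top _ 1) = e ∧
      (∀ n x v, F ((VFBar.rep B B' c₁ c₂ c).fst.op n x v) = R.fst.op n x (F v)) ∧
      (∀ n x v, F ((VFBar.rep B B' c₁ c₂ c).snd.op n x v) = R.snd.op n x (F v)) ∧
      (∀ n v, F ((VFBar.rep B B' c₁ c₂ c).vir.op n v) = R.vir.op n (F v)) := by
  obtain ⟨F, h1, h2⟩ := TorVOA.exists_lift (R := FBarVacRel B B' c₁ c₂ c) R.isRep
    (LinearMap.toSpanSingleton ℂ M e) (by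
      rintro p A (⟨a, A, (⟨x, n, hn⟩ | _)⟩ | ⟨a, A, (⟨x, n, hn⟩ | _)⟩ | ⟨a, A, (⟨n, hn⟩ | _)⟩) r
      · rw [FBarRep.lin_ofFst, LoopRep.lin_el, LinearMap.toSpanSingleton_apply, map_smul, h₁ n hn,
          smul_zero]
        simp
      · rw [FBarRep.lin_ofFst, LoopRep.lin_C]
        simp [smul_smul, mul_comm]
      · rw [FBarRep.lin_ofSnd, LoopRep.lin_el, LinearMap.toSpanSingleton_apply, map_smul, h₂ n hn,
          smul_zero]
        simp
      · rw [FBarRep.lin_ofSnd, LoopRep.lin_C]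
        simp [smul_smul, mul_comm]
      · rw [FBarRep.lin_ofVir, VirRep.lin_L, LinearMap.toSpanSingleton_apply, map_smul, h₃ n hn,
          smul_zero]
        simp
      · rw [FBarRep.lin_ofVir, VirRep.lin_C]
        simp [smul_smul, mul_comm])
  refine ⟨F, by rw [h1]; simp, fun n x v => ?_, fun n x v => ?_, fun n v => ?_⟩
  · rw [VFBar.rep_fst, h2, FBarRep.lin_ofFst, LoopRep.lin_el]
  · rw [VFBar.rep_snd, h2, FBarRep.lin_ofSnd, LoopRep.lin_el]
  · rw [VFBar.rep_vir, h2, FBarRep.lin_ofVir, VirRep.lin_L]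

/-- Composition makes Hom(N, M) a representation of ĝ in which `F` satisfies the vacuum conditions;
uncurrying the induced map gives the claim. Hom(N, M) need not be smooth, so only `IsRep` is used.
-/
lemma VAffine.exists_lift (R : LoopRep B c M) (F : N →ₗ[ℂ] M)
    (hF : ∀ n ≥ 0, ∀ x w, R.op n x (F w) = 0) :
    ∃ F' : VAffine B c ⊗[ℂ] N →ₗ[ℂ] M, (∀ w, F' (Induced.top _ 1 ⊗ₜ w) = F w) ∧
      ∀ n x u w, F' ((VAffine.rep B c).op n x u ⊗ₜ w) = R.op n x (F' (u ⊗ₜ w)) := by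
  obtain ⟨F', h1, h2⟩ := TorVOA.exists_lift (R := AffineVacRel B c)
    (ρ := LinearMap.llcomp ℂ N M M ∘ₗ R.lin) (fun a b G => LinearMap.ext fun w => R.isRep a b (G w))
    (LinearMap.toSpanSingleton ℂ (N →ₗ[ℂ] M) F) (by
      rintro p A (⟨x, n, hn⟩ | _) r
      · refine LinearMap.ext fun w => ?_
        change R.lin _ (r • F w) = ((0 : Module.End ℂ ℂ) r) • F w
        rw [LoopRep.lin_el, map_smul, hF n hn, smul_zero, LinearMap.zero_apply, zero_smul]
      · refine LinearMap.ext fun w => ?_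
        change R.lin _ (r • F w) = (c * r) • F w
        rw [LoopRep.lin_C, LinearMap.smul_apply, Module.End.one_apply, smul_smul])
  refine ⟨TensorProduct.lift F', fun w => ?_, fun n x u w => ?_⟩
  · rw [TensorProduct.lift.tmul, h1, LinearMap.toSpanSingleton_apply, one_smul]
  · rw [TensorProduct.lift.tmul, VAffine.rep_op, h2, TensorProduct.lift.tmul]
    change R.lin _ (F' u w) = _
    rw [LoopRep.lin_el]

/-- The universal property of the tensor product of vacuum modules. -/
lemma SplitRep.exists_lift (R : SplitRep B B' c₁ c₂ c M) (e : M)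
    (h₁ : ∀ n ≥ 0, ∀ x, R.fst.op n x e = 0) (h₂ : ∀ n ≥ 0, ∀ x, R.snd.op n x e = 0)
    (h₃ : ∀ n ≥ -1, R.vir.op n e = 0) :
    ∃ F : VAffine B c₁ ⊗[ℂ] (VAffine B' c₂ ⊗[ℂ] VVir c) →ₗ[ℂ] M,
      F (Induced.top _ 1 ⊗ₜ (Induced.top _ 1 ⊗ₜ Induced.top _ 1)) = e ∧
      (∀ n x u v w, F ((VAffine.rep B c₁).op n x u ⊗ₜ (v ⊗ₜ w)) = R.fst.op n x (F (u ⊗ₜ (v ⊗ₜ w)))) ∧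
      (∀ n x u v w, F (u ⊗ₜ ((VAffine.rep B' c₂).op n x v ⊗ₜ w)) = R.snd.op n x (F (u ⊗ₜ (v ⊗ₜ w)))) ∧
      (∀ n u v w, F (u ⊗ₜ (v ⊗ₜ (VVir.rep c).op n w)) = R.vir.op n (F (u ⊗ₜ (v ⊗ₜ w)))) := by
  -- The map is built one tensor factor at a time, beginning with the Virasoro factor.
  obtain ⟨F₃, a1, a2⟩ := VVir.exists_lift R.vir e h₃
  -- An operator killing e and commuting with the Virasoro action kills the image of `F₃`. Applied
  -- to the modes x(n), n ≥ 0, it provides the vacuum conditions for the next factor.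
  have hz3 (D : Module.End ℂ M) (hD : ∀ n v, D (R.vir.op n v) = R.vir.op n (D v)) (he : D e = 0) (w) :
      D (F₃ w) = 0 := by
    have : D ∘ₗ F₃ = 0 := VVir.hom_ext R.vir
      (fun n v => by rw [LinearMap.comp_apply, a2, hD]; rfl)
      (fun n v => by simp) (by rw [LinearMap.comp_apply, a1, he]; rfl)
    exact LinearMap.congr_fun this w
  obtain ⟨F₂, b1, b2⟩ := VAffine.exists_lift R.snd F₃ fun n hn x w =>
    hz3 _ (fun m v => (R.vir_snd m n x v).symm) (h₂ n hn x) w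
  have hz2 (D : Module.End ℂ M) (hD : ∀ n v, D (R.vir.op n v) = R.vir.op n (D v))
      (hD' : ∀ n x v, D (R.snd.op n x v) = R.snd.op n x (D v)) (he : D e = 0) (t) :
      D (F₂ t) = 0 := by
    have : D ∘ₗ F₂ = 0 := TensorProduct.ext' fun v w => by
      have : D ∘ₗ F₂ ∘ₗ (TensorProduct.mk ℂ _ _).flip w = 0 := VAffine.hom_ext R.snd
        (fun n x v => by
          simp only [LinearMap.comp_apply, LinearMap.flip_apply, TensorProduct.mk_apply]
          rw [b2, hD'])
        (fun n x v => by simp)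
        (by
          simp only [LinearMap.comp_apply, LinearMap.flip_apply, TensorProduct.mk_apply]
          rw [b1, hz3 D hD he]; rfl)
      exact LinearMap.congr_fun this v
    exact LinearMap.congr_fun this t
  have b3 (n v w) : F₂ (v ⊗ₜ (VVir.rep c).op n w) = R.vir.op n (F₂ (v ⊗ₜ w)) := by
    have : F₂ ∘ₗ (TensorProduct.mk ℂ _ _).flip ((VVir.rep c).op n w) =
        R.vir.op n ∘ₗ F₂ ∘ₗ (TensorProduct.mk ℂ _ _).flip w := VAffine.hom_ext R.snd
      (fun m x v => by
        simp only [LinearMap.comp_apply, LinearMap.flip_apply, TensorProduct.mk_apply]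
        rw [b2])
      (fun m x v => by
        simp only [LinearMap.comp_apply, LinearMap.flip_apply, TensorProduct.mk_apply]
        rw [b2, R.vir_snd])
      (by
        simp only [LinearMap.comp_apply, LinearMap.flip_apply, TensorProduct.mk_apply]
        rw [b1, b1, a2])
    exact LinearMap.congr_fun this v
  obtain ⟨F₁, d1, d2⟩ := VAffine.exists_lift R.fst F₂ fun n hn x w =>
    hz2 _ (fun m v => (R.vir_fst m n x v).symm) (fun m y v => R.fst_snd n m x y v) (h₁ n hn x) w
  -- What `F₂` intertwines, `F₁` does too: both sides are homomorphisms from the first factor that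
  -- agree on its vacuum.
  have key (D : Module.End ℂ (VAffine B' c₂ ⊗[ℂ] VVir c)) (D' : Module.End ℂ M)
      (hD' : ∀ n x v, D' (R.fst.op n x v) = R.fst.op n x (D' v)) (h : ∀ t, F₂ (D t) = D' (F₂ t))
      (u t) : F₁ (u ⊗ₜ D t) = D' (F₁ (u ⊗ₜ t)) := by
    have : F₁ ∘ₗ (TensorProduct.mk ℂ _ _).flip (D t) =
        D' ∘ₗ F₁ ∘ₗ (TensorProduct.mk ℂ _ _).flip t := VAffine.hom_ext R.fst
      (fun m x v => by
        simp only [LinearMap.comp_apply, LinearMap.flip_apply, TensorProduct.mk_apply]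
        rw [d2])
      (fun m x v => by
        simp only [LinearMap.comp_apply, LinearMap.flip_apply, TensorProduct.mk_apply]
        rw [d2, hD'])
      (by
        simp only [LinearMap.comp_apply, LinearMap.flip_apply, TensorProduct.mk_apply]
        rw [d1, d1, h])
    exact LinearMap.congr_fun this u
  refine ⟨F₁, by rw [d1, b1, a1], fun n x u v w => d2 n x u _, fun n x u v w => ?_,
    fun n u v w => ?_⟩
  · refine key (((VAffine.rep B' c₂).op n x).rTensor _) _ (fun m y v => (R.fst_snd m n y x v).symm)
      (fun t => ?_) u (v ⊗ₜ w)
    have : F₂ ∘ₗ ((VAffine.rep B' c₂).op n x).rTensor _ = R.snd.op n x ∘ₗ F₂ :=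
      TensorProduct.ext' fun v w => b2 n x v w
    exact LinearMap.congr_fun this t
  · refine key (((VVir.rep c).op n).lTensor _) _ (fun m y v => R.vir_fst n m y v)
      (fun t => ?_) u (v ⊗ₜ w)
    have : F₂ ∘ₗ ((VVir.rep c).op n).lTensor _ = R.vir.op n ∘ₗ F₂ :=
      TensorProduct.ext' fun v w => b3 n v w
    exact LinearMap.congr_fun this t

lemma SplitRep.hom_ext (R : SplitRep B B' c₁ c₂ c M)
    {f f' : VAffine B c₁ ⊗[ℂ] (VAffine B' c₂ ⊗[ℂ] VVir c) →ₗ[ℂ] M}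
    (h₁ : ∀ n x u v w, f ((VAffine.rep B c₁).op n x u ⊗ₜ (v ⊗ₜ w)) = R.fst.op n x (f (u ⊗ₜ (v ⊗ₜ w))))
    (h₂ : ∀ n x u v w, f (u ⊗ₜ ((VAffine.rep B' c₂).op n x v ⊗ₜ w)) = R.snd.op n x (f (u ⊗ₜ (v ⊗ₜ w))))
    (h₃ : ∀ n u v w, f (u ⊗ₜ (v ⊗ₜ (VVir.rep c).op n w)) = R.vir.op n (f (u ⊗ₜ (v ⊗ₜ w))))
    (h₁' : ∀ n x u v w,
      f' ((VAffine.rep B c₁).op n x u ⊗ₜ (v ⊗ₜ w)) = R.fst.op n x (f' (u ⊗ₜ (v ⊗ₜ w))))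
    (h₂' : ∀ n x u v w,
      f' (u ⊗ₜ ((VAffine.rep B' c₂).op n x v ⊗ₜ w)) = R.snd.op n x (f' (u ⊗ₜ (v ⊗ₜ w))))
    (h₃' : ∀ n u v w, f' (u ⊗ₜ (v ⊗ₜ (VVir.rep c).op n w)) = R.vir.op n (f' (u ⊗ₜ (v ⊗ₜ w))))
    (h : f (Induced.top _ 1 ⊗ₜ (Induced.top _ 1 ⊗ₜ Induced.top _ 1)) =
      f' (Induced.top _ 1 ⊗ₜ (Induced.top _ 1 ⊗ₜ Induced.top _ 1))) : f = f' := by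
  have e3 (w) : f (Induced.top _ 1 ⊗ₜ (Induced.top _ 1 ⊗ₜ w)) =
      f' (Induced.top _ 1 ⊗ₜ (Induced.top _ 1 ⊗ₜ w)) := by
    have := VVir.hom_ext R.vir
      (f := f ∘ₗ TensorProduct.mk ℂ _ _ (Induced.top _ 1) ∘ₗ TensorProduct.mk ℂ _ _ (Induced.top _ 1))
      (f' := f' ∘ₗ TensorProduct.mk ℂ _ _ (Induced.top _ 1) ∘ₗ TensorProduct.mk ℂ _ _ (Induced.top _ 1))
      (fun n v => h₃ n _ _ _) (fun n v => h₃' n _ _ _) h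
    exact LinearMap.congr_fun this w
  have e2 (v w) : f (Induced.top _ 1 ⊗ₜ (v ⊗ₜ w)) = f' (Induced.top _ 1 ⊗ₜ (v ⊗ₜ w)) := by
    have := VAffine.hom_ext R.snd
      (f := f ∘ₗ TensorProduct.mk ℂ _ _ (Induced.top _ 1) ∘ₗ (TensorProduct.mk ℂ _ _).flip w)
      (f' := f' ∘ₗ TensorProduct.mk ℂ _ _ (Induced.top _ 1) ∘ₗ (TensorProduct.mk ℂ _ _).flip w)
      (fun n x v => h₂ n x _ _ _) (fun n x v => h₂' n x _ _ _) (e3 w)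
    exact LinearMap.congr_fun this v
  refine TensorProduct.ext_threefold' fun u v w => ?_
  have := VAffine.hom_ext R.fst
    (f := f ∘ₗ (TensorProduct.mk ℂ _ _).flip (v ⊗ₜ w))
    (f' := f' ∘ₗ (TensorProduct.mk ℂ _ _).flip (v ⊗ₜ w))
    (fun n x v => h₁ n x _ _ _) (fun n x v => h₁' n x _ _ _) (e2 v w)
  exact LinearMap.congr_fun this u

end Universal

/-! ### The decomposition of the vertex operator algebra of `f̄` -/

section Decomposition

variable {g s : Type*} [LieRing g] [LieAlgebra ℂ g] [LieRing s] [LieAlgebra ℂ s]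
  [FiniteDimensional ℂ g] [FiniteDimensional ℂ s]
  {B : InvForm g} {B' : InvForm s} {c₁ c₂ c c' k₁ k₂ : ℂ}

/-- The central charge occurs in the type, so it is kept as a variable subject to an equation. -/
lemma FBarRep.exists_splitRep {M : Type*} [AddCommGroup M] [Module ℂ M]
    (R : FBarRep B B' c₁ c₂ c M) (hk₁ : IsDualCoxeter B k₁)
    (hk₂ : IsDualCoxeter B' k₂) (hc₁ : c₁ + k₁ ≠ 0) (hc₂ : c₂ + k₂ ≠ 0)
    (hc : c' = c - c₁ * (Module.finrank ℂ g : ℂ) / (c₁ + k₁) -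
      c₂ * (Module.finrank ℂ s : ℂ) / (c₂ + k₂)) :
    ∃ S : SplitRep B B' c₁ c₂ c' M, S.fst = R.fst ∧ S.snd = R.snd ∧
      ∀ n v, R.vir.op n v = R.fst.sug k₁ n v + (R.snd.sug k₂ n v + S.vir.op n v) := by
  subst hc
  refine ⟨R.toSplitRep hk₁ hk₂ hc₁ hc₂, rfl, rfl, fun n v => ?_⟩
  change _ = _ + (_ + (R.vir.op n v - R.fst.sug k₁ n v - R.snd.sug k₂ n v))
  abel

lemma SplitRep.exists_fBarRep {M : Type*} [AddCommGroup M] [Module ℂ M]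
    (R : SplitRep B B' c₁ c₂ c' M) (hk₁ : IsDualCoxeter B k₁)
    (hk₂ : IsDualCoxeter B' k₂) (hc₁ : c₁ + k₁ ≠ 0) (hc₂ : c₂ + k₂ ≠ 0)
    (hc : c' = c - c₁ * (Module.finrank ℂ g : ℂ) / (c₁ + k₁) -
      c₂ * (Module.finrank ℂ s : ℂ) / (c₂ + k₂)) :
    ∃ S : FBarRep B B' c₁ c₂ c M, S.fst = R.fst ∧ S.snd = R.snd ∧
      ∀ n, S.vir.op n = R.fst.sug k₁ n + (R.snd.sug k₂ n + R.vir.op n) := by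
  obtain rfl : c = c₁ * (Module.finrank ℂ g : ℂ) / (c₁ + k₁) +
      (c₂ * (Module.finrank ℂ s : ℂ) / (c₂ + k₂) + c') := by rw [hc]; ring
  exact ⟨R.toFBarRep hk₁ hk₂ hc₁ hc₂, rfl, rfl, fun n => rfl⟩

set_option maxHeartbeats 1000000 in
/-- The decomposition of the vacuum module of `f̄`. -/
theorem exists_vacuum_equiv (hk₁ : IsDualCoxeter B k₁) (hk₂ : IsDualCoxeter B' k₂)
    (hc₁ : c₁ + k₁ ≠ 0) (hc₂ : c₂ + k₂ ≠ 0)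
    (hc : c' = c - c₁ * (Module.finrank ℂ g : ℂ) / (c₁ + k₁) -
      c₂ * (Module.finrank ℂ s : ℂ) / (c₂ + k₂)) :
    ∃ φ : VFBar B B' c₁ c₂ c ≃ₗ[ℂ] VAffine B c₁ ⊗[ℂ] (VAffine B' c₂ ⊗[ℂ] VVir c'),
      φ (Induced.top _ 1) = Induced.top _ 1 ⊗ₜ (Induced.top _ 1 ⊗ₜ Induced.top _ 1) ∧
      (∀ n x v, φ ((VFBar.rep B B' c₁ c₂ c).fst.op n x v) =
        ((VAffine.rep B c₁).op n x).rTensor _ (φ v)) ∧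
      (∀ n x v, φ ((VFBar.rep B B' c₁ c₂ c).snd.op n x v) =
        (((VAffine.rep B' c₂).op n x).rTensor _).lTensor _ (φ v)) ∧
      (∀ n v, φ ((VFBar.rep B B' c₁ c₂ c).vir.op n v) =
        (((VAffine.rep B c₁).sug k₁ n).rTensor _ + (((VAffine.rep B' c₂).sug k₂ n).rTensor _ +
          ((VVir.rep c').op n).lTensor _).lTensor _) (φ v)) := by
  let Q := SplitRep.tensor (VAffine.rep B c₁) (VAffine.rep B' c₂) (VVir.rep c')
  obtain ⟨P, hP₁, hP₂, hP₃⟩ := Q.exists_fBarRep (c := c) hk₁ hk₂ hc₁ hc₂ hc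
  obtain ⟨S, hS₁, hS₂, hS₃⟩ := (VFBar.rep B B' c₁ c₂ c).exists_splitRep hk₁ hk₂ hc₁ hc₂ hc
  have hPv (n) : P.vir.op n = ((VAffine.rep B c₁).sug k₁ n).rTensor _ +
      (((VAffine.rep B' c₂).sug k₂ n).rTensor _ + ((VVir.rep c').op n).lTensor _).lTensor _ := by
    rw [hP₃]
    simp only [Q, SplitRep.tensor]
    rw [LoopRep.rTensor_sug, LoopRep.lTensor_sug, LoopRep.rTensor_sug, LinearMap.lTensor_add]
    rfl
  have hsug₁ (n : ℤ) (hn : -1 ≤ n) : (VAffine.rep B c₁).sug k₁ n (Induced.top _ 1) = 0 :=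
    (VAffine.rep B c₁).sug_vac (fun _ hn => VAffine.rep_vac hn) hn
  have hsug₂ (n : ℤ) (hn : -1 ≤ n) : (VAffine.rep B' c₂).sug k₂ n (Induced.top _ 1) = 0 :=
    (VAffine.rep B' c₂).sug_vac (fun _ hn => VAffine.rep_vac hn) hn
  -- The tensor product of the vacua satisfies the vacuum conditions for f̄; in particular the three
  -- summands of L(n) kill it for n ≥ -1.
  obtain ⟨φ, f0, f1, f2, f3⟩ := VFBar.exists_lift P
    (Induced.top _ 1 ⊗ₜ (Induced.top _ 1 ⊗ₜ Induced.top _ 1))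
    (fun n hn x => by
      rw [hP₁]
      change (VAffine.rep B c₁).op n x _ ⊗ₜ _ = _
      rw [VAffine.rep_vac hn, TensorProduct.zero_tmul])
    (fun n hn x => by
      rw [hP₂]
      change _ ⊗ₜ ((VAffine.rep B' c₂).op n x _ ⊗ₜ _) = _
      rw [VAffine.rep_vac hn, TensorProduct.zero_tmul, TensorProduct.tmul_zero])
    (fun n hn => by
      rw [hPv]
      simp only [LinearMap.add_apply, LinearMap.rTensor_tmul, LinearMap.lTensor_tmul]
      rw [hsug₁ n hn, hsug₂ n hn, VVir.rep_vac hn]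
      simp)
  have hv₁ (n : ℤ) (hn : -1 ≤ n) :
      (VFBar.rep B B' c₁ c₂ c).fst.sug k₁ n (Induced.top _ 1) = 0 :=
    LoopRep.sug_vac _ (fun _ hn x => VFBar.top_fst hn x) hn
  have hv₂ (n : ℤ) (hn : -1 ≤ n) :
      (VFBar.rep B B' c₁ c₂ c).snd.sug k₂ n (Induced.top _ 1) = 0 :=
    LoopRep.sug_vac _ (fun _ hn x => VFBar.top_snd hn x) hn
  -- Conversely, the vacuum of f̄ is a vacuum for the coset Virasoro operators, since L(n) and both
  -- Sugawara operators kill it for n ≥ -1.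
  obtain ⟨ψ, p0, p1, p2, p3⟩ := S.exists_lift (Induced.top _ 1)
    (fun n hn x => by rw [hS₁]; exact VFBar.top_fst hn x)
    (fun n hn x => by rw [hS₂]; exact VFBar.top_snd hn x)
    (fun n hn => by
      have := hS₃ n (Induced.top _ 1)
      rw [hv₁ n hn, hv₂ n hn, zero_add, zero_add] at this
      rw [← this]
      exact VFBar.top_vir hn)
  have q1 (n x t) : ψ (P.fst.op n x t) = (VFBar.rep B B' c₁ c₂ c).fst.op n x (ψ t) := by
    rw [hP₁, ← hS₁]
    have : ψ ∘ₗ Q.fst.op n x = S.fst.op n x ∘ₗ ψ :=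
      TensorProduct.ext_threefold' fun u v w => p1 n x u v w
    exact LinearMap.congr_fun this t
  have q2 (n x t) : ψ (P.snd.op n x t) = (VFBar.rep B B' c₁ c₂ c).snd.op n x (ψ t) := by
    rw [hP₂, ← hS₂]
    have : ψ ∘ₗ Q.snd.op n x = S.snd.op n x ∘ₗ ψ :=
      TensorProduct.ext_threefold' fun u v w => p2 n x u v w
    exact LinearMap.congr_fun this t
  -- A map commuting with the loops commutes with the Sugawara operators, so intertwining the coset
  -- operators amounts to intertwining the L(n).
  have q3 (n t) : ψ (P.vir.op n t) = (VFBar.rep B B' c₁ c₂ c).vir.op n (ψ t) := by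
    have h : ψ ∘ₗ Q.vir.op n = S.vir.op n ∘ₗ ψ :=
      TensorProduct.ext_threefold' fun u v w => p3 n u v w
    rw [hP₃, hS₃]
    simp only [LinearMap.add_apply, map_add]
    rw [← hP₁, ← hP₂, P.fst.map_sug _ ψ q1, P.snd.map_sug _ ψ q2]
    exact congrArg _ (congrArg _ (LinearMap.congr_fun h t))
  -- Both composites are homomorphisms fixing a generating vacuum vector.
  have hψφ : ψ ∘ₗ φ = LinearMap.id := VFBar.hom_ext (VFBar.rep B B' c₁ c₂ c)
    (fun n x v => by rw [LinearMap.comp_apply, f1, q1]; rfl)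
    (fun n x v => by rw [LinearMap.comp_apply, f2, q2]; rfl)
    (fun n v => by rw [LinearMap.comp_apply, f3, q3]; rfl)
    (fun n x v => rfl) (fun n x v => rfl) (fun n v => rfl)
    (by rw [LinearMap.comp_apply, f0, p0]; rfl)
  have r3 (n v) : φ (S.vir.op n v) = Q.vir.op n (φ v) := by
    have h := f3 n v
    rw [hS₃, hP₃, map_add, map_add, LoopRep.map_sug _ P.fst φ f1, LoopRep.map_sug _ P.snd φ f2,
      hP₁, hP₂] at h
    simpa using h
  have hφψ : φ ∘ₗ ψ = LinearMap.id := Q.hom_ext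
    (fun n x u v w => by
      rw [LinearMap.comp_apply, p1, hS₁, f1, hP₁]; rfl)
    (fun n x u v w => by
      rw [LinearMap.comp_apply, p2, hS₂, f2, hP₂]; rfl)
    (fun n u v w => by rw [LinearMap.comp_apply, p3, r3]; rfl)
    (fun n x u v w => rfl) (fun n x u v w => rfl) (fun n u v w => rfl)
    (by rw [LinearMap.comp_apply, p0, f0]; rfl)
  refine ⟨LinearEquiv.ofLinearMap φ ψ hφψ hψφ, f0, fun n x v => ?_, fun n x v => ?_, fun n v => ?_⟩
  · exact (f1 n x v).trans (by rw [hP₁]; rfl)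
  · exact (f2 n x v).trans (by rw [hP₂]; rfl)
  · exact (f3 n v).trans (by rw [hPv]; rfl)

lemma VOAData.LocalWith.add {V : Type*} [AddCommGroup V] [Module ℂ V] {S : VOAData V}
    {G G' : ℤ → Module.End ℂ V} (h : S.LocalWith G) (h' : S.LocalWith G') :
    S.LocalWith fun n => G n + G' n := fun a => ((h a).symm.add (h' a).symm).symm

/-- By uniqueness the fields of `S` are those reconstructed from the generators, and so is the
Sugawara field; reconstructed fields are mutually local. -/
lemma IsAffineVOA.localWith_sug {S : VOAData (VAffine B c)} (h : IsAffineVOA B c k₁ S)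
    (hk : IsDualCoxeter B k₁) (hc : c + k₁ ≠ 0) :
    S.LocalWith fun n => (VAffine.rep B c).sug k₁ (n - 1) := fun a => by
  have h1 : S.mode a = ((VAffine.fields hk hc).ofState a).1 := funext fun n =>
    (VAffine.fields hk hc).mode_eq_ofState h.isVOA h.vac (h.translation_eq hk hc)
      (fun x => ⟨_, h.field x⟩) a n
  rw [h1, ← (VAffine.fields hk hc).ofState_eq (VAffine.sug_mem hk hc) rfl]
  exact (VAffine.fields hk hc).ofState_isLocal _ _

/-- The vertex operator algebra of `f̄` is the tensor product of two affine vertex operator algebras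
and a Virasoro vertex operator algebra. -/
theorem exists_isIso (hk₁ : IsDualCoxeter B k₁) (hk₂ : IsDualCoxeter B' k₂)
    (hc₁ : c₁ + k₁ ≠ 0) (hc₂ : c₂ + k₂ ≠ 0)
    (hc : c' = c - c₁ * (Module.finrank ℂ g : ℂ) / (c₁ + k₁) -
      c₂ * (Module.finrank ℂ s : ℂ) / (c₂ + k₂)) {S : VOAData (VFBar B B' c₁ c₂ c)}
    {S₁ : VOAData (VAffine B c₁)} {S₂ : VOAData (VAffine B' c₂)} {S₃ : VOAData (VVir c')}
    (hS : IsFBarVOA B B' c₁ c₂ c S) (hS₁ : IsAffineVOA B c₁ k₁ S₁)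
    (hS₂ : IsAffineVOA B' c₂ k₂ S₂) (hS₃ : IsVirVOA c' S₃) :
    ∃ φ, VOAData.IsIso S (S₁.tensor (S₂.tensor S₃)) φ := by
  obtain ⟨φ, f0, f1, f2, f3⟩ := exists_vacuum_equiv hk₁ hk₂ hc₁ hc₂ hc
  have t1 := hS₁.isVOA.isTranslationCovariant
  rw [hS₁.translation_eq hk₁ hc₁] at t1
  have t2 := hS₂.isVOA.isTranslationCovariant
  rw [hS₂.translation_eq hk₂ hc₂] at t2
  have t3 := hS₃.isVOA.isTranslationCovariant
  rw [hS₃.field] at t3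
  have hvac : φ (Induced.top _ 1) = (S₁.tensor (S₂.tensor S₃)).vac := by
    rw [f0]
    change _ = S₁.vac ⊗ₜ (S₂.vac ⊗ₜ S₃.vac)
    rw [hS₁.vac, hS₂.vac, hS₃.vac]
  have l1 (x : g) : S₁.LocalWith fun n => (VAffine.rep B c₁).op n x := by
    have := hS₁.isVOA.localWith (act (Affine.el B x (-1)) S₁.vac)
    rwa [show S₁.mode (act (Affine.el B x (-1)) S₁.vac) = fun n => (VAffine.rep B c₁).op n x from
      funext fun n => hS₁.field x n] at this
  have l2 (x : s) : S₂.LocalWith fun n => (VAffine.rep B' c₂).op n x := by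
    have := hS₂.isVOA.localWith (act (Affine.el B' x (-1)) S₂.vac)
    rwa [show S₂.mode (act (Affine.el B' x (-1)) S₂.vac) = fun n => (VAffine.rep B' c₂).op n x from
      funext fun n => hS₂.field x n] at this
  have l3 : S₃.LocalWith fun n => (VVir.rep c').op (n - 1) := by
    have := hS₃.isVOA.localWith S₃.conf
    rwa [show S₃.mode S₃.conf = fun n => (VVir.rep c').op (n - 1) from funext fun n => by
      rw [VVir.rep_op, ← hS₃.field, VOAData.L, sub_add_cancel]] at this
  refine ⟨φ, fun a v n => VOAData.map_mode_of_generatingFields (VFBar.fields B B' c₁ c₂ c) hS.mode_eq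
    (t1.tensor (t2.tensor t3)) φ hvac (fun v => f3 (-1) v) (fun i => ?_) a v n, ?_, ?_⟩
  · rcases i with (x | x) | ⟨⟩
    · exact ⟨_, (l1 x).rTensor _, fun n v => f1 n x v⟩
    · exact ⟨_, ((l2 x).rTensor _).lTensor _, fun n v => f2 n x v⟩
    · exact ⟨_, ((hS₁.localWith_sug hk₁ hc₁).rTensor _).add
        ((((hS₂.localWith_sug hk₂ hc₂).rTensor _).add (l3.lTensor _)).lTensor _),
        fun n v => f3 (n - 1) v⟩
  · rw [hS.vac, hvac]
  -- Each conformal vector is the mode -2 applied to the vacuum, so the case n = -2 of the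
  -- intertwining relation matches them.
  · have h := f3 (-2) (Induced.top _ 1)
    rw [f0] at h
    simp only [LinearMap.add_apply, LinearMap.rTensor_tmul, LinearMap.lTensor_tmul] at h
    rw [VAffine.sug_vac, VAffine.sug_vac, VVir.rep_op] at h
    rw [hS.conf, hS.vac, ← VFBar.rep_vir, h]
    change _ = S₁.conf ⊗ₜ (S₂.vac ⊗ₜ S₃.vac) + S₁.vac ⊗ₜ (S₂.conf ⊗ₜ S₃.vac + S₂.vac ⊗ₜ S₃.conf)
    rw [hS₁.conf, hS₂.conf, hS₃.conf, hS₁.vac, hS₂.vac, hS₃.vac]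

end Decomposition

end

end TorVOA


namespace TorVOA

noncomputable section

/-! ### Irreducible families of operators -/

section Density

variable {V : Type*} [AddCommGroup V] [Module ℂ V]

/-- The only subspaces that are stable under the operators in `S` are `⊥` and `⊤`. -/
def IsIrreducibleFamily (S : Set (Module.End ℂ V)) : Prop :=
  ∀ K : Submodule ℂ V, (∀ a ∈ S, ∀ v ∈ K, a v ∈ K) → K = ⊥ ∨ K = ⊤

/-- The only operators commuting with those in `S` are the scalars. -/
def HasScalarCommutant (S : Set (Module.End ℂ V)) : Prop :=
  ∀ φ : Module.End ℂ V, (∀ a ∈ S, ∀ v, φ (a v) = a (φ v)) → ∃ μ : ℂ, ∀ v, φ v = μ • v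

/-- Schur's lemma. -/
lemma IsIrreducibleFamily.hasScalarCommutant {S : Set (Module.End ℂ V)} (hS : IsIrreducibleFamily S)
    (F : Submodule ℂ V) [FiniteDimensional ℂ F] (hF : F ≠ ⊥)
    (h : ∀ φ : Module.End ℂ V, (∀ a ∈ S, ∀ v, φ (a v) = a (φ v)) → ∀ v ∈ F, φ v ∈ F) :
    HasScalarCommutant S := by
  intro φ hφ
  have : Nontrivial F := Submodule.nontrivial_iff_ne_bot.2 hF
  -- `V` may be infinite-dimensional, so the eigenvalue is found on the finite-dimensional invariant
  -- space `F`. The eigenspace in `V` is then stable and nonzero.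
  obtain ⟨μ, hμ⟩ := Module.End.exists_eigenvalue (φ.restrict (h φ hφ))
  obtain ⟨w, hw⟩ := hμ.exists_hasEigenvector
  refine ⟨μ, fun v => ?_⟩
  have key : Module.End.eigenspace φ μ = ⊤ := by
    refine (hS (Module.End.eigenspace φ μ) fun a ha v hv => ?_).resolve_left fun hbot => hw.2 ?_
    · rw [Module.End.mem_eigenspace_iff] at hv ⊢
      rw [hφ a ha, hv, map_smul]
    · have hw1 := congrArg Subtype.val hw.apply_eq_smul
      rw [LinearMap.coe_restrict_apply] at hw1
      have : (w : V) ∈ Module.End.eigenspace φ μ := Module.End.mem_eigenspace_iff.2 hw1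
      rw [hbot, Submodule.mem_bot] at this
      exact Subtype.ext this
  exact Module.End.mem_eigenspace_iff.1 (key ▸ Submodule.mem_top)

/-- The density theorem for rank one operators. -/
lemma IsIrreducibleFamily.exists_mem_adjoin {S : Set (Module.End ℂ V)} (hS : IsIrreducibleFamily S)
    (hS' : HasScalarCommutant S) (v : V) (ξ : V →ₗ[ℂ] ℂ) (s : Finset V) :
    ∃ a ∈ Algebra.adjoin ℂ S, ∀ m ∈ s, a m = ξ m • v := by
  by_cases hV : Nontrivial V
  swap
  · rw [not_nontrivial_iff_subsingleton] at hV
    exact ⟨0, Subalgebra.zero_mem _, fun m _ => Subsingleton.elim _ _⟩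
  set A := Algebra.adjoin ℂ S
  have hmem (a) (ha : a ∈ S) : a ∈ A := Algebra.subset_adjoin ha
  have : IsSimpleModule A V := by
    refine (isSimpleModule_iff A V).2 (IsSimpleOrder.of_forall_eq_top fun K hK => ?_)
    have := hS (K.restrictScalars ℂ) fun a ha v hv => K.smul_mem ⟨a, hmem a ha⟩ hv
    rcases this with h | h
    · exact absurd ((Submodule.restrictScalars_eq_bot_iff _ _ _).1 h) hK
    · exact (Submodule.restrictScalars_eq_top_iff _ _ _).1 h
  have hcomm (φ : Module.End A V) : ∃ μ : ℂ, ∀ v, φ v = μ • v :=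
    hS' (φ.restrictScalars ℂ) fun a ha v => φ.map_smul ⟨a, hmem a ha⟩ v
  -- The A-endomorphisms are scalars, so every complex linear map is linear over them, and Jacobson
  -- density realizes it on the finite set by an element of A.
  let f : Module.End (Module.End A V) V :=
    { toFun m := ξ m • v
      map_add' x y := by rw [map_add, add_smul]
      map_smul' φ m := by
        obtain ⟨μ, hμ⟩ := hcomm φ
        change ξ (φ m) • v = φ (ξ m • v)
        rw [hμ, hμ, map_smul, smul_eq_mul, mul_smul] }
  obtain ⟨r, hr⟩ := jacobson_density (R := A) f s
  exact ⟨r, r.2, fun m hm => (hr m hm).symm⟩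

variable {N : Type*} [AddCommGroup N] [Module ℂ N]

lemma rTensor_mem_of_mem_adjoin {S : Set (Module.End ℂ V)} {K : Submodule ℂ (V ⊗[ℂ] N)}
    (hK : ∀ a ∈ S, ∀ t ∈ K, a.rTensor N t ∈ K) {a : Module.End ℂ V} (ha : a ∈ Algebra.adjoin ℂ S)
    {t : V ⊗[ℂ] N} (ht : t ∈ K) : a.rTensor N t ∈ K := by
  induction ha using Algebra.adjoin_induction generalizing t with
  | mem a ha => exact hK a ha t ht
  | algebraMap r =>
    rw [Algebra.algebraMap_eq_smul_one, LinearMap.rTensor_smul, LinearMap.smul_apply]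
    refine K.smul_mem r ?_
    rw [Module.End.one_eq_id, LinearMap.rTensor_id]
    exact ht
  | add a b _ _ ha hb =>
    rw [LinearMap.rTensor_add]
    exact K.add_mem (ha ht) (hb ht)
  | mul a b _ _ ha hb =>
    rw [LinearMap.rTensor_mul]
    exact ha (hb ht)

/-- A nonzero subspace of `V ⊗ N` that is stable under an irreducible family of operators on `V`
contains `V ⊗ n` for some `n ≠ 0`. -/
lemma IsIrreducibleFamily.exists_tmul_mem {S : Set (Module.End ℂ V)} (hS : IsIrreducibleFamily S)
    (hS' : HasScalarCommutant S) {K : Submodule ℂ (V ⊗[ℂ] N)}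
    (hK : ∀ a ∈ S, ∀ t ∈ K, a.rTensor N t ∈ K) (hK' : K ≠ ⊥) :
    ∃ n : N, n ≠ 0 ∧ ∀ v, v ⊗ₜ n ∈ K := by
  obtain ⟨t, ht, ht0⟩ := Submodule.exists_mem_ne_zero_of_ne_bot hK'
  let T (ξ : V →ₗ[ℂ] ℂ) : V ⊗[ℂ] N →ₗ[ℂ] N := (TensorProduct.lid ℂ N).toLinearMap ∘ₗ ξ.rTensor N
  have hT (ξ : V →ₗ[ℂ] ℂ) (v : V) (n : N) : T ξ (v ⊗ₜ n) = ξ v • n := by simp [T]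
  -- Density gives an operator acting as m ↦ ξ(m)v on the finitely many left factors of t. It sends
  -- t to v ⊗ T_ξ(t), where T_ξ is contraction with ξ.
  have h1 (ξ : V →ₗ[ℂ] ℂ) (v : V) : v ⊗ₜ[ℂ] T ξ t ∈ K := by
    obtain ⟨s, hs⟩ := TensorProduct.exists_finset t
    classical
    obtain ⟨a, ha, ha'⟩ := hS.exists_mem_adjoin hS' v ξ (s.image Prod.fst)
    have h2 := rTensor_mem_of_mem_adjoin hK ha ht
    have h3 : a.rTensor N t = v ⊗ₜ T ξ t := by
      rw [hs, map_sum, map_sum, TensorProduct.tmul_sum]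
      refine Finset.sum_congr rfl fun i hi => ?_
      rw [LinearMap.rTensor_tmul, ha' _ (Finset.mem_image_of_mem _ hi), hT,
        TensorProduct.smul_tmul]
    rwa [h3] at h2
  by_contra hc
  push Not at hc
  refine ht0 ?_
  have h2 (ξ : V →ₗ[ℂ] ℂ) : T ξ t = 0 := by
    by_contra h0
    obtain ⟨v, hv⟩ := hc _ h0
    exact hv (h1 ξ v)
  classical
  let b := Module.Basis.ofVectorSpace ℂ V
  let e := TensorProduct.equivFinsuppOfBasisLeft (M := V) (N := N) b
  refine e.injective (Finsupp.ext fun i => ?_)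
  rw [map_zero, Finsupp.zero_apply]
  have h3 : T (b.coord i) = Finsupp.lapply i ∘ₗ e.toLinearMap :=
    TensorProduct.ext' fun v n => by simp [hT, e]
  have h4 := LinearMap.congr_fun h3 t
  rw [h2] at h4
  exact h4.symm

/-- The tensor product of irreducible families. -/
lemma IsIrreducibleFamily.tensor {S : Set (Module.End ℂ V)} {S' : Set (Module.End ℂ N)}
    (hS : IsIrreducibleFamily S) (hS' : HasScalarCommutant S) (hN : IsIrreducibleFamily S') :
    IsIrreducibleFamily ((fun a => a.rTensor N) '' S ∪ (fun a => a.lTensor V) '' S') := by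
  intro K hK
  by_cases hK' : K = ⊥
  · exact .inl hK'
  right
  obtain ⟨n, hn, h⟩ := hS.exists_tmul_mem hS' (fun a ha => hK _ (.inl ⟨a, ha, rfl⟩)) hK'
  -- The n with V ⊗ n inside K form a stable subspace of N, nonzero by `exists_tmul_mem`, hence all
  -- of N.
  let N' : Submodule ℂ N := ⨅ v, K.comap (TensorProduct.mk ℂ V N v)
  have hN' (m) : m ∈ N' ↔ ∀ v, v ⊗ₜ m ∈ K := by simp [N', Submodule.mem_iInf]
  have htop : N' = ⊤ := by
    refine (hN N' fun a ha m hm => (hN' _).2 fun v => ?_).resolve_left fun hbot => hn ?_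
    · exact hK _ (.inr ⟨a, ha, rfl⟩) _ ((hN' m).1 hm v)
    · have := (hN' n).2 h
      rwa [hbot, Submodule.mem_bot] at this
  refine eq_top_iff.2 fun t _ => ?_
  induction t using TensorProduct.induction_on with
  | zero => exact K.zero_mem
  | add t u ht hu => exact K.add_mem (ht trivial) (hu trivial)
  | tmul v m => exact (hN' m).1 (htop ▸ Submodule.mem_top) v

end Density

/-! ### Highest weight modules -/

section HighestWeight

variable {L : Type*} [LieRing L] [LieAlgebra ℂ L] {M : Type*} [AddCommGroup M] [Module ℂ M]
  [Module (UniversalEnvelopingAlgebra ℂ L) M] [IsScalarTower ℂ (UniversalEnvelopingAlgebra ℂ L) M]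

/-- The module `M` is generated by the space `T` of highest weight vectors, on which the grading
operator `L₀` acts as the scalar `h`. -/
structure IsHighestWeight (D : ℤ → Submodule ℂ L) (Z : Submodule ℂ L) (T : Submodule ℂ M)
    (L₀ : Module.End ℂ M) (h : ℂ) : Prop where
  grading : CentralGrading D Z
  generates : Generates L (T : Set M)
  pos (n : ℤ) (hn : 0 < n) (x) (hx : x ∈ D n) (t) (ht : t ∈ T) : act x t = 0
  zero (x) (hx : x ∈ D 0) (t) (ht : t ∈ T) : act x t ∈ T
  central (z) (hz : z ∈ Z) (t) (ht : t ∈ T) : act z t ∈ T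
  comm (n : ℤ) (x) (hx : x ∈ D n) (v : M) : L₀ (act x v) = act x (L₀ v) - (n : ℂ) • act x v
  eigen (t) (ht : t ∈ T) : L₀ t = h • t
  stable (X : Submodule ℂ M) (hX : ∀ x : L, ∀ v ∈ X, act x v ∈ X) (v) (hv : v ∈ X) : L₀ v ∈ X

namespace IsHighestWeight

variable {D : ℤ → Submodule ℂ L} {Z : Submodule ℂ L} {T : Submodule ℂ M} {L₀ : Module.End ℂ M} {h : ℂ}

/-- Elements of degree ≥ 0 and the centre preserve `T`, and elements of negative degree raise the
eigenvalue of `L₀` by a positive integer. -/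
lemma sup_eq_top (H : IsHighestWeight D Z T L₀ h) :
    T ⊔ ⨆ n : ℕ, Module.End.eigenspace L₀ (h + (n + 1)) = ⊤ := by
  set Y := T ⊔ ⨆ n : ℕ, Module.End.eigenspace L₀ (h + (n + 1)) with hYdef
  have hmem (n : ℕ) (v : M) (hv : L₀ v = (h + (n + 1)) • v) : v ∈ Y :=
    (le_sup_right : _ ≤ Y) (Submodule.mem_iSup_of_mem n (Module.End.mem_eigenspace_iff.2 hv))
  refine H.generates.eq_top_of_stable ((⨆ n : {n : ℤ // 0 ≤ n}, D n) ⊔ Z) {x | ∃ n < 0, x ∈ D n} ?_ ?_ Y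
    le_sup_left ?_
  · rw [eq_top_iff, ← H.grading.span]
    refine sup_le (iSup_le fun n => ?_) (le_sup_right.trans le_sup_left)
    by_cases hn : 0 ≤ n
    · exact (le_iSup (fun n : {n : ℤ // 0 ≤ n} => D n) ⟨n, hn⟩).trans (le_sup_left.trans le_sup_left)
    · exact le_trans (fun x hx => Submodule.subset_span
        (show x ∈ {x | ∃ n < 0, x ∈ D n} from ⟨n, by omega, hx⟩)) le_sup_right
  · intro p hp t ht
    have : (⨆ n : {n : ℤ // 0 ≤ n}, D n) ⊔ Z ≤ T.comap ((actRep L M).flip t) := by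
      refine sup_le (iSup_le fun n x hx => ?_) fun z hz => H.central z hz t ht
      obtain ⟨n, hn⟩ := n
      rw [Submodule.mem_comap, LinearMap.flip_apply, actRep_apply]
      by_cases hn0 : n = 0
      · subst hn0; exact H.zero x hx t ht
      · rw [H.pos n (by omega) x hx t ht]; exact T.zero_mem
    exact this hp
  · rintro x ⟨n, hn, hx⟩
    change Y ≤ Y.comap (act x)
    rw [hYdef, sup_le_iff, iSup_le_iff, ← hYdef]
    refine ⟨fun t ht => hmem (-n - 1).toNat _ ?_, fun k v hv => hmem (k - n).toNat _ ?_⟩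
    · rw [H.comm n x hx, H.eigen t ht, map_smul, ← sub_smul]
      congr 1
      rw [show (((-n - 1).toNat : ℕ) : ℂ) = (((-n - 1).toNat : ℤ) : ℂ) from
        (Int.cast_natCast _).symm,
        Int.toNat_of_nonneg (by omega)]
      push_cast
      ring
    · rw [Module.End.mem_eigenspace_iff] at hv
      rw [H.comm n x hx, hv, map_smul, ← sub_smul]
      congr 1
      rw [show (((k - n).toNat : ℕ) : ℂ) = (((k - n).toNat : ℤ) : ℂ) from
        (Int.cast_natCast _).symm,
        Int.toNat_of_nonneg (by omega)]
      push_cast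
      ring

lemma disjoint (L₀ : Module.End ℂ M) (h : ℂ) : Disjoint (Module.End.eigenspace L₀ h)
    (⨆ n : ℕ, Module.End.eigenspace L₀ (h + (n + 1))) := by
  refine (Module.End.eigenspaces_iSupIndep L₀ h).mono_right (iSup_le fun n => ?_)
  refine le_iSup₂_of_le (h + (n + 1)) ?_ le_rfl
  intro h1
  exact Nat.cast_add_one_ne_zero n (add_left_cancel (h1.trans (add_zero h).symm))

lemma le_eigenspace (H : IsHighestWeight D Z T L₀ h) : T ≤ Module.End.eigenspace L₀ h :=
  fun t ht => Module.End.mem_eigenspace_iff.2 (H.eigen t ht)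

/-- Recovers the top from `L₀` alone, so that operators commuting with `L₀` preserve it. -/
lemma eigenspace_eq (H : IsHighestWeight D Z T L₀ h) : Module.End.eigenspace L₀ h = T := by
  refine le_antisymm (fun v hv => ?_) H.le_eigenspace
  obtain ⟨t, ht, y, hy, rfl⟩ := Submodule.mem_sup.1 (H.sup_eq_top ▸ Submodule.mem_top : v ∈ T ⊔ _)
  have h1 : y ∈ Module.End.eigenspace L₀ h := by
    have := Submodule.sub_mem _ hv (H.le_eigenspace ht)
    rwa [add_sub_cancel_left] at this
  rw [Submodule.disjoint_def.1 (disjoint L₀ h) y h1 hy, add_zero]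
  exact ht

/-- A submodule that meets the space of highest weight vectors trivially is contained in the sum of
the eigenspaces of lower weight. -/
lemma le_iSup (H : IsHighestWeight D Z T L₀ h) {X : Submodule ℂ M} (hX : ∀ v ∈ X, L₀ v ∈ X)
    (hXT : ∀ v ∈ X, v ∈ T → v = 0) : X ≤ ⨆ n : ℕ, Module.End.eigenspace L₀ (h + (n + 1)) := by
  intro v hv
  obtain ⟨t, ht, y, hy, rfl⟩ := Submodule.mem_sup.1 (H.sup_eq_top ▸ Submodule.mem_top : v ∈ T ⊔ _)
  -- Such a polynomial in `L₀` sends t + y to a nonzero scalar times t, which puts t in `X`.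
  have key : ∃ p : Polynomial ℂ, p.eval h ≠ 0 ∧ Polynomial.aeval L₀ p y = 0 := by
    clear hv
    induction hy using Submodule.iSup_induction' with
    | mem n y hy =>
      refine ⟨Polynomial.X - Polynomial.C (h + (n + 1)), ?_, ?_⟩
      · rw [Polynomial.eval_sub, Polynomial.eval_X, Polynomial.eval_C, sub_add_cancel_left]
        exact neg_ne_zero.2 (Nat.cast_add_one_ne_zero n)
      · rw [Module.End.mem_eigenspace_iff] at hy
        rw [map_sub, Polynomial.aeval_X, Polynomial.aeval_C, LinearMap.sub_apply, hy,
          Module.algebraMap_end_apply, sub_self]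
    | zero => exact ⟨1, by simp, by simp⟩
    | add y z _ _ hy hz =>
      obtain ⟨p, hp, hp'⟩ := hy
      obtain ⟨q, hq, hq'⟩ := hz
      refine ⟨p * q, by simp [hp, hq], ?_⟩
      rw [map_add, map_mul]
      conv_lhs => arg 1; rw [(Polynomial.aeval_mul L₀).symm, mul_comm]
      rw [map_mul, Module.End.mul_apply, hp', map_zero, zero_add, ← map_mul, map_mul,
        Module.End.mul_apply, hq', map_zero]
  obtain ⟨p, hp, hpy⟩ := key
  have hpX (q : Polynomial ℂ) : ∀ w ∈ X, Polynomial.aeval L₀ q w ∈ X := by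
    induction q using Polynomial.induction_on' with
    | add q r hq hr => intro w hw; rw [map_add]; exact X.add_mem (hq w hw) (hr w hw)
    | monomial n a =>
      intro w hw
      rw [Polynomial.aeval_monomial, Module.End.mul_apply, Module.algebraMap_end_apply]
      refine X.smul_mem a ?_
      induction n with
      | zero => exact hw
      | succ n ih => rw [pow_succ', Module.End.mul_apply]; exact hX _ ih
  have hpt : Polynomial.aeval L₀ p t = p.eval h • t := by
    by_cases ht0 : t = 0
    · rw [ht0, map_zero, smul_zero]
    · exact Module.End.aeval_apply_of_hasEigenvector ⟨H.le_eigenspace ht, ht0⟩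
  have h1 := hpX p _ hv
  rw [map_add, hpy, add_zero, hpt] at h1
  have h2 : t ∈ X := by
    have := X.smul_mem (p.eval h)⁻¹ h1
    rwa [smul_smul, inv_mul_cancel₀ hp, one_smul] at this
  rw [hXT t h2 ht, zero_add]
  exact hy

end IsHighestWeight

end HighestWeight

/-! ### Irreducible quotients -/

section IrrQuotient

variable {L : Type*} [LieRing L] [LieAlgebra ℂ L] {M : Type*} [AddCommGroup M] [Module ℂ M]
  [Module (UniversalEnvelopingAlgebra ℂ L) M] [IsScalarTower ℂ (UniversalEnvelopingAlgebra ℂ L) M]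

/-- A subspace that is stable under the action of `L` as a submodule. -/
def stableSubmodule (X : Submodule ℂ M) (hX : ∀ x : L, ∀ v ∈ X, act x v ∈ X) :
    Submodule (UniversalEnvelopingAlgebra ℂ L) M :=
  { X with smul_mem' := fun u _ hv => smul_mem_of_act_mem X hX u hv }

variable {E : Type*} [AddCommGroup E] [Module ℂ E] {R : L → Module.End ℂ E → Prop}

variable (R) in
/-- The largest proper submodule of an induced module. -/
abbrev maxSubmodule : Submodule (UniversalEnvelopingAlgebra ℂ L) (Induced R) :=
  sSup {X : Submodule (UniversalEnvelopingAlgebra ℂ L) (Induced R) | X ≠ ⊤}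

variable (R) in
/-- The projection to the irreducible quotient. -/
def irrMap : Induced R →ₗ[ℂ] IrrQuotient R :=
  (maxSubmodule R).mkQ.restrictScalars ℂ

lemma irrMap_act (x : L) (v : Induced R) : irrMap R (act x v) = act x (irrMap R v) := rfl

lemma irrMap_surjective : Function.Surjective (irrMap R) := (maxSubmodule R).mkQ_surjective

lemma irrMap_eq_zero {v : Induced R} : irrMap R v = 0 ↔ v ∈ maxSubmodule R :=
  Submodule.Quotient.mk_eq_zero _

variable (R) in
/-- The image of the inducing module in the irreducible quotient. -/
def irrTop : E →ₗ[ℂ] IrrQuotient R := irrMap R ∘ₗ topMap R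

lemma irrTop_act {p : L} {A : Module.End ℂ E} (h : R p A) (e : E) :
    act p (irrTop R e) = irrTop R (A e) := by
  rw [irrTop, LinearMap.comp_apply, ← irrMap_act, topMap_apply, act_top h]
  rfl

lemma generates_irrTop : Generates L (LinearMap.range (irrTop R) : Set (IrrQuotient R)) := by
  intro X hT hX
  have := generates_top (R := R) (X.comap (irrMap R)) (by rintro _ ⟨e, rfl⟩; exact hT ⟨e, rfl⟩)
    fun x v hv => by rw [Submodule.mem_comap, irrMap_act]; exact hX x _ hv
  refine eq_top_iff.2 fun v _ => ?_
  obtain ⟨v, rfl⟩ := irrMap_surjective v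
  exact (this ▸ Submodule.mem_top : v ∈ X.comap (irrMap R))

variable (R) in
-- The preimage of a stable subspace is a submodule, either everything or proper; in the latter case
-- it lies in the sum of the proper submodules and has zero image.
lemma irr_isIrreducibleFamily :
    IsIrreducibleFamily (Set.range (act (L := L) (M := IrrQuotient R))) := by
  intro X hX
  let X' := stableSubmodule (X.comap (irrMap R)) fun (x : L) v hv => by
    rw [Submodule.mem_comap, irrMap_act]
    exact hX _ ⟨x, rfl⟩ _ hv
  by_cases h : X' = ⊤
  · right
    refine eq_top_iff.2 fun v _ => ?_
    obtain ⟨v, rfl⟩ := irrMap_surjective v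
    exact (h ▸ Submodule.mem_top : v ∈ X')
  · left
    refine eq_bot_iff.2 fun v hv => ?_
    obtain ⟨v, rfl⟩ := irrMap_surjective v
    exact irrMap_eq_zero.2 ((le_sSup h : X' ≤ maxSubmodule R) hv)

/-- If the inducing module is irreducible and its image in the induced module is nonzero, then the
sum of all proper submodules is proper. -/
lemma IsHighestWeight.top_eq_zero {D : ℤ → Submodule ℂ L} {Z : Submodule ℂ L}
    {L₀ : Module.End ℂ (Induced R)} {h : ℂ}
    (H : IsHighestWeight D Z (LinearMap.range (topMap R)) L₀ h)
    (hE : IsIrreducibleFamily {A | ∃ p, R p A}) (hJ : maxSubmodule R = ⊤) (e : E) :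
    Induced.top R e = 0 := by
  let Y : Submodule ℂ (Induced R) := ⨆ n : ℕ, Module.End.eigenspace L₀ (h + (n + 1))
  -- The preimage of a proper submodule in E is stable, and it is not E because the top generates,
  -- so it is zero. The submodule then lies in `Y` by `le_iSup`.
  have hproper (X : Submodule (UniversalEnvelopingAlgebra ℂ L) (Induced R)) (hX : X ≠ ⊤) :
      X.restrictScalars ℂ ≤ Y := by
    have hact (x : L) (v) (hv : v ∈ X.restrictScalars ℂ) : act x v ∈ X.restrictScalars ℂ :=
      X.smul_mem _ hv
    refine H.le_iSup (H.stable _ hact) ?_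
    rintro _ h1 ⟨e, rfl⟩
    rcases hE ((X.restrictScalars ℂ).comap (topMap R)) (by
      rintro A ⟨p, hA⟩ e he
      rw [Submodule.mem_comap, topMap_apply, ← act_top hA]
      exact hact p _ he) with h2 | h2
    · have : e ∈ (X.restrictScalars ℂ).comap (topMap R) := h1
      rw [h2, Submodule.mem_bot] at this
      rw [this, map_zero]
    · refine absurd ((Submodule.restrictScalars_eq_top_iff _ _ _).1
        (generates_top (X.restrictScalars ℂ) ?_ hact)) hX
      rintro _ ⟨e, rfl⟩
      exact (h2 ▸ Submodule.mem_top : e ∈ (X.restrictScalars ℂ).comap (topMap R))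
  -- The sum of all proper submodules still lies in `Y`, which meets the eigenspace of h trivially;
  -- if the sum is everything, the top must vanish.
  have hJY (v : Induced R) : v ∈ Y := by
    have h1 : v ∈ maxSubmodule R := hJ ▸ Submodule.mem_top
    clear e
    rw [maxSubmodule, sSup_eq_iSup'] at h1
    induction h1 using Submodule.iSup_induction' with
    | mem X v hv => exact hproper X.1 X.2 hv
    | zero => exact Y.zero_mem
    | add v w _ _ hv hw => exact Y.add_mem hv hw
  exact Submodule.disjoint_def.1 (IsHighestWeight.disjoint L₀ h) _ (H.le_eigenspace ⟨e, rfl⟩) (hJY _)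

end IrrQuotient

end

end TorVOA


namespace TorVOA

noncomputable section

/-! ### Highest weight modules for `ĝ`, the Virasoro algebra and `f̄` -/

section TopMap

variable {L : Type*} [LieRing L] [LieAlgebra ℂ L] {E : Type*} [AddCommGroup E] [Module ℂ E]
  {R : L → Module.End ℂ E → Prop} {M : Type*} [AddCommGroup M] [Module ℂ M]
  [Module (UniversalEnvelopingAlgebra ℂ L) M] [IsScalarTower ℂ (UniversalEnvelopingAlgebra ℂ L) M]

/-- The map `f : E → M` is compatible with the action prescribed by `R`, and its image generates
`M`. -/
structure IsTopMap (R : L → Module.End ℂ E → Prop) (f : E →ₗ[ℂ] M) : Prop where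
  generates : Generates L (LinearMap.range f : Set M)
  act_apply {p : L} {A : Module.End ℂ E} (h : R p A) (e : E) : act p (f e) = f (A e)

lemma isTopMap_topMap : IsTopMap R (topMap R) := ⟨generates_top, act_top⟩

lemma isTopMap_irrTop : IsTopMap R (irrTop R) := ⟨generates_irrTop, irrTop_act⟩

lemma IsTopMap.central {f : E →ₗ[ℂ] M} (hf : IsTopMap R f) {z : L} (hz : ∀ x : L, ⁅z, x⁆ = 0) {c : ℂ}
    (h : R z (c • 1)) (v : M) : act z v = c • v :=
  hf.generates.central hz (by
    rintro _ ⟨e, rfl⟩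
    rw [hf.act_apply h, LinearMap.smul_apply, map_smul, Module.End.one_apply]) v

lemma Generates.eq_top {f : E →ₗ[ℂ] M} (hf : Generates L (LinearMap.range f : Set M)) (h : f = 0) :
    (⊥ : Submodule ℂ M) = ⊤ :=
  hf ⊥ (by rintro _ ⟨e, rfl⟩; rw [h]; exact Submodule.zero_mem _) fun x v hv => by
    rw [(Submodule.mem_bot ℂ).1 hv, map_zero]
    exact Submodule.zero_mem _

end TopMap

section Simple

variable {g : Type*} [LieRing g] [LieAlgebra ℂ g]
  {V : Type*} [AddCommGroup V] [Module ℂ V] [LieRingModule g V] [LieModule ℂ g V]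

/-- The operators of an irreducible module form an irreducible family. -/
lemma isIrreducibleFamily_toEnd [LieModule.IsIrreducible ℂ g V] :
    IsIrreducibleFamily (Set.range (LieModule.toEnd ℂ g V)) := by
  intro K hK
  let K' : LieSubmodule ℂ g V := { K with lie_mem := fun {x v} hv => hK _ ⟨x, rfl⟩ v hv }
  rcases eq_bot_or_eq_top K' with h | h
  · left
    have := congrArg LieSubmodule.toSubmodule h
    simpa [K'] using this
  · right
    have := congrArg LieSubmodule.toSubmodule h
    simpa [K'] using this

end Simple

/-! ### Sugawara operators on tops and Casimir eigenvalues. -/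

section Sugawara

variable {g : Type*} [LieRing g] [LieAlgebra ℂ g] [FiniteDimensional ℂ g] {B : InvForm g} {c k : ℂ}
  {M : Type*} [AddCommGroup M] [Module ℂ M]
  {V : Type*} [AddCommGroup V] [Module ℂ V] [LieRingModule g V]

lemma LoopRep.sug_mem (R : LoopRep B c M) (X : Submodule ℂ M)
    (hX : ∀ n x, ∀ v ∈ X, R.op n x v ∈ X) (n : ℤ) {v : M} (hv : v ∈ X) : R.sug k n v ∈ X := by
  rw [R.sug_apply]
  refine X.smul_mem _ (finsum_induction (· ∈ X) X.zero_mem (fun _ _ => X.add_mem) fun j => ?_)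
  rw [LoopRep.normal, LinearMap.sum_apply]
  refine X.sum_mem fun i _ => ?_
  split_ifs
  · exact hX _ _ _ (hX _ _ _ hv)
  · exact hX _ _ _ (hX _ _ _ hv)

lemma LoopRep.sug_pos (R : LoopRep B c M) {f : V →ₗ[ℂ] M}
    (hpos : ∀ n > 0, ∀ x v, R.op n x (f v) = 0) (hzero : ∀ x v, R.op 0 x (f v) = f ⁅x, v⁆)
    {n : ℤ} (hn : 0 < n) (v : V) : R.sug k n (f v) = 0 := by
  rw [R.sug_apply, finsum_eq_zero_of_forall_eq_zero fun j => ?_, smul_zero]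
  rw [LoopRep.normal, LinearMap.sum_apply]
  refine Finset.sum_eq_zero fun i _ => ?_
  split_ifs with h
  · rw [Module.End.mul_apply, hpos _ (by omega), map_zero]
  · rw [Module.End.mul_apply]
    rcases eq_or_ne j 0 with rfl | hj
    · rw [hzero, hpos _ (by omega)]
    · rw [hpos _ (by omega), map_zero]

variable [LieModule ℂ g V]

lemma casimir_eq_sum_dualBasis (v : V) :
    casimir B V v = ∑ i, ⁅dualBasis B i, ⁅basis g i, v⁆⁆ := by
  have := congrArg (fun A : Module.End ℂ V => A v) (sum_dualBasis_symm B
    ((LinearMap.mul ℂ (Module.End ℂ V)).compl₁₂ (LieModule.toEnd ℂ g V : g →ₗ[ℂ] Module.End ℂ V)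
      (LieModule.toEnd ℂ g V : g →ₗ[ℂ] Module.End ℂ V)))
  simp only [LinearMap.sum_apply] at this
  rw [casimir, LinearMap.sum_apply]
  exact this.symm

/-- Only the term j = 0 has no factor of positive degree, and it is the Casimir operator. -/
lemma LoopRep.sug_zero (R : LoopRep B c M) {f : V →ₗ[ℂ] M}
    (hpos : ∀ n > 0, ∀ x v, R.op n x (f v) = 0) (hzero : ∀ x v, R.op 0 x (f v) = f ⁅x, v⁆)
    (v : V) : R.sug k 0 (f v) = (1 / (2 * (c + k))) • f (casimir B V v) := by
  rw [R.sug_apply, finsum_eq_single _ 0 fun j hj => ?_]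
  · rw [LoopRep.normal, LinearMap.sum_apply, casimir_eq_sum_dualBasis, map_sum]
    congr 1
    refine Finset.sum_congr rfl fun i _ => ?_
    rw [if_neg (lt_irrefl _), Module.End.mul_apply, hzero, sub_zero, hzero]
  · rw [LoopRep.normal, LinearMap.sum_apply]
    refine Finset.sum_eq_zero fun i _ => ?_
    split_ifs with h
    · rw [Module.End.mul_apply, hpos _ (by omega), map_zero]
    · rw [Module.End.mul_apply, hpos _ (by omega), map_zero]

lemma casimir_lie (y : g) (v : V) : casimir B V ⁅y, v⁆ = ⁅y, casimir B V v⁆ := by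
  have := congrArg (fun A : Module.End ℂ V => A v) (sum_dualBasis_invariant B
    ((LinearMap.mul ℂ (Module.End ℂ V)).compl₁₂ (LieModule.toEnd ℂ g V : g →ₗ[ℂ] Module.End ℂ V)
      (LieModule.toEnd ℂ g V : g →ₗ[ℂ] Module.End ℂ V)) y)
  simp only [LinearMap.sum_apply, LinearMap.neg_apply] at this
  change ∑ i, ⁅⁅y, dualBasis B i⁆, ⁅basis g i, v⁆⁆ = -∑ i, ⁅dualBasis B i, ⁅⁅y, basis g i⁆, v⁆⁆ at this
  rw [casimir_eq_sum_dualBasis, casimir_eq_sum_dualBasis, lie_sum]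
  simp only [leibniz_lie y, Finset.sum_add_distrib, lie_add]
  rw [this]
  simp only [lie_lie, lie_sub, Finset.sum_sub_distrib]
  abel

/-- The eigenspace is a nonzero submodule, since the Casimir operator commutes with g. -/
lemma casimir_apply [LieModule.IsIrreducible ℂ g V] {Ω : ℂ} (h : (casimir B V).HasEigenvalue Ω)
    (v : V) : casimir B V v = Ω • v := by
  rcases isIrreducibleFamily_toEnd (g := g) (Module.End.eigenspace (casimir B V) Ω) (by
    rintro _ ⟨x, rfl⟩ v hv
    rw [Module.End.mem_eigenspace_iff] at hv ⊢
    rw [LieModule.toEnd_apply_apply, casimir_lie, hv, lie_smul]) with h1 | h1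
  · exact absurd h1 h
  · exact Module.End.mem_eigenspace_iff.1 (h1 ▸ Submodule.mem_top)

end Sugawara

/-! ### Highest weight modules of ĝ. -/

section Affine

variable {g : Type*} [LieRing g] [LieAlgebra ℂ g] {B : InvForm g} {c k : ℂ}
  {V : Type*} [AddCommGroup V] [Module ℂ V] [LieRingModule g V] [LieModule ℂ g V]
  {M : Type*} [AddCommGroup M] [Module ℂ M] [Module (UniversalEnvelopingAlgebra ℂ (Affine B)) M]
  [IsScalarTower ℂ (UniversalEnvelopingAlgebra ℂ (Affine B)) M] {f : V →ₗ[ℂ] M}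

namespace IsTopMap

lemma affine_central (hf : IsTopMap (AffineTopRel B V c) f) (v : M) : act (Affine.C B) v = c • v :=
  hf.central (Affine.lie_C B) .central v

lemma affine_pos (hf : IsTopMap (AffineTopRel B V c) f) (n : ℤ) (hn : 0 < n) (x : g) (v : V) :
    act (Affine.el B x n) (f v) = 0 := by
  rw [hf.act_apply (.pos x n hn), LinearMap.zero_apply, map_zero]

/-- The action of `ĝ` on a highest weight module. -/
def loopRep (hf : IsTopMap (AffineTopRel B V c) f) : LoopRep B c M :=
  LoopRep.ofModule hf.affine_central
    ((Affine.centralGrading B).smooth hf.generates (by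
      rintro _ ⟨v, rfl⟩
      refine ⟨1, fun n hn x hx => ?_⟩
      obtain ⟨x, rfl⟩ := hx
      exact hf.affine_pos n (by omega) x v))

lemma loopRep_op (hf : IsTopMap (AffineTopRel B V c) f) (n : ℤ) (x : g) :
    hf.loopRep.op n x = act (Affine.el B x n) := rfl

lemma loopRep_zero (hf : IsTopMap (AffineTopRel B V c) f) (x : g) (v : V) :
    hf.loopRep.op 0 x (f v) = f ⁅x, v⁆ :=
  hf.act_apply (.zero x) v

lemma loopRep_lin (hf : IsTopMap (AffineTopRel B V c) f) (a : Affine B) : hf.loopRep.lin a = act a :=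
  hf.loopRep.lin_eq_act (fun _ _ => rfl) hf.affine_central a

variable [FiniteDimensional ℂ g]

lemma loopRep_sug (hf : IsTopMap (AffineTopRel B V c) f) {Ω : ℂ} (hΩ : ∀ v, casimir B V v = Ω • v)
    (v : V) : hf.loopRep.sug k 0 (f v) = (Ω / (2 * (c + k))) • f v := by
  rw [hf.loopRep.sug_zero hf.affine_pos hf.loopRep_zero, hΩ, map_smul, smul_smul]
  congr 1
  ring

lemma isHighestWeight_affine (hf : IsTopMap (AffineTopRel B V c) f) (hk : IsDualCoxeter B k)
    (hc : c + k ≠ 0) {Ω : ℂ} (hΩ : ∀ v, casimir B V v = Ω • v) :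
    IsHighestWeight (fun n => LinearMap.range (Affine.elMap B n)) (Submodule.span ℂ {Affine.C B})
      (LinearMap.range f) (hf.loopRep.sug k 0) (Ω / (2 * (c + k))) where
  grading := Affine.centralGrading B
  generates := hf.generates
  pos n hn := by
    rintro _ ⟨x, rfl⟩ _ ⟨v, rfl⟩
    exact hf.affine_pos n hn x v
  zero := by
    rintro _ ⟨x, rfl⟩ _ ⟨v, rfl⟩
    exact ⟨_, (hf.loopRep_zero x v).symm⟩
  central z hz t ht := by
    obtain ⟨r, rfl⟩ := Submodule.mem_span_singleton.1 hz
    rw [← actRep_apply, map_smul, LinearMap.smul_apply, actRep_apply, hf.affine_central]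
    exact Submodule.smul_mem _ _ (Submodule.smul_mem _ _ ht)
  comm n := by
    rintro _ ⟨x, rfl⟩ v
    rw [Affine.elMap_apply, ← hf.loopRep_op, hf.loopRep.lie_sug hk hc n 0, add_zero,
      add_sub_cancel_right]
  eigen := by
    rintro _ ⟨v, rfl⟩
    exact hf.loopRep_sug hΩ v
  stable X hX v hv := hf.loopRep.sug_mem X (fun n x => hX _) 0 hv

/-- Schur's lemma for irreducible highest weight modules of `ĝ`. -/
lemma hasScalarCommutant_affine [FiniteDimensional ℂ V] [Nontrivial M]
    (hf : IsTopMap (AffineTopRel B V c) f)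
    (hk : IsDualCoxeter B k) (hc : c + k ≠ 0) {Ω : ℂ} (hΩ : ∀ v, casimir B V v = Ω • v)
    (hM : IsIrreducibleFamily (Set.range (act (L := Affine B) (M := M)))) :
    HasScalarCommutant (Set.range (act (L := Affine B) (M := M))) := by
  refine hM.hasScalarCommutant (LinearMap.range f) (fun h => ?_) fun φ hφ v hv => ?_
  -- The finite-dimensional space required for Schur's lemma is the top. It is an eigenspace of the
  -- Sugawara L(0), which commutes with everything that commutes with ĝ.
  · exact bot_ne_top (hf.generates.eq_top (LinearMap.range_eq_bot.1 h))
  · have H := hf.isHighestWeight_affine hk hc hΩ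
    rw [← H.eigenspace_eq, Module.End.mem_eigenspace_iff] at hv ⊢
    rw [← map_smul, ← hv]
    exact (hf.loopRep.map_sug hf.loopRep φ (fun n x v => hφ _ ⟨_, rfl⟩ v) k 0 v).symm

end IsTopMap

lemma isIrreducibleFamily_affineTopRel [LieModule.IsIrreducible ℂ g V] :
    IsIrreducibleFamily {A | ∃ p, AffineTopRel B V c p A} := fun K hK =>
  isIrreducibleFamily_toEnd (g := g) K (by
    rintro _ ⟨x, rfl⟩
    exact hK _ ⟨_, .zero x⟩)

end Affine
end
end TorVOA


namespace TorVOA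

noncomputable section

/-! ### Highest weight modules of the Virasoro algebra. -/

section Virasoro

variable {c h : ℂ} {M : Type*} [AddCommGroup M] [Module ℂ M]
  [Module (UniversalEnvelopingAlgebra ℂ Virasoro) M]
  [IsScalarTower ℂ (UniversalEnvelopingAlgebra ℂ Virasoro) M] {f : ℂ →ₗ[ℂ] M}

namespace IsTopMap

lemma vir_central (hf : IsTopMap (VirTopRel h c) f) (v : M) : act Virasoro.C v = c • v :=
  hf.central Virasoro.lie_C .central v

/-- The action of the Virasoro algebra on a highest weight module. -/
def virRep (hf : IsTopMap (VirTopRel h c) f) : VirRep c M := VirRep.ofModule hf.vir_central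

lemma virRep_op (hf : IsTopMap (VirTopRel h c) f) (n : ℤ) : hf.virRep.op n = act (Virasoro.L n) := rfl

lemma virRep_lin (hf : IsTopMap (VirTopRel h c) f) (a : Virasoro) : hf.virRep.lin a = act a :=
  hf.virRep.lin_eq_act (fun _ => rfl) hf.vir_central a

lemma vir_pos (hf : IsTopMap (VirTopRel h c) f) (n : ℤ) (hn : 0 < n) (e : ℂ) :
    act (Virasoro.L n) (f e) = 0 := by
  rw [hf.act_apply (.pos n hn), LinearMap.zero_apply, map_zero]

lemma vir_zero (hf : IsTopMap (VirTopRel h c) f) (e : ℂ) :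
    act (Virasoro.L 0) (f e) = h • f e := by
  rw [hf.act_apply .zero, LinearMap.smul_apply, map_smul, Module.End.one_apply]

lemma isHighestWeight_vir (hf : IsTopMap (VirTopRel h c) f) :
    IsHighestWeight (fun n => Submodule.span ℂ {Virasoro.L n}) (Submodule.span ℂ {Virasoro.C})
      (LinearMap.range f) (act (Virasoro.L 0)) h where
  grading := Virasoro.centralGrading
  generates := hf.generates
  pos n hn x hx := by
    rintro _ ⟨v, rfl⟩
    obtain ⟨r, rfl⟩ := Submodule.mem_span_singleton.1 hx
    rw [← actRep_apply, map_smul, LinearMap.smul_apply, actRep_apply, hf.vir_pos n hn, smul_zero]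
  zero x hx := by
    rintro _ ⟨v, rfl⟩
    obtain ⟨r, rfl⟩ := Submodule.mem_span_singleton.1 hx
    rw [← actRep_apply, map_smul, LinearMap.smul_apply, actRep_apply, hf.vir_zero]
    exact Submodule.smul_mem _ _ (Submodule.smul_mem _ _ ⟨v, rfl⟩)
  central z hz t ht := by
    obtain ⟨r, rfl⟩ := Submodule.mem_span_singleton.1 hz
    rw [← actRep_apply, map_smul, LinearMap.smul_apply, actRep_apply, hf.vir_central]
    exact Submodule.smul_mem _ _ (Submodule.smul_mem _ _ ht)
  comm n x hx v := by
    obtain ⟨r, rfl⟩ := Submodule.mem_span_singleton.1 hx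
    have := hf.virRep.comm 0 n v
    rw [Int.cast_zero, zero_add, zero_sub, zero_pow three_ne_zero, sub_zero, zero_div, ite_self,
      zero_mul, zero_smul, add_zero] at this
    simp only [hf.virRep_op] at this
    have hr (w : M) : act (r • Virasoro.L n) w = r • act (Virasoro.L n) w := by
      rw [← actRep_apply, map_smul, LinearMap.smul_apply, actRep_apply]
    rw [hr, hr, map_smul, this]
    module
  eigen := by
    rintro _ ⟨v, rfl⟩
    exact hf.vir_zero v
  stable X hX v hv := hX _ v hv

end IsTopMap

lemma isIrreducibleFamily_complex (S : Set (Module.End ℂ ℂ)) : IsIrreducibleFamily S :=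
  fun K _ => eq_bot_or_eq_top K

end Virasoro

/-! ### Highest weight modules of f̄. -/

section FBar

variable {g s : Type*} [LieRing g] [LieAlgebra ℂ g] [LieRing s] [LieAlgebra ℂ s]
  {B : InvForm g} {B' : InvForm s} {h c₁ c₂ c : ℂ}
  {V : Type*} [AddCommGroup V] [Module ℂ V] [LieRingModule g V] [LieModule ℂ g V]
  {W : Type*} [AddCommGroup W] [Module ℂ W] [LieRingModule s W] [LieModule ℂ s W]
  {M : Type*} [AddCommGroup M] [Module ℂ M] [Module (UniversalEnvelopingAlgebra ℂ (FBar B B')) M]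
  [IsScalarTower ℂ (UniversalEnvelopingAlgebra ℂ (FBar B B')) M] {f : V ⊗[ℂ] W →ₗ[ℂ] M}

namespace IsTopMap

lemma fBar_fst_pos (hf : IsTopMap (FBarTopRel B B' V W h c₁ c₂ c) f) (n : ℤ) (hn : 0 < n) (x : g)
    (v : V ⊗[ℂ] W) : act (FBar.ofFst B B' (.el B x n)) (f v) = 0 := by
  rw [hf.act_apply (.fst_pos x n hn), LinearMap.zero_apply, map_zero]

lemma fBar_snd_pos (hf : IsTopMap (FBarTopRel B B' V W h c₁ c₂ c) f) (n : ℤ) (hn : 0 < n) (x : s)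
    (v : V ⊗[ℂ] W) : act (FBar.ofSnd B B' (.el B' x n)) (f v) = 0 := by
  rw [hf.act_apply (.snd_pos x n hn), LinearMap.zero_apply, map_zero]

lemma fBar_vir_pos (hf : IsTopMap (FBarTopRel B B' V W h c₁ c₂ c) f) (n : ℤ) (hn : 0 < n)
    (v : V ⊗[ℂ] W) : act (FBar.ofVir B B' (.L n)) (f v) = 0 := by
  rw [hf.act_apply (.vir_pos n hn), LinearMap.zero_apply, map_zero]

lemma fBar_fst_zero (hf : IsTopMap (FBarTopRel B B' V W h c₁ c₂ c) f) (x : g) (v : V) (w : W) :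
    act (FBar.ofFst B B' (.el B x 0)) (f (v ⊗ₜ w)) = f (⁅x, v⁆ ⊗ₜ w) :=
  hf.act_apply (.fst_zero x) _

lemma fBar_snd_zero (hf : IsTopMap (FBarTopRel B B' V W h c₁ c₂ c) f) (x : s) (v : V) (w : W) :
    act (FBar.ofSnd B B' (.el B' x 0)) (f (v ⊗ₜ w)) = f (v ⊗ₜ ⁅x, w⁆) :=
  hf.act_apply (.snd_zero x) _

lemma fBar_vir_zero (hf : IsTopMap (FBarTopRel B B' V W h c₁ c₂ c) f) (v : V ⊗[ℂ] W) :
    act (FBar.ofVir B B' (.L 0)) (f v) = h • f v := by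
  rw [hf.act_apply .vir_zero, LinearMap.smul_apply, map_smul, Module.End.one_apply]

lemma act_degMap (n : ℤ) (p : (g × s) × ℂ) (v : M) : act (FBar.degMap B B' n p) v =
    act (FBar.ofFst B B' (.el B p.1.1 n)) v + act (FBar.ofSnd B B' (.el B' p.1.2 n)) v +
      p.2 • act (FBar.ofVir B B' (.L n)) v := by
  rw [FBar.degMap_apply, ← actRep_apply]
  simp only [map_add, map_smul, LinearMap.add_apply, LinearMap.smul_apply, actRep_apply]

lemma fBar_pos (hf : IsTopMap (FBarTopRel B B' V W h c₁ c₂ c) f) (n : ℤ) (hn : 0 < n)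
    (p : (g × s) × ℂ) (v : V ⊗[ℂ] W) : act (FBar.degMap B B' n p) (f v) = 0 := by
  rw [act_degMap, hf.fBar_fst_pos n hn, hf.fBar_snd_pos n hn, hf.fBar_vir_pos n hn, smul_zero,
    add_zero, add_zero]

lemma fBar_central (hf : IsTopMap (FBarTopRel B B' V W h c₁ c₂ c) f) :
    (∀ v : M, act (FBar.ofFst B B' (.C B)) v = c₁ • v) ∧
    (∀ v : M, act (FBar.ofSnd B B' (.C B')) v = c₂ • v) ∧
    (∀ v : M, act (FBar.ofVir B B' .C) v = c • v) :=
  ⟨hf.central FBar.lie_fst_C .fst_central, hf.central FBar.lie_snd_C .snd_central,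
    hf.central FBar.lie_vir_C .vir_central⟩

/-- The action of `f̄` on a highest weight module. -/
def fBarRep (hf : IsTopMap (FBarTopRel B B' V W h c₁ c₂ c) f) : FBarRep B B' c₁ c₂ c M :=
  FBarRep.ofModule hf.fBar_central.1 hf.fBar_central.2.1 hf.fBar_central.2.2
    ((FBar.centralGrading B B').smooth hf.generates (by
      rintro _ ⟨v, rfl⟩
      refine ⟨1, fun n hn x hx => ?_⟩
      obtain ⟨p, rfl⟩ := hx
      exact hf.fBar_pos n (by omega) p v))

lemma fBarRep_fst (hf : IsTopMap (FBarTopRel B B' V W h c₁ c₂ c) f) (n : ℤ) (x : g) :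
    hf.fBarRep.fst.op n x = act (FBar.ofFst B B' (.el B x n)) := rfl

lemma fBarRep_snd (hf : IsTopMap (FBarTopRel B B' V W h c₁ c₂ c) f) (n : ℤ) (x : s) :
    hf.fBarRep.snd.op n x = act (FBar.ofSnd B B' (.el B' x n)) := rfl

lemma fBarRep_vir (hf : IsTopMap (FBarTopRel B B' V W h c₁ c₂ c) f) (n : ℤ) :
    hf.fBarRep.vir.op n = act (FBar.ofVir B B' (.L n)) := rfl

lemma isHighestWeight_fBar (hf : IsTopMap (FBarTopRel B B' V W h c₁ c₂ c) f) :
    IsHighestWeight (fun n => LinearMap.range (FBar.degMap B B' n))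
      (Submodule.span ℂ {FBar.ofFst B B' (.C B), FBar.ofSnd B B' (.C B'), FBar.ofVir B B' .C})
      (LinearMap.range f) (act (FBar.ofVir B B' (.L 0))) h where
  grading := FBar.centralGrading B B'
  generates := hf.generates
  pos n hn := by
    rintro _ ⟨p, rfl⟩ _ ⟨v, rfl⟩
    exact hf.fBar_pos n hn p v
  zero := by
    rintro _ ⟨p, rfl⟩ _ ⟨v, rfl⟩
    rw [act_degMap, hf.act_apply (.fst_zero _), hf.act_apply (.snd_zero _), hf.fBar_vir_zero]
    exact Submodule.add_mem _ (Submodule.add_mem _ ⟨_, rfl⟩ ⟨_, rfl⟩)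
      (Submodule.smul_mem _ _ (Submodule.smul_mem _ _ ⟨_, rfl⟩))
  central z hz t ht := by
    have : Submodule.span ℂ {FBar.ofFst B B' (.C B), FBar.ofSnd B B' (.C B'), FBar.ofVir B B' .C} ≤
        (LinearMap.range f).comap ((actRep (FBar B B') M).flip t) := by
      rw [Submodule.span_le]
      rintro z (rfl | rfl | rfl)
      · change act (FBar.ofFst B B' (.C B)) t ∈ LinearMap.range f
        rw [hf.fBar_central.1]
        exact Submodule.smul_mem _ _ ht
      · change act (FBar.ofSnd B B' (.C B')) t ∈ LinearMap.range f
        rw [hf.fBar_central.2.1]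
        exact Submodule.smul_mem _ _ ht
      · change act (FBar.ofVir B B' .C) t ∈ LinearMap.range f
        rw [hf.fBar_central.2.2]
        exact Submodule.smul_mem _ _ ht
    exact this hz
  comm n := by
    rintro _ ⟨p, rfl⟩ v
    have := hf.fBarRep.vir_zero n p.1.1 p.1.2 p.2 v
    simp only [fBarRep_fst, fBarRep_snd, fBarRep_vir] at this
    rw [act_degMap, act_degMap]
    exact this
  eigen := by
    rintro _ ⟨v, rfl⟩
    exact hf.fBar_vir_zero v
  stable X hX v hv := hX _ v hv

end IsTopMap

/-- V ⊗ W is already irreducible under the zero modes of the two affine algebras; Schur's lemma for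
V uses its finite dimension. -/
lemma isIrreducibleFamily_fBarTopRel [FiniteDimensional ℂ V] [LieModule.IsIrreducible ℂ g V]
    [LieModule.IsIrreducible ℂ s W] :
    IsIrreducibleFamily {A | ∃ p, FBarTopRel B B' V W h c₁ c₂ c p A} := by
  have hV : IsIrreducibleFamily (Set.range (LieModule.toEnd ℂ g V)) := isIrreducibleFamily_toEnd
  have : Nontrivial V := LieModule.nontrivial_of_isIrreducible ℂ g V
  refine fun K hK => hV.tensor
    (hV.hasScalarCommutant ⊤ top_ne_bot fun _ _ _ _ => Submodule.mem_top)
    (isIrreducibleFamily_toEnd (g := s)) K ?_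
  rintro _ (⟨_, ⟨x, rfl⟩, rfl⟩ | ⟨_, ⟨x, rfl⟩, rfl⟩)
  · exact hK _ ⟨_, .fst_zero x⟩
  · exact hK _ ⟨_, .snd_zero x⟩

end FBar
end
end TorVOA


namespace TorVOA

noncomputable section

/-! ### Decomposition of the irreducible highest weight modules -/

section Stable

variable {g s : Type*} [LieRing g] [LieAlgebra ℂ g] [LieRing s] [LieAlgebra ℂ s]
  {B : InvForm g} {B' : InvForm s} {c₁ c₂ c : ℂ} {M N : Type*} [AddCommGroup M] [Module ℂ M]
  [AddCommGroup N] [Module ℂ N]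

lemma LoopRep.rTensor_lin (R : LoopRep B c M) (a : Affine B) :
    (R.rTensor N).lin a = (R.lin a).rTensor N :=
  TensorProduct.ext' fun u v => (R.map_lin (R.rTensor N) ((TensorProduct.mk ℂ M N).flip v)
    (fun _ _ _ => rfl) a u).symm

lemma LoopRep.lTensor_lin (R : LoopRep B c M) (a : Affine B) :
    (R.lTensor N).lin a = (R.lin a).lTensor N :=
  TensorProduct.ext' fun u v => (R.map_lin (R.lTensor N) (TensorProduct.mk ℂ N M u)
    (fun _ _ _ => rfl) a v).symm

lemma VirRep.lTensor_lin (R : VirRep c M) (a : Virasoro) :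
    (R.lTensor N).lin a = (R.lin a).lTensor N :=
  TensorProduct.ext' fun u v => (R.map_lin (R.lTensor N) (TensorProduct.mk ℂ N M u)
    (fun _ _ => rfl) a v).symm

lemma VirRep.lin_mem (R : VirRep c M) {X : Submodule ℂ M}
    (hX : ∀ n, ∀ v ∈ X, R.op n v ∈ X) (a : Virasoro) {v : M} (hv : v ∈ X) : R.lin a v ∈ X := by
  have : (⊤ : Submodule ℂ Virasoro) ≤ X.comap (R.lin.flip v) := by
    rw [← Virasoro.span_eq_top, sup_le_iff, iSup_le_iff, Submodule.span_singleton_le_iff_mem]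
    refine ⟨fun n => ?_, ?_⟩
    · rw [Submodule.span_singleton_le_iff_mem]
      simpa using hX n v hv
    · simpa using X.smul_mem c hv
  exact this (Submodule.mem_top (x := a))

/-- An induced module with a quotient that is irreducible as a representation has this quotient as
its irreducible quotient, provided that its largest proper submodule is proper. -/
lemma exists_irrQuotient_equiv {L : Type*} [LieRing L] [LieAlgebra ℂ L] {E : Type*} [AddCommGroup E]
    [Module ℂ E] {R : L → Module.End ℂ E → Prop} {ρ : L →ₗ[ℂ] Module.End ℂ M}
    (hM : IsIrreducibleFamily (Set.range ρ)) (F : Induced R →ₗ[ℂ] M)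
    (hF : ∀ x v, F (act x v) = ρ x (F v)) (hF0 : F ≠ 0) (hJ : maxSubmodule R ≠ ⊤) :
    ∃ φ : IrrQuotient R ≃ₗ[ℂ] M, ∀ x v, φ (act x v) = ρ x (φ v) := by
  have hstable (X : Submodule (UniversalEnvelopingAlgebra ℂ L) (Induced R)) :
      ∀ a ∈ Set.range ρ, ∀ v ∈ (X.restrictScalars ℂ).map F, a v ∈ (X.restrictScalars ℂ).map F := by
    rintro _ ⟨x, rfl⟩ _ ⟨v, hv, rfl⟩
    exact ⟨act x v, X.smul_mem _ hv, hF x v⟩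
  have hsurj : Function.Surjective F := by
    rw [← LinearMap.range_eq_top, LinearMap.range_eq_map]
    refine (hM _ (hstable ⊤)).resolve_left fun h => hF0 ?_
    rw [Submodule.restrictScalars_top, ← LinearMap.range_eq_map] at h
    exact LinearMap.range_eq_bot.1 h
  let K : Submodule (UniversalEnvelopingAlgebra ℂ L) (Induced R) :=
    stableSubmodule (LinearMap.ker F) fun x v hv => by
      rw [LinearMap.mem_ker] at hv ⊢
      rw [hF, hv, map_zero]
  have hK : K ≤ maxSubmodule R := le_sSup fun h => hF0 <| LinearMap.ext fun v =>
    (h ▸ Submodule.mem_top : v ∈ K)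
  -- The image of the maximal submodule under F is 0 or all of M. In the second case the maximal
  -- submodule, which contains ker F, would be everything.
  have hker : LinearMap.ker (irrMap R) = LinearMap.ker F := by
    refine le_antisymm (fun v hv => ?_) fun v hv => irrMap_eq_zero.2 (hK hv)
    rw [LinearMap.mem_ker, irrMap_eq_zero] at hv
    rcases hM _ (hstable (maxSubmodule R)) with h | h
    · have : F v ∈ ((maxSubmodule R).restrictScalars ℂ).map F := ⟨v, hv, rfl⟩
      rwa [h, Submodule.mem_bot] at this
    · refine absurd (eq_top_iff.2 fun w _ => ?_) hJ
      obtain ⟨u, hu, huw⟩ := (h ▸ Submodule.mem_top :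
        F w ∈ ((maxSubmodule R).restrictScalars ℂ).map F)
      have : w - u ∈ K := by
        change F (w - u) = 0
        rw [map_sub, huw, sub_self]
      exact (sub_add_cancel w u) ▸ (maxSubmodule R).add_mem (hK this) hu
  let φ : IrrQuotient R ≃ₗ[ℂ] M :=
    ((irrMap R).quotKerEquivOfSurjective irrMap_surjective).symm ≪≫ₗ
      Submodule.quotEquivOfEq _ _ hker ≪≫ₗ F.quotKerEquivOfSurjective hsurj
  have hφ (v : Induced R) : φ (irrMap R v) = F v := by
    have : ((irrMap R).quotKerEquivOfSurjective irrMap_surjective).symm (irrMap R v) =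
        Submodule.Quotient.mk v := (LinearEquiv.symm_apply_eq _).2 rfl
    simp only [φ, LinearEquiv.trans_apply, this]
    rfl
  refine ⟨φ, fun x v => ?_⟩
  obtain ⟨v, rfl⟩ := irrMap_surjective v
  rw [← irrMap_act, hφ, hφ, hF]

end Stable

lemma tmul_ne_zero {M N : Type*} [AddCommGroup M] [Module ℂ M] [AddCommGroup N] [Module ℂ N] {m : M}
    {n : N} (hm : m ≠ 0) (hn : n ≠ 0) : m ⊗ₜ[ℂ] n ≠ 0 := by
  intro h0
  have : ¬ ∀ ξ : Module.Dual ℂ M, ξ m = 0 := fun h => hm ((Module.forall_dual_apply_eq_zero_iff ℂ m).1 h)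
  push Not at this
  obtain ⟨ξ, hξ⟩ := this
  have h1 := congrArg (TensorProduct.lid ℂ N ∘ ξ.rTensor N) h0
  simp [hξ, hn] at h1

section TensorTop

variable {V W M₁ M₂ M₃ : Type*} [AddCommGroup V] [Module ℂ V] [AddCommGroup W] [Module ℂ W]
  [AddCommGroup M₁] [Module ℂ M₁] [AddCommGroup M₂] [Module ℂ M₂] [AddCommGroup M₃] [Module ℂ M₃]
  {f₁ : V →ₗ[ℂ] M₁} {f₂ : W →ₗ[ℂ] M₂} {f₃ : ℂ →ₗ[ℂ] M₃}

/-- The map of the tops into a tensor product of highest weight modules. -/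
def tensorTop (f₁ : V →ₗ[ℂ] M₁) (f₂ : W →ₗ[ℂ] M₂) (f₃ : ℂ →ₗ[ℂ] M₃) :
    V ⊗[ℂ] W →ₗ[ℂ] M₁ ⊗[ℂ] (M₂ ⊗[ℂ] M₃) :=
  TensorProduct.map f₁ ((TensorProduct.mk ℂ _ _).flip (f₃ 1) ∘ₗ f₂)

lemma tensorTop_tmul (v : V) (w : W) :
    tensorTop f₁ f₂ f₃ (v ⊗ₜ w) = f₁ v ⊗ₜ (f₂ w ⊗ₜ f₃ 1) := rfl

lemma tensorTop_ne_zero (h₁ : f₁ ≠ 0) (h₂ : f₂ ≠ 0) (h₃ : f₃ ≠ 0) : tensorTop f₁ f₂ f₃ ≠ 0 := by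
  obtain ⟨v, hv⟩ := DFunLike.ne_iff.1 h₁
  obtain ⟨w, hw⟩ := DFunLike.ne_iff.1 h₂
  have h3 : f₃ 1 ≠ 0 := fun h => h₃ (LinearMap.ext_ring h)
  intro h0
  have h4 := tensorTop_tmul (f₁ := f₁) (f₂ := f₂) (f₃ := f₃) v w
  rw [h0, LinearMap.zero_apply] at h4
  exact tmul_ne_zero hv (tmul_ne_zero hw h3) h4.symm

end TensorTop

section Main

variable {g s : Type*} [LieRing g] [LieAlgebra ℂ g] [LieRing s] [LieAlgebra ℂ s]
  [FiniteDimensional ℂ g] [FiniteDimensional ℂ s]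
  {B : InvForm g} {B' : InvForm s} {h h' c₁ c₂ c c' k₁ k₂ ΩV ΩW : ℂ}
  {V : Type*} [AddCommGroup V] [Module ℂ V] [LieRingModule g V] [LieModule ℂ g V]
  {W : Type*} [AddCommGroup W] [Module ℂ W] [LieRingModule s W] [LieModule ℂ s W]

/-- If the irreducible quotient of an induced module with irreducible top vanishes, then every
compatible map from the top to a representation vanishes. -/
lemma IsHighestWeight.eq_zero_of_subsingleton {L : Type*} [LieRing L] [LieAlgebra ℂ L] {E : Type*}
    [AddCommGroup E] [Module ℂ E] {R : L → Module.End ℂ E → Prop} {D : ℤ → Submodule ℂ L}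
    {Z : Submodule ℂ L} {L₀ : Module.End ℂ (Induced R)} {h : ℂ}
    (H : IsHighestWeight D Z (LinearMap.range (topMap R)) L₀ h)
    (hE : IsIrreducibleFamily {A | ∃ p, R p A}) (hR : Subsingleton (IrrQuotient R))
    {M : Type*} [AddCommGroup M] [Module ℂ M] {ρ : L →ₗ[ℂ] Module.End ℂ M} (hρ : IsRep ρ)
    (f : E →ₗ[ℂ] M) (hf : ∀ p A, R p A → ∀ e, ρ p (f e) = f (A e)) (e : E) : f e = 0 := by
  obtain ⟨F, hF, -⟩ := TorVOA.exists_lift hρ f hf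
  rw [← hF, H.top_eq_zero hE (Submodule.Quotient.subsingleton_iff.1 hR), map_zero]

lemma IsTopMap.subsingleton {L : Type*} [LieRing L] [LieAlgebra ℂ L] {E : Type*}
    [AddCommGroup E] [Module ℂ E] {R : L → Module.End ℂ E → Prop} {M : Type*} [AddCommGroup M]
    [Module ℂ M] [Module (UniversalEnvelopingAlgebra ℂ L) M]
    [IsScalarTower ℂ (UniversalEnvelopingAlgebra ℂ L) M] {f : E →ₗ[ℂ] M} (hf : IsTopMap R f)
    (h : f = 0) : Subsingleton M :=
  (Submodule.subsingleton_iff ℂ).1 (subsingleton_of_bot_eq_top (hf.generates.eq_top h))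

/-- The module `V_f̄` vanishes if one of the three irreducible modules does. -/
lemma subsingleton_of_factor (hk₁ : IsDualCoxeter B k₁) (hk₂ : IsDualCoxeter B' k₂)
    (hc₁ : c₁ + k₁ ≠ 0) (hc₂ : c₂ + k₂ ≠ 0)
    (hc : c' = c - c₁ * (Module.finrank ℂ g : ℂ) / (c₁ + k₁) -
      c₂ * (Module.finrank ℂ s : ℂ) / (c₂ + k₂))
    [LieModule.IsIrreducible ℂ g V] [LieModule.IsIrreducible ℂ s W]
    (hV : ∀ v, casimir B V v = ΩV • v) (hW : ∀ w, casimir B' W w = ΩW • w)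
    (hh : h' = h - ΩV / (2 * (c₁ + k₁)) - ΩW / (2 * (c₂ + k₂)))
    (hL : Subsingleton (LAffine B V c₁) ∨ Subsingleton (LAffine B' W c₂) ∨
      Subsingleton (LVir h' c')) :
    Subsingleton (Induced (FBarTopRel B B' V W h c₁ c₂ c)) := by
  have hf : IsTopMap (FBarTopRel B B' V W h c₁ c₂ c) _ := isTopMap_topMap
  set f := topMap (FBarTopRel B B' V W h c₁ c₂ c)
  refine hf.subsingleton ?_
  -- For fixed w, the map v ↦ f(v ⊗ w) satisfies the relations defining the induced module of ĝ, so
  -- it vanishes if that module's irreducible quotient does; likewise for the second factor.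
  rcases hL with hL | hL | hL
  · refine TensorProduct.ext' fun v w => ?_
    refine ((isTopMap_topMap (R := AffineTopRel B V c₁)).isHighestWeight_affine hk₁ hc₁ hV
      ).eq_zero_of_subsingleton isIrreducibleFamily_affineTopRel hL hf.fBarRep.fst.isRep
      (f ∘ₗ (TensorProduct.mk ℂ V W).flip w) ?_ v
    rintro _ _ (⟨x, n, hn⟩ | x | _) e
    · rw [LoopRep.lin_el]
      rw [LinearMap.zero_apply, map_zero]
      exact hf.fBar_fst_pos n hn x _
    · rw [LoopRep.lin_el]
      exact hf.act_apply (.fst_zero x) _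
    · rw [LoopRep.lin_C]
      simp
  · refine TensorProduct.ext' fun v w => ?_
    refine ((isTopMap_topMap (R := AffineTopRel B' W c₂)).isHighestWeight_affine hk₂ hc₂ hW
      ).eq_zero_of_subsingleton isIrreducibleFamily_affineTopRel hL hf.fBarRep.snd.isRep
      (f ∘ₗ TensorProduct.mk ℂ V W v) ?_ w
    rintro _ _ (⟨x, n, hn⟩ | x | _) e
    · rw [LoopRep.lin_el]
      rw [LinearMap.zero_apply, map_zero]
      exact hf.fBar_snd_pos n hn x _
    · rw [LoopRep.lin_el]
      exact hf.act_apply (.snd_zero x) _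
    · rw [LoopRep.lin_C]
      simp
  -- The coset operators act on f(v ⊗ w) as on a Virasoro highest weight vector: subtracting the two
  -- Sugawara eigenvalues from h leaves h'.
  · obtain ⟨S, hS₁, hS₂, hS₃⟩ := hf.fBarRep.exists_splitRep hk₁ hk₂ hc₁ hc₂ hc
    refine TensorProduct.ext' fun v w => ?_
    have h1 (n : ℤ) (hn : 0 < n) : hf.fBarRep.fst.sug k₁ n (f (v ⊗ₜ w)) = 0 :=
      hf.fBarRep.fst.sug_pos (f := f ∘ₗ (TensorProduct.mk ℂ V W).flip w)
        (fun n hn x v => hf.fBar_fst_pos n hn x _) (fun x v => hf.fBar_fst_zero x v w) hn v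
    have h2 (n : ℤ) (hn : 0 < n) : hf.fBarRep.snd.sug k₂ n (f (v ⊗ₜ w)) = 0 :=
      hf.fBarRep.snd.sug_pos (f := f ∘ₗ TensorProduct.mk ℂ V W v)
        (fun n hn x v => hf.fBar_snd_pos n hn x _) (fun x w => hf.fBar_snd_zero x v w) hn w
    have h3 : hf.fBarRep.fst.sug k₁ 0 (f (v ⊗ₜ w)) = (ΩV / (2 * (c₁ + k₁))) • f (v ⊗ₜ w) := by
      have := hf.fBarRep.fst.sug_zero (k := k₁) (f := f ∘ₗ (TensorProduct.mk ℂ V W).flip w)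
        (fun n hn x v => hf.fBar_fst_pos n hn x _) (fun x v => hf.fBar_fst_zero x v w) v
      rw [hV, map_smul, smul_smul, one_div_mul_eq_div] at this
      exact this
    have h4 : hf.fBarRep.snd.sug k₂ 0 (f (v ⊗ₜ w)) = (ΩW / (2 * (c₂ + k₂))) • f (v ⊗ₜ w) := by
      have := hf.fBarRep.snd.sug_zero (k := k₂) (f := f ∘ₗ TensorProduct.mk ℂ V W v)
        (fun n hn x v => hf.fBar_snd_pos n hn x _) (fun x w => hf.fBar_snd_zero x v w) w
      rw [hW, map_smul, smul_smul, one_div_mul_eq_div] at this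
      exact this
    have := (isTopMap_topMap (R := VirTopRel h' c')).isHighestWeight_vir.eq_zero_of_subsingleton
      (isIrreducibleFamily_complex _) hL S.vir.isRep (LinearMap.toSpanSingleton ℂ _ (f (v ⊗ₜ w))) ?_ 1
    · rwa [LinearMap.toSpanSingleton_apply, one_smul] at this
    rintro _ _ (⟨n, hn⟩ | _ | _) e
    · have h5 := hS₃ n (f (v ⊗ₜ w))
      rw [hf.fBarRep_vir, hf.fBar_vir_pos n hn, h1 n hn, h2 n hn, zero_add, zero_add] at h5
      rw [VirRep.lin_L, LinearMap.toSpanSingleton_apply, map_smul, ← h5]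
      simp
    · have h5 := hS₃ 0 (f (v ⊗ₜ w))
      rw [hf.fBarRep_vir, hf.fBar_vir_zero, h3, h4] at h5
      have h6 : S.vir.op 0 (f (v ⊗ₜ w)) = h' • f (v ⊗ₜ w) := by
        rw [hh]
        linear_combination (norm := module) -h5
      rw [VirRep.lin_L, LinearMap.toSpanSingleton_apply, map_smul, h6]
      simp [smul_smul, mul_comm]
    · rw [VirRep.lin_C]
      simp [smul_smul, mul_comm]

section Tensor

variable {M₁ M₂ M₃ : Type*} [AddCommGroup M₁] [Module ℂ M₁]
  [Module (UniversalEnvelopingAlgebra ℂ (Affine B)) M₁]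
  [IsScalarTower ℂ (UniversalEnvelopingAlgebra ℂ (Affine B)) M₁]
  [AddCommGroup M₂] [Module ℂ M₂] [Module (UniversalEnvelopingAlgebra ℂ (Affine B')) M₂]
  [IsScalarTower ℂ (UniversalEnvelopingAlgebra ℂ (Affine B')) M₂]
  [AddCommGroup M₃] [Module ℂ M₃] [Module (UniversalEnvelopingAlgebra ℂ Virasoro) M₃]
  [IsScalarTower ℂ (UniversalEnvelopingAlgebra ℂ Virasoro) M₃]
  {f₁ : V →ₗ[ℂ] M₁} {f₂ : W →ₗ[ℂ] M₂} {f₃ : ℂ →ₗ[ℂ] M₃}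

/-- The representation of `f̄` on a tensor product. -/
lemma exists_tensorRep (hf₁ : IsTopMap (AffineTopRel B V c₁) f₁)
    (hf₂ : IsTopMap (AffineTopRel B' W c₂) f₂) (hf₃ : IsTopMap (VirTopRel h' c') f₃)
    (hk₁ : IsDualCoxeter B k₁) (hk₂ : IsDualCoxeter B' k₂)
    (hc₁ : c₁ + k₁ ≠ 0) (hc₂ : c₂ + k₂ ≠ 0)
    (hc : c' = c - c₁ * (Module.finrank ℂ g : ℂ) / (c₁ + k₁) -
      c₂ * (Module.finrank ℂ s : ℂ) / (c₂ + k₂)) :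
    ∃ P : FBarRep B B' c₁ c₂ c (M₁ ⊗[ℂ] (M₂ ⊗[ℂ] M₃)),
      (∀ u v w a, P.lin (FBar.ofFst B B' a) (u ⊗ₜ (v ⊗ₜ w)) = act a u ⊗ₜ (v ⊗ₜ w)) ∧
      (∀ u v w a, P.lin (FBar.ofSnd B B' a) (u ⊗ₜ (v ⊗ₜ w)) = u ⊗ₜ (act a v ⊗ₜ w)) ∧
      (∀ u v w n, P.lin (FBar.ofVir B B' (.L n)) (u ⊗ₜ (v ⊗ₜ w)) =
        hf₁.loopRep.sug k₁ n u ⊗ₜ (v ⊗ₜ w) + (u ⊗ₜ (hf₂.loopRep.sug k₂ n v ⊗ₜ w) +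
          u ⊗ₜ (v ⊗ₜ act (Virasoro.L n) w))) ∧
      ∀ X : Submodule ℂ (M₁ ⊗[ℂ] (M₂ ⊗[ℂ] M₃)), (∀ a, ∀ v ∈ X, P.lin a v ∈ X) →
        (∀ a : Affine B, ∀ v ∈ X, (act a).rTensor _ v ∈ X) ∧
        (∀ a : Affine B', ∀ v ∈ X, ((act a).rTensor _).lTensor _ v ∈ X) ∧
        (∀ a : Virasoro, ∀ v ∈ X, ((act a).lTensor _).lTensor _ v ∈ X) := by
  obtain ⟨P, hP₁, hP₂, hP₃⟩ := (SplitRep.tensor hf₁.loopRep hf₂.loopRep hf₃.virRep).exists_fBarRep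
    hk₁ hk₂ hc₁ hc₂ hc
  have hfst (a : Affine B) : P.lin (FBar.ofFst B B' a) = (act a).rTensor _ := by
    rw [P.lin_ofFst, hP₁, ← hf₁.loopRep_lin]
    exact hf₁.loopRep.rTensor_lin a
  have hsnd (a : Affine B') : P.lin (FBar.ofSnd B B' a) = ((act a).rTensor _).lTensor _ := by
    rw [P.lin_ofSnd, hP₂, ← hf₂.loopRep_lin, ← LoopRep.rTensor_lin]
    exact (hf₂.loopRep.rTensor _).lTensor_lin a
  have hvir (n : ℤ) : P.lin (FBar.ofVir B B' (.L n)) = (hf₁.loopRep.rTensor _).sug k₁ n +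
      (((hf₂.loopRep.rTensor _).lTensor _).sug k₂ n +
        ((hf₃.virRep.lTensor _).lTensor _).op n) := by
    rw [P.lin_ofVir, VirRep.lin_L, hP₃]
    rfl
  refine ⟨P, fun u v w a => ?_, fun u v w a => ?_, fun u v w n => ?_, fun X hX =>
    ⟨fun a v hv => ?_, fun a v hv => ?_, fun a v hv => ?_⟩⟩
  · rw [hfst, LinearMap.rTensor_tmul]
  · rw [hsnd, LinearMap.lTensor_tmul, LinearMap.rTensor_tmul]
  · rw [hvir, LoopRep.rTensor_sug, LoopRep.lTensor_sug, LoopRep.rTensor_sug]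
    rfl
  · exact hfst a ▸ hX _ v hv
  · exact hsnd a ▸ hX _ v hv
  -- A subspace stable under the loops is stable under their Sugawara operators, so the Virasoro
  -- action on the third factor is recovered by subtraction.
  · have h1 (n) (v) (hv : v ∈ X) : (hf₁.loopRep.rTensor _).sug k₁ n v ∈ X :=
      (hf₁.loopRep.rTensor _).sug_mem X (fun n x v hv => by
        have := hX (FBar.ofFst B B' (.el B x n)) v hv
        rwa [hfst] at this) n hv
    have h2 (n) (v) (hv : v ∈ X) : ((hf₂.loopRep.rTensor _).lTensor _).sug k₂ n v ∈ X :=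
      ((hf₂.loopRep.rTensor _).lTensor _).sug_mem X (fun n x v hv => by
        have := hX (FBar.ofSnd B B' (.el B' x n)) v hv
        rwa [hsnd] at this) n hv
    rw [← hf₃.virRep_lin, ← VirRep.lTensor_lin, ← VirRep.lTensor_lin]
    refine VirRep.lin_mem _ (fun n v hv => ?_) a hv
    have h3 := X.sub_mem (hX (FBar.ofVir B B' (.L n)) v hv) (X.add_mem (h1 n v hv) (h2 n v hv))
    rwa [hvir, LinearMap.add_apply, LinearMap.add_apply, ← add_assoc, add_sub_cancel_left] at h3

/-- This makes the universal property of the induced module applicable; the three eigenvalues of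
L(0) add up to h. -/
lemma tensorTop_act (hf₁ : IsTopMap (AffineTopRel B V c₁) f₁)
    (hf₂ : IsTopMap (AffineTopRel B' W c₂) f₂) (hf₃ : IsTopMap (VirTopRel h' c') f₃)
    {P : FBarRep B B' c₁ c₂ c (M₁ ⊗[ℂ] (M₂ ⊗[ℂ] M₃))}
    (hP₁ : ∀ u v w a, P.lin (FBar.ofFst B B' a) (u ⊗ₜ (v ⊗ₜ w)) = act a u ⊗ₜ (v ⊗ₜ w))
    (hP₂ : ∀ u v w a, P.lin (FBar.ofSnd B B' a) (u ⊗ₜ (v ⊗ₜ w)) = u ⊗ₜ (act a v ⊗ₜ w))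
    (hP₃ : ∀ u v w n, P.lin (FBar.ofVir B B' (.L n)) (u ⊗ₜ (v ⊗ₜ w)) =
      hf₁.loopRep.sug k₁ n u ⊗ₜ (v ⊗ₜ w) + (u ⊗ₜ (hf₂.loopRep.sug k₂ n v ⊗ₜ w) +
        u ⊗ₜ (v ⊗ₜ act (Virasoro.L n) w)))
    (hV : ∀ v, casimir B V v = ΩV • v) (hW : ∀ w, casimir B' W w = ΩW • w)
    (hh : h' = h - ΩV / (2 * (c₁ + k₁)) - ΩW / (2 * (c₂ + k₂)))
    (p : FBar B B') (A) (hpA : FBarTopRel B B' V W h c₁ c₂ c p A) (t : V ⊗[ℂ] W) :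
    P.lin p (tensorTop f₁ f₂ f₃ t) = tensorTop f₁ f₂ f₃ (A t) := by
  suffices h1 : P.lin p ∘ₗ tensorTop f₁ f₂ f₃ = tensorTop f₁ f₂ f₃ ∘ₗ A from LinearMap.congr_fun h1 t
  refine TensorProduct.ext' fun v w => ?_
  rw [LinearMap.comp_apply, LinearMap.comp_apply, tensorTop_tmul]
  rcases hpA with ⟨x, n, hn⟩ | x | _ | ⟨x, n, hn⟩ | x | _ | ⟨n, hn⟩ | _ | _
  · rw [hP₁, hf₁.affine_pos n hn, LinearMap.zero_apply, map_zero, TensorProduct.zero_tmul]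
  · rw [hP₁, hf₁.act_apply (.zero x)]
    rfl
  · rw [P.lin_ofFst, LoopRep.lin_C]
    simp [tensorTop_tmul]
  · rw [hP₂, hf₂.affine_pos n hn, LinearMap.zero_apply, map_zero, TensorProduct.zero_tmul,
      TensorProduct.tmul_zero]
  · rw [hP₂, hf₂.act_apply (.zero x)]
    rfl
  · rw [P.lin_ofSnd, LoopRep.lin_C]
    simp [tensorTop_tmul]
  · rw [hP₃, hf₁.loopRep.sug_pos hf₁.affine_pos hf₁.loopRep_zero hn,
      hf₂.loopRep.sug_pos hf₂.affine_pos hf₂.loopRep_zero hn, hf₃.vir_pos n hn]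
    simp
  · rw [hP₃, hf₁.loopRep_sug hV, hf₂.loopRep_sug hW, hf₃.vir_zero]
    simp only [← TensorProduct.smul_tmul', TensorProduct.tmul_smul, LinearMap.smul_apply,
      Module.End.one_apply, map_smul, tensorTop_tmul, ← add_smul]
    congr 1
    rw [hh]
    ring
  · rw [P.lin_ofVir, VirRep.lin_C]
    simp [tensorTop_tmul]

set_option maxHeartbeats 1000000 in
/-- The tensor product of irreducible highest weight modules is an irreducible highest weight module
of `f̄`. -/
lemma exists_equiv_tensor (hf₁ : IsTopMap (AffineTopRel B V c₁) f₁)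
    (hf₂ : IsTopMap (AffineTopRel B' W c₂) f₂) (hf₃ : IsTopMap (VirTopRel h' c') f₃)
    (hk₁ : IsDualCoxeter B k₁) (hk₂ : IsDualCoxeter B' k₂)
    (hc₁ : c₁ + k₁ ≠ 0) (hc₂ : c₂ + k₂ ≠ 0)
    (hc : c' = c - c₁ * (Module.finrank ℂ g : ℂ) / (c₁ + k₁) -
      c₂ * (Module.finrank ℂ s : ℂ) / (c₂ + k₂))
    [FiniteDimensional ℂ V] [FiniteDimensional ℂ W]
    [LieModule.IsIrreducible ℂ g V] [LieModule.IsIrreducible ℂ s W]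
    (hV : ∀ v, casimir B V v = ΩV • v) (hW : ∀ w, casimir B' W w = ΩW • w)
    (hh : h' = h - ΩV / (2 * (c₁ + k₁)) - ΩW / (2 * (c₂ + k₂)))
    (hM₁ : IsIrreducibleFamily (Set.range (act (L := Affine B) (M := M₁))))
    (hM₂ : IsIrreducibleFamily (Set.range (act (L := Affine B') (M := M₂))))
    (hM₃ : IsIrreducibleFamily (Set.range (act (L := Virasoro) (M := M₃))))
    [Nontrivial M₁] [Nontrivial M₂] [Nontrivial M₃] :
    ∃ φ : M₁ ⊗[ℂ] (M₂ ⊗[ℂ] M₃) ≃ₗ[ℂ] LFBar B B' V W h c₁ c₂ c,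
      (∀ u v w (a : Affine B), act (FBar.ofFst B B' a) (φ (u ⊗ₜ (v ⊗ₜ w))) =
        φ (act a u ⊗ₜ (v ⊗ₜ w))) ∧
      (∀ u v w (a : Affine B'), act (FBar.ofSnd B B' a) (φ (u ⊗ₜ (v ⊗ₜ w))) =
        φ (u ⊗ₜ (act a v ⊗ₜ w))) ∧
      (∀ u v w n, act (FBar.ofVir B B' (.L n)) (φ (u ⊗ₜ (v ⊗ₜ w))) =
        φ (hf₁.loopRep.sug k₁ n u ⊗ₜ (v ⊗ₜ w) + (u ⊗ₜ (hf₂.loopRep.sug k₂ n v ⊗ₜ w) +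
          u ⊗ₜ (v ⊗ₜ act (Virasoro.L n) w)))) ∧
      ∀ m, act (FBar.ofVir B B' .C) (φ m) = φ (c • m) := by
  obtain ⟨P, hP₁', hP₂', hP₃', hP⟩ := exists_tensorRep hf₁ hf₂ hf₃ hk₁ hk₂ hc₁ hc₂ hc
  have hirr : IsIrreducibleFamily (Set.range P.lin) := fun X hX => by
    obtain ⟨h1, h2, h3⟩ := hP X fun a => hX _ ⟨a, rfl⟩
    refine hM₁.tensor (hf₁.hasScalarCommutant_affine hk₁ hc₁ hV hM₁)
      (hM₂.tensor (hf₂.hasScalarCommutant_affine hk₂ hc₂ hW hM₂) hM₃) X ?_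
    rintro _ (⟨_, ⟨a, rfl⟩, rfl⟩ | ⟨_, ⟨_, ⟨a, rfl⟩, rfl⟩ | ⟨_, ⟨a, rfl⟩, rfl⟩, rfl⟩)
    · exact h1 a
    · exact h2 a
    · exact h3 a
  have hlift := tensorTop_act hf₁ hf₂ hf₃ hP₁' hP₂' hP₃' hV hW hh
  have hf0 := tensorTop_ne_zero (fun h => not_subsingleton _ (hf₁.subsingleton h))
    (fun h => not_subsingleton _ (hf₂.subsingleton h))
    (fun h => not_subsingleton _ (hf₃.subsingleton h))
  obtain ⟨F, hF, hFact⟩ := TorVOA.exists_lift P.isRep (tensorTop f₁ f₂ f₃) hlift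
  have hF0 : F ≠ 0 := fun h0 => hf0 <| LinearMap.ext fun t => by rw [← hF, h0]; rfl
  -- If the sum of the proper submodules were everything, the top of the induced module would
  -- vanish, and with it the nonzero map `tensorTop`.
  obtain ⟨φ, hφ⟩ := exists_irrQuotient_equiv hirr F hFact hF0 fun hJ => hf0 <|
    LinearMap.ext fun t => by
      rw [← hF, isTopMap_topMap.isHighestWeight_fBar.top_eq_zero isIrreducibleFamily_fBarTopRel hJ,
        map_zero, LinearMap.zero_apply]
  have hφ' (x) (m) : act x (φ.symm m) = φ.symm (P.lin x m) := by
    rw [LinearEquiv.eq_symm_apply, hφ, LinearEquiv.apply_symm_apply]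
  refine ⟨φ.symm, fun u v w a => ?_, fun u v w a => ?_, fun u v w n => ?_, fun m => ?_⟩
  · rw [hφ', hP₁']
  · rw [hφ', hP₂']
  · rw [hφ', hP₃']
  · rw [hφ', P.lin_ofVir, VirRep.lin_C]
    rfl

end Tensor

set_option maxHeartbeats 1000000 in
/-- The irreducible highest weight modules of `f̄` are tensor products. -/
theorem exists_isFBarIso (hk₁ : IsDualCoxeter B k₁) (hk₂ : IsDualCoxeter B' k₂)
    (hc₁ : c₁ + k₁ ≠ 0) (hc₂ : c₂ + k₂ ≠ 0)
    (hc : c' = c - c₁ * (Module.finrank ℂ g : ℂ) / (c₁ + k₁) -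
      c₂ * (Module.finrank ℂ s : ℂ) / (c₂ + k₂))
    [FiniteDimensional ℂ V] [FiniteDimensional ℂ W]
    [LieModule.IsIrreducible ℂ g V] [LieModule.IsIrreducible ℂ s W]
    (hV : ∀ v, casimir B V v = ΩV • v) (hW : ∀ w, casimir B' W w = ΩW • w)
    (hh : h' = h - ΩV / (2 * (c₁ + k₁)) - ΩW / (2 * (c₂ + k₂))) :
    ∃ φ : LAffine B V c₁ ⊗[ℂ] (LAffine B' W c₂ ⊗[ℂ] LVir h' c') ≃ₗ[ℂ]
      LFBar B B' V W h c₁ c₂ c, IsFBarIso k₁ k₂ φ := by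
  -- If one factor is zero, both sides are zero and the zero map is the isomorphism.
  by_cases hL : Subsingleton (LAffine B V c₁) ∨ Subsingleton (LAffine B' W c₂) ∨
      Subsingleton (LVir h' c')
  · have hsub := subsingleton_of_factor hk₁ hk₂ hc₁ hc₂ hc hV hW hh hL
    have h1 : Subsingleton (LFBar B B' V W h c₁ c₂ c) := irrMap_surjective.subsingleton
    have h2 : Subsingleton (LAffine B V c₁ ⊗[ℂ] (LAffine B' W c₂ ⊗[ℂ] LVir h' c')) := by
      rcases hL with hL | hL | hL <;> infer_instance
    exact ⟨0, fun _ _ _ _ => Subsingleton.elim _ _, fun _ _ _ _ => Subsingleton.elim _ _,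
      fun _ _ _ _ => Subsingleton.elim _ _, fun _ _ _ => Subsingleton.elim _ _⟩
  rw [not_or, not_or, not_subsingleton_iff_nontrivial, not_subsingleton_iff_nontrivial,
    not_subsingleton_iff_nontrivial] at hL
  obtain ⟨n₁, n₂, n₃⟩ := hL
  have hf₁ := isTopMap_irrTop (R := AffineTopRel B V c₁)
  have hf₂ := isTopMap_irrTop (R := AffineTopRel B' W c₂)
  obtain ⟨φ, h1, h2, h3, h4⟩ := exists_equiv_tensor hf₁ hf₂ isTopMap_irrTop hk₁ hk₂ hc₁ hc₂ hc
    hV hW hh (irr_isIrreducibleFamily _) (irr_isIrreducibleFamily _) (irr_isIrreducibleFamily _)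
  refine ⟨φ, fun a u v w => h1 u v w a, fun a u v w => h2 u v w a, fun n u v w => ?_,
    fun u v w => h4 _⟩
  rw [sugawara_eq_sug hf₁.loopRep (fun _ _ _ => rfl),
    sugawara_eq_sug hf₂.loopRep (fun _ _ _ => rfl), add_assoc]
  exact h3 u v w n

end Main
end
end TorVOA


namespace TorVOA

noncomputable section

/-! ### The dual Coxeter number -/

section RootSystem

variable {ι R M N : Type*} [CommRing R] [AddCommGroup M] [Module R M]
  [AddCommGroup N] [Module R N] {P : RootPairing ι R M N} {b : P.Base}

lemma exists_eq_sum_nat_of_mem_closure (b : P.Base) {m : M}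
    (hm : m ∈ AddSubmonoid.closure (P.root '' b.support)) :
    ∃ f : ι → ℕ, m = ∑ j ∈ b.support, f j • P.root j := by
  classical
  induction hm using AddSubmonoid.closure_induction with
  | mem x hx =>
    obtain ⟨j, hj, rfl⟩ := hx
    refine ⟨Pi.single j 1, ?_⟩
    rw [Finset.sum_eq_single_of_mem j hj fun i _ hi => by simp [hi]]
    simp
  | zero => exact ⟨0, by simp⟩
  | add x y _ _ hx hy =>
    obtain ⟨f, rfl⟩ := hx
    obtain ⟨g, rfl⟩ := hy
    exact ⟨f + g, by simp [add_smul, Finset.sum_add_distrib]⟩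

variable [CharZero R]

/-- The highest root has larger height than all other roots. -/
lemma height_lt_of_highest {θ : ι}
    (hθ : ∀ i, P.root θ - P.root i ∈ AddSubmonoid.closure (P.root '' b.support)) {i : ι} (hi : i ≠ θ) :
    b.height i < b.height θ := by
  obtain ⟨f, hf⟩ := exists_eq_sum_nat_of_mem_closure b (hθ i)
  obtain ⟨e, -, -, he⟩ := b.exists_root_eq_sum_int i
  have h1 : P.root θ = ∑ j ∈ b.support, (e j + f j) • P.root j := by
    simp only [add_smul, Finset.sum_add_distrib, natCast_zsmul]
    rw [← he, ← hf, add_sub_cancel]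
  rw [RootPairing.Base.height_eq_sum h1, RootPairing.Base.height_eq_sum he, Finset.sum_add_distrib,
    lt_add_iff_pos_right]
  refine lt_of_le_of_ne (Finset.sum_nonneg fun j _ => Int.natCast_nonneg _) fun h0 => hi ?_
  rw [eq_comm, Finset.sum_eq_zero_iff_of_nonneg fun j _ => Int.natCast_nonneg _] at h0
  have h2 : P.root θ - P.root i = 0 := by
    rw [hf]
    exact Finset.sum_eq_zero fun j hj => by rw [Int.natCast_eq_zero.1 (h0 j hj), zero_smul]
  exact (P.root.injective (sub_eq_zero.1 h2)).symm

variable [P.IsCrystallographic]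

lemma height_reflectionPerm (b : P.Base) (i j : ι) :
    b.height (P.reflectionPerm j i) = b.height i - P.pairingIn ℤ i j * b.height j := by
  have : P.root (P.reflectionPerm j i) = P.root i + (-P.pairingIn ℤ i j) • P.root j := by
    rw [P.root_reflectionPerm, neg_smul, P.reflection_apply_root' ℤ, sub_eq_add_neg]
  rw [b.height_add_zsmul this, smul_eq_mul]
  ring

lemma pairingIn_reflectionPerm (i j : ι) :
    P.pairingIn ℤ (P.reflectionPerm j i) j = -P.pairingIn ℤ i j :=
  FaithfulSMul.algebraMap_injective ℤ R (by
    rw [P.algebraMap_pairingIn, map_neg, P.algebraMap_pairingIn, ← P.pairing_reflectionPerm,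
      P.pairing_reflectionPerm_self_right])

variable [IsDomain R]

/-- The sum of the values of the positive roots on a simple coroot is two. -/
lemma sum_pairingIn_simple [P.IsReduced] [Fintype ι] [DecidablePred b.IsPos] {j : ι} (hj : j ∈ b.support) :
    ∑ i with b.IsPos i, P.pairingIn ℤ i j = 2 := by
  classical
  have hjpos := RootPairing.Base.isPos_of_mem_support hj
  rw [← Finset.add_sum_erase _ _ (Finset.mem_filter.2 ⟨Finset.mem_univ j, hjpos⟩),
    P.pairingIn_same, add_eq_left]
  -- The simple reflection s_j permutes the positive roots other than α_j and negates the pairing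
  -- with its coroot, so these roots contribute zero in total.
  have h1 : ∑ i ∈ (Finset.univ.filter b.IsPos).erase j, P.pairingIn ℤ i j =
      ∑ i ∈ (Finset.univ.filter b.IsPos).erase j, -P.pairingIn ℤ i j := by
    have hmem (i) (hi : i ∈ (Finset.univ.filter b.IsPos).erase j) :
        P.reflectionPerm j i ∈ (Finset.univ.filter b.IsPos).erase j := by
      rw [Finset.mem_erase, Finset.mem_filter] at hi ⊢
      refine ⟨fun h => ?_, Finset.mem_univ _, hi.2.2.reflectionPerm hj hi.1⟩
      have h2 := height_reflectionPerm b i j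
      have h3 := pairingIn_reflectionPerm (P := P) i j
      have h4 := hi.2.2
      rw [RootPairing.Base.isPos_iff] at h4
      rw [h, P.pairingIn_same] at h3
      rw [h, RootPairing.Base.height_one_of_mem_support hj] at h2
      lia
    refine Finset.sum_nbij' (P.reflectionPerm j) (P.reflectionPerm j) hmem hmem (fun i _ => by simp)
      (fun i _ => by simp) fun i _ => ?_
    rw [pairingIn_reflectionPerm, neg_neg]
  rw [Finset.sum_neg_distrib] at h1
  lia

/-- This is the pairing of 2ρ with θ^∨; each simple coroot in the expansion of θ^∨ contributes 2. -/
lemma sum_pairingIn_pos [P.IsReduced] [Fintype ι] [DecidablePred b.IsPos] (θ : ι) :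
    ∑ i with b.IsPos i, P.pairingIn ℤ i θ = 2 * b.flip.height θ := by
  obtain ⟨f, -, -, hf⟩ := b.flip.exists_root_eq_sum_int θ
  rw [RootPairing.Base.height_eq_sum hf, Finset.mul_sum]
  have h1 (i : ι) : P.pairingIn ℤ i θ = ∑ j ∈ b.support, f j * P.pairingIn ℤ i j := by
    refine FaithfulSMul.algebraMap_injective ℤ R ?_
    have h2 := congrArg (P.toLinearMap (P.root i)) hf
    simp only [map_sum, map_zsmul] at h2
    simp only [map_sum, map_mul, P.algebraMap_pairingIn]
    simpa using h2
  rw [Finset.sum_congr rfl fun i _ => h1 i, Finset.sum_comm]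
  refine Finset.sum_congr rfl fun j hj => ?_
  rw [← Finset.mul_sum, sum_pairingIn_simple (b := b) hj, mul_comm]

/-- For positive α ≠ θ the integer ⟨α, θ^∨⟩ is 0 or 1, hence equal to its square. The sum of squares
over the positive roots thus exceeds the linear sum only by 4 - 2 at θ; the negative roots double
it. -/
lemma sum_sq_pairingIn_highest [P.IsReduced] [Fintype ι] {θ : ι}
    (hθ : ∀ i, P.root θ - P.root i ∈ AddSubmonoid.closure (P.root '' b.support)) :
    ∑ i, P.pairingIn ℤ i θ ^ 2 = 4 * (1 + b.flip.height θ) := by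
  classical
  let := P.indexNeg
  have hmax (i : ι) : b.height i ≤ b.height θ := by
    rcases eq_or_ne i θ with rfl | h
    · exact le_rfl
    · exact (height_lt_of_highest hθ h).le
  have hpos : b.IsPos θ := by
    have h1 := hmax (-θ)
    rw [b.height_reflectionPerm_self] at h1
    rw [RootPairing.Base.isPos_iff']
    lia
  have hneg : ∑ i with ¬ b.IsPos i, P.pairingIn ℤ i θ ^ 2 = ∑ i with b.IsPos i, P.pairingIn ℤ i θ ^ 2 := by
    refine Finset.sum_nbij' (fun i => -i) (fun i => -i) (fun i hi => ?_) (fun i hi => ?_)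
      (fun i _ => neg_neg i) (fun i _ => neg_neg i) fun i _ => ?_
    · simp only [Finset.mem_filter, Finset.mem_univ, true_and] at hi ⊢
      exact (RootPairing.Base.IsPos.neg_iff_not b i).2 hi
    · simp only [Finset.mem_filter, Finset.mem_univ, true_and] at hi ⊢
      rw [← RootPairing.Base.IsPos.neg_iff_not, neg_neg]
      exact hi
    · simp
  have hval (i) (hi : b.IsPos i) (hiθ : i ≠ θ) : P.pairingIn ℤ i θ ^ 2 = P.pairingIn ℤ i θ := by
    rw [RootPairing.Base.isPos_iff] at hi hpos
    have h0 : 0 ≤ P.pairingIn ℤ i θ := by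
      by_contra! h
      -- A negative pairing would make α + θ a root higher than θ; the exception α = -θ is excluded
      -- by positivity.
      obtain ⟨k, hk⟩ := P.root_add_root_mem_of_pairingIn_neg h (by
        intro h2
        have h3 : i = -θ := P.root.injective (by simpa using h2)
        have := b.height_reflectionPerm_self θ
        rw [← h3] at this
        lia)
      have := hmax k
      rw [b.height_add hk] at this
      lia
    have h1 : P.pairingIn ℤ i θ ≤ 1 := by
      -- A pairing p ≥ 2 would make the root -s_θ(α) = pθ - α higher than θ.
      have h2 := hmax (-(P.reflectionPerm θ i))
      rw [b.height_reflectionPerm_self, height_reflectionPerm] at h2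
      have h3 := height_lt_of_highest hθ hiθ
      by_contra! h
      nlinarith
    obtain h2 | h2 : P.pairingIn ℤ i θ = 0 ∨ P.pairingIn ℤ i θ = 1 := by lia
    · rw [h2]; rfl
    · rw [h2]; rfl
  have hθmem : θ ∈ Finset.univ.filter b.IsPos := Finset.mem_filter.2 ⟨Finset.mem_univ θ, hpos⟩
  have hsum : ∑ i with b.IsPos i, P.pairingIn ℤ i θ ^ 2 = 2 * (1 + b.flip.height θ) := by
    have h1 := sum_pairingIn_pos (b := b) θ
    rw [← Finset.add_sum_erase _ _ hθmem, P.pairingIn_same] at h1 ⊢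
    rw [Finset.sum_congr rfl fun i hi => hval i
      (Finset.mem_filter.1 (Finset.mem_of_mem_erase hi)).2 (Finset.ne_of_mem_erase hi)]
    linarith
  rw [← Finset.sum_filter_add_sum_filter_not _ b.IsPos, hneg, hsum]
  ring

end RootSystem

/-! ### The Casimir scalar of the adjoint representation. -/

section Killing

variable {g : Type*} [LieRing g] [LieAlgebra ℂ g] [FiniteDimensional ℂ g] (B : InvForm g)

lemma trace_eq_sum_form (f : Module.End ℂ g) :
    LinearMap.trace ℂ g f = ∑ i, B.form (f (basis g i)) (dualBasis B i) := by
  rw [LinearMap.trace_eq_matrix_trace ℂ (basis g), Matrix.trace]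
  refine Finset.sum_congr rfl fun i _ => ?_
  rw [Matrix.diag_apply, LinearMap.toMatrix_apply]
  conv_lhs => rw [← sum_form_dualBasis_smul B (f (basis g i))]
  rw [Module.Basis.repr_sum_self]

/-- The Casimir operator of the adjoint representation relates the invariant form to the Killing
form. -/
lemma form_casimir (y z : g) : B.form (casimir B g y) z = killingForm ℂ g y z := by
  rw [killingForm_apply_apply, trace_eq_sum_form B, casimir, LinearMap.sum_apply, map_sum,
    LinearMap.sum_apply]
  refine Finset.sum_congr rfl fun i _ => ?_
  rw [Module.End.mul_apply, LieModule.toEnd_apply_apply, LieModule.toEnd_apply_apply,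
    LinearMap.comp_apply, LieAlgebra.ad_apply, LieAlgebra.ad_apply, B.form_lie,
    B.form_lie y, ← lie_skew _ y, ← lie_skew _ z, map_neg, map_neg, LinearMap.neg_apply,
    neg_neg, B.form_comm]

open LieAlgebra.IsKilling

/-- The adjoint representation is irreducible, so the Casimir operator is a scalar Ω and Ω times the
form is the Killing form. At θ^∨ this reads 2Ω = ∑ α(θ^∨)² = 4h^∨. -/
lemma isDualCoxeter_dualCoxeter [LieAlgebra.IsSimple ℂ g] (H : LieSubalgebra ℂ g)
    [H.IsCartanSubalgebra] (b : (rootSystem H).Base) (θ : H.root) (hθ : IsHighestRoot b θ)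
    (hB : B.form ((rootSystem H).coroot θ : H) ((rootSystem H).coroot θ : H) = 2) :
    IsDualCoxeter B (dualCoxeter b θ : ℂ) := by
  have : Nontrivial g := LieModule.nontrivial_of_isIrreducible ℂ g g
  obtain ⟨Ω, hΩ⟩ := Module.End.exists_eigenvalue (casimir B g)
  have h1 (y : g) : casimir B g y = Ω • y := casimir_apply hΩ y
  have h2 : killingForm ℂ g ((rootSystem H).coroot θ : H) ((rootSystem H).coroot θ : H) =
      4 * (dualCoxeter b θ : ℂ) := by
    have h3 := LinearMap.congr_fun₂ (corootForm_rootSystem_eq_killing H) ((rootSystem H).coroot θ)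
      ((rootSystem H).coroot θ)
    rw [RootPairing.CorootForm, RootPairing.RootForm, LinearMap.sum_apply, LinearMap.sum_apply] at h3
    have h4 := congrArg (Int.cast (R := ℂ)) (sum_sq_pairingIn_highest hθ)
    rw [Int.cast_sum] at h4
    refine (h3.symm.trans ?_).trans (h4.trans (by rw [dualCoxeter]; push_cast; ring))
    refine Finset.sum_congr rfl fun i _ => ?_
    rw [Int.cast_pow, ← eq_intCast (algebraMap ℤ ℂ), (rootSystem H).algebraMap_pairingIn, sq]
    rfl
  have h3 : Ω = 2 * (dualCoxeter b θ : ℂ) := by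
    rw [← form_casimir B, h1, map_smul, LinearMap.smul_apply, hB, smul_eq_mul] at h2
    linear_combination h2 / 2
  intro y
  rw [← h3]
  exact (LinearMap.sum_apply _ _ _).symm.trans (h1 y)

end Killing

/-! ### The trace form and the Casimir scalar of sl_N. -/

section SpecialLinear

variable {N : ℕ}

/-- The dual bases compute the orthogonal projection of a matrix to sl_N for the trace form, since
multiples of the identity are orthogonal to traceless matrices. -/
lemma sum_trace_smul_basis (hN : 1 ≤ N) (X : Matrix (Fin N) (Fin N) ℂ) :
    ∑ i, (X * (dualBasis (slForm N) i).1).trace • (basis (SL N) i).1 =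
      X - (X.trace / N) • (1 : Matrix (Fin N) (Fin N) ℂ) := by
  have hN' : (N : ℂ) ≠ 0 := Nat.cast_ne_zero.2 (by omega)
  have hX : X - (X.trace / N) • (1 : Matrix (Fin N) (Fin N) ℂ) ∈
      LieAlgebra.SpecialLinear.sl (Fin N) ℂ := by
    change (X - (X.trace / N) • (1 : Matrix (Fin N) (Fin N) ℂ)).trace = 0
    rw [Matrix.trace_sub, Matrix.trace_smul, Matrix.trace_one, Fintype.card_fin, smul_eq_mul,
      div_mul_cancel₀ _ hN', sub_self]
  have h1 := congrArg Subtype.val (sum_form_dualBasis_smul (slForm N) (⟨_, hX⟩ : SL N))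
  rw [AddSubmonoidClass.coe_finsetSum] at h1
  refine Eq.trans (Finset.sum_congr rfl fun i _ => ?_) h1
  have h2 : (dualBasis (slForm N) i).1.trace = 0 := (dualBasis (slForm N) i).2
  change _ = Matrix.trace ((X - (X.trace / N) • (1 : Matrix (Fin N) (Fin N) ℂ)) *
    (dualBasis (slForm N) i).1) • (basis (SL N) i).1
  rw [sub_mul, Matrix.trace_sub, smul_mul_assoc, one_mul, Matrix.trace_smul, h2, smul_zero, sub_zero]

/-- The completeness relation for the dual bases of `sl_N`. -/
lemma sum_basis_mul_dualBasis (hN : 1 ≤ N) (A : Matrix (Fin N) (Fin N) ℂ) :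
    ∑ i, (basis (SL N) i).1 * A * (dualBasis (slForm N) i).1 =
      A.trace • (1 : Matrix (Fin N) (Fin N) ℂ) - (1 / (N : ℂ)) • A := by
  ext p q
  -- The (p, u) entry of the projection of the matrix unit E_{qv}.
  have h1 (u v : Fin N) : ∑ i, (dualBasis (slForm N) i).1 v q * (basis (SL N) i).1 p u =
      (if p = q ∧ u = v then 1 else 0) - (if q = v then 1 / (N : ℂ) else 0) * (if p = u then 1 else 0) := by
    have h2 := congrFun (congrFun (sum_trace_smul_basis hN (Matrix.single q v (1 : ℂ))) p) u
    rw [Matrix.sum_apply] at h2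
    simp only [Matrix.trace_single_mul, Matrix.smul_apply, smul_eq_mul, one_mul, Matrix.sub_apply] at h2
    rw [h2, Matrix.single_apply, Matrix.one_apply, Matrix.trace]
    simp only [Matrix.diag_apply, Matrix.single_apply]
    by_cases hqv : q = v
    · subst hqv
      simp [eq_comm]
    · have h3 (i : Fin N) : ¬(q = i ∧ v = i) := fun h => hqv (h.1.trans h.2.symm)
      simp only [h3, hqv, if_false, Finset.sum_const_zero, zero_div, zero_mul, sub_zero]
      simp only [eq_comm]
  have h2 (i) : ((basis (SL N) i).1 * A * (dualBasis (slForm N) i).1) p q =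
      ∑ v, ∑ u, A u v * ((dualBasis (slForm N) i).1 v q * (basis (SL N) i).1 p u) := by
    rw [Matrix.mul_apply]
    refine Finset.sum_congr rfl fun v _ => ?_
    rw [Matrix.mul_apply, Finset.sum_mul]
    exact Finset.sum_congr rfl fun u _ => by ring
  rw [Matrix.sum_apply, Finset.sum_congr rfl fun i _ => h2 i, Finset.sum_comm]
  have h3 (v : Fin N) : ∑ i, ∑ u, A u v * ((dualBasis (slForm N) i).1 v q * (basis (SL N) i).1 p u) =
      (if p = q then A v v else 0) - (if q = v then 1 / (N : ℂ) * A p v else 0) := by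
    rw [Finset.sum_comm]
    simp only [← Finset.mul_sum, h1, mul_sub, Finset.sum_sub_distrib]
    by_cases hpq : p = q <;> by_cases hqv : q = v 
    · simp [hpq, hqv, mul_comm]
    · simp [hpq, hqv]
    · subst hqv
      simp [hpq, mul_comm]
    · simp [hpq, hqv]
  rw [Finset.sum_congr rfl fun v _ => h3 v, Finset.sum_sub_distrib]
  by_cases hpq : p = q <;> simp [hpq, Matrix.trace]

/-- Expand the double bracket and apply the completeness relation. The two terms with y outside give
(N - 1/N) y each, and the two with y inside give y/N each because tr y = 0. -/
lemma isDualCoxeter_slForm (hN : 1 ≤ N) : IsDualCoxeter (slForm N) N := by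
  intro y
  have hN' : (N : ℂ) ≠ 0 := Nat.cast_ne_zero.2 (by omega)
  have hy : y.1.trace = 0 := y.2
  have hsymm (A : Matrix (Fin N) (Fin N) ℂ) :
      ∑ i, (dualBasis (slForm N) i).1 * A * (basis (SL N) i).1 =
        A.trace • (1 : Matrix (Fin N) (Fin N) ℂ) - (1 / (N : ℂ)) • A := by
    rw [← sum_basis_mul_dualBasis hN]
    exact sum_dualBasis_symm (slForm N) (LinearMap.mk₂ ℂ (fun x z : SL N => x.1 * A * z.1)
      (by simp [add_mul]) (by simp) (by simp [mul_add]) (by simp))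
  refine Subtype.ext ?_
  rw [AddSubmonoidClass.coe_finsetSum]
  have h1 (i) : (⁅basis (SL N) i, ⁅dualBasis (slForm N) i, y⁆⁆ : SL N).1 =
      (basis (SL N) i).1 * 1 * (dualBasis (slForm N) i).1 * y.1 -
        (basis (SL N) i).1 * y.1 * (dualBasis (slForm N) i).1 -
        ((dualBasis (slForm N) i).1 * y.1 * (basis (SL N) i).1 -
          y.1 * ((dualBasis (slForm N) i).1 * 1 * (basis (SL N) i).1)) := by
    rw [LieAlgebra.SpecialLinear.sl_bracket, LieAlgebra.SpecialLinear.sl_bracket]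
    noncomm_ring
  rw [Finset.sum_congr rfl fun i _ => h1 i]
  simp only [Finset.sum_sub_distrib, ← Finset.sum_mul, ← Finset.mul_sum, hsymm,
    sum_basis_mul_dualBasis hN, hy, Matrix.trace_one, Fintype.card_fin]
  change _ = (2 * (N : ℂ)) • y.1
  simp only [sub_mul, mul_sub, smul_mul_assoc, mul_smul_comm, one_mul, mul_one, zero_smul]
  module

lemma finrank_SL (hN : 1 ≤ N) : (Module.finrank ℂ (SL N) : ℂ) = (N : ℂ) ^ 2 - 1 := by
  have : Nonempty (Fin N) := ⟨⟨0, hN⟩⟩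
  have h1 := LinearMap.finrank_range_add_finrank_ker (Matrix.traceLinearMap (Fin N) ℂ ℂ)
  rw [LinearMap.range_eq_top.2 (Matrix.trace_surjective), finrank_top, Module.finrank_self,
    Module.finrank_matrix, Fintype.card_fin, Module.finrank_self, mul_one] at h1
  have h2 : Module.finrank ℂ (SL N) = Module.finrank ℂ (LinearMap.ker (Matrix.traceLinearMap (Fin N) ℂ ℂ)) :=
    rfl
  rw [h2]
  have h3 := congrArg (Nat.cast (R := ℂ)) h1
  push_cast at h3
  linear_combination h3

end SpecialLinear

end
end TorVOA

theorem proposition3p1 {g : Type*} [LieRing g] [LieAlgebra ℂ g] [FiniteDimensional ℂ g]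
    [LieAlgebra.IsSimple ℂ g] (B : TorVOA.InvForm g)
    (H : LieSubalgebra ℂ g) [H.IsCartanSubalgebra]
    (b : (LieAlgebra.IsKilling.rootSystem H).Base) (θ : H.root) (hθ : TorVOA.IsHighestRoot b θ)
    (hB : B.form ((LieAlgebra.IsKilling.rootSystem H).coroot θ : H)
      ((LieAlgebra.IsKilling.rootSystem H).coroot θ : H) = 2)
    (N : ℕ) (hN : 1 ≤ N) (c₁ c₂ c c' : ℂ)
    (hc₁ : c₁ ≠ -(TorVOA.dualCoxeter b θ : ℂ)) (hc₂ : c₂ ≠ -(N : ℂ))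
    (hc' : c' = c - c₁ * (Module.finrank ℂ g : ℂ) / (c₁ + (TorVOA.dualCoxeter b θ : ℂ))
      - c₂ * ((N : ℂ) ^ 2 - 1) / (c₂ + (N : ℂ))) :
    -- (i) the vertex operator algebras exist and decompose
    ((∃ S, TorVOA.IsFBarVOA B (TorVOA.slForm N) c₁ c₂ c S) ∧
      (∃ S, TorVOA.IsAffineVOA B c₁ (TorVOA.dualCoxeter b θ) S) ∧
      (∃ S, TorVOA.IsAffineVOA (TorVOA.slForm N) c₂ N S) ∧
      (∃ S, TorVOA.IsVirVOA c' S) ∧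
      ∀ S S₁ S₂ S₃, TorVOA.IsFBarVOA B (TorVOA.slForm N) c₁ c₂ c S →
        TorVOA.IsAffineVOA B c₁ (TorVOA.dualCoxeter b θ) S₁ →
        TorVOA.IsAffineVOA (TorVOA.slForm N) c₂ N S₂ → TorVOA.IsVirVOA c' S₃ →
        ∃ φ, TorVOA.VOAData.IsIso S (S₁.tensor (S₂.tensor S₃)) φ) ∧
    -- (ii) the irreducible highest weight modules decompose
    ∀ (V : Type*) [AddCommGroup V] [Module ℂ V] [LieRingModule g V] [LieModule ℂ g V]
      [FiniteDimensional ℂ V] [LieModule.IsIrreducible ℂ g V]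
      (W : Type*) [AddCommGroup W] [Module ℂ W] [LieRingModule (TorVOA.SL N) W]
      [LieModule ℂ (TorVOA.SL N) W] [FiniteDimensional ℂ W]
      [LieModule.IsIrreducible ℂ (TorVOA.SL N) W] (ΩV ΩW h h' : ℂ),
      (TorVOA.casimir B V).HasEigenvalue ΩV →
      (TorVOA.casimir (TorVOA.slForm N) W).HasEigenvalue ΩW →
      h' = h - ΩV / (2 * (c₁ + (TorVOA.dualCoxeter b θ : ℂ))) - ΩW / (2 * (c₂ + (N : ℂ))) →
      ∃ φ : TorVOA.LAffine B V c₁ ⊗[ℂ]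
          (TorVOA.LAffine (TorVOA.slForm N) W c₂ ⊗[ℂ] TorVOA.LVir h' c') ≃ₗ[ℂ]
          TorVOA.LFBar B (TorVOA.slForm N) V W h c₁ c₂ c,
        TorVOA.IsFBarIso (TorVOA.dualCoxeter b θ) N φ := by
  have hk₁ := TorVOA.isDualCoxeter_dualCoxeter B H b θ hθ hB
  have hk₂ := TorVOA.isDualCoxeter_slForm hN
  have hc₁' : c₁ + (TorVOA.dualCoxeter b θ : ℂ) ≠ 0 := fun h => hc₁ (eq_neg_of_add_eq_zero_left h)
  have hc₂' : c₂ + (N : ℂ) ≠ 0 := fun h => hc₂ (eq_neg_of_add_eq_zero_left h)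
  rw [← TorVOA.finrank_SL hN] at hc'
  refine ⟨⟨TorVOA.exists_isFBarVOA .., TorVOA.exists_isAffineVOA hk₁ hc₁',
    TorVOA.exists_isAffineVOA hk₂ hc₂', TorVOA.exists_isVirVOA c', fun S S₁ S₂ S₃ hS hS₁ hS₂ hS₃ =>
      TorVOA.exists_isIso hk₁ hk₂ hc₁' hc₂' hc' hS hS₁ hS₂ hS₃⟩, ?_⟩
  intro V _ _ _ _ _ _ W _ _ _ _ _ _ ΩV ΩW h h' hΩV hΩW hh
  exact TorVOA.exists_isFBarIso hk₁ hk₂ hc₁' hc₂' hc' (TorVOA.casimir_apply hΩV)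
    (TorVOA.casimir_apply hΩW) hh
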